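/- Let $\Omega=(0,1)^2$ and consider $-\varepsilon_1\Delta u+\varepsilon_2 b(x)u_x+c(x)u=f(x,y)$ in $\Omega$, $u=0$ on $\partial\Omega$, where $b\in C^1[0,1]$, $c\in C[0,1]$, $f\in C(\bar\Omega)$, $b\ge\lambda>0$, $c\ge\beta>0$ on $[0,1]$, and $f$ vanishes at the four corners of $\Omega$. Fix an integer $k\ge1$, numbers $p\in(0,1)$, $k_0\in(0,\tfrac12)$, $\delta>0$ with $\delta^2\le(1-p)\beta/2$, $\tau\ge k+1$, $\gamma>0$, $C_0$ and $\bar\varepsilon<1$. Put $b_*=\max_{[0,1]}b$ and $$\mu_0=\frac{-\varepsilon_2b_*+\sqrt{\varepsilon_2^2b_*^2+4\varepsilon_1\beta}}{2\varepsilon_1},\qquad \mu_1=\frac{\varepsilon_2\lambda+\sqrt{\varepsilon_2^2\lambda^2+4\varepsilon_1\beta}}{2\varepsilon_1}.$$ *Parameters.* Let $0<\varepsilon_1,\varepsilon_2\le\bar\varepsilon$ satisfy $c-\tfrac12\varepsilon_2b'\ge\gamma$ on $[0,1]$ and $2\|b'\|_\infty\varepsilon_2\le k_0(1-p)\beta$.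 Let $N\ge8$ be divisible by $4$ with $\mu_1^{-1}\le\mu_0^{-1}\le N^{-1}$. Put $\sigma_{x,i}=\frac{\tau}{p\mu_i}\ln\mu_i$ ($i=0,1$), $\sigma_y=\frac{\tau}{\delta}\sqrt{\varepsilon_1}\ln\frac1{\sqrt{\varepsilon_1}}$, and assume $\sigma_{x,0},\sigma_{x,1},\sigma_y\le\frac14$. *Mesh.* With $t_i=i/N$, let $$x_i=\begin{cases}-\frac{\tau}{p\mu_0}\ln\bigl(1-4(1-\mu_0^{-1})t_i\bigr),&0\le i\le\frac N4,\\ \sigma_{x,0}+2(t_i-\frac14)(1-\sigma_{x,0}-\sigma_{x,1}),&\frac N4\le i\le\frac{3N}4,\\ 1+\frac{\tau}{p\mu_1}\ln\bigl(1-4(1-\mu_1^{-1})(1-t_i)\bigr),&\frac{3N}4\le i\le N,\end{cases}$$ $$y_j=\begin{cases}-\frac{\tau}{\delta}\sqrt{\varepsilon_1}\ln\bigl(1-4(1-\sqrt{\varepsilon_1})t_j\bigr),&0\le j\le\frac N4,\\ \sigma_y+2(t_j-\frac14)(1-2\sigma_y),&\frac N4\le j\le\frac{3N}4,\\ 1+\frac{\tau}{\delta}\sqrt{\varepsilon_1}\ln\bigl(1-4(1-\sqrt{\varepsilon_1})(1-t_j)\bigr),&\frac{3N}4\le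 j\le N.\end{cases}$$ *Decomposition.* Let $u$ be the solution, and assume that $u=S+E_{10}+E_{11}+E_{20}+E_{21}+E_{31}+E_{32}+E_{33}+E_{34}$ with parts in $C^{k+1}(\bar\Omega)$ such that on $\bar\Omega$, for all $0\le i+j\le k+1$, the derivatives $\partial_x^i\partial_y^j$ of the parts are bounded in absolute value by $C_0$ times, respectively, $1$ for $S$; $\mu_0^ie^{-p\mu_0x}$ for $E_{10}$; $\mu_1^ie^{-p\mu_1(1-x)}$ for $E_{11}$; $\varepsilon_1^{-j/2}e^{-\delta y/\sqrt{\varepsilon_1}}$ for $E_{20}$; $\varepsilon_1^{-j/2}e^{-\delta(1-y)/\sqrt{\varepsilon_1}}$ for $E_{21}$; $\varepsilon_1^{-j/2}\mu_0^ie^{-p\mu_0x}e^{-\delta y/\sqrt{\varepsilon_1}}$ for $E_{31}$; $\varepsilon_1^{-j/2}\mu_1^ie^{-p\mu_1(1-x)}e^{-\delta y/\sqrt{\varepsilon_1}}$ for $E_{32}$; $\varepsilon_1^{-j/2}\mu_1^ie^{-p\mu_1(1-x)}e^{-\delta(1-y)/\sqrt{\varepsilon_1}}$ for $E_{33}$;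 $\varepsilon_1^{-j/2}\mu_0^ie^{-p\mu_0x}e^{-\delta(1-y)/\sqrt{\varepsilon_1}}$ for $E_{34}$. *Finite element method.* Let $V^N$ be the space of continuous functions on $\bar\Omega$ that vanish on $\partial\Omega$ and are, on every $[x_i,x_{i+1}]\times[y_j,y_{j+1}]$, polynomials of degree at most $k$ in each variable. Let $u^N\in V^N$ satisfy $a(u^N,v)=(f,v)$ for all $v\in V^N$, where $a(u,v)=\varepsilon_1(\nabla u,\nabla v)+(\varepsilon_2bu_x+cu,v)$ and $(\cdot,\cdot)$ is the $L^2(\Omega)$ product. Let $\|v\|_E^2=\varepsilon_1\|\nabla v\|_{L^2(\Omega)}^2+\|v\|_{L^2(\Omega)}^2$. *Interpolants.* Let $x_i^s=x_i+\frac sk(x_{i+1}-x_i)$, $y_j^t=y_j+\frac tk(y_{j+1}-y_j)$; let $\theta_{i,j}^{s,t}$ be the continuous piecewise polynomial Lagrange basis function (degree $\le k$ in each variable on each mesh rectangle) of the node $(x_i^s,y_j^t)$, and let $v^I$ be the corresponding Lagrange interpolant of $v\in C(\bar\Omega)$. Put $$\Pi u=S^I+E_{10}^I+\pi E_{11}+E_{20}^I+E_{21}^I+E_{31}^I+\pi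 E_{32}+\pi E_{33}+E_{34}^I,\qquad \pi E=E^I-PE+\Theta E,$$ where, with $m=\frac{3N}4$, $$PE=\sum_{s=1}^k\Bigl(\sum_{j=0}^{N-1}\sum_{t=0}^{k-1}E(x_m^s,y_j^t)\theta_{m,j}^{s,t}+E(x_m^s,y_N)\theta_{m,N}^{s,0}\Bigr),$$ $$\Theta E=\sum_{s=1}^kE(x_m^s,y_0)\theta_{m,0}^{s,0}+\sum_{s=1}^kE(x_m^s,y_N)\theta_{m,N}^{s,0}.$$ **Theorem.** There is a constant $C>0$, which does not depend on $\varepsilon_1$, $\varepsilon_2$ or $N$ (only on $b,c,f,\lambda,\beta,\gamma,k,p,k_0,\delta,\tau,C_0,\bar\varepsilon$), such that in the above situation always $$\|u^I-u^N\|_E+\|\Pi u-u^N\|_E\le C(\varepsilon_1^{1/2}+\varepsilon_2)^{1/2}N^{-k}+CN^{-(k+1)},$$ $$\|u-u^N\|_E\le C(\varepsilon_1^{1/2}+\varepsilon_2)^{1/2}N^{-k}+CN^{-(k+1)}.$$ -/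

import Mathlib

open Set MeasureTheory

noncomputable section

namespace BakhvalovFEM

/-! ### The domain, partial derivatives and the boundary value problem -/

/-- The open unit square `Ω`. -/
def openSquare : Set (ℝ × ℝ) := Ioo 0 1 ×ˢ Ioo 0 1

/-- The closed unit square. -/
def closedSquare : Set (ℝ × ℝ) := Icc 0 1 ×ˢ Icc 0 1

/-- The mixed partial derivative `∂^{i+j} g / ∂x^i ∂y^j` on the closed unit square
(one-sided at the boundary; the usual partial derivative at interior points). -/
def mixedPartial (i j : ℕ) (g : ℝ × ℝ → ℝ) (z : ℝ × ℝ) : ℝ :=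
  iteratedDerivWithin i
    (fun x => iteratedDerivWithin j (fun y => g (x, y)) (Icc 0 1) z.2) (Icc 0 1) z.1

/-- The assumptions on the data that do not involve the perturbation parameters. -/
structure DataConditions (b c : ℝ → ℝ) (f : ℝ × ℝ → ℝ) (lam β : ℝ) : Prop where
  b_smooth : ContDiffOn ℝ 1 b (Icc 0 1)
  c_cont : ContinuousOn c (Icc 0 1)
  f_cont : ContinuousOn f closedSquare
  lam_pos : 0 < lam
  beta_pos : 0 < β
  b_lower : ∀ x ∈ Icc (0 : ℝ) 1, lam ≤ b x
  c_lower : ∀ x ∈ Icc (0 : ℝ) 1, β ≤ c x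
  f_corner₀₀ : f (0, 0) = 0
  f_corner₀₁ : f (0, 1) = 0
  f_corner₁₁ : f (1, 1) = 0
  f_corner₁₀ : f (1, 0) = 0

/-- `u` is a classical solution of `-ε₁ Δu + ε₂ b u_x + c u = f` in `Ω`, `u = 0` on `∂Ω`. -/
structure IsSolution (ε₁ ε₂ : ℝ) (b c : ℝ → ℝ) (f u : ℝ × ℝ → ℝ) : Prop where
  continuousOn : ContinuousOn u closedSquare
  contDiffOn : ContDiffOn ℝ 2 u openSquare
  equation : ∀ z ∈ openSquare,
    -ε₁ * (mixedPartial 2 0 u z + mixedPartial 0 2 u z)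
      + ε₂ * b z.1 * mixedPartial 1 0 u z + c z.1 * u z = f z
  boundary : ∀ z ∈ closedSquare \ openSquare, u z = 0

/-! ### The layer parameters and the solution decomposition -/

/-- `b_* = max_{[0,1]} b`. -/
def bMax (b : ℝ → ℝ) : ℝ := sSup (b '' Icc 0 1)

/-- `μ₀ = (-ε₂ b_* + √(ε₂² b_*² + 4 ε₁ β)) / (2 ε₁)`. -/
def mu0 (ε₁ ε₂ : ℝ) (b : ℝ → ℝ) (β : ℝ) : ℝ :=
  (-(ε₂ * bMax b) + √(ε₂ ^ 2 * bMax b ^ 2 + 4 * ε₁ * β)) / (2 * ε₁)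

/-- `μ₁ = (ε₂ λ + √(ε₂² λ² + 4 ε₁ β)) / (2 ε₁)`. -/
def mu1 (ε₁ ε₂ lam β : ℝ) : ℝ :=
  (ε₂ * lam + √(ε₂ ^ 2 * lam ^ 2 + 4 * ε₁ * β)) / (2 * ε₁)

/-- `g` is of class `C^{k+1}` on the closed square and
`|∂^{i+j} g / ∂x^i ∂y^j| ≤ C₀ w i j` there for all `0 ≤ i + j ≤ k + 1`. -/
def DerivBound (k : ℕ) (C₀ : ℝ) (w : ℕ → ℕ → ℝ × ℝ → ℝ) (g : ℝ × ℝ → ℝ) : Prop :=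
  ContDiffOn ℝ ((k + 1 : ℕ) : WithTop ℕ∞) g closedSquare ∧
    ∀ i j : ℕ, i + j ≤ k + 1 → ∀ z ∈ closedSquare, |mixedPartial i j g z| ≤ C₀ * w i j z

/-- The nine parts of the decomposition of the solution: the regular part `S`, the exponential
layers `E10` (at `x = 0`) and `E11` (at `x = 1`), the parabolic layers `E20` (at `y = 0`) and
`E21` (at `y = 1`), and the corner layers `E31`, `E32`, `E33`, `E34` at `(0,0)`, `(1,0)`,
`(1,1)`, `(0,1)`. -/
structure Parts where
  S : ℝ × ℝ → ℝ
  E10 : ℝ × ℝ → ℝ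
  E11 : ℝ × ℝ → ℝ
  E20 : ℝ × ℝ → ℝ
  E21 : ℝ × ℝ → ℝ
  E31 : ℝ × ℝ → ℝ
  E32 : ℝ × ℝ → ℝ
  E33 : ℝ × ℝ → ℝ
  E34 : ℝ × ℝ → ℝ

/-- `D` decomposes `u` on the closed unit square, and its parts satisfy the derivative bounds
up to order `k + 1` with constant `C₀`. -/
structure IsLayerDecomposition (k : ℕ) (C₀ ε₁ μ₀ μ₁ p δ : ℝ) (u : ℝ × ℝ → ℝ) (D : Parts) :
    Prop where
  sum_eq : ∀ z ∈ closedSquare,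
    u z = D.S z + D.E10 z + D.E11 z + D.E20 z + D.E21 z + D.E31 z + D.E32 z + D.E33 z + D.E34 z
  bound_S : DerivBound k C₀ (fun _ _ _ => 1) D.S
  bound_E10 : DerivBound k C₀ (fun i _ z => μ₀ ^ i * Real.exp (-(p * μ₀ * z.1))) D.E10
  bound_E11 : DerivBound k C₀ (fun i _ z => μ₁ ^ i * Real.exp (-(p * μ₁ * (1 - z.1)))) D.E11
  bound_E20 : DerivBound k C₀ (fun _ j z => (√ε₁)⁻¹ ^ j * Real.exp (-(δ * z.2 / √ε₁))) D.E20
  bound_E21 : DerivBound k C₀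
    (fun _ j z => (√ε₁)⁻¹ ^ j * Real.exp (-(δ * (1 - z.2) / √ε₁))) D.E21
  bound_E31 : DerivBound k C₀
    (fun i j z => (√ε₁)⁻¹ ^ j * μ₀ ^ i * Real.exp (-(p * μ₀ * z.1))
      * Real.exp (-(δ * z.2 / √ε₁))) D.E31
  bound_E32 : DerivBound k C₀
    (fun i j z => (√ε₁)⁻¹ ^ j * μ₁ ^ i * Real.exp (-(p * μ₁ * (1 - z.1)))
      * Real.exp (-(δ * z.2 / √ε₁))) D.E32
  bound_E33 : DerivBound k C₀
    (fun i j z => (√ε₁)⁻¹ ^ j * μ₁ ^ i * Real.exp (-(p * μ₁ * (1 - z.1)))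
      * Real.exp (-(δ * (1 - z.2) / √ε₁))) D.E33
  bound_E34 : DerivBound k C₀
    (fun i j z => (√ε₁)⁻¹ ^ j * μ₀ ^ i * Real.exp (-(p * μ₀ * z.1))
      * Real.exp (-(δ * (1 - z.2) / √ε₁))) D.E34

/-! ### The Bakhvalov-type mesh -/

/-- `σ_{x,i} = τ / (p μ_i) * ln μ_i`. -/
def sigmaX (τ p μ : ℝ) : ℝ := τ / (p * μ) * Real.log μ

/-- `σ_y = τ / δ * √ε₁ * ln (1 / √ε₁)`. -/
def sigmaY (τ δ ε₁ : ℝ) : ℝ := τ / δ * √ε₁ * Real.log (1 / √ε₁)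

/-- The mesh points `x_i`, `0 ≤ i ≤ N` (with `4 ∣ N`). -/
def meshX (τ p μ₀ μ₁ : ℝ) (N i : ℕ) : ℝ :=
  if i ≤ N / 4 then
    τ / (p * μ₀) * -Real.log (1 - 4 * (1 - μ₀⁻¹) * ((i : ℝ) / N))
  else if i ≤ 3 * (N / 4) then
    sigmaX τ p μ₀ + 2 * ((i : ℝ) / N - 1 / 4) * (1 - sigmaX τ p μ₀ - sigmaX τ p μ₁)
  else
    1 - τ / (p * μ₁) * -Real.log (1 - 4 * (1 - μ₁⁻¹) * (1 - (i : ℝ) / N))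

/-- The mesh points `y_j`, `0 ≤ j ≤ N` (with `4 ∣ N`). -/
def meshY (τ δ ε₁ : ℝ) (N j : ℕ) : ℝ :=
  if j ≤ N / 4 then
    τ / δ * √ε₁ * -Real.log (1 - 4 * (1 - √ε₁) * ((j : ℝ) / N))
  else if j ≤ 3 * (N / 4) then
    sigmaY τ δ ε₁ + 2 * ((j : ℝ) / N - 1 / 4) * (1 - 2 * sigmaY τ δ ε₁)
  else
    1 - τ / δ * √ε₁ * -Real.log (1 - 4 * (1 - √ε₁) * (1 - (j : ℝ) / N))

/-! ### The finite element method

All functions to which the following integrals are applied are continuous on the closed square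
and continuously differentiable on each closed mesh rectangle, so their classical partial
derivatives exist off the mesh lines and are their weak derivatives. -/

/-- The partial derivative `v_x`. -/
def dx (v : ℝ × ℝ → ℝ) (z : ℝ × ℝ) : ℝ := deriv (fun x => v (x, z.2)) z.1

/-- The partial derivative `v_y`. -/
def dy (v : ℝ × ℝ → ℝ) (z : ℝ × ℝ) : ℝ := deriv (fun y => v (z.1, y)) z.2

/-- `a(u, v) = ε₁ (∇u, ∇v) + (ε₂ b u_x + c u, v)`. -/
def bilin (ε₁ ε₂ : ℝ) (b c : ℝ → ℝ) (u v : ℝ × ℝ → ℝ) : ℝ :=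
  ε₁ * (∫ z in openSquare, (dx u z * dx v z + dy u z * dy v z))
    + ∫ z in openSquare, (ε₂ * b z.1 * dx u z + c z.1 * u z) * v z

/-- `‖v‖_E = (ε₁ |v|_1² + ‖v‖²)^{1/2}`. -/
def energyNorm (ε₁ : ℝ) (v : ℝ × ℝ → ℝ) : ℝ :=
  √(ε₁ * (∫ z in openSquare, (dx v z ^ 2 + dy v z ^ 2)) + ∫ z in openSquare, v z ^ 2)

/-- The finite element space `V^N`: continuous functions on the closed square, vanishing on its
boundary, whose restriction to each rectangle `[x_i, x_{i+1}] × [y_j, y_{j+1}]` is a polynomial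
of degree at most `k` in each variable. -/
structure InFESpace (k N : ℕ) (X Y : ℕ → ℝ) (w : ℝ × ℝ → ℝ) : Prop where
  continuousOn : ContinuousOn w closedSquare
  boundary : ∀ z ∈ closedSquare \ openSquare, w z = 0
  piecewise : ∀ i < N, ∀ j < N, ∃ α : ℕ → ℕ → ℝ,
    ∀ z ∈ Icc (X i) (X (i + 1)) ×ˢ Icc (Y j) (Y (j + 1)),
      w z = ∑ l ∈ Finset.range (k + 1), ∑ r ∈ Finset.range (k + 1), α l r * z.1 ^ l * z.2 ^ r

/-- `u^N` is a finite element solution: `u^N ∈ V^N` and `a(u^N, v) = (f, v)` for `v ∈ V^N`. -/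
def IsFESolution (k N : ℕ) (X Y : ℕ → ℝ) (ε₁ ε₂ : ℝ) (b c : ℝ → ℝ) (f uN : ℝ × ℝ → ℝ) : Prop :=
  InFESpace k N X Y uN ∧
    ∀ v, InFESpace k N X Y v →
      bilin ε₁ ε₂ b c uN v = ∫ z in openSquare, f z * v z

/-! ### Lagrange interpolation and the interpolant `Πu` -/

/-- The node `x_i^s = x_i + (s / k) (x_{i+1} - x_i)`. -/
def node (X : ℕ → ℝ) (k i s : ℕ) : ℝ := X i + (s : ℝ) / k * (X (i + 1) - X i)

/-- The Lagrange basis polynomial on `[x_i, x_{i+1}]` for the node `x_i^s`, among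
`x_i^0, …, x_i^k`. -/
def localBasis (X : ℕ → ℝ) (k i s : ℕ) (x : ℝ) : ℝ :=
  (Lagrange.basis (Finset.range (k + 1)) (node X k i) s).eval x

/-- The piecewise polynomial Lagrange basis function of the mesh point `x_i`, `0 ≤ i ≤ N`. -/
def vertexBasis (X : ℕ → ℝ) (N k i : ℕ) (x : ℝ) : ℝ :=
  open Classical in
  if i < N ∧ x ∈ Icc (X i) (X (i + 1)) then localBasis X k i 0 x
  else if 0 < i ∧ x ∈ Icc (X (i - 1)) (X i) then localBasis X k (i - 1) k x
  else 0

/-- The piecewise polynomial Lagrange basis function of the node `x_i^s`, `0 ≤ s ≤ k`, in one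
dimension (for `s = k` the node is the mesh point `x_{i+1}`). -/
def basis1 (X : ℕ → ℝ) (N k i s : ℕ) (x : ℝ) : ℝ :=
  open Classical in
  if s = 0 then vertexBasis X N k i x
  else if s = k then vertexBasis X N k (i + 1) x
  else if x ∈ Icc (X i) (X (i + 1)) then localBasis X k i s x
  else 0

/-- The basis function `θ_{i,j}^{s,t}` of the node `(x_i^s, y_j^t)`. -/
def theta (X Y : ℕ → ℝ) (N k i j s t : ℕ) (z : ℝ × ℝ) : ℝ :=
  basis1 X N k i s z.1 * basis1 Y N k j t z.2

/-- The piecewise `Q_k` Lagrange interpolant `v^I`. -/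
def interp (X Y : ℕ → ℝ) (N k : ℕ) (v : ℝ × ℝ → ℝ) (z : ℝ × ℝ) : ℝ :=
  (∑ i ∈ Finset.range N, ∑ s ∈ Finset.range k,
    ((∑ j ∈ Finset.range N, ∑ t ∈ Finset.range k,
        v (node X k i s, node Y k j t) * theta X Y N k i j s t z)
      + v (node X k i s, Y N) * theta X Y N k i N s 0 z))
  + (∑ j ∈ Finset.range N, ∑ t ∈ Finset.range k,
      v (X N, node Y k j t) * theta X Y N k N j 0 t z)
  + v (X N, Y N) * theta X Y N k N N 0 0 z

/-- `PE`: the part of the interpolant of `E` that belongs to the nodes `x_{3N/4}^s`,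
`1 ≤ s ≤ k`. -/
def opP (X Y : ℕ → ℝ) (N k : ℕ) (E : ℝ × ℝ → ℝ) (z : ℝ × ℝ) : ℝ :=
  ∑ s ∈ Finset.Icc 1 k,
    ((∑ j ∈ Finset.range N, ∑ t ∈ Finset.range k,
        E (node X k (3 * (N / 4)) s, node Y k j t) * theta X Y N k (3 * (N / 4)) j s t z)
      + E (node X k (3 * (N / 4)) s, Y N) * theta X Y N k (3 * (N / 4)) N s 0 z)

/-- `ΘE`: the boundary correction, from the nodes `(x_{3N/4}^s, y_0)` and `(x_{3N/4}^s, y_N)`,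
`1 ≤ s ≤ k`. -/
def opTheta (X Y : ℕ → ℝ) (N k : ℕ) (E : ℝ × ℝ → ℝ) (z : ℝ × ℝ) : ℝ :=
  (∑ s ∈ Finset.Icc 1 k,
    E (node X k (3 * (N / 4)) s, Y 0) * theta X Y N k (3 * (N / 4)) 0 s 0 z)
  + ∑ s ∈ Finset.Icc 1 k,
    E (node X k (3 * (N / 4)) s, Y N) * theta X Y N k (3 * (N / 4)) N s 0 z

/-- `πE = E^I - PE + ΘE`. -/
def opPi (X Y : ℕ → ℝ) (N k : ℕ) (E : ℝ × ℝ → ℝ) (z : ℝ × ℝ) : ℝ :=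
  interp X Y N k E z - opP X Y N k E z + opTheta X Y N k E z

/-- `Πu = S^I + E₁₀^I + πE₁₁ + E₂₀^I + E₂₁^I + E₃₁^I + πE₃₂ + πE₃₃ + E₃₄^I`. -/
def bigPi (X Y : ℕ → ℝ) (N k : ℕ) (D : Parts) (z : ℝ × ℝ) : ℝ :=
  interp X Y N k D.S z + interp X Y N k D.E10 z + opPi X Y N k D.E11 z
    + interp X Y N k D.E20 z + interp X Y N k D.E21 z + interp X Y N k D.E31 z
    + opPi X Y N k D.E32 z + opPi X Y N k D.E33 z + interp X Y N k D.E34 z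

end BakhvalovFEM

end

open BakhvalovFEM

/-! The form a is coercive in the energy norm: integration by parts turns the convection term of
a(χ, χ) into -½ε₂(b'χ, χ), and c - ½ε₂b' ≥ γ. With χ = Πu - u^N in V^N, Galerkin orthogonality gives
min(1, γ)‖χ‖² ≤ a(Πu - u, χ), so the theorem becomes a statement on interpolation errors
(`energy_estimate`). Diffusion and reaction are handled by the Cauchy-Schwarz inequality.

The convection term needs two treatments. For S, the layers at y = 0, 1 and the layers at x = 0 it
is estimated directly, since ε₂ and ε₂√μ₀ are at most Q(√ε₁ + ε₂)^{1/2}. For the three layers at x =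
1 the factor ε₂√μ₁ is not uniformly controlled. There the derivative is moved onto χ, which costs
ε₁^{-1/2}, and an L² error of order μ₁^{-1/2} N^{-k} is needed; it suffices because ε₁μ₁ ≥ λε₂.
Plain interpolation is not known to give this on the first cell behind the transition point x_m,
whose width exceeds 1/μ₁ by a logarithm. The operator π drops the nodes x_m^1, …, x_m^k, so that
only the tiny value at x_m survives on that cell (`opPi_error`, `nrm_opPi_error_le`). The term Θ
restores the values at y = 0, 1, so that Πu still vanishes on the boundary. The correction P - Θ is
small in the energy norm (`correction_sumError`), which compares Πu with u^I.

The interpolation estimates rest on one condition, `LayerCell`. Write the layer of width 1/A as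
ρ^{k+1}. Since τ ≥ k + 1, the logarithmic mesh satisfies ρ(x_i) ≤ g_i, where g_i is the argument of
the logarithm, while A h_i is about (τ/p) d / g_{i+1} with the step d ≤ 4/N. Hence min(1, A h)ρ ≤
K/N on every cell (`meshX_layerMesh`). Either the cell resolves the layer, and Rolle's theorem
bounds the error by powers of A h ρ; or ρ ≤ K/N, and the function and its interpolant are both
negligible. The derivative of the error is at most (K/N)^k times Aρ + (K/N)√(A/h), whose L² norm is
O(√A) (`LayerMesh.nrm_le`). In two variables V - I_x I_y V is split as (V - I_x V) + I_x(V - I_y V)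
(`tensor_error`, `tensor_deriv_error`).

Finally μ₀ and μ₁ are roots of quadratic equations, and `parameter_bounds` turns every combination
such as √ε₁√μ₁ or ε₂/(√ε₁√μ₁) into a multiple of (√ε₁ + ε₂)^{1/2}. All constants are absorbed in K
and Q, which are fixed before ε₁, ε₂ and N. -/

noncomputable section
namespace BakhvalovFEM

/-! ### One-dimensional Lagrange interpolation on a cell -/

/-- The equidistant nodes of `[a, b]`. -/
def cellNode (a b : ℝ) (k s : ℕ) : ℝ := a + (s : ℝ) / k * (b - a)

/-- The Lagrange basis polynomials of the equidistant nodes of `[a, b]`. -/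
def cellPoly (a b : ℝ) (k s : ℕ) : Polynomial ℝ :=
  Lagrange.basis (Finset.range (k + 1)) (cellNode a b k) s

/-- The Lagrange interpolation polynomial of `g` at the equidistant nodes of `[a, b]`. -/
def cellInterp (a b : ℝ) (k : ℕ) (g : ℝ → ℝ) : Polynomial ℝ :=
  ∑ s ∈ Finset.range (k + 1), Polynomial.C (g (cellNode a b k s)) * cellPoly a b k s

lemma cellInterp_eval (a b : ℝ) (k : ℕ) (g : ℝ → ℝ) (x : ℝ) :
    (cellInterp a b k g).eval x
      = ∑ s ∈ Finset.range (k + 1), g (cellNode a b k s) * (cellPoly a b k s).eval x := by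
  simp [cellInterp, Polynomial.eval_finsetSum]

lemma cellInterp_derivative_eval (a b : ℝ) (k : ℕ) (g : ℝ → ℝ) (x : ℝ) :
    (cellInterp a b k g).derivative.eval x
      = ∑ s ∈ Finset.range (k + 1),
          g (cellNode a b k s) * (cellPoly a b k s).derivative.eval x := by
  simp [cellInterp, Polynomial.eval_finsetSum]

lemma cellNode_zero (a b : ℝ) (k : ℕ) : cellNode a b k 0 = a := by simp [cellNode]

lemma cellNode_last (a b : ℝ) {k : ℕ} (hk : 1 ≤ k) : cellNode a b k k = b := by
  have : (k : ℝ) ≠ 0 := by positivity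
  simp [cellNode, this]

lemma cellNode_lt {a b : ℝ} (hab : a < b) {k : ℕ} (hk : 1 ≤ k) {s t : ℕ} (hst : s < t) :
    cellNode a b k s < cellNode a b k t := by
  have hk' : (0 : ℝ) < k := by positivity
  have : (s : ℝ) < t := by exact_mod_cast hst
  have h2 : (0 : ℝ) < b - a := by linarith
  unfold cellNode
  gcongr

lemma cellNode_strictMono {a b : ℝ} (hab : a < b) {k : ℕ} (hk : 1 ≤ k) :
    StrictMono (cellNode a b k) := fun _ _ h => cellNode_lt hab hk h

lemma cellNode_mem {a b : ℝ} (hab : a < b) {k : ℕ} (hk : 1 ≤ k) {s : ℕ} (hs : s ≤ k) :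
    cellNode a b k s ∈ Icc a b := by
  have h := (cellNode_strictMono hab hk).monotone
  constructor
  · simpa [cellNode_zero] using h (Nat.zero_le s)
  · simpa [cellNode_last a b hk] using h hs

lemma cellNode_injOn {a b : ℝ} (hab : a < b) {k : ℕ} (hk : 1 ≤ k) (S : Set ℕ) :
    Set.InjOn (cellNode a b k) S := (cellNode_strictMono hab hk).injective.injOn

lemma cellPoly_eval_self {a b : ℝ} (hab : a < b) {k : ℕ} (hk : 1 ≤ k) {s : ℕ} (hs : s ≤ k) :
    (cellPoly a b k s).eval (cellNode a b k s) = 1 :=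
  Lagrange.eval_basis_self (cellNode_injOn hab hk _) (by simpa using Nat.lt_succ_of_le hs)

lemma cellPoly_eval_of_ne (a b : ℝ) {k s t : ℕ} (hst : s ≠ t) (ht : t ≤ k) :
    (cellPoly a b k s).eval (cellNode a b k t) = 0 :=
  Lagrange.eval_basis_of_ne hst (by simpa using Nat.lt_succ_of_le ht)

lemma cellPoly_sum {a b : ℝ} (hab : a < b) {k : ℕ} (hk : 1 ≤ k) :
    ∑ s ∈ Finset.range (k + 1), cellPoly a b k s = 1 :=
  Lagrange.sum_basis (cellNode_injOn hab hk _) ⟨0, by simp⟩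

lemma cellInterp_eval_node {a b : ℝ} (hab : a < b) {k : ℕ} (hk : 1 ≤ k) (g : ℝ → ℝ)
    {s : ℕ} (hs : s ≤ k) :
    (cellInterp a b k g).eval (cellNode a b k s) = g (cellNode a b k s) := by
  rw [cellInterp_eval, Finset.sum_eq_single s]
  · rw [cellPoly_eval_self hab hk hs, mul_one]
  · intro t _ hts
    rw [cellPoly_eval_of_ne a b hts hs, mul_zero]
  · intro h
    exact absurd (Finset.mem_range.2 (Nat.lt_succ_of_le hs)) h

lemma cellPoly_degree_lt {a b : ℝ} (hab : a < b) {k : ℕ} (hk : 1 ≤ k) {s : ℕ} (hs : s ≤ k) :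
    (cellPoly a b k s).natDegree ≤ k := by
  have := Lagrange.natDegree_basis (s := Finset.range (k + 1)) (i := s)
    (cellNode_injOn hab hk _) (by simpa using Nat.lt_succ_of_le hs)
  rw [cellPoly, this]
  simp

lemma cellInterp_natDegree {a b : ℝ} (hab : a < b) {k : ℕ} (hk : 1 ≤ k) (g : ℝ → ℝ) :
    (cellInterp a b k g).natDegree ≤ k := by
  refine Polynomial.natDegree_sum_le_of_forall_le _ _ fun s hs => ?_
  refine (Polynomial.natDegree_C_mul_le _ _).trans (cellPoly_degree_lt hab hk ?_)
  exact Nat.lt_succ_iff.1 (Finset.mem_range.1 hs)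

/-- The affine map onto [0, 1] carries equidistant nodes to equidistant nodes, and polynomials of
degree at most k which agree at k + 1 points coincide. This makes all basis constants independent of
the cell. -/
lemma cellPoly_eq_comp {a b : ℝ} (hab : a < b) {k : ℕ} (hk : 1 ≤ k) {s : ℕ} (hs : s ≤ k) :
    cellPoly a b k s
      = (cellPoly 0 1 k s).comp (Polynomial.C (b - a)⁻¹ * (Polynomial.X - Polynomial.C a)) := by
  have hba : b - a ≠ 0 := by linarith
  have hk0 : (k : ℝ) ≠ 0 := by positivity
  refine Polynomial.eq_of_degrees_lt_of_eval_index_eq (Finset.range (k + 1))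
    (v := cellNode a b k) (cellNode_injOn hab hk _) ?_ ?_ ?_
  · refine lt_of_le_of_lt (Polynomial.degree_le_of_natDegree_le (cellPoly_degree_lt hab hk hs)) ?_
    rw [Finset.card_range]; exact_mod_cast Nat.lt_succ_self k
  · refine lt_of_le_of_lt (Polynomial.degree_le_of_natDegree_le (n := k) ?_) ?_
    · refine (Polynomial.natDegree_comp_le).trans ?_
      have h1 := cellPoly_degree_lt (a := 0) (b := 1) one_pos hk hs
      have h2 : (Polynomial.C (b - a)⁻¹ * (Polynomial.X - Polynomial.C a)).natDegree ≤ 1 :=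
        (Polynomial.natDegree_C_mul_le _ _).trans (by simp)
      calc _ ≤ k * 1 := Nat.mul_le_mul h1 h2
        _ = k := mul_one k
    · rw [Finset.card_range]; exact_mod_cast Nat.lt_succ_self k
  · intro t ht
    have ht' : t ≤ k := Nat.lt_succ_iff.1 (Finset.mem_range.1 ht)
    have h3 : (b - a)⁻¹ * (cellNode a b k t - a) = cellNode 0 1 k t := by
      unfold cellNode; field_simp; ring
    rw [Polynomial.eval_comp]
    simp only [Polynomial.eval_mul, Polynomial.eval_C, Polynomial.eval_sub, Polynomial.eval_X, h3]
    by_cases hst : s = t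
    · subst hst
      rw [cellPoly_eval_self hab hk hs, cellPoly_eval_self one_pos hk hs]
    · rw [cellPoly_eval_of_ne _ _ hst ht', cellPoly_eval_of_ne _ _ hst ht']

lemma cellPoly_bound_exists (k : ℕ) :
    ∃ Λ : ℝ, 1 ≤ Λ ∧ ∀ s ≤ k, ∀ x ∈ Icc (0 : ℝ) 1,
      |(cellPoly 0 1 k s).eval x| ≤ Λ ∧ |(cellPoly 0 1 k s).derivative.eval x| ≤ Λ := by
  have key : ∀ q : Polynomial ℝ, ∃ M : ℝ, 0 ≤ M ∧ ∀ x ∈ Icc (0 : ℝ) 1, |q.eval x| ≤ M := by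
    intro q
    obtain ⟨M, hM⟩ := isCompact_Icc.exists_bound_of_continuousOn
      (q.continuous.continuousOn (s := Icc (0 : ℝ) 1))
    exact ⟨M, (abs_nonneg _).trans (hM 0 (by simp)), hM⟩
  choose M hM0 hM using key
  refine ⟨1 + ∑ s ∈ Finset.range (k + 1),
    (M (cellPoly 0 1 k s) + M (cellPoly 0 1 k s).derivative), ?_, ?_⟩
  · have : 0 ≤ ∑ s ∈ Finset.range (k + 1),
        (M (cellPoly 0 1 k s) + M (cellPoly 0 1 k s).derivative) :=
      Finset.sum_nonneg fun s _ => add_nonneg (hM0 _) (hM0 _)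
    linarith
  · intro s hs x hx
    have h1 := Finset.single_le_sum
      (f := fun s => M (cellPoly 0 1 k s) + M (cellPoly 0 1 k s).derivative)
      (fun s _ => add_nonneg (hM0 _) (hM0 _)) (Finset.mem_range.2 (Nat.lt_succ_of_le hs))
    have h2 := hM (cellPoly 0 1 k s) x hx
    have h3 := hM (cellPoly 0 1 k s).derivative x hx
    have h4 := hM0 (cellPoly 0 1 k s)
    have h5 := hM0 (cellPoly 0 1 k s).derivative
    constructor <;> linarith

/-- A bound for the Lagrange basis polynomials of degree `k` and their derivatives on `[0, 1]`. -/
def basisConst (k : ℕ) : ℝ := (cellPoly_bound_exists k).choose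

lemma one_le_basisConst (k : ℕ) : 1 ≤ basisConst k := (cellPoly_bound_exists k).choose_spec.1

lemma cellPoly_bound {a b : ℝ} (hab : a < b) {k : ℕ} (hk : 1 ≤ k) {s : ℕ} (hs : s ≤ k) {x : ℝ}
    (hx : x ∈ Icc a b) :
    |(cellPoly a b k s).eval x| ≤ basisConst k ∧
      |(cellPoly a b k s).derivative.eval x| ≤ basisConst k / (b - a) := by
  have hba : 0 < b - a := by linarith
  have hmem : (b - a)⁻¹ * (x - a) ∈ Icc (0 : ℝ) 1 := by
    constructor
    · have : 0 ≤ x - a := by linarith [hx.1]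
      positivity
    · rw [inv_mul_le_iff₀ hba]; linarith [hx.2]
  have h : _ ≤ basisConst k ∧ _ ≤ basisConst k :=
    (cellPoly_bound_exists k).choose_spec.2 s hs _ hmem
  rw [cellPoly_eq_comp hab hk hs]
  constructor
  · simpa [Polynomial.eval_comp] using h.1
  · rw [Polynomial.derivative_comp]
    simp only [Polynomial.derivative_mul, Polynomial.derivative_C, Polynomial.eval_mul,
      Polynomial.eval_comp, Polynomial.eval_C, Polynomial.eval_sub, Polynomial.eval_X,
      Polynomial.derivative_sub, Polynomial.derivative_X, zero_mul, zero_add, sub_zero,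
      mul_one]
    rw [abs_mul, abs_of_pos (inv_pos.2 hba), div_eq_inv_mul]
    exact mul_le_mul_of_nonneg_left h.2 (inv_pos.2 hba).le

/-- The stability constant of Lagrange interpolation of degree `k`. -/
def interpConst (k : ℕ) : ℝ := (k + 1) * basisConst k

lemma one_le_interpConst (k : ℕ) : 1 ≤ interpConst k := by
  have := one_le_basisConst k
  have h2 : (0 : ℝ) ≤ k := k.cast_nonneg
  unfold interpConst
  nlinarith

lemma cellInterp_bound {a b : ℝ} (hab : a < b) {k : ℕ} (hk : 1 ≤ k) {g : ℝ → ℝ} {M : ℝ}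
    (hM : ∀ s ≤ k, |g (cellNode a b k s)| ≤ M) {x : ℝ} (hx : x ∈ Icc a b) :
    |(cellInterp a b k g).eval x| ≤ interpConst k * M := by
  rw [cellInterp_eval]
  calc _ ≤ ∑ s ∈ Finset.range (k + 1), |g (cellNode a b k s) * (cellPoly a b k s).eval x| :=
        Finset.abs_sum_le_sum_abs _ _
    _ ≤ ∑ _s ∈ Finset.range (k + 1), M * basisConst k := by
        refine Finset.sum_le_sum fun s hs => ?_
        have hs' := Nat.lt_succ_iff.1 (Finset.mem_range.1 hs)
        rw [abs_mul]
        exact mul_le_mul (hM s hs') (cellPoly_bound hab hk hs' hx).1 (abs_nonneg _)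
          ((abs_nonneg _).trans (hM s hs'))
    _ = interpConst k * M := by simp [interpConst]; ring

/-- The derivatives of the basis polynomials sum to zero, so a constant `d` may be subtracted from
all nodal values. With `d = g a` the bound sees the increments of `g`, with `d = 0` its size. -/
lemma cellInterp_derivative_bound {a b : ℝ} (hab : a < b) {k : ℕ} (hk : 1 ≤ k) {g : ℝ → ℝ}
    {M : ℝ} (d : ℝ) (hM : ∀ s ≤ k, |g (cellNode a b k s) - d| ≤ M) {x : ℝ} (hx : x ∈ Icc a b) :
    |(cellInterp a b k g).derivative.eval x| ≤ interpConst k * M / (b - a) := by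
  have h0 : (cellInterp a b k g).derivative.eval x
      = ∑ s ∈ Finset.range (k + 1),
          (g (cellNode a b k s) - d) * (cellPoly a b k s).derivative.eval x := by
    have h1 := congrArg (fun q : Polynomial ℝ => q.derivative.eval x) (cellPoly_sum hab hk)
    simp only [Polynomial.derivative_sum, Polynomial.eval_finsetSum, Polynomial.derivative_one,
      Polynomial.eval_zero] at h1
    rw [cellInterp_derivative_eval]
    simp only [sub_mul, Finset.sum_sub_distrib, ← Finset.mul_sum, h1, mul_zero, sub_zero]
  rw [h0]
  calc _ ≤ ∑ s ∈ Finset.range (k + 1),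
          |(g (cellNode a b k s) - d) * (cellPoly a b k s).derivative.eval x| :=
        Finset.abs_sum_le_sum_abs _ _
    _ ≤ ∑ _s ∈ Finset.range (k + 1), M * (basisConst k / (b - a)) := by
        refine Finset.sum_le_sum fun s hs => ?_
        have hs' := Nat.lt_succ_iff.1 (Finset.mem_range.1 hs)
        rw [abs_mul]
        exact mul_le_mul (hM s hs') (cellPoly_bound hab hk hs' hx).2 (abs_nonneg _)
          ((abs_nonneg _).trans (hM s hs'))
    _ = interpConst k * M / (b - a) := by simp [interpConst]; ring

/-! ### Functions with many zeros -/

/-- `G m` is the `m`-th derivative of `G 0` on `s` for `m ≤ n`. -/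
def DerivChain (n : ℕ) (s : Set ℝ) (G : ℕ → ℝ → ℝ) : Prop :=
  ∀ m < n, ∀ x ∈ s, HasDerivWithinAt (G m) (G (m + 1) x) s x

lemma DerivChain.sub {n : ℕ} {s : Set ℝ} {G H : ℕ → ℝ → ℝ} (hG : DerivChain n s G)
    (hH : DerivChain n s H) : DerivChain n s (fun m x => G m x - H m x) :=
  fun m hm x hx => (hG m hm x hx).sub (hH m hm x hx)

lemma derivChain_polynomial (n : ℕ) (s : Set ℝ) (q : Polynomial ℝ) :
    DerivChain n s (fun m x => (Polynomial.derivative^[m] q).eval x) := by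
  intro m _ x _
  simp only [Function.iterate_succ_apply']
  exact (Polynomial.hasDerivAt _ x).hasDerivWithinAt

/-- Rolle's theorem between consecutive zeros. The new zeros interlace the old ones, so they are
again ordered and the step can be iterated. -/
lemma exists_zeros_deriv {a b : ℝ} {w w' : ℝ → ℝ}
    (hw : ∀ x ∈ Icc a b, HasDerivWithinAt w (w' x) (Icc a b) x) {r : ℕ} {z : ℕ → ℝ}
    (hz : ∀ i ≤ r, z i ∈ Icc a b ∧ w (z i) = 0) (hmono : ∀ i < r, z i < z (i + 1)) :
    ∃ ζ : ℕ → ℝ, (∀ i < r, ζ i ∈ Icc a b ∧ w' (ζ i) = 0) ∧ ∀ i, i + 1 < r → ζ i < ζ (i + 1) := by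
  have key : ∀ i, ∃ ξ, i < r → (ξ ∈ Ioo (z i) (z (i + 1)) ∧ w' ξ = 0) := by
    intro i
    by_cases hi : i < r
    · have h1 := (hz i hi.le).1
      have h2 := (hz (i + 1) hi).1
      have hsub : Icc (z i) (z (i + 1)) ⊆ Icc a b := Icc_subset_Icc h1.1 h2.2
      obtain ⟨ξ, hξ, hξ'⟩ := exists_hasDerivAt_eq_zero (f := w) (f' := w') (hmono i hi)
        (fun x hx => ((hw x (hsub hx)).continuousWithinAt).mono hsub)
        (by rw [(hz i hi.le).2, (hz (i + 1) hi).2])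
        (fun x hx => (hw x (hsub (Ioo_subset_Icc_self hx))).hasDerivAt
          (Icc_mem_nhds (h1.1.trans_lt hx.1) (hx.2.trans_le h2.2)))
      exact ⟨ξ, fun _ => ⟨hξ, hξ'⟩⟩
    · exact ⟨0, fun h => absurd h hi⟩
  choose ζ hζ using key
  refine ⟨ζ, fun i hi => ⟨⟨?_, ?_⟩, (hζ i hi).2⟩, fun i hi => ?_⟩
  · exact (hz i hi.le).1.1.trans (hζ i hi).1.1.le
  · exact (hζ i hi).1.2.le.trans (hz (i + 1) hi).1.2
  · exact (hζ i (by omega)).1.2.trans (hζ (i + 1) hi).1.1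

lemma exists_zero_of_derivChain {a b : ℝ} (n : ℕ) : ∀ {G : ℕ → ℝ → ℝ} {z : ℕ → ℝ},
    DerivChain n (Icc a b) G → (∀ i ≤ n, z i ∈ Icc a b ∧ G 0 (z i) = 0) →
    (∀ i < n, z i < z (i + 1)) → ∃ ξ ∈ Icc a b, G n ξ = 0 := by
  induction n with
  | zero => intro G z _ hz _; exact ⟨z 0, hz 0 le_rfl⟩
  | succ n ih =>
    intro G z hG hz hm
    obtain ⟨ζ, h1, h2⟩ := exists_zeros_deriv (hG 0 (Nat.succ_pos n)) hz hm
    exact ih (G := fun m => G (m + 1)) (z := ζ)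
      (fun m hm x hx => hG (m + 1) (Nat.succ_lt_succ hm) x hx)
      (fun i hi => h1 i (Nat.lt_succ_of_le hi)) (fun i hi => h2 i (Nat.succ_lt_succ hi))

/-- Induction on the number of zeros: by Rolle the derivative has one zero less, hence is at most M
h^n, and the mean value inequality from a zero of the function contributes one more factor h. -/
lemma abs_le_of_zeros {a b M : ℝ} (n : ℕ) : ∀ {G : ℕ → ℝ → ℝ} {z : ℕ → ℝ},
    DerivChain n (Icc a b) G → (∀ i < n, z i ∈ Icc a b ∧ G 0 (z i) = 0) →
    (∀ i, i + 1 < n → z i < z (i + 1)) → (∀ x ∈ Icc a b, |G n x| ≤ M) →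
    ∀ x ∈ Icc a b, |G 0 x| ≤ M * (b - a) ^ n := by
  induction n with
  | zero => intro G z _ _ _ hM x hx; simpa using hM x hx
  | succ n ih =>
    intro G z hG hz hm hM x hx
    have hder : ∀ x ∈ Icc a b, |G 1 x| ≤ M * (b - a) ^ n := by
      obtain ⟨ζ, h1, h2⟩ := exists_zeros_deriv (hG 0 (Nat.succ_pos n)) (r := n) (z := z)
        (fun i hi => hz i (Nat.lt_succ_of_le hi)) (fun i hi => hm i (Nat.succ_lt_succ hi))
      exact ih (G := fun m => G (m + 1)) (z := ζ)
        (fun m hm x hx => hG (m + 1) (Nat.succ_lt_succ hm) x hx) h1 h2 hM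
    have h0 := hz 0 (Nat.succ_pos n)
    have h := (convex_Icc a b).norm_image_sub_le_of_norm_hasDerivWithin_le
      (hG 0 (Nat.succ_pos n)) hder h0.1 hx
    rw [h0.2, sub_zero, Real.norm_eq_abs, Real.norm_eq_abs] at h
    have hM0 : 0 ≤ M * (b - a) ^ n := (abs_nonneg _).trans (hder x hx)
    calc |G 0 x| ≤ M * (b - a) ^ n * |x - z 0| := h
      _ ≤ M * (b - a) ^ n * (b - a) := by
        refine mul_le_mul_of_nonneg_left ?_ hM0
        rw [abs_le]; constructor <;> linarith [hx.1, hx.2, h0.1.1, h0.1.2]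
      _ = _ := by ring

/-! ### Interpolation errors -/

section Errors

variable {a b M : ℝ} {k : ℕ} {G : ℕ → ℝ → ℝ}

lemma derivChain_error {n : ℕ} (hG : DerivChain n (Icc a b) G) :
    DerivChain n (Icc a b)
      (fun m x => G m x - (Polynomial.derivative^[m] (cellInterp a b k (G 0))).eval x) :=
  hG.sub (derivChain_polynomial n _ _)

lemma error_zeros (hab : a < b) (hk : 1 ≤ k) {i : ℕ} (hi : i ≤ k) :
    cellNode a b k i ∈ Icc a b ∧ G 0 (cellNode a b k i)
      - (Polynomial.derivative^[0] (cellInterp a b k (G 0))).eval (cellNode a b k i) = 0 :=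
  ⟨cellNode_mem hab hk hi, by
    rw [Function.iterate_zero_apply, cellInterp_eval_node hab hk _ hi, sub_self]⟩

lemma derivative_cellInterp_top (hab : a < b) (hk : 1 ≤ k) (g : ℝ → ℝ) :
    Polynomial.derivative^[k + 1] (cellInterp a b k g) = 0 :=
  Polynomial.iterate_derivative_eq_zero (Nat.lt_succ_of_le (cellInterp_natDegree hab hk g))

/-- The interpolation error of order `k + 1`. -/
lemma interp_error_succ (hab : a < b) (hk : 1 ≤ k) (hG : DerivChain (k + 1) (Icc a b) G)
    (hM : ∀ x ∈ Icc a b, |G (k + 1) x| ≤ M) {x : ℝ} (hx : x ∈ Icc a b) :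
    |G 0 x - (cellInterp a b k (G 0)).eval x| ≤ M * (b - a) ^ (k + 1) := by
  refine abs_le_of_zeros (k + 1) (derivChain_error (k := k) hG) (z := cellNode a b k)
    (fun i hi => error_zeros hab hk (Nat.lt_succ_iff.1 hi))
    (fun i _ => cellNode_lt hab hk (Nat.lt_succ_self i)) (fun y hy => ?_) x hx
  simpa [derivative_cellInterp_top hab hk] using hM y hy

/-- The error of the derivative of the interpolant. -/
lemma interp_deriv_error (hab : a < b) (hk : 1 ≤ k) (hG : DerivChain (k + 1) (Icc a b) G)
    (hM : ∀ x ∈ Icc a b, |G (k + 1) x| ≤ M) {x : ℝ} (hx : x ∈ Icc a b) :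
    |G 1 x - (cellInterp a b k (G 0)).derivative.eval x| ≤ M * (b - a) ^ k := by
  have hE := derivChain_error (k := k) hG
  -- The error vanishes at k + 1 nodes, so its derivative has k zeros, and k further
  -- differentiations reach the order k + 1 at which the interpolant disappears.
  obtain ⟨ζ, h1, h2⟩ := exists_zeros_deriv (hE 0 (Nat.succ_pos k)) (r := k)
    (z := cellNode a b k) (fun i hi => error_zeros hab hk hi)
    (fun i _ => cellNode_lt hab hk (Nat.lt_succ_self i))
  refine abs_le_of_zeros k (a := a) (b := b)
    (G := fun m x => G (m + 1) x
      - (Polynomial.derivative^[m + 1] (cellInterp a b k (G 0))).eval x) (z := ζ)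
    (fun m hm x hx => hE (m + 1) (Nat.succ_lt_succ hm) x hx) h1 h2 (fun y hy => ?_) x hx
  simpa [derivative_cellInterp_top hab hk] using hM y hy

/-- The interpolation error of order `k`. -/
lemma interp_error_self (hab : a < b) (hk : 1 ≤ k) (hG : DerivChain k (Icc a b) G)
    (hM : ∀ x ∈ Icc a b, |G k x| ≤ M) {x : ℝ} (hx : x ∈ Icc a b) :
    |G 0 x - (cellInterp a b k (G 0)).eval x| ≤ 2 * M * (b - a) ^ k := by
  have hE := derivChain_error (k := k) hG
  -- With only k derivatives available the interpolant does not drop out. Its k-th derivative is a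
  -- constant `d`; the k-th derivative of the error vanishes at some `ξ`, so `d = G k ξ` and |d| ≤
  -- M.
  obtain ⟨ξ, hξ, hξ0⟩ := exists_zero_of_derivChain k hE (z := cellNode a b k)
    (fun i hi => error_zeros hab hk hi) (fun i _ => cellNode_lt hab hk (Nat.lt_succ_self i))
  have hdeg : (Polynomial.derivative^[k] (cellInterp a b k (G 0))).natDegree ≤ 0 :=
    (Polynomial.natDegree_iterate_derivative _ _).trans
      (by have := cellInterp_natDegree hab hk (G 0); omega)
  obtain ⟨d, hd⟩ : ∃ d, Polynomial.derivative^[k] (cellInterp a b k (G 0)) = Polynomial.C d :=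
    ⟨_, Polynomial.eq_C_of_natDegree_le_zero hdeg⟩
  have hdM : |d| ≤ M := by
    rw [hd, Polynomial.eval_C, sub_eq_zero] at hξ0
    rw [← hξ0]; exact hM ξ hξ
  refine abs_le_of_zeros k hE (z := cellNode a b k)
    (fun i hi => error_zeros hab hk hi.le)
    (fun i _ => cellNode_lt hab hk (Nat.lt_succ_self i)) (fun y hy => ?_) x hx
  rw [hd, Polynomial.eval_C]
  calc |G k y - d| ≤ |G k y| + |d| := abs_sub _ _
    _ ≤ 2 * M := by linarith [hM y hy]

end Errors

end BakhvalovFEM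
end

noncomputable section
namespace BakhvalovFEM

/-! ### Interpolation of layer functions on one cell -/

/-- The relation between the cell `[a, b]` and a layer of width `1 / A` with the weight
`ρ ^ (k + 1)`: either the cell is short compared with the layer and resolves it, or the layer
function is negligible on it. -/
structure LayerCell (a b A κ K r : ℝ) (ρ : ℝ → ℝ) : Prop where
  lt : a < b
  A_pos : 0 < A
  one_le_K : 1 ≤ K
  r_nonneg : 0 ≤ r
  r_le_one : r ≤ 1
  min_le : min 1 (A * (b - a)) * r ≤ κ
  nonneg : ∀ x ∈ Icc a b, 0 ≤ ρ x
  le : ∀ x ∈ Icc a b, ρ x ≤ r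
  comparable : A * (b - a) ≤ 1 → ∀ x ∈ Icc a b, r ≤ K * ρ x

/-- The majorant of the derivative of a layer function and its interpolants. -/
def layerDeriv (A κ h t : ℝ) : ℝ := A * t + κ * √(A / h)

section LayerCell

variable {a b A κ K r M : ℝ} {ρ : ℝ → ℝ} {k : ℕ}

lemma LayerCell.h_pos (hc : LayerCell a b A κ K r ρ) : 0 < b - a := sub_pos.2 hc.lt

lemma LayerCell.kappa_nonneg (hc : LayerCell a b A κ K r ρ) : 0 ≤ κ := by
  have h1 := hc.h_pos
  have h2 := hc.A_pos
  have h3 := hc.r_nonneg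
  exact le_trans (by positivity) hc.min_le

lemma LayerCell.fine (hc : LayerCell a b A κ K r ρ) (h : A * (b - a) ≤ 1) :
    A * (b - a) * r ≤ κ := by
  have := hc.min_le
  rwa [min_eq_right h] at this

lemma LayerCell.coarse (hc : LayerCell a b A κ K r ρ) (h : 1 ≤ A * (b - a)) : r ≤ κ := by
  have := hc.min_le
  rwa [min_eq_left h, one_mul] at this

lemma LayerCell.pow_le (hc : LayerCell a b A κ K r ρ) (h : 1 ≤ A * (b - a)) {n m : ℕ}
    (hn : n ≤ m) : r ^ m ≤ κ ^ n :=
  (pow_le_pow_of_le_one hc.r_nonneg hc.r_le_one hn).trans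
    (pow_le_pow_left₀ hc.r_nonneg (hc.coarse h) n)

/-- Converts the 1/h of an inverse estimate into √(A/h), whose square has integral A over a cell of
length h, whatever h is. -/
lemma LayerCell.inv_le_sqrt (hc : LayerCell a b A κ K r ρ) (h : 1 ≤ A * (b - a)) :
    1 / (b - a) ≤ √(A / (b - a)) := by
  have hh := hc.h_pos
  apply Real.le_sqrt_of_sq_le
  rw [div_pow, one_pow, div_le_div_iff₀ (by positivity) hh]
  nlinarith

lemma LayerCell.layerDeriv_nonneg (hc : LayerCell a b A κ K r ρ) {x : ℝ} (hx : x ∈ Icc a b) :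
    0 ≤ layerDeriv A κ (b - a) (ρ x) := by
  have h1 := hc.kappa_nonneg
  have h2 := hc.A_pos
  have h3 := hc.nonneg x hx
  unfold layerDeriv
  positivity

/-- The interpolation error of order `n ∈ {k, k + 1}` for a layer function. -/
lemma LayerCell.interp_error (hc : LayerCell a b A κ K r ρ) (hk : 1 ≤ k) {n : ℕ}
    (hn : n = k ∨ n = k + 1) {G : ℕ → ℝ → ℝ} (hG : DerivChain n (Icc a b) G) (hM : 0 ≤ M)
    (h0 : ∀ x ∈ Icc a b, |G 0 x| ≤ M * r ^ (k + 1))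
    (h1 : ∀ x ∈ Icc a b, |G n x| ≤ M * (A ^ n * r ^ (k + 1))) {x : ℝ} (hx : x ∈ Icc a b) :
    |G 0 x - (cellInterp a b k (G 0)).eval x| ≤ 2 * interpConst k * M * κ ^ n := by
  have hΛ := one_le_interpConst k
  have hκ := hc.kappa_nonneg
  have hh := hc.h_pos
  have hA := hc.A_pos
  have hr := hc.r_nonneg
  have hnk : n ≤ k + 1 := by omega
  -- On a short cell the error is bounded by (A h r)^n up to a constant. On a long cell r ≤ κ, and
  -- the function and its interpolant are bounded separately.
  rcases le_total (A * (b - a)) 1 with hf | hf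
  · have e1 : |G 0 x - (cellInterp a b k (G 0)).eval x|
        ≤ 2 * (M * (A ^ n * r ^ (k + 1))) * (b - a) ^ n := by
      rcases hn with rfl | rfl
      · exact interp_error_self hc.lt hk hG h1 hx
      · refine (interp_error_succ hc.lt hk hG h1 hx).trans ?_
        linarith [show 0 ≤ M * (A ^ (k + 1) * r ^ (k + 1)) * (b - a) ^ (k + 1) by positivity]
    have e2 : r ^ (k + 1) ≤ r ^ n := pow_le_pow_of_le_one hr hc.r_le_one hnk
    calc _ ≤ 2 * (M * (A ^ n * r ^ (k + 1))) * (b - a) ^ n := e1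
      _ ≤ 2 * (M * (A ^ n * r ^ n)) * (b - a) ^ n := by gcongr
      _ = 2 * 1 * M * (A * (b - a) * r) ^ n := by rw [mul_pow, mul_pow]; ring
      _ ≤ 2 * interpConst k * M * κ ^ n := by
        gcongr
        exact hc.fine hf
  · have e2 := hc.pow_le hf hnk
    have e3 := cellInterp_bound hc.lt hk (g := G 0) (M := M * r ^ (k + 1))
      (fun s hs => h0 _ (cellNode_mem hc.lt hk hs)) hx
    calc _ ≤ |G 0 x| + |(cellInterp a b k (G 0)).eval x| := abs_sub _ _
      _ ≤ M * r ^ (k + 1) + interpConst k * (M * r ^ (k + 1)) := add_le_add (h0 x hx) e3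
      _ ≤ 2 * interpConst k * (M * r ^ (k + 1)) := by
        nlinarith [show 0 ≤ M * r ^ (k + 1) by positivity]
      _ ≤ 2 * interpConst k * M * κ ^ n := by
        rw [mul_assoc (2 * interpConst k)]
        gcongr

/-- The error of the derivative of the interpolant of a layer function. -/
lemma LayerCell.interp_deriv_error (hc : LayerCell a b A κ K r ρ) (hk : 1 ≤ k)
    {G : ℕ → ℝ → ℝ} (hG : DerivChain (k + 1) (Icc a b) G) (hM : 0 ≤ M)
    (h0 : ∀ m ≤ k + 1, ∀ x ∈ Icc a b, |G m x| ≤ M * (A ^ m * ρ x ^ (k + 1))) {x : ℝ}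
    (hx : x ∈ Icc a b) :
    |G 1 x - (cellInterp a b k (G 0)).derivative.eval x|
      ≤ interpConst k * K * M * κ ^ k * layerDeriv A κ (b - a) (ρ x) := by
  have hΛ := one_le_interpConst k
  have hκ := hc.kappa_nonneg
  have hh := hc.h_pos
  have hA := hc.A_pos
  have hr := hc.r_nonneg
  have hK := hc.one_le_K
  have hρ := hc.nonneg x hx
  have hρr := hc.le x hx
  -- On a short cell one factor A r is left over and becomes A K ρ(x) by comparability. On a long
  -- cell G 1 is at most M A κ^k ρ(x), and the derivative of the interpolant is paid for by κ√(A/h).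
  rcases le_total (A * (b - a)) 1 with hf | hf
  · have e1 := BakhvalovFEM.interp_deriv_error hc.lt hk hG
      (M := M * (A ^ (k + 1) * r ^ (k + 1))) (fun y hy => (h0 _ le_rfl y hy).trans (by
        have := hc.nonneg y hy
        have := hc.le y hy
        gcongr)) hx
    calc _ ≤ M * (A ^ (k + 1) * r ^ (k + 1)) * (b - a) ^ k := e1
      _ = 1 * M * (A * (b - a) * r) ^ k * (A * r) := by rw [mul_pow, mul_pow]; ring
      _ ≤ interpConst k * M * κ ^ k * (A * (K * ρ x)) := by
        gcongr
        · exact hc.fine hf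
        · exact hc.comparable hf x hx
      _ = interpConst k * K * M * κ ^ k * (A * ρ x) := by ring
      _ ≤ _ := by
        unfold layerDeriv
        gcongr
        have : 0 ≤ κ * √(A / (b - a)) := by positivity
        linarith
  · have e3 := cellInterp_derivative_bound hc.lt hk (g := G 0) (M := M * r ^ (k + 1)) 0
      (fun s hs => by
        have hm := cellNode_mem hc.lt hk hs
        have h5 := h0 0 (Nat.zero_le _) _ hm
        have := hc.nonneg _ hm
        have := hc.le _ hm
        rw [pow_zero, one_mul] at h5
        rw [sub_zero]
        exact h5.trans (by gcongr)) hx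
    have e4 : |G 1 x| ≤ M * (A * (κ ^ k * ρ x)) := by
      refine (h0 1 (by omega) x hx).trans ?_
      rw [pow_one, pow_succ]
      gcongr
      exact hρr.trans (hc.coarse hf)
    calc _ ≤ |G 1 x| + |(cellInterp a b k (G 0)).derivative.eval x| := abs_sub _ _
      _ ≤ M * (A * (κ ^ k * ρ x)) + interpConst k * (M * κ ^ (k + 1)) * √(A / (b - a)) := by
        refine add_le_add e4 (e3.trans ?_)
        rw [div_eq_mul_one_div]
        gcongr
        · exact hc.coarse hf
        · exact hc.inv_le_sqrt hf
      _ = 1 * 1 * M * κ ^ k * (A * ρ x)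
          + interpConst k * 1 * M * κ ^ k * (κ * √(A / (b - a))) := by ring
      _ ≤ interpConst k * K * M * κ ^ k * (A * ρ x)
          + interpConst k * K * M * κ ^ k * (κ * √(A / (b - a))) := by gcongr
      _ = _ := by unfold layerDeriv; ring

/-- The stability of the derivative of the interpolant of a layer function. -/
lemma LayerCell.interp_deriv_bound (hc : LayerCell a b A κ K r ρ) (hk : 1 ≤ k) {g : ℝ → ℝ}
    (hM : 0 ≤ M) (h0 : ∀ s ≤ k, |g (cellNode a b k s)| ≤ M * r ^ (k + 1))
    (h1 : ∀ s ≤ k, |g (cellNode a b k s) - g a| ≤ M * (A * (b - a) * r ^ (k + 1))) {x : ℝ}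
    (hx : x ∈ Icc a b) :
    |(cellInterp a b k g).derivative.eval x|
      ≤ interpConst k * K * M * layerDeriv A κ (b - a) (ρ x) := by
  have hΛ := one_le_interpConst k
  have hκ := hc.kappa_nonneg
  have hh := hc.h_pos
  have hA := hc.A_pos
  have hr := hc.r_nonneg
  have hK := hc.one_le_K
  have hρ := hc.nonneg x hx
  rcases le_total (A * (b - a)) 1 with hf | hf
  -- Subtracting `g a` brings in the increments, whose factor h cancels the 1/h of the inverse
  -- estimate.
  · have e1 := cellInterp_derivative_bound hc.lt hk (g a) h1 hx
    have e2 : r ^ (k + 1) ≤ r := by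
      simpa using pow_le_pow_of_le_one hr hc.r_le_one (show 1 ≤ k + 1 by omega)
    calc _ ≤ interpConst k * (M * (A * (b - a) * r ^ (k + 1))) / (b - a) := e1
      _ = interpConst k * M * (A * r ^ (k + 1)) := by field_simp
      _ ≤ interpConst k * M * (A * (K * ρ x)) := by
        gcongr
        exact e2.trans (hc.comparable hf x hx)
      _ = interpConst k * K * M * (A * ρ x) := by ring
      _ ≤ _ := by
        unfold layerDeriv
        gcongr
        have : 0 ≤ κ * √(A / (b - a)) := by positivity
        linarith
  · have e3 := cellInterp_derivative_bound hc.lt hk 0 (fun s hs => by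
      rw [sub_zero]; exact h0 s hs) hx
    have e5 : r ^ (k + 1) ≤ κ := by simpa using hc.pow_le hf (show 1 ≤ k + 1 by omega)
    calc _ ≤ interpConst k * (M * r ^ (k + 1)) / (b - a) := e3
      _ ≤ interpConst k * (M * κ) * √(A / (b - a)) := by
        rw [div_eq_mul_one_div]
        gcongr
        exact hc.inv_le_sqrt hf
      _ = interpConst k * 1 * M * (κ * √(A / (b - a))) := by ring
      _ ≤ interpConst k * K * M * (κ * √(A / (b - a))) := by gcongr
      _ ≤ _ := by
        unfold layerDeriv
        gcongr
        have : 0 ≤ A * ρ x := by positivity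
        linarith

end LayerCell

/-! ### Interpolation on one rectangle -/

/-- The functions `V i j` are the derivatives `∂^{i+j} V₀₀ / ∂x^i ∂y^j` on `[0, 1]²` up to order
`n`. -/
structure Jet (n : ℕ) (V : ℕ → ℕ → ℝ → ℝ → ℝ) : Prop where
  deriv_fst : ∀ i j, i + j < n → ∀ x ∈ Icc (0 : ℝ) 1, ∀ y ∈ Icc (0 : ℝ) 1,
    HasDerivWithinAt (fun t => V i j t y) (V (i + 1) j x y) (Icc 0 1) x
  deriv_snd : ∀ i j, i + j < n → ∀ x ∈ Icc (0 : ℝ) 1, ∀ y ∈ Icc (0 : ℝ) 1,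
    HasDerivWithinAt (fun t => V i j x t) (V i (j + 1) x y) (Icc 0 1) y

lemma Jet.flip {n : ℕ} {V : ℕ → ℕ → ℝ → ℝ → ℝ} (hV : Jet n V) :
    Jet n (fun i j x y => V j i y x) where
  deriv_fst i j h x hx y hy := hV.deriv_snd j i (by omega) y hy x hx
  deriv_snd i j h x hx y hy := hV.deriv_fst j i (by omega) y hy x hx

/-- The layer bounds of the derivatives up to order `n`. -/
def LayerBound (n : ℕ) (M A B : ℝ) (ρ ψ : ℝ → ℝ) (V : ℕ → ℕ → ℝ → ℝ → ℝ) : Prop :=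
  ∀ i j, i + j ≤ n → ∀ x ∈ Icc (0 : ℝ) 1, ∀ y ∈ Icc (0 : ℝ) 1,
    |V i j x y| ≤ M * ((A ^ i * ρ x ^ n) * (B ^ j * ψ y ^ n))

lemma LayerBound.flip {n : ℕ} {M A B : ℝ} {ρ ψ : ℝ → ℝ} {V : ℕ → ℕ → ℝ → ℝ → ℝ}
    (h : LayerBound n M A B ρ ψ V) : LayerBound n M B A ψ ρ (fun i j x y => V j i y x) := by
  intro i j hij x hx y hy
  have := h j i (by omega) y hy x hx
  rwa [mul_comm (A ^ j * _)] at this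

/-- The tensor product Lagrange interpolant on the rectangle `[a, b] × [c, d]`. -/
def tensorInterp (a b c d : ℝ) (k : ℕ) (F : ℝ → ℝ → ℝ) (x y : ℝ) : ℝ :=
  (cellInterp a b k (fun x' => (cellInterp c d k (F x')).eval y)).eval x

lemma tensorInterp_eq_sum (a b c d : ℝ) (k : ℕ) (F : ℝ → ℝ → ℝ) (x y : ℝ) :
    tensorInterp a b c d k F x y = ∑ s ∈ Finset.range (k + 1), ∑ t ∈ Finset.range (k + 1),
      F (cellNode a b k s) (cellNode c d k t) * (cellPoly a b k s).eval x
        * (cellPoly c d k t).eval y := by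
  simp only [tensorInterp, cellInterp_eval, Finset.sum_mul]
  refine Finset.sum_congr rfl fun s _ => Finset.sum_congr rfl fun t _ => by ring

lemma tensorInterp_flip (a b c d : ℝ) (k : ℕ) (F : ℝ → ℝ → ℝ) (x y : ℝ) :
    tensorInterp a b c d k F x y = tensorInterp c d a b k (fun y x => F x y) y x := by
  rw [tensorInterp_eq_sum, tensorInterp_eq_sum, Finset.sum_comm]
  refine Finset.sum_congr rfl fun s _ => Finset.sum_congr rfl fun t _ => by ring

section Rectangle

variable {a b c d A B κ K r q M : ℝ} {ρ ψ : ℝ → ℝ} {k : ℕ} {V : ℕ → ℕ → ℝ → ℝ → ℝ}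

lemma cellInterp_sub (a b : ℝ) (k : ℕ) (g₁ g₂ : ℝ → ℝ) :
    cellInterp a b k g₁ - cellInterp a b k g₂ = cellInterp a b k (fun x => g₁ x - g₂ x) := by
  simp only [cellInterp, ← Finset.sum_sub_distrib, ← sub_mul, Polynomial.C_sub]

/-- The error of interpolation in the second variable. -/
lemma snd_interp_error (hy : LayerCell c d B κ K q ψ) (hk : 1 ≤ k) (hcd : Icc c d ⊆ Icc 0 1)
    (hV : Jet (k + 1) V) (hM : 0 ≤ M) (hB : LayerBound (k + 1) M A B ρ ψ V) {n : ℕ}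
    (hn : n = k ∨ n = k + 1) {x : ℝ} (hx : x ∈ Icc (0 : ℝ) 1) (hρ : 0 ≤ ρ x) {y : ℝ}
    (hyy : y ∈ Icc c d) :
    |V 0 0 x y - (cellInterp c d k (V 0 0 x)).eval y|
      ≤ 2 * interpConst k * (M * ρ x ^ (k + 1)) * κ ^ n := by
  have hBp := hy.A_pos
  refine hy.interp_error hk hn (G := fun m y => V 0 m x y) (M := M * ρ x ^ (k + 1))
    (fun m hm y hy' => (hV.deriv_snd 0 m (by omega) x hx y (hcd hy')).mono hcd) (by positivity)
    (fun y hy' => ?_) (fun y hy' => ?_) hyy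
  · refine (hB 0 0 (by omega) x hx y (hcd hy')).trans ?_
    have := hy.nonneg y hy'
    have := hy.le y hy'
    rw [pow_zero, pow_zero, one_mul, one_mul, ← mul_assoc]
    gcongr
  · refine (hB 0 n (by omega) x hx y (hcd hy')).trans ?_
    have := hy.nonneg y hy'
    have := hy.le y hy'
    rw [pow_zero, one_mul, ← mul_assoc]
    gcongr

/-- The increment in the first variable of the error of interpolation in the second variable. -/
lemma snd_interp_error_increment (hx : LayerCell a b A κ K r ρ) (hy : LayerCell c d B κ K q ψ)
    (hk : 1 ≤ k) (hab : Icc a b ⊆ Icc 0 1) (hcd : Icc c d ⊆ Icc 0 1) (hV : Jet (k + 1) V)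
    (hM : 0 ≤ M) (hB : LayerBound (k + 1) M A B ρ ψ V) {x x' : ℝ} (hxx : x ∈ Icc a b)
    (hxx' : x' ∈ Icc a b) {y : ℝ} (hyy : y ∈ Icc c d) :
    |(V 0 0 x y - (cellInterp c d k (V 0 0 x)).eval y)
        - (V 0 0 x' y - (cellInterp c d k (V 0 0 x')).eval y)|
      ≤ 2 * interpConst k * (M * (A * (b - a) * r ^ (k + 1))) * κ ^ k := by
  have hBp := hy.A_pos
  have hAp := hx.A_pos
  have hh := hx.h_pos
  have hr := hx.r_nonneg
  have hdiff : ∀ m ≤ k, ∀ t ∈ Icc c d, |V 0 m x t - V 0 m x' t|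
      ≤ M * (A * (b - a) * r ^ (k + 1)) * (B ^ m * q ^ (k + 1)) := by
    intro m hm t ht
    have hψ := hy.nonneg t ht
    have hψq := hy.le t ht
    have h := (convex_Icc a b).norm_image_sub_le_of_norm_hasDerivWithin_le
      (f := fun s => V 0 m s t) (f' := fun s => V 1 m s t)
      (C := M * ((A * r ^ (k + 1)) * (B ^ m * q ^ (k + 1))))
      (fun s hs => (hV.deriv_fst 0 m (by omega) s (hab hs) t (hcd ht)).mono hab)
      (fun s hs => by
        have hρ := hx.nonneg s hs
        have hρr := hx.le s hs
        refine (hB 1 m (by omega) s (hab hs) t (hcd ht)).trans ?_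
        rw [pow_one]
        gcongr) hxx' hxx
    rw [Real.norm_eq_abs, Real.norm_eq_abs] at h
    have hq := hy.r_nonneg
    calc _ ≤ M * ((A * r ^ (k + 1)) * (B ^ m * q ^ (k + 1))) * |x - x'| := h
      _ ≤ M * ((A * r ^ (k + 1)) * (B ^ m * q ^ (k + 1))) * (b - a) := by
        gcongr
        rw [abs_le]; constructor <;> linarith [hxx.1, hxx.2, hxx'.1, hxx'.2]
      _ = _ := by ring
  -- One of the k + 1 available derivatives has been spent on the increment in x, so only the order
  -- k estimate can be used in y.
  have := hy.interp_error hk (Or.inl rfl) (G := fun m y => V 0 m x y - V 0 m x' y)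
    (M := M * (A * (b - a) * r ^ (k + 1)))
    (fun m hm y hy' => ((hV.deriv_snd 0 m (by omega) x (hab hxx) y (hcd hy')).mono hcd).sub
      ((hV.deriv_snd 0 m (by omega) x' (hab hxx') y (hcd hy')).mono hcd)) (by positivity)
    (fun y hy' => by simpa using hdiff 0 (by omega) y hy') (fun y hy' => hdiff k le_rfl y hy') hyy
  rw [← cellInterp_sub, Polynomial.eval_sub] at this
  convert this using 2
  ring

lemma tensorInterp_bound (hab : a < b) (hcd : c < d) (hk : 1 ≤ k) {F : ℝ → ℝ → ℝ} {M : ℝ}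
    (hM : ∀ s ≤ k, ∀ t ≤ k, |F (cellNode a b k s) (cellNode c d k t)| ≤ M) {x y : ℝ}
    (hx : x ∈ Icc a b) (hy : y ∈ Icc c d) :
    |tensorInterp a b c d k F x y| ≤ interpConst k ^ 2 * M := by
  have := cellInterp_bound hab hk (g := fun x' => (cellInterp c d k (F x')).eval y)
    (M := interpConst k * M) (fun s hs => cellInterp_bound hcd hk (hM s hs) hy) hx
  rw [tensorInterp]
  calc _ ≤ _ := this
    _ = _ := by ring

/-- The interpolation error on a rectangle. -/
lemma tensor_error (hx : LayerCell a b A κ K r ρ) (hy : LayerCell c d B κ K q ψ)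
    (hk : 1 ≤ k) (hab : Icc a b ⊆ Icc 0 1) (hcd : Icc c d ⊆ Icc 0 1) (hV : Jet (k + 1) V)
    (hM : 0 ≤ M) (hB : LayerBound (k + 1) M A B ρ ψ V) {x y : ℝ} (hxx : x ∈ Icc a b)
    (hyy : y ∈ Icc c d) :
    |V 0 0 x y - tensorInterp a b c d k (V 0 0) x y|
      ≤ 4 * interpConst k ^ 2 * M * κ ^ (k + 1) := by
  have hΛ := one_le_interpConst k
  have hκ := hx.kappa_nonneg
  have hψ1 : ψ y ^ (k + 1) ≤ 1 :=
    pow_le_one₀ (hy.nonneg y hyy) ((hy.le y hyy).trans hy.r_le_one)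
  -- V - I_x I_y V = (V - I_x V) + I_x(V - I_y V): `e1` bounds the first difference by exchanging
  -- the variables, `e2` the second by the stability of I_x.
  have e1 := snd_interp_error hx hk hab hV.flip hM hB.flip (Or.inr rfl) (hcd hyy)
    (hy.nonneg y hyy) hxx
  have e2 := cellInterp_bound hx.lt hk
    (g := fun x' => V 0 0 x' y - (cellInterp c d k (V 0 0 x')).eval y)
    (M := 2 * interpConst k * M * κ ^ (k + 1)) (fun s hs => by
      have hm := cellNode_mem hx.lt hk hs
      have := snd_interp_error hy hk hcd hV hM hB (Or.inr rfl) (hab hm) (hx.nonneg _ hm) hyy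
      have hρ1 : ρ (cellNode a b k s) ^ (k + 1) ≤ 1 :=
        pow_le_one₀ (hx.nonneg _ hm) ((hx.le _ hm).trans hx.r_le_one)
      refine this.trans ?_
      gcongr
      nlinarith) hxx
  rw [← cellInterp_sub, Polynomial.eval_sub] at e2
  calc _ = |(V 0 0 x y - (cellInterp a b k (fun x' => V 0 0 x' y)).eval x)
          + ((cellInterp a b k (fun x' => V 0 0 x' y)).eval x
            - tensorInterp a b c d k (V 0 0) x y)| := by congr 1; ring
    _ ≤ 2 * interpConst k * (M * 1) * κ ^ (k + 1)
        + interpConst k * (2 * interpConst k * M * κ ^ (k + 1)) := by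
      refine (abs_add_le _ _).trans (add_le_add (e1.trans ?_) e2)
      gcongr
    _ = (2 * interpConst k + 2 * interpConst k ^ 2) * (M * κ ^ (k + 1)) := by ring
    _ ≤ (4 * interpConst k ^ 2) * (M * κ ^ (k + 1)) := by
      gcongr
      nlinarith
    _ = _ := by ring

/-- The `x`-derivative of the interpolation error on a rectangle. -/
lemma tensor_deriv_error (hx : LayerCell a b A κ K r ρ) (hy : LayerCell c d B κ K q ψ)
    (hk : 1 ≤ k) (hab : Icc a b ⊆ Icc 0 1) (hcd : Icc c d ⊆ Icc 0 1) (hV : Jet (k + 1) V)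
    (hM : 0 ≤ M) (hB : LayerBound (k + 1) M A B ρ ψ V) {x y : ℝ} (hxx : x ∈ Icc a b)
    (hyy : y ∈ Icc c d) :
    |V 1 0 x y - (cellInterp a b k
        (fun x' => (cellInterp c d k (V 0 0 x')).eval y)).derivative.eval x|
      ≤ 3 * interpConst k ^ 2 * K * M * κ ^ k * layerDeriv A κ (b - a) (ρ x) := by
  have hΛ := one_le_interpConst k
  have hκ := hx.kappa_nonneg
  have hK := hx.one_le_K
  have hAp := hx.A_pos
  have hL := hx.layerDeriv_nonneg hxx
  have hψ0 := hy.nonneg y hyy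
  have hψ1 : ψ y ^ (k + 1) ≤ 1 := pow_le_one₀ hψ0 ((hy.le y hyy).trans hy.r_le_one)
  have e1 := hx.interp_deriv_error hk (G := fun m x => V m 0 x y) (M := M)
    (fun m hm x hx' => (hV.deriv_fst m 0 (by omega) x (hab hx') y (hcd hyy)).mono hab) hM
    (fun m hm x hx' => by
      refine (hB m 0 (by omega) x (hab hx') y (hcd hyy)).trans ?_
      have := hx.nonneg x hx'
      rw [pow_zero, one_mul]
      exact mul_le_mul_of_nonneg_left (mul_le_of_le_one_right (by positivity) hψ1) hM) hxx
  -- The derivative of I_x(V - I_y V) is bounded through the nodal values of V - I_y V and their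
  -- increments in x, so that no mixed derivative of order k + 2 enters.
  have e2 := hx.interp_deriv_bound hk
    (g := fun x' => V 0 0 x' y - (cellInterp c d k (V 0 0 x')).eval y)
    (M := 2 * interpConst k * M * κ ^ k) (by positivity) (fun s hs => by
      have hm := cellNode_mem hx.lt hk hs
      have h0 := hx.nonneg _ hm
      have h1 := hx.le _ hm
      have := snd_interp_error hy hk hcd hV hM hB (Or.inl rfl) (hab hm) h0 hyy
      calc _ ≤ _ := this
        _ ≤ 2 * interpConst k * (M * r ^ (k + 1)) * κ ^ k := by gcongr
        _ = _ := by ring) (fun s hs => by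
      have := snd_interp_error_increment hx hy hk hab hcd hV hM hB
        (cellNode_mem hx.lt hk hs) (left_mem_Icc.2 hx.lt.le) hyy
      calc _ ≤ _ := this
        _ = _ := by ring) hxx
  rw [← cellInterp_sub, Polynomial.derivative_sub, Polynomial.eval_sub] at e2
  calc _ = |(V 1 0 x y - (cellInterp a b k (fun x' => V 0 0 x' y)).derivative.eval x)
          + ((cellInterp a b k (fun x' => V 0 0 x' y)).derivative.eval x
            - (cellInterp a b k
              (fun x' => (cellInterp c d k (V 0 0 x')).eval y)).derivative.eval x)| := by
        congr 1; ring
    _ ≤ _ := (abs_add_le _ _).trans (add_le_add e1 e2)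
    _ = (interpConst k + 2 * interpConst k ^ 2)
          * (K * M * κ ^ k * layerDeriv A κ (b - a) (ρ x)) := by ring
    _ ≤ (3 * interpConst k ^ 2) * (K * M * κ ^ k * layerDeriv A κ (b - a) (ρ x)) := by
      gcongr
      nlinarith
    _ = _ := by ring

end Rectangle

end BakhvalovFEM
end

noncomputable section
namespace BakhvalovFEM

/-! ### One-dimensional meshes and their basis functions -/

/-- `0 = X 0 < X 1 < … < X N = 1`. -/
structure Mesh (X : ℕ → ℝ) (N : ℕ) : Prop where
  zero : X 0 = 0
  last : X N = 1
  lt_succ : ∀ i < N, X i < X (i + 1)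

section Mesh

variable {X : ℕ → ℝ} {N : ℕ}

lemma Mesh.lt (hX : Mesh X N) {i j : ℕ} (hij : i < j) (hj : j ≤ N) : X i < X j := by
  induction j with
  | zero => omega
  | succ j ih =>
    rcases Nat.lt_succ_iff_lt_or_eq.1 hij with h | rfl
    · exact (ih h (by omega)).trans (hX.lt_succ j hj)
    · exact hX.lt_succ i hj

lemma Mesh.le (hX : Mesh X N) {i j : ℕ} (hij : i ≤ j) (hj : j ≤ N) : X i ≤ X j := by
  rcases hij.eq_or_lt with rfl | h
  · rfl
  · exact (hX.lt h hj).le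

lemma Mesh.mem (hX : Mesh X N) {i : ℕ} (hi : i ≤ N) : X i ∈ Icc (0 : ℝ) 1 :=
  ⟨hX.zero ▸ hX.le (Nat.zero_le i) hi, hX.last ▸ hX.le hi le_rfl⟩

lemma Mesh.cell_subset (hX : Mesh X N) {i : ℕ} (hi : i < N) :
    Icc (X i) (X (i + 1)) ⊆ Icc 0 1 :=
  Icc_subset_Icc (hX.mem hi.le).1 (hX.mem hi).2

lemma Mesh.exists_cell (hX : Mesh X N) {x : ℝ} (hx : x ∈ Icc (0 : ℝ) 1) (hN : 0 < N) :
    ∃ i < N, x ∈ Icc (X i) (X (i + 1)) := by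
  have key : ∀ n ≤ N, X n ≤ x ∨ ∃ i < N, x ∈ Icc (X i) (X (i + 1)) := by
    intro n
    induction n with
    | zero => intro _; left; rw [hX.zero]; exact hx.1
    | succ n ih =>
      intro hn
      rcases ih (by omega) with h | h
      · rcases le_total (X (n + 1)) x with h' | h'
        · exact Or.inl h'
        · exact Or.inr ⟨n, hn, h, h'⟩
      · exact Or.inr h
  rcases key N le_rfl with h | h
  · refine ⟨N - 1, by omega, ?_⟩
    have hN1 : N - 1 + 1 = N := by omega
    rw [hN1]
    refine ⟨(hX.le (Nat.sub_le N 1) le_rfl).trans h, ?_⟩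
    rw [hX.last]; exact hx.2
  · exact h

/-- Two different cells meet at most in an end point. -/
lemma Mesh.cell_inter (hX : Mesh X N) {i l : ℕ} (hi : i < N) (hl : l < N) (hil : i ≠ l) {x : ℝ}
    (hx : x ∈ Icc (X l) (X (l + 1))) (hx' : x ∈ Icc (X i) (X (i + 1))) :
    (i = l + 1 ∧ x = X (l + 1)) ∨ (l = i + 1 ∧ x = X l) := by
  rcases lt_or_gt_of_ne hil with h | h
  · right
    have h1 : X (i + 1) ≤ X l := hX.le h hl.le
    have h2 : X (i + 1) = X l := le_antisymm h1 (hx.1.trans hx'.2)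
    refine ⟨?_, le_antisymm (h2 ▸ hx'.2) hx.1⟩
    by_contra hne
    have := hX.lt (show i + 1 < l by omega) hl.le
    linarith
  · left
    have h1 : X (l + 1) ≤ X i := hX.le h hi.le
    have h2 : X (l + 1) = X i := le_antisymm h1 (hx'.1.trans hx.2)
    refine ⟨?_, le_antisymm hx.2 (h2 ▸ hx'.1)⟩
    by_contra hne
    have := hX.lt (show l + 1 < i by omega) hi.le
    linarith

end Mesh

lemma node_eq (X : ℕ → ℝ) (k i s : ℕ) : node X k i s = cellNode (X i) (X (i + 1)) k s := rfl

lemma localBasis_eq (X : ℕ → ℝ) (k i s : ℕ) (x : ℝ) :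
    localBasis X k i s x = (cellPoly (X i) (X (i + 1)) k s).eval x := rfl

section Basis

variable {X : ℕ → ℝ} {N k : ℕ}

lemma cellPoly_left {a b : ℝ} (hab : a < b) (hk : 1 ≤ k) {s : ℕ} :
    (cellPoly a b k s).eval a = if s = 0 then 1 else 0 := by
  split_ifs with h
  · subst h
    simpa [cellNode_zero] using cellPoly_eval_self hab hk (Nat.zero_le k)
  · simpa [cellNode_zero] using cellPoly_eval_of_ne a b h (Nat.zero_le k)

lemma cellPoly_right {a b : ℝ} (hab : a < b) (hk : 1 ≤ k) {s : ℕ} :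
    (cellPoly a b k s).eval b = if s = k then 1 else 0 := by
  split_ifs with h
  · subst h
    simpa [cellNode_last a b hk] using cellPoly_eval_self hab hk le_rfl
  · simpa [cellNode_last a b hk] using cellPoly_eval_of_ne a b h le_rfl

/-- The closed cells in the definition overlap only at mesh points, where the local polynomials of
both sides take the same value 0 or 1; so the preference for the right-hand cell is harmless. -/
lemma vertexBasis_on_cell (hX : Mesh X N) (hk : 1 ≤ k) {l : ℕ} (hl : l < N) {i : ℕ} (hi : i ≤ N)
    {x : ℝ} (hx : x ∈ Icc (X l) (X (l + 1))) :
    vertexBasis X N k i x = if i = l then (cellPoly (X l) (X (l + 1)) k 0).eval x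
      else if i = l + 1 then (cellPoly (X l) (X (l + 1)) k k).eval x else 0 := by
  have hk0 : k ≠ 0 := by omega
  simp only [vertexBasis, localBasis_eq]
  by_cases h1 : i = l
  · subst h1
    rw [if_pos ⟨hl, hx⟩, if_pos rfl]
  rw [if_neg h1]
  by_cases h2 : i = l + 1
  · subst h2
    rw [if_pos rfl]
    split_ifs with h3 h4
    · have hxe : x = X (l + 1) := le_antisymm hx.2 h3.2.1
      subst hxe
      rw [cellPoly_left (hX.lt_succ _ h3.1) hk, cellPoly_right (hX.lt_succ _ hl) hk, if_pos rfl,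
        if_pos rfl]
    · simp
    · exact absurd ⟨Nat.succ_pos l, by simpa using hx⟩ h4
  rw [if_neg h2]
  split_ifs with h3 h4
  · rcases hX.cell_inter h3.1 hl h1 hx h3.2 with h | ⟨rfl, rfl⟩
    · exact absurd h.1 h2
    · rw [cellPoly_right (hX.lt_succ _ h3.1) hk, if_neg (by omega)]
  · obtain ⟨j, rfl⟩ : ∃ j, i = j + 1 := ⟨i - 1, by omega⟩
    simp only [Nat.add_sub_cancel] at h4 ⊢
    rcases hX.cell_inter (i := j) (by omega) hl (by omega) hx h4.2 with ⟨rfl, rfl⟩ | h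
    · rw [cellPoly_left (hX.lt_succ _ (by omega)) hk, if_neg hk0]
    · omega
  · rfl

lemma basis1_zero (i : ℕ) (x : ℝ) : basis1 X N k i 0 x = vertexBasis X N k i x := by
  simp [basis1]

lemma basis1_last (hk : 1 ≤ k) (i : ℕ) (x : ℝ) :
    basis1 X N k i k x = vertexBasis X N k (i + 1) x := by
  have : k ≠ 0 := by omega
  simp [basis1, this]

lemma basis1_interior (hX : Mesh X N) (hk : 1 ≤ k) {l : ℕ} (hl : l < N) {i s : ℕ} (hi : i < N)
    (hs : s ≠ 0) (hs' : s ≠ k) {x : ℝ} (hx : x ∈ Icc (X l) (X (l + 1))) :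
    basis1 X N k i s x = if i = l then (cellPoly (X l) (X (l + 1)) k s).eval x else 0 := by
  simp only [basis1, if_neg hs, if_neg hs', localBasis_eq]
  by_cases h : i = l
  · subst h; simp [hx]
  rw [if_neg h]
  split_ifs with h1
  · rcases hX.cell_inter hi hl h hx h1 with ⟨rfl, rfl⟩ | ⟨rfl, rfl⟩
    · rw [cellPoly_left (hX.lt_succ _ hi) hk, if_neg hs]
    · rw [cellPoly_right (hX.lt_succ _ hi) hk, if_neg hs']
  · rfl

/-- On every cell the global interpolant is the local one. -/
lemma sum_basis1 (hX : Mesh X N) (hk : 1 ≤ k) (g : ℝ → ℝ) {l : ℕ} (hl : l < N) {x : ℝ}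
    (hx : x ∈ Icc (X l) (X (l + 1))) :
    (∑ i ∈ Finset.range N, ∑ s ∈ Finset.range k, g (node X k i s) * basis1 X N k i s x)
        + g (X N) * basis1 X N k N 0 x
      = (cellInterp (X l) (X (l + 1)) k g).eval x := by
  -- Writing k = n + 1 splits off the index s = 0. The mesh points, completed by the last node, form
  -- one sum over N + 1 vertices, of which only the two end points of the cell contribute; the
  -- interior nodes contribute only from the cell itself.
  obtain ⟨n, rfl⟩ : ∃ n, k = n + 1 := ⟨k - 1, by omega⟩
  have hmain : ∀ i ∈ Finset.range N, ∑ s ∈ Finset.range (n + 1),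
      g (node X (n + 1) i s) * basis1 X N (n + 1) i s x
      = (if i = l then ∑ s ∈ Finset.range n, g (node X (n + 1) l (s + 1))
          * (cellPoly (X l) (X (l + 1)) (n + 1) (s + 1)).eval x else 0)
        + g (X i) * vertexBasis X N (n + 1) i x := by
    intro i hi
    have hi' := Finset.mem_range.1 hi
    rw [Finset.sum_range_succ', basis1_zero, node_eq X _ i 0, cellNode_zero]
    congr 1
    split_ifs with h
    · subst h
      refine Finset.sum_congr rfl fun s hs => ?_
      have := Finset.mem_range.1 hs
      rw [basis1_interior hX hk hl hi' (by omega) (by omega) hx, if_pos rfl]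
    · refine Finset.sum_eq_zero fun s hs => ?_
      have := Finset.mem_range.1 hs
      rw [basis1_interior hX hk hl hi' (by omega) (by omega) hx, if_neg h, mul_zero]
  rw [Finset.sum_congr rfl hmain, Finset.sum_add_distrib, Finset.sum_ite_eq',
    if_pos (Finset.mem_range.2 hl), basis1_zero, add_assoc,
    ← Finset.sum_range_succ (fun i => g (X i) * vertexBasis X N (n + 1) i x)]
  have hv : ∀ i ∈ Finset.range (N + 1), g (X i) * vertexBasis X N (n + 1) i x
      = (if i = l then g (X l) * (cellPoly (X l) (X (l + 1)) (n + 1) 0).eval x else 0)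
        + (if i = l + 1 then
            g (X (l + 1)) * (cellPoly (X l) (X (l + 1)) (n + 1) (n + 1)).eval x else 0) := by
    intro i hi
    rw [vertexBasis_on_cell hX hk hl (Nat.lt_succ_iff.1 (Finset.mem_range.1 hi)) hx]
    by_cases h1 : i = l
    · subst h1; simp
    · by_cases h2 : i = l + 1
      · subst h2; simp
      · simp [h1, h2]
  rw [Finset.sum_congr rfl hv, Finset.sum_add_distrib, Finset.sum_ite_eq', Finset.sum_ite_eq',
    if_pos (Finset.mem_range.2 (by omega)), if_pos (Finset.mem_range.2 (by omega)),
    cellInterp_eval, Finset.sum_range_succ, Finset.sum_range_succ', cellNode_zero,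
    cellNode_last _ _ hk]
  simp only [node_eq]
  ring

lemma basis1_at_node_zero (hX : Mesh X N) (hk : 1 ≤ k) (hN : 0 < N) :
    basis1 X N k 0 0 0 = 1 ∧ basis1 X N k N 0 0 = 0 := by
  have hx : (0 : ℝ) ∈ Icc (X 0) (X (0 + 1)) :=
    ⟨hX.zero.le, hX.zero ▸ (hX.lt_succ 0 hN).le⟩
  have h0 := cellPoly_left (hX.lt_succ 0 hN) hk (s := 0)
  have h1 := cellPoly_left (hX.lt_succ 0 hN) hk (s := k)
  rw [hX.zero] at h0 h1
  constructor
  · rw [basis1_zero, vertexBasis_on_cell hX hk hN (Nat.zero_le N) hx, if_pos rfl, hX.zero, h0,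
      if_pos rfl]
  · rw [basis1_zero, vertexBasis_on_cell hX hk hN le_rfl hx, if_neg (by omega)]
    split_ifs
    · rw [hX.zero, h1, if_neg (by omega)]
    · rfl

lemma basis1_at_node_one (hX : Mesh X N) (hk : 1 ≤ k) (hN : 0 < N) :
    basis1 X N k 0 0 1 = 0 ∧ basis1 X N k N 0 1 = 1 := by
  obtain ⟨n, rfl⟩ : ∃ n, N = n + 1 := ⟨N - 1, by omega⟩
  have hx : (1 : ℝ) ∈ Icc (X n) (X (n + 1)) :=
    ⟨hX.last ▸ (hX.lt_succ n (by omega)).le, hX.last.ge⟩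
  have h0 := cellPoly_right (hX.lt_succ n (by omega)) hk (s := 0)
  have h1 := cellPoly_right (hX.lt_succ n (by omega)) hk (s := k)
  rw [hX.last] at h0 h1
  constructor
  · rw [basis1_zero, vertexBasis_on_cell hX hk (by omega) (Nat.zero_le _) hx]
    rw [if_neg (show ¬0 = n + 1 by omega)]
    split_ifs with h
    · rw [hX.last, h0, if_neg (by omega)]
    · rfl
  · rw [basis1_zero, vertexBasis_on_cell hX hk (by omega) le_rfl hx, if_neg (by omega),
      if_pos rfl, hX.last, h1, if_pos rfl]

/-- The basis functions of the nodes `x_m^s`, `1 ≤ s ≤ k`, on a cell. -/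
lemma basis1_on_cell (hX : Mesh X N) (hk : 1 ≤ k) {m s l : ℕ} (hm : m < N) (hs : s ∈ Finset.Icc 1 k)
    (hl : l < N) {x : ℝ} (hx : x ∈ Icc (X l) (X (l + 1))) :
    basis1 X N k m s x = if l = m then (cellPoly (X l) (X (l + 1)) k s).eval x
      else if l = m + 1 ∧ s = k then (cellPoly (X l) (X (l + 1)) k 0).eval x else 0 := by
  rw [Finset.mem_Icc] at hs
  by_cases hsk : s = k
  · subst hsk
    rw [basis1_last hk, vertexBasis_on_cell hX hk hl hm hx]
    by_cases h1 : m + 1 = l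
    · subst h1; simp
    · by_cases h2 : l = m
      · subst h2; simp
      · rw [if_neg h1, if_neg (by omega), if_neg h2, if_neg (by omega)]
  · rw [basis1_interior hX hk hl hm (by omega) hsk hx]
    by_cases h2 : l = m
    · subst h2; simp
    · rw [if_neg (Ne.symm h2), if_neg h2, if_neg (by tauto)]

end Basis

/-! ### The two-dimensional interpolants on a mesh rectangle -/

section Local

variable {X Y : ℕ → ℝ} {N k : ℕ}

lemma interp_on_cell (hX : Mesh X N) (hY : Mesh Y N) (hk : 1 ≤ k) (v : ℝ × ℝ → ℝ) {i j : ℕ}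
    (hi : i < N) (hj : j < N) {x y : ℝ} (hx : x ∈ Icc (X i) (X (i + 1)))
    (hy : y ∈ Icc (Y j) (Y (j + 1))) :
    interp X Y N k v (x, y)
      = tensorInterp (X i) (X (i + 1)) (Y j) (Y (j + 1)) k (fun a b => v (a, b)) x y := by
  rw [tensorInterp, ← sum_basis1 hX hk _ hi hx]
  simp only [← sum_basis1 hY hk _ hj hy, interp, theta]
  have hfac : ∀ a e : ℝ,
      (∑ j ∈ Finset.range N, ∑ t ∈ Finset.range k,
        v (a, node Y k j t) * (e * basis1 Y N k j t y)) + v (a, Y N) * (e * basis1 Y N k N 0 y)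
      = ((∑ j ∈ Finset.range N, ∑ t ∈ Finset.range k,
        v (a, node Y k j t) * basis1 Y N k j t y) + v (a, Y N) * basis1 Y N k N 0 y) * e := by
    intro a e
    simp only [add_mul, Finset.sum_mul]
    congr 1
    · refine Finset.sum_congr rfl fun _ _ => Finset.sum_congr rfl fun _ _ => by ring
    · ring
  simp only [hfac]
  rw [add_assoc, hfac]

/-- The one-dimensional interpolant. -/
def fullPart (Y : ℕ → ℝ) (N k : ℕ) (g : ℝ → ℝ) (y : ℝ) : ℝ :=
  (∑ j ∈ Finset.range N, ∑ t ∈ Finset.range k, g (node Y k j t) * basis1 Y N k j t y)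
    + g (Y N) * basis1 Y N k N 0 y

/-- The contribution of the end points to the one-dimensional interpolant. -/
def endPart (Y : ℕ → ℝ) (N k : ℕ) (g : ℝ → ℝ) (y : ℝ) : ℝ :=
  g (Y 0) * basis1 Y N k 0 0 y + g (Y N) * basis1 Y N k N 0 y

/-- The combination of the basis functions of the nodes `x_m^s`, `1 ≤ s ≤ k`, with coefficients
which depend on `y`. -/
def stripFun (X : ℕ → ℝ) (N k m : ℕ) (p : ℕ → ℝ → ℝ) (z : ℝ × ℝ) : ℝ :=
  ∑ s ∈ Finset.Icc 1 k, basis1 X N k m s z.1 * p s z.2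

/-- P and Θ separate into the same factors in x and different factors in y: the whole interpolant
for P, its two end contributions for Θ. The two factors agree at y = 0 and y = 1. -/
lemma opP_eq (X Y : ℕ → ℝ) (N k : ℕ) (E : ℝ × ℝ → ℝ) (z : ℝ × ℝ) :
    opP X Y N k E z = stripFun X N k (3 * (N / 4))
      (fun s => fullPart Y N k fun y => E (node X k (3 * (N / 4)) s, y)) z := by
  refine Finset.sum_congr rfl fun s _ => ?_
  simp only [fullPart, theta, mul_add, Finset.mul_sum]
  congr 1
  · exact Finset.sum_congr rfl fun _ _ => Finset.sum_congr rfl fun _ _ => by ring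
  · ring

lemma opTheta_eq (X Y : ℕ → ℝ) (N k : ℕ) (E : ℝ × ℝ → ℝ) (z : ℝ × ℝ) :
    opTheta X Y N k E z = stripFun X N k (3 * (N / 4))
      (fun s => endPart Y N k fun y => E (node X k (3 * (N / 4)) s, y)) z := by
  rw [opTheta, ← Finset.sum_add_distrib]
  refine Finset.sum_congr rfl fun s _ => ?_
  simp only [endPart, theta]
  ring

lemma endPart_on_cell (hY : Mesh Y N) (hk : 1 ≤ k) (g : ℝ → ℝ) {j : ℕ} (hj : j < N) {y : ℝ}
    (hy : y ∈ Icc (Y j) (Y (j + 1))) :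
    endPart Y N k g y = ((if j = 0 then Polynomial.C (g (Y 0)) * cellPoly (Y j) (Y (j + 1)) k 0
        else 0) + (if j + 1 = N then Polynomial.C (g (Y N)) * cellPoly (Y j) (Y (j + 1)) k k
        else 0)).eval y := by
  rw [endPart, basis1_zero, basis1_zero, Polynomial.eval_add,
    vertexBasis_on_cell hY hk hj (Nat.zero_le N) hy, vertexBasis_on_cell hY hk hj le_rfl hy]
  congr 1
  · by_cases h : j = 0
    · subst h; simp
    · rw [if_neg (Ne.symm h), if_neg (by omega), if_neg h, mul_zero, Polynomial.eval_zero]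
  · rw [if_neg (by omega)]
    by_cases h : j + 1 = N
    · rw [if_pos h.symm, if_pos h, Polynomial.eval_mul, Polynomial.eval_C]
    · rw [if_neg (Ne.symm h), if_neg h, mul_zero, Polynomial.eval_zero]

end Local

end BakhvalovFEM
end

noncomputable section
namespace BakhvalovFEM

/-! ### Square integrable functions on the unit square -/

/-- Square integrability on the unit square. -/
abbrev L2 (f : ℝ × ℝ → ℝ) : Prop := MemLp f 2 (volume.restrict openSquare)

/-- The `L²(Ω)` norm. -/
def nrm (f : ℝ × ℝ → ℝ) : ℝ := √(∫ z in openSquare, f z ^ 2)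

lemma isOpen_openSquare : IsOpen openSquare := isOpen_Ioo.prod isOpen_Ioo

lemma measurableSet_openSquare : MeasurableSet openSquare := isOpen_openSquare.measurableSet

lemma openSquare_subset : openSquare ⊆ closedSquare :=
  prod_mono Ioo_subset_Icc_self Ioo_subset_Icc_self

lemma isCompact_closedSquare : IsCompact closedSquare := isCompact_Icc.prod isCompact_Icc

lemma volume_openSquare : volume openSquare = 1 := by
  rw [openSquare, Measure.volume_eq_prod, Measure.prod_prod]
  simp

instance : IsFiniteMeasure (volume.restrict openSquare) :=
  ⟨by rw [Measure.restrict_apply_univ, volume_openSquare]; exact ENNReal.one_lt_top⟩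

section L2

variable {f g : ℝ × ℝ → ℝ}

lemma L2.integrable_mul (hf : L2 f) (hg : L2 g) : IntegrableOn (fun z => f z * g z) openSquare :=
  MemLp.integrable_mul hf hg

lemma L2.integrable_sq (hf : L2 f) : IntegrableOn (fun z => f z ^ 2) openSquare :=
  MemLp.integrable_sq hf

lemma L2.integrableOn (hf : L2 f) : IntegrableOn f openSquare :=
  hf.integrable (by norm_num)

lemma L2.add' (hf : L2 f) (hg : L2 g) : L2 (fun z => f z + g z) := MemLp.add hf hg

lemma nrm_nonneg (f : ℝ × ℝ → ℝ) : 0 ≤ nrm f := Real.sqrt_nonneg _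

lemma nrm_sq (f : ℝ × ℝ → ℝ) : nrm f ^ 2 = ∫ z in openSquare, f z ^ 2 :=
  Real.sq_sqrt (integral_nonneg fun _ => sq_nonneg _)

/-- The Cauchy-Schwarz inequality. -/
lemma abs_integral_mul_le (hf : L2 f) (hg : L2 g) :
    |∫ z in openSquare, f z * g z| ≤ nrm f * nrm g := by
  have h1 := hf.integrable_sq
  have h2 := hg.integrable_sq
  have h3 := hf.integrable_mul hg
  have key : ∀ t : ℝ, 0 ≤ (∫ z in openSquare, g z ^ 2) * (t * t)
      + (2 * ∫ z in openSquare, f z * g z) * t + ∫ z in openSquare, f z ^ 2 := by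
    intro t
    have : 0 ≤ ∫ z in openSquare, (g z ^ 2 * (t * t) + f z * g z * (2 * t)) + f z ^ 2 :=
      integral_nonneg fun z => by
        have : (g z ^ 2 * (t * t) + f z * g z * (2 * t)) + f z ^ 2 = (f z + t * g z) ^ 2 := by ring
        rw [this]; exact sq_nonneg _
    have h4 : IntegrableOn (fun z => g z ^ 2 * (t * t) + f z * g z * (2 * t)) openSquare :=
      (h2.mul_const _).add (h3.mul_const _)
    rw [integral_add h4 h1,
      integral_add (h2.mul_const _) (h3.mul_const _), integral_mul_const, integral_mul_const] at this
    linarith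
  have h := discrim_le_zero key
  rw [discrim, ← nrm_sq, ← nrm_sq] at h
  refine abs_le_of_sq_le_sq (by nlinarith) (mul_nonneg (nrm_nonneg f) (nrm_nonneg g))

lemma nrm_add_le (hf : L2 f) (hg : L2 g) : nrm (fun z => f z + g z) ≤ nrm f + nrm g := by
  have h1 := hf.integrable_sq
  have h2 := hg.integrable_sq
  have h3 := hf.integrable_mul hg
  have h4 := (abs_le.1 (abs_integral_mul_le hf hg)).2
  refine Real.sqrt_le_iff.2 ⟨add_nonneg (nrm_nonneg f) (nrm_nonneg g), ?_⟩
  have : ∫ z in openSquare, (f z + g z) ^ 2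
      = ∫ z in openSquare, (f z ^ 2 + f z * g z * 2) + g z ^ 2 := by
    congr 1; ext z; ring
  have h5 : IntegrableOn (fun z => f z ^ 2 + f z * g z * 2) openSquare := h1.add (h3.mul_const _)
  rw [this, integral_add h5 h2, integral_add h1 (h3.mul_const _),
    integral_mul_const, ← nrm_sq, ← nrm_sq]
  nlinarith

lemma nrm_neg (f : ℝ × ℝ → ℝ) : nrm (fun z => -f z) = nrm f := by simp [nrm]

lemma nrm_congr (h : f =ᵐ[volume.restrict openSquare] g) : nrm f = nrm g := by
  unfold nrm
  congr 1
  exact integral_congr_ae (h.mono fun z hz => by simp only [hz])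

/-- A bound of the norm from a pointwise majorant of the square. -/
lemma nrm_sq_le {F : ℝ × ℝ → ℝ} (hF : IntegrableOn F openSquare)
    (h : ∀ᵐ z ∂(volume.restrict openSquare), f z ^ 2 ≤ F z) :
    nrm f ^ 2 ≤ ∫ z in openSquare, F z := by
  rw [nrm_sq]
  exact integral_mono_of_nonneg (ae_of_all _ fun _ => sq_nonneg _) hF h

lemma le_of_sq_le_sq {a b : ℝ} (h : a ^ 2 ≤ b ^ 2) (hb : 0 ≤ b) : a ≤ b :=
  (le_abs_self a).trans (abs_le_of_sq_le_sq h hb)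

lemma nrm_le_of_abs_le {C : ℝ} (hC : 0 ≤ C) (hg : L2 g)
    (h : ∀ᵐ z ∂(volume.restrict openSquare), |f z| ≤ C * |g z|) : nrm f ≤ C * nrm g := by
  have h1 : nrm f ^ 2 ≤ ∫ z in openSquare, C ^ 2 * g z ^ 2 :=
    nrm_sq_le (hg.integrable_sq.const_mul _) (h.mono fun z hz => by
      rw [← sq_abs (f z), ← sq_abs (g z), ← mul_pow]
      exact pow_le_pow_left₀ (abs_nonneg _) hz 2)
  rw [integral_const_mul, ← nrm_sq, ← mul_pow] at h1
  exact le_of_sq_le_sq h1 (mul_nonneg hC (nrm_nonneg g))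

lemma nrm_le_of_bound {C : ℝ} (hC : 0 ≤ C)
    (h : ∀ᵐ z ∂(volume.restrict openSquare), |f z| ≤ C) : nrm f ≤ C := by
  have h1 := nrm_le_of_abs_le (g := fun _ => 1) hC (memLp_const 1) (h.mono fun z hz => by simpa)
  have h2 : nrm (fun _ => (1 : ℝ)) = 1 := by
    simp [nrm, Measure.real, volume_openSquare]
  rwa [h2, mul_one] at h1

end L2

lemma integral_fst (F : ℝ → ℝ) :
    ∫ z in openSquare, F z.1 = ∫ x in Ioo (0 : ℝ) 1, F x := by
  have := setIntegral_prod_mul (μ := volume) (ν := volume) F (fun _ : ℝ => (1 : ℝ))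
    (Ioo (0 : ℝ) 1) (Ioo (0 : ℝ) 1)
  simpa [openSquare, Measure.volume_eq_prod] using this

lemma integrableOn_fst {F : ℝ → ℝ} (hF : IntegrableOn F (Ioo 0 1)) :
    IntegrableOn (fun z : ℝ × ℝ => F z.1) openSquare := by
  rw [IntegrableOn, openSquare, Measure.volume_eq_prod, ← Measure.prod_restrict]
  exact hF.comp_fst _

lemma integral_swap (F : ℝ × ℝ → ℝ) :
    ∫ z in openSquare, F z.swap = ∫ z in openSquare, F z := by
  have h := (Measure.measurePreserving_swap (μ := (volume : Measure ℝ))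
    (ν := (volume : Measure ℝ))).setIntegral_preimage_emb
    (MeasurableEquiv.prodComm (α := ℝ) (β := ℝ)).measurableEmbedding F openSquare
  rw [← Measure.volume_eq_prod] at h
  have hs : Prod.swap ⁻¹' openSquare = openSquare := by
    ext z; simp [openSquare]
  rw [← h, hs]

/-! ### Piecewise continuously differentiable functions -/

/-- A closed mesh rectangle. -/
def cell (X Y : ℕ → ℝ) (i j : ℕ) : Set (ℝ × ℝ) := Icc (X i) (X (i + 1)) ×ˢ Icc (Y j) (Y (j + 1))

/-- An open mesh rectangle. -/
def ocell (X Y : ℕ → ℝ) (i j : ℕ) : Set (ℝ × ℝ) := Ioo (X i) (X (i + 1)) ×ˢ Ioo (Y j) (Y (j + 1))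

/-- Continuous functions which are continuously differentiable on every closed mesh rectangle. -/
structure PW (X Y : ℕ → ℝ) (N : ℕ) (w : ℝ × ℝ → ℝ) : Prop where
  cont : ContinuousOn w closedSquare
  smooth : ∀ i < N, ∀ j < N, ContDiffOn ℝ 1 w (cell X Y i j)

lemma isOpen_ocell (X Y : ℕ → ℝ) (i j : ℕ) : IsOpen (ocell X Y i j) := isOpen_Ioo.prod isOpen_Ioo

lemma ocell_subset (X Y : ℕ → ℝ) (i j : ℕ) : ocell X Y i j ⊆ cell X Y i j :=
  prod_mono Ioo_subset_Icc_self Ioo_subset_Icc_self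

section PW

variable {X Y : ℕ → ℝ} {N : ℕ} {w w₁ w₂ : ℝ × ℝ → ℝ}

lemma cell_subset (hX : Mesh X N) (hY : Mesh Y N) {i j : ℕ} (hi : i < N) (hj : j < N) :
    cell X Y i j ⊆ closedSquare := prod_mono (hX.cell_subset hi) (hY.cell_subset hj)

lemma ocell_subset_openSquare (hX : Mesh X N) (hY : Mesh Y N) {i j : ℕ} (hi : i < N)
    (hj : j < N) : ocell X Y i j ⊆ openSquare :=
  prod_mono (Ioo_subset_Ioo (hX.mem hi.le).1 (hX.mem hi).2)
    (Ioo_subset_Ioo (hY.mem hj.le).1 (hY.mem hj).2)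

lemma Mesh.exists_open_cell (hX : Mesh X N) {x : ℝ} (hx : x ∈ Ioo (0 : ℝ) 1)
    (hx' : x ∉ X '' Iic N) (hN : 0 < N) : ∃ i < N, x ∈ Ioo (X i) (X (i + 1)) := by
  obtain ⟨i, hi, h⟩ := hX.exists_cell (Ioo_subset_Icc_self hx) hN
  refine ⟨i, hi, lt_of_le_of_ne h.1 fun he => hx' ⟨i, hi.le, he⟩,
    lt_of_le_of_ne h.2 fun he => hx' ⟨i + 1, hi, he.symm⟩⟩

lemma ae_fst_not_mem (X : ℕ → ℝ) (N : ℕ) :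
    ∀ᵐ z ∂(volume : Measure (ℝ × ℝ)), z.1 ∉ X '' Iic N :=
  Measure.quasiMeasurePreserving_fst.ae
    (((finite_Iic N).image X).countable.ae_notMem volume)

lemma ae_snd_not_mem (X : ℕ → ℝ) (N : ℕ) :
    ∀ᵐ z ∂(volume : Measure (ℝ × ℝ)), z.2 ∉ X '' Iic N :=
  Measure.quasiMeasurePreserving_snd.ae
    (((finite_Iic N).image X).countable.ae_notMem volume)

/-- Almost every point of the square lies in an open mesh rectangle. -/
lemma ae_ocell (hX : Mesh X N) (hY : Mesh Y N) (hN : 0 < N) :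
    ∀ᵐ z ∂(volume.restrict openSquare), ∃ i < N, ∃ j < N, z ∈ ocell X Y i j := by
  rw [ae_restrict_iff' measurableSet_openSquare]
  filter_upwards [ae_fst_not_mem X N, ae_snd_not_mem Y N] with z h1 h2 hz
  obtain ⟨i, hi, hx⟩ := hX.exists_open_cell hz.1 h1 hN
  obtain ⟨j, hj, hy⟩ := hY.exists_open_cell hz.2 h2 hN
  exact ⟨i, hi, j, hj, hx, hy⟩

lemma PW.add (h₁ : PW X Y N w₁) (h₂ : PW X Y N w₂) : PW X Y N (fun z => w₁ z + w₂ z) :=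
  ⟨h₁.cont.add h₂.cont, fun i hi j hj => (h₁.smooth i hi j hj).add (h₂.smooth i hi j hj)⟩

lemma PW.sub (h₁ : PW X Y N w₁) (h₂ : PW X Y N w₂) : PW X Y N (fun z => w₁ z - w₂ z) :=
  ⟨h₁.cont.sub h₂.cont, fun i hi j hj => (h₁.smooth i hi j hj).sub (h₂.smooth i hi j hj)⟩

lemma PW.mul (h₁ : PW X Y N w₁) (h₂ : PW X Y N w₂) : PW X Y N (fun z => w₁ z * w₂ z) :=
  ⟨h₁.cont.mul h₂.cont, fun i hi j hj => (h₁.smooth i hi j hj).mul (h₂.smooth i hi j hj)⟩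

lemma PW.of_contDiffOn (hX : Mesh X N) (hY : Mesh Y N) (h : ContDiffOn ℝ 1 w closedSquare) :
    PW X Y N w :=
  ⟨h.continuousOn, fun _ hi _ hj => h.mono (cell_subset hX hY hi hj)⟩

lemma PW.swap (h : PW X Y N w) : PW Y X N (fun z => w z.swap) := by
  refine ⟨h.cont.comp continuous_swap.continuousOn fun z hz => ⟨hz.2, hz.1⟩,
    fun i hi j hj => ?_⟩
  exact (h.smooth j hj i hi).comp (contDiff_snd.prodMk contDiff_fst).contDiffOn
    fun z hz => ⟨hz.2, hz.1⟩

lemma PW.differentiableAt (h : PW X Y N w) {i j : ℕ} (hi : i < N) (hj : j < N) {z : ℝ × ℝ}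
    (hz : z ∈ ocell X Y i j) : DifferentiableAt ℝ w z :=
  ((h.smooth i hi j hj).differentiableOn (by norm_num)).differentiableAt
    (Filter.mem_of_superset ((isOpen_ocell X Y i j).mem_nhds hz) (ocell_subset X Y i j))

lemma hasDerivAt_dx {z : ℝ × ℝ} (h : DifferentiableAt ℝ w z) :
    HasDerivAt (fun x => w (x, z.2)) (fderiv ℝ w z (1, 0)) z.1 := by
  have h1 : HasDerivAt (fun x : ℝ => (x, z.2)) ((1 : ℝ), (0 : ℝ)) z.1 :=
    (hasDerivAt_id z.1).prodMk (hasDerivAt_const z.1 z.2)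
  exact (show HasFDerivAt w (fderiv ℝ w z) (z.1, z.2) from h.hasFDerivAt).comp_hasDerivAt z.1 h1

lemma dx_eq_fderiv {z : ℝ × ℝ} (h : DifferentiableAt ℝ w z) : dx w z = fderiv ℝ w z (1, 0) :=
  (hasDerivAt_dx h).deriv

lemma hasDerivAt_dx' {z : ℝ × ℝ} (h : DifferentiableAt ℝ w z) :
    HasDerivAt (fun x => w (x, z.2)) (dx w z) z.1 := by
  rw [dx_eq_fderiv h]; exact hasDerivAt_dx h

lemma hasDerivAt_dy' {z : ℝ × ℝ} (h : DifferentiableAt ℝ w z) :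
    HasDerivAt (fun y => w (z.1, y)) (dy w z) z.2 := by
  have h1 : DifferentiableAt ℝ (fun z : ℝ × ℝ => w z.swap) z.swap :=
    DifferentiableAt.comp (g := w) (f := Prod.swap) z.swap (by simpa using h)
      (differentiableAt_snd.prodMk differentiableAt_fst)
  exact hasDerivAt_dx' h1

lemma PW.hasDerivAt_dx (h : PW X Y N w) {i j : ℕ} (hi : i < N) (hj : j < N) {z : ℝ × ℝ}
    (hz : z ∈ ocell X Y i j) : HasDerivAt (fun x => w (x, z.2)) (dx w z) z.1 :=
  hasDerivAt_dx' (h.differentiableAt hi hj hz)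

lemma PW.hasDerivAt_dy (h : PW X Y N w) {i j : ℕ} (hi : i < N) (hj : j < N) {z : ℝ × ℝ}
    (hz : z ∈ ocell X Y i j) : HasDerivAt (fun y => w (z.1, y)) (dy w z) z.2 :=
  hasDerivAt_dy' (h.differentiableAt hi hj hz)

lemma uniqueDiffOn_cell (hX : Mesh X N) (hY : Mesh Y N) {i j : ℕ} (hi : i < N) (hj : j < N) :
    UniqueDiffOn ℝ (cell X Y i j) :=
  (uniqueDiffOn_Icc (hX.lt_succ i hi)).prod (uniqueDiffOn_Icc (hY.lt_succ j hj))

lemma PW.dx_eq_fderivWithin (h : PW X Y N w) {i j : ℕ} (hi : i < N) (hj : j < N) {z : ℝ × ℝ}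
    (hz : z ∈ ocell X Y i j) : dx w z = fderivWithin ℝ w (cell X Y i j) z (1, 0) := by
  rw [dx_eq_fderiv (h.differentiableAt hi hj hz), fderivWithin_of_mem_nhds
    (Filter.mem_of_superset ((isOpen_ocell X Y i j).mem_nhds hz) (ocell_subset X Y i j))]

lemma PW.continuousOn_fderivWithin (h : PW X Y N w) (hX : Mesh X N) (hY : Mesh Y N) {i j : ℕ}
    (hi : i < N) (hj : j < N) :
    ContinuousOn (fun z => fderivWithin ℝ w (cell X Y i j) z (1, 0)) (cell X Y i j) :=
  ((h.smooth i hi j hj).continuousOn_fderivWithin (uniqueDiffOn_cell hX hY hi hj)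
    le_rfl).clm_apply continuousOn_const

lemma aestronglyMeasurable_of_cells (hX : Mesh X N) (hY : Mesh Y N) (hN : 0 < N)
    {f : ℝ × ℝ → ℝ} (hf : ∀ i < N, ∀ j < N, ContinuousOn f (ocell X Y i j)) :
    AEStronglyMeasurable f (volume.restrict openSquare) := by
  have hset : openSquare =ᵐ[volume]
      (⋃ i : Fin N, ⋃ j : Fin N, ocell X Y i j : Set (ℝ × ℝ)) := by
    have h := (ae_restrict_iff' measurableSet_openSquare).1 (ae_ocell hX hY hN)
    filter_upwards [h] with z hz
    apply propext
    constructor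
    · intro hz'
      obtain ⟨i, hi, j, hj, hm⟩ := hz hz'
      exact mem_iUnion.2 ⟨⟨i, hi⟩, mem_iUnion.2 ⟨⟨j, hj⟩, hm⟩⟩
    · intro hz'
      obtain ⟨i, hz'⟩ := mem_iUnion.1 hz'
      obtain ⟨j, hz'⟩ := mem_iUnion.1 hz'
      exact ocell_subset_openSquare hX hY i.2 j.2 hz'
  rw [Measure.restrict_congr_set hset, aestronglyMeasurable_iUnion_iff]
  intro i
  rw [aestronglyMeasurable_iUnion_iff]
  intro j
  exact (hf i i.2 j j.2).aestronglyMeasurable (isOpen_ocell X Y i j).measurableSet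

/-- Only the values on open cells matter, and there the function has continuous extensions to the
compact closed cells. This covers `dx` and `dy`, which carry no information on the mesh lines. -/
lemma L2_of_cells (hX : Mesh X N) (hY : Mesh Y N) (hN : 0 < N)
    {f : ℝ × ℝ → ℝ} {F : ℕ → ℕ → ℝ × ℝ → ℝ}
    (hF : ∀ i < N, ∀ j < N, ContinuousOn (F i j) (cell X Y i j))
    (hf : ∀ i < N, ∀ j < N, ∀ z ∈ ocell X Y i j, f z = F i j z) : L2 f := by
  have hb : ∀ i j, ∃ C, 0 ≤ C ∧ (i < N → j < N → ∀ z ∈ cell X Y i j, |F i j z| ≤ C) := by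
    intro i j
    by_cases h : i < N ∧ j < N
    · obtain ⟨C, hC⟩ := (isCompact_Icc.prod isCompact_Icc).exists_bound_of_continuousOn
        (hF i h.1 j h.2)
      exact ⟨|C|, abs_nonneg _, fun _ _ z hz => (hC z hz).trans (le_abs_self C)⟩
    · exact ⟨0, le_rfl, fun h1 h2 => absurd ⟨h1, h2⟩ h⟩
  choose C hC0 hC using hb
  refine MemLp.of_bound (aestronglyMeasurable_of_cells hX hY hN fun i hi j hj =>
    ((hF i hi j hj).mono (ocell_subset X Y i j)).congr (hf i hi j hj))
    (∑ i ∈ Finset.range N, ∑ j ∈ Finset.range N, C i j) ?_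
  filter_upwards [ae_ocell hX hY hN] with z hz
  obtain ⟨i, hi, j, hj, hm⟩ := hz
  rw [hf i hi j hj z hm, Real.norm_eq_abs]
  refine (hC i j hi hj z (ocell_subset X Y i j hm)).trans ?_
  refine (Finset.single_le_sum (f := fun j => C i j) (fun j _ => hC0 i j)
    (Finset.mem_range.2 hj)).trans ?_
  exact Finset.single_le_sum (f := fun i => ∑ j ∈ Finset.range N, C i j)
    (fun i _ => Finset.sum_nonneg fun j _ => hC0 i j) (Finset.mem_range.2 hi)

lemma PW.L2 (h : PW X Y N w) (hX : Mesh X N) (hY : Mesh Y N) (hN : 0 < N) :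
    BakhvalovFEM.L2 w :=
  L2_of_cells hX hY hN (F := fun _ _ => w) (fun i hi j hj => (h.smooth i hi j hj).continuousOn)
    fun _ _ _ _ _ _ => rfl

lemma PW.L2_dx (h : PW X Y N w) (hX : Mesh X N) (hY : Mesh Y N) (hN : 0 < N) :
    BakhvalovFEM.L2 (dx w) :=
  L2_of_cells hX hY hN (fun _ hi _ hj => h.continuousOn_fderivWithin hX hY hi hj)
    fun _ hi _ hj _ hz => h.dx_eq_fderivWithin hi hj hz

lemma L2.swap {f : ℝ × ℝ → ℝ} (hf : BakhvalovFEM.L2 f) :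
    BakhvalovFEM.L2 (fun z => f z.swap) := by
  have hmp := Measure.measurePreserving_swap (μ := (volume : Measure ℝ))
    (ν := (volume : Measure ℝ))
  rw [← Measure.volume_eq_prod] at hmp
  have hr := hmp.restrict_preimage measurableSet_openSquare
  have hs : Prod.swap ⁻¹' openSquare = openSquare := by
    ext z; simp [openSquare]
  rw [hs] at hr
  exact MemLp.comp_measurePreserving hf hr

lemma PW.L2_dy (h : PW X Y N w) (hX : Mesh X N) (hY : Mesh Y N) (hN : 0 < N) :
    BakhvalovFEM.L2 (dy w) := (h.swap.L2_dx hY hX hN).swap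

lemma PW.dx_add (h₁ : PW X Y N w₁) (h₂ : PW X Y N w₂) (hX : Mesh X N) (hY : Mesh Y N)
    (hN : 0 < N) : dx (fun z => w₁ z + w₂ z)
      =ᵐ[volume.restrict openSquare] fun z => dx w₁ z + dx w₂ z := by
  filter_upwards [ae_ocell hX hY hN] with z ⟨i, hi, j, hj, hz⟩
  exact ((h₁.hasDerivAt_dx hi hj hz).add (h₂.hasDerivAt_dx hi hj hz)).deriv

lemma PW.dy_add (h₁ : PW X Y N w₁) (h₂ : PW X Y N w₂) (hX : Mesh X N) (hY : Mesh Y N)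
    (hN : 0 < N) : dy (fun z => w₁ z + w₂ z)
      =ᵐ[volume.restrict openSquare] fun z => dy w₁ z + dy w₂ z := by
  filter_upwards [ae_ocell hX hY hN] with z ⟨i, hi, j, hj, hz⟩
  exact ((h₁.hasDerivAt_dy hi hj hz).add (h₂.hasDerivAt_dy hi hj hz)).deriv

lemma PW.dx_sub (h₁ : PW X Y N w₁) (h₂ : PW X Y N w₂) (hX : Mesh X N) (hY : Mesh Y N)
    (hN : 0 < N) : dx (fun z => w₁ z - w₂ z)
      =ᵐ[volume.restrict openSquare] fun z => dx w₁ z - dx w₂ z := by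
  filter_upwards [ae_ocell hX hY hN] with z ⟨i, hi, j, hj, hz⟩
  exact ((h₁.hasDerivAt_dx hi hj hz).sub (h₂.hasDerivAt_dx hi hj hz)).deriv

lemma PW.dy_sub (h₁ : PW X Y N w₁) (h₂ : PW X Y N w₂) (hX : Mesh X N) (hY : Mesh Y N)
    (hN : 0 < N) : dy (fun z => w₁ z - w₂ z)
      =ᵐ[volume.restrict openSquare] fun z => dy w₁ z - dy w₂ z := by
  filter_upwards [ae_ocell hX hY hN] with z ⟨i, hi, j, hj, hz⟩
  exact ((h₁.hasDerivAt_dy hi hj hz).sub (h₂.hasDerivAt_dy hi hj hz)).deriv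

/-- The integral of `G_x` vanishes if `G` vanishes on the boundary. -/
lemma PW.integral_dx_eq_zero (h : PW X Y N w) (hX : Mesh X N) (hY : Mesh Y N) (hN : 0 < N)
    (h0 : ∀ z ∈ closedSquare \ openSquare, w z = 0) : ∫ z in openSquare, dx w z = 0 := by
  have hint : IntegrableOn (dx w) openSquare := (h.L2_dx hX hY hN).integrableOn
  have hprod : Integrable (dx w)
      ((volume.restrict (Ioo (0 : ℝ) 1)).prod (volume.restrict (Ioo (0 : ℝ) 1))) := by
    rw [Measure.prod_restrict]
    exact hint
  -- By Fubini's theorem it is enough to integrate along almost every horizontal line, namely those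
  -- which avoid the mesh lines y = Y j.
  have e1 : ∫ z in openSquare, dx w z
      = ∫ y in Ioo (0 : ℝ) 1, ∫ x in Ioo (0 : ℝ) 1, dx w (x, y) := by
    rw [← integral_prod_symm _ hprod, Measure.prod_restrict]
    rfl
  rw [e1]
  refine integral_eq_zero_of_ae ?_
  have hY0 : ∀ᵐ y ∂(volume.restrict (Ioo (0 : ℝ) 1)), y ∉ Y '' Iic N :=
    ((finite_Iic N).image Y).countable.ae_notMem _
  filter_upwards [hY0, hprod.prod_left_ae, ae_restrict_mem measurableSet_Ioo] with y hy hyi hy01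
  obtain ⟨j, hj, hyj⟩ := hY.exists_open_cell hy01 hy hN
  -- On such a line `w` is continuous and differentiable off finitely many mesh points, which is
  -- enough for the fundamental theorem of calculus.
  have hFTC := integral_eq_of_hasDerivAt_off_countable (fun x => w (x, y)) (fun x => dx w (x, y))
    (a := 0) (b := 1) (s := X '' Iic N) ((finite_Iic N).image X).countable
    (by
      rw [uIcc_of_le zero_le_one]
      exact h.cont.comp (by fun_prop) fun x hx => ⟨hx, Ioo_subset_Icc_self hy01⟩)
    (by
      intro x hx
      rw [min_eq_left zero_le_one, max_eq_right zero_le_one] at hx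
      obtain ⟨i, hi, hxi⟩ := hX.exists_open_cell hx.1 hx.2 hN
      exact h.hasDerivAt_dx (z := (x, y)) hi hj ⟨hxi, hyj⟩)
    (by
      rw [intervalIntegrable_iff_integrableOn_Ioo_of_le zero_le_one]
      exact hyi)
  rw [intervalIntegral.integral_of_le zero_le_one, integral_Ioc_eq_integral_Ioo] at hFTC
  rw [hFTC, h0 (1, y) ⟨⟨by simp, Ioo_subset_Icc_self hy01⟩, fun h => by simpa using h.1.2⟩,
    h0 (0, y) ⟨⟨by simp, Ioo_subset_Icc_self hy01⟩, fun h => by simpa using h.1.1⟩]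
  simp

lemma PW.integral_dy_eq_zero (h : PW X Y N w) (hX : Mesh X N) (hY : Mesh Y N) (hN : 0 < N)
    (h0 : ∀ z ∈ closedSquare \ openSquare, w z = 0) : ∫ z in openSquare, dy w z = 0 := by
  have := h.swap.integral_dx_eq_zero hY hX hN fun z hz =>
    h0 z.swap ⟨⟨hz.1.2, hz.1.1⟩, fun h => hz.2 ⟨h.2, h.1⟩⟩
  rw [← this, ← integral_swap]
  rfl

end PW

end BakhvalovFEM
end

noncomputable section
namespace BakhvalovFEM

/-! ### Partial derivatives on the closed square -/

/-- The partial derivative in the direction `e` on the closed square. -/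
def partialWithin (e : ℝ × ℝ) (g : ℝ × ℝ → ℝ) (z : ℝ × ℝ) : ℝ := fderivWithin ℝ g closedSquare z e

/-- `∂_x` on the closed square. -/
abbrev Dx : (ℝ × ℝ → ℝ) → ℝ × ℝ → ℝ := partialWithin (1, 0)

/-- `∂_y` on the closed square. -/
abbrev Dy : (ℝ × ℝ → ℝ) → ℝ × ℝ → ℝ := partialWithin (0, 1)

lemma uniqueDiffOn_closedSquare : UniqueDiffOn ℝ closedSquare :=
  (uniqueDiffOn_Icc zero_lt_one).prod (uniqueDiffOn_Icc zero_lt_one)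

section Partial

variable {g h : ℝ × ℝ → ℝ} {e : ℝ × ℝ} {n : ℕ}

lemma ContDiffOn.partialWithin (hg : ContDiffOn ℝ ((n + 1 : ℕ) : WithTop ℕ∞) g closedSquare) :
    ContDiffOn ℝ (n : WithTop ℕ∞) (BakhvalovFEM.partialWithin e g) closedSquare :=
  (hg.fderivWithin (m := (n : WithTop ℕ∞)) uniqueDiffOn_closedSquare (by norm_cast)).clm_apply
    contDiffOn_const

lemma ContDiffOn.iterate_partialWithin (i : ℕ) : ∀ {n : ℕ} {g : ℝ × ℝ → ℝ},
    ContDiffOn ℝ ((n + i : ℕ) : WithTop ℕ∞) g closedSquare →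
    ContDiffOn ℝ (n : WithTop ℕ∞) ((BakhvalovFEM.partialWithin e)^[i] g) closedSquare := by
  induction i with
  | zero => intro n g h; simpa using h
  | succ i ih =>
    intro n g h
    rw [Function.iterate_succ_apply']
    exact ContDiffOn.partialWithin (ih (n := n + 1) (by
      rwa [show n + 1 + i = n + (i + 1) by omega]))

lemma partialWithin_congr (hgh : EqOn g h closedSquare) :
    EqOn (partialWithin e g) (partialWithin e h) closedSquare := by
  intro z hz
  rw [partialWithin, partialWithin, fderivWithin_congr hgh (hgh hz)]

lemma hasDerivWithinAt_fst (hg : DifferentiableOn ℝ g closedSquare) {x y : ℝ}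
    (hx : x ∈ Icc (0 : ℝ) 1) (hy : y ∈ Icc (0 : ℝ) 1) :
    HasDerivWithinAt (fun t => g (t, y)) (Dx g (x, y)) (Icc 0 1) x := by
  have h1 : HasDerivWithinAt (fun t : ℝ => (t, y)) ((1 : ℝ), (0 : ℝ)) (Icc 0 1) x :=
    (hasDerivWithinAt_id x _).prodMk (hasDerivWithinAt_const x _ y)
  exact (hg (x, y) ⟨hx, hy⟩).hasFDerivWithinAt.comp_hasDerivWithinAt x h1
    fun t ht => (⟨ht, hy⟩ : (t, y) ∈ closedSquare)

lemma hasDerivWithinAt_snd (hg : DifferentiableOn ℝ g closedSquare) {x y : ℝ}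
    (hx : x ∈ Icc (0 : ℝ) 1) (hy : y ∈ Icc (0 : ℝ) 1) :
    HasDerivWithinAt (fun t => g (x, t)) (Dy g (x, y)) (Icc 0 1) y := by
  have h1 : HasDerivWithinAt (fun t : ℝ => (x, t)) ((0 : ℝ), (1 : ℝ)) (Icc 0 1) y :=
    (hasDerivWithinAt_const y _ x).prodMk (hasDerivWithinAt_id y _)
  exact (hg (x, y) ⟨hx, hy⟩).hasFDerivWithinAt.comp_hasDerivWithinAt y h1
    fun t ht => (⟨hx, ht⟩ : (x, t) ∈ closedSquare)

lemma closedSquare_subset_closure_interior : closedSquare ⊆ closure (interior closedSquare) := by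
  rw [closedSquare, interior_prod_eq, interior_Icc, closure_prod_eq, closure_Ioo zero_ne_one]

/-- Symmetry of the second derivative holds up to the boundary because the square lies in the
closure of its interior. -/
lemma partialWithin_comm (hg : ContDiffOn ℝ 2 g closedSquare) (e e' : ℝ × ℝ) :
    EqOn (partialWithin e (partialWithin e' g)) (partialWithin e' (partialWithin e g))
      closedSquare := by
  intro z hz
  have hu := uniqueDiffOn_closedSquare
  have hd : DifferentiableWithinAt ℝ (fderivWithin ℝ g closedSquare) closedSquare z :=
    ((hg.fderivWithin (m := 1) hu (by norm_num)).differentiableOn (by norm_num)) z hz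
  have hs := (hg z hz).isSymmSndFDerivWithinAt (by simp) hu
    (closedSquare_subset_closure_interior hz) hz
  have key : ∀ a b : ℝ × ℝ, partialWithin a (partialWithin b g) z
      = fderivWithin ℝ (fderivWithin ℝ g closedSquare) closedSquare z a b := by
    intro a b
    have := hd.hasFDerivWithinAt.clm_apply (hasFDerivWithinAt_const b z closedSquare)
    rw [partialWithin, show partialWithin b g = fun z => fderivWithin ℝ g closedSquare z b from rfl,
      this.fderivWithin (hu z hz)]
    simp
  rw [key, key]
  exact hs e e'

/-- The jet takes the y-derivatives first, so a further y-derivative has to be moved past all the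
x-derivatives. -/
lemma Dy_iterate_Dx (i : ℕ) : ∀ {g : ℝ × ℝ → ℝ},
    ContDiffOn ℝ ((i + 1 : ℕ) : WithTop ℕ∞) g closedSquare →
    EqOn (Dy (Dx^[i] g)) (Dx^[i] (Dy g)) closedSquare := by
  induction i with
  | zero => intro g _ z _; rfl
  | succ i ih =>
    intro g hg z hz
    rw [Function.iterate_succ_apply', Function.iterate_succ_apply']
    have h2 : ContDiffOn ℝ ((2 : ℕ) : WithTop ℕ∞) (Dx^[i] g) closedSquare :=
      ContDiffOn.iterate_partialWithin i (by rwa [show 2 + i = i + 1 + 1 by omega])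
    refine (partialWithin_comm (by exact_mod_cast h2) (0, 1) (1, 0) hz).trans ?_
    exact partialWithin_congr (ih (hg.of_le (by norm_cast; omega))) hz

lemma iteratedDerivWithin_fst (i : ℕ) :
    ContDiffOn ℝ (i : WithTop ℕ∞) g closedSquare → ∀ x ∈ Icc (0 : ℝ) 1, ∀ y ∈ Icc (0 : ℝ) 1,
      iteratedDerivWithin i (fun t => g (t, y)) (Icc 0 1) x = Dx^[i] g (x, y) := by
  induction i with
  | zero => intro _ x _ y _; simp
  | succ i ih =>
    intro hg x hx y hy
    have ih' := ih (hg.of_le (by norm_cast; omega))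
    rw [iteratedDerivWithin_succ, Function.iterate_succ_apply',
      derivWithin_congr (fun t ht => ih' t ht y hy) (ih' x hx y hy)]
    have h1 : ContDiffOn ℝ ((1 : ℕ) : WithTop ℕ∞) (Dx^[i] g) closedSquare :=
      ContDiffOn.iterate_partialWithin i (by rwa [add_comm])
    exact (hasDerivWithinAt_fst (h1.differentiableOn (by norm_num)) hx hy).derivWithin
      (uniqueDiffOn_Icc zero_lt_one x hx)

lemma iteratedDerivWithin_snd (i : ℕ) :
    ContDiffOn ℝ (i : WithTop ℕ∞) g closedSquare → ∀ x ∈ Icc (0 : ℝ) 1, ∀ y ∈ Icc (0 : ℝ) 1,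
      iteratedDerivWithin i (fun t => g (x, t)) (Icc 0 1) y = Dy^[i] g (x, y) := by
  induction i with
  | zero => intro _ x _ y _; simp
  | succ i ih =>
    intro hg x hx y hy
    have ih' := ih (hg.of_le (by norm_cast; omega))
    rw [iteratedDerivWithin_succ, Function.iterate_succ_apply',
      derivWithin_congr (fun t ht => ih' x hx t ht) (ih' x hx y hy)]
    have h1 : ContDiffOn ℝ ((1 : ℕ) : WithTop ℕ∞) (Dy^[i] g) closedSquare :=
      ContDiffOn.iterate_partialWithin i (by rwa [add_comm])
    exact (hasDerivWithinAt_snd (h1.differentiableOn (by norm_num)) hx hy).derivWithin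
      (uniqueDiffOn_Icc zero_lt_one y hy)

/-- Passes from iterated derivatives along lines, in which the hypotheses are phrased, to Fréchet
derivatives, for which smoothness and commutation are available. -/
lemma mixedPartial_eq {i j : ℕ} (hg : ContDiffOn ℝ ((i + j : ℕ) : WithTop ℕ∞) g closedSquare)
    {z : ℝ × ℝ} (hz : z ∈ closedSquare) : mixedPartial i j g z = Dx^[i] (Dy^[j] g) z := by
  have hj : ContDiffOn ℝ (j : WithTop ℕ∞) g closedSquare := hg.of_le (by norm_cast; omega)
  rw [mixedPartial, iteratedDerivWithin_congr
    (fun x hx => iteratedDerivWithin_snd j hj x hx z.2 hz.2) hz.1]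
  exact iteratedDerivWithin_fst (g := Dy^[j] g) i (ContDiffOn.iterate_partialWithin j hg) z.1 hz.1
    z.2 hz.2

/-- The derivatives of a smooth function on the closed square form a jet. -/
lemma jet_of_contDiffOn (hg : ContDiffOn ℝ (n : WithTop ℕ∞) g closedSquare) :
    Jet n (fun i j x y => Dx^[i] (Dy^[j] g) (x, y)) where
  deriv_fst i j hij x hx y hy := by
    have h1 : ContDiffOn ℝ ((1 : ℕ) : WithTop ℕ∞) (Dx^[i] (Dy^[j] g)) closedSquare :=
      ContDiffOn.iterate_partialWithin i (ContDiffOn.iterate_partialWithin j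
        (hg.of_le (by norm_cast; omega)))
    simp only [Function.iterate_succ_apply']
    exact hasDerivWithinAt_fst (h1.differentiableOn (by norm_num)) hx hy
  deriv_snd i j hij x hx y hy := by
    have h2 : ContDiffOn ℝ ((i + 1 : ℕ) : WithTop ℕ∞) (Dy^[j] g) closedSquare :=
      ContDiffOn.iterate_partialWithin j (hg.of_le (by norm_cast; omega))
    have h1 : ContDiffOn ℝ ((1 : ℕ) : WithTop ℕ∞) (Dx^[i] (Dy^[j] g)) closedSquare :=
      ContDiffOn.iterate_partialWithin i (by rwa [add_comm])
    have := hasDerivWithinAt_snd (h1.differentiableOn (by norm_num)) hx hy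
    rw [Dy_iterate_Dx i h2 ⟨hx, hy⟩] at this
    simpa only [Function.iterate_succ_apply'] using this

end Partial

end BakhvalovFEM
end

noncomputable section
namespace BakhvalovFEM

/-! ### The bilinear form and the energy norm -/

section FE

variable {X Y : ℕ → ℝ} {k N : ℕ} {ε₁ ε₂ : ℝ} {b c : ℝ → ℝ} {w e χ : ℝ × ℝ → ℝ}

lemma InFESpace.pw (hw : InFESpace k N X Y w) : PW X Y N w := by
  refine ⟨hw.continuousOn, fun i hi j hj => ?_⟩
  obtain ⟨α, hα⟩ := hw.piecewise i hi j hj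
  refine ContDiffOn.congr (ContDiff.contDiffOn ?_) hα
  fun_prop

lemma InFESpace.sub {w' : ℝ × ℝ → ℝ} (hw : InFESpace k N X Y w) (hw' : InFESpace k N X Y w') :
    InFESpace k N X Y (fun z => w z - w' z) where
  continuousOn := hw.continuousOn.sub hw'.continuousOn
  boundary z hz := by rw [hw.boundary z hz, hw'.boundary z hz, sub_zero]
  piecewise i hi j hj := by
    obtain ⟨α, hα⟩ := hw.piecewise i hi j hj
    obtain ⟨α', hα'⟩ := hw'.piecewise i hi j hj
    refine ⟨fun l r => α l r - α' l r, fun z hz => ?_⟩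
    rw [hα z hz, hα' z hz, ← Finset.sum_sub_distrib]
    refine Finset.sum_congr rfl fun l _ => ?_
    rw [← Finset.sum_sub_distrib]
    exact Finset.sum_congr rfl fun r _ => by ring

lemma L2.continuousOn_mul {h f : ℝ × ℝ → ℝ} (hh : ContinuousOn h closedSquare) (hf : L2 f) :
    L2 (fun z => h z * f z) := by
  obtain ⟨C, hC⟩ := isCompact_closedSquare.exists_bound_of_continuousOn hh
  have hm : AEStronglyMeasurable h (volume.restrict openSquare) :=
    (hh.mono openSquare_subset).aestronglyMeasurable measurableSet_openSquare
  refine MemLp.of_le_mul (c := C) hf (hm.mul hf.1) ?_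
  filter_upwards [ae_restrict_mem measurableSet_openSquare] with z hz
  rw [norm_mul]
  exact mul_le_mul_of_nonneg_right (hC z (openSquare_subset hz)) (norm_nonneg _)

lemma continuousOn_comp_fst {h : ℝ → ℝ} (hh : ContinuousOn h (Icc 0 1)) :
    ContinuousOn (fun z : ℝ × ℝ => h z.1) closedSquare :=
  hh.comp continuousOn_fst fun _ hz => hz.1

lemma energyNorm_sq (hε : 0 ≤ ε₁) (hx : L2 (dx w)) (hy : L2 (dy w)) :
    energyNorm ε₁ w ^ 2 = ε₁ * (nrm (dx w) ^ 2 + nrm (dy w) ^ 2) + nrm w ^ 2 := by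
  have h : ∫ z in openSquare, (dx w z ^ 2 + dy w z ^ 2) = nrm (dx w) ^ 2 + nrm (dy w) ^ 2 := by
    rw [integral_add hx.integrable_sq hy.integrable_sq, nrm_sq, nrm_sq]
  rw [energyNorm, h, ← nrm_sq, Real.sq_sqrt (by positivity)]

lemma energyNorm_nonneg (ε₁ : ℝ) (w : ℝ × ℝ → ℝ) : 0 ≤ energyNorm ε₁ w := Real.sqrt_nonneg _

/-- The energy norm is at most the sum of its three contributions. -/
def sumNorm (ε₁ : ℝ) (w : ℝ × ℝ → ℝ) : ℝ := √ε₁ * nrm (dx w) + √ε₁ * nrm (dy w) + nrm w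

lemma energyNorm_le_sumNorm (hε : 0 ≤ ε₁) (hx : L2 (dx w)) (hy : L2 (dy w)) :
    energyNorm ε₁ w ≤ sumNorm ε₁ w := by
  have h1 := nrm_nonneg (dx w)
  have h2 := nrm_nonneg (dy w)
  have h3 := nrm_nonneg w
  have h4 := Real.sqrt_nonneg ε₁
  have hnn : 0 ≤ sumNorm ε₁ w := by unfold sumNorm; positivity
  refine le_of_sq_le_sq ?_ hnn
  rw [energyNorm_sq hε hx hy]
  have h5 : ε₁ * (nrm (dx w) ^ 2 + nrm (dy w) ^ 2)
      = (√ε₁ * nrm (dx w)) ^ 2 + (√ε₁ * nrm (dy w)) ^ 2 := by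
    rw [mul_pow, mul_pow, Real.sq_sqrt hε]; ring
  rw [h5, sumNorm]
  have h6 : 0 ≤ √ε₁ * nrm (dx w) := by positivity
  have h7 : 0 ≤ √ε₁ * nrm (dy w) := by positivity
  nlinarith [mul_nonneg h6 h7, mul_nonneg h6 h3, mul_nonneg h7 h3]

lemma nrm_le_energyNorm (hε : 0 ≤ ε₁) (hx : L2 (dx w)) (hy : L2 (dy w)) :
    √ε₁ * nrm (dx w) ≤ energyNorm ε₁ w ∧ √ε₁ * nrm (dy w) ≤ energyNorm ε₁ w ∧
      nrm w ≤ energyNorm ε₁ w := by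
  have h0 := energyNorm_nonneg ε₁ w
  have h1 := energyNorm_sq hε hx hy
  have h2 : 0 ≤ ε₁ * nrm (dx w) ^ 2 := by positivity
  have h3 : 0 ≤ ε₁ * nrm (dy w) ^ 2 := by positivity
  have h4 := sq_nonneg (nrm w)
  refine ⟨le_of_sq_le_sq ?_ h0, le_of_sq_le_sq ?_ h0, le_of_sq_le_sq ?_ h0⟩
  · rw [mul_pow, Real.sq_sqrt hε, h1]; linarith
  · rw [mul_pow, Real.sq_sqrt hε, h1]; linarith
  · rw [h1]; linarith

lemma sumNorm_add_le {w₁ w₂ : ℝ × ℝ → ℝ} (h₁ : PW X Y N w₁) (h₂ : PW X Y N w₂) (hX : Mesh X N)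
    (hY : Mesh Y N) (hN : 0 < N) :
    sumNorm ε₁ (fun z => w₁ z + w₂ z) ≤ sumNorm ε₁ w₁ + sumNorm ε₁ w₂ := by
  have e1 : nrm (dx fun z => w₁ z + w₂ z) ≤ nrm (dx w₁) + nrm (dx w₂) := by
    rw [nrm_congr (h₁.dx_add h₂ hX hY hN)]
    exact nrm_add_le (h₁.L2_dx hX hY hN) (h₂.L2_dx hX hY hN)
  have e2 : nrm (dy fun z => w₁ z + w₂ z) ≤ nrm (dy w₁) + nrm (dy w₂) := by
    rw [nrm_congr (h₁.dy_add h₂ hX hY hN)]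
    exact nrm_add_le (h₁.L2_dy hX hY hN) (h₂.L2_dy hX hY hN)
  have e3 := nrm_add_le (h₁.L2 hX hY hN) (h₂.L2 hX hY hN)
  have h4 := Real.sqrt_nonneg ε₁
  unfold sumNorm
  nlinarith [mul_le_mul_of_nonneg_left e1 h4, mul_le_mul_of_nonneg_left e2 h4]

lemma pw_comp_fst (hX : Mesh X N) (hY : Mesh Y N) (hb : ContDiffOn ℝ 1 b (Icc 0 1)) :
    PW X Y N (fun z => b z.1) :=
  PW.of_contDiffOn hX hY (hb.comp contDiffOn_fst fun _ hz => hz.1)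

lemma hasDerivAt_of_contDiffOn (hb : ContDiffOn ℝ 1 b (Icc 0 1)) {x : ℝ} (hx : x ∈ Ioo (0 : ℝ) 1) :
    HasDerivAt b (derivWithin b (Icc 0 1) x) x :=
  ((hb.differentiableOn (by norm_num)) x (Ioo_subset_Icc_self hx)).hasDerivWithinAt.hasDerivAt
    (Icc_mem_nhds hx.1 hx.2)

/-- Integration by parts in the convection term. -/
lemma convection_by_parts (hX : Mesh X N) (hY : Mesh Y N) (hN : 0 < N)
    (hb : ContDiffOn ℝ 1 b (Icc 0 1)) (he : PW X Y N e) (hχ : PW X Y N χ)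
    (h0 : ∀ z ∈ closedSquare \ openSquare, χ z = 0) :
    ∫ z in openSquare, (b z.1 * dx e z) * χ z
      = -(∫ z in openSquare, (b z.1 * e z) * dx χ z)
        - ∫ z in openSquare, (derivWithin b (Icc 0 1) z.1 * e z) * χ z := by
  have hbc := continuousOn_comp_fst hb.continuousOn
  have hb' : ContinuousOn (derivWithin b (Icc 0 1)) (Icc 0 1) :=
    hb.continuousOn_derivWithin (uniqueDiffOn_Icc zero_lt_one) le_rfl
  -- The integral of the x-derivative of b e χ is zero. Only χ has to vanish on the boundary, not
  -- the error e.
  have h := (((pw_comp_fst hX hY hb).mul he).mul hχ).integral_dx_eq_zero hX hY hN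
    fun z hz => by rw [h0 z hz, mul_zero]
  have hL := hχ.L2 hX hY hN
  have i1 : IntegrableOn (fun z => (b z.1 * dx e z) * χ z) openSquare :=
    (L2.continuousOn_mul hbc (he.L2_dx hX hY hN)).integrable_mul hL
  have i2 : IntegrableOn (fun z => (b z.1 * e z) * dx χ z) openSquare :=
    (L2.continuousOn_mul hbc (he.L2 hX hY hN)).integrable_mul (hχ.L2_dx hX hY hN)
  have i3 : IntegrableOn (fun z => (derivWithin b (Icc 0 1) z.1 * e z) * χ z) openSquare :=
    (L2.continuousOn_mul (continuousOn_comp_fst hb') (he.L2 hX hY hN)).integrable_mul hL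
  have hae : dx (fun z => b z.1 * e z * χ z) =ᵐ[volume.restrict openSquare] fun z =>
      ((b z.1 * dx e z) * χ z + (b z.1 * e z) * dx χ z)
        + (derivWithin b (Icc 0 1) z.1 * e z) * χ z := by
    filter_upwards [ae_ocell hX hY hN, ae_restrict_mem measurableSet_openSquare]
      with z ⟨i, hi, j, hj, hz⟩ hzo
    have := (((hasDerivAt_of_contDiffOn hb hzo.1).mul (he.hasDerivAt_dx hi hj hz)).mul
      (hχ.hasDerivAt_dx hi hj hz)).deriv
    refine Eq.trans this ?_
    simp only [Prod.mk.eta, Pi.mul_apply]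
    ring
  have i12 : IntegrableOn (fun z => (b z.1 * dx e z) * χ z + (b z.1 * e z) * dx χ z) openSquare :=
    i1.add i2
  rw [integral_congr_ae hae, integral_add i12 i3, integral_add i1 i2] at h
  linarith

lemma bilin_eq (hX : Mesh X N) (hY : Mesh Y N) (hN : 0 < N) (hb : ContinuousOn b (Icc 0 1))
    (hc : ContinuousOn c (Icc 0 1)) (he : PW X Y N e) (hχ : PW X Y N χ) :
    bilin ε₁ ε₂ b c e χ = ε₁ * ((∫ z in openSquare, dx e z * dx χ z)
        + ∫ z in openSquare, dy e z * dy χ z)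
      + (ε₂ * (∫ z in openSquare, (b z.1 * dx e z) * χ z)
        + ∫ z in openSquare, (c z.1 * e z) * χ z) := by
  have hL := hχ.L2 hX hY hN
  have i1 : IntegrableOn (fun z => (b z.1 * dx e z) * χ z) openSquare :=
    (L2.continuousOn_mul (continuousOn_comp_fst hb) (he.L2_dx hX hY hN)).integrable_mul hL
  have i3 : IntegrableOn (fun z => (c z.1 * e z) * χ z) openSquare :=
    (L2.continuousOn_mul (continuousOn_comp_fst hc) (he.L2 hX hY hN)).integrable_mul hL
  have i4 := (he.L2_dx hX hY hN).integrable_mul (hχ.L2_dx hX hY hN)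
  have i5 := (he.L2_dy hX hY hN).integrable_mul (hχ.L2_dy hX hY hN)
  rw [bilin, integral_add i4 i5, ← integral_const_mul ε₂, ← integral_add (i1.const_mul ε₂) i3]
  congr 2
  ext z
  ring

lemma bilin_sub {w₁ w₂ : ℝ × ℝ → ℝ} (hX : Mesh X N) (hY : Mesh Y N) (hN : 0 < N)
    (hb : ContinuousOn b (Icc 0 1)) (hc : ContinuousOn c (Icc 0 1)) (h₁ : PW X Y N w₁)
    (h₂ : PW X Y N w₂) (hχ : PW X Y N χ) :
    bilin ε₁ ε₂ b c (fun z => w₁ z - w₂ z) χ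
      = bilin ε₁ ε₂ b c w₁ χ - bilin ε₁ ε₂ b c w₂ χ := by
  have hL := hχ.L2 hX hY hN
  have hbc := continuousOn_comp_fst hb
  have hcc := continuousOn_comp_fst hc
  have hg : ∀ {w}, PW X Y N w → IntegrableOn (fun z => dx w z * dx χ z + dy w z * dy χ z)
      openSquare := fun h => ((h.L2_dx hX hY hN).integrable_mul (hχ.L2_dx hX hY hN)).add
        ((h.L2_dy hX hY hN).integrable_mul (hχ.L2_dy hX hY hN))
  have hr : ∀ {w}, PW X Y N w → IntegrableOn
      (fun z => (ε₂ * b z.1 * dx w z + c z.1 * w z) * χ z) openSquare := fun h =>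
    (L2.add' (L2.continuousOn_mul (h := fun z => ε₂ * b z.1) (continuousOn_const.mul hbc)
      (h.L2_dx hX hY hN)) (L2.continuousOn_mul hcc (h.L2 hX hY hN))).integrable_mul hL
  have e1 : ∫ z in openSquare, (dx (fun z => w₁ z - w₂ z) z * dx χ z
        + dy (fun z => w₁ z - w₂ z) z * dy χ z)
      = ∫ z in openSquare, (dx w₁ z * dx χ z + dy w₁ z * dy χ z)
        - (dx w₂ z * dx χ z + dy w₂ z * dy χ z) := by
    refine integral_congr_ae ?_
    filter_upwards [h₁.dx_sub h₂ hX hY hN, h₁.dy_sub h₂ hX hY hN] with z hz1 hz2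
    rw [hz1, hz2]; ring
  have e2 : ∫ z in openSquare, (ε₂ * b z.1 * dx (fun z => w₁ z - w₂ z) z
        + c z.1 * (w₁ z - w₂ z)) * χ z
      = ∫ z in openSquare, (ε₂ * b z.1 * dx w₁ z + c z.1 * w₁ z) * χ z
        - (ε₂ * b z.1 * dx w₂ z + c z.1 * w₂ z) * χ z := by
    refine integral_congr_ae ?_
    filter_upwards [h₁.dx_sub h₂ hX hY hN] with z hz1
    rw [hz1]; ring
  rw [bilin, e1, e2, integral_sub (hg h₁) (hg h₂), integral_sub (hr h₁) (hr h₂), bilin, bilin]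
  ring

/-- Coercivity of the bilinear form. -/
lemma bilin_coercive {γ : ℝ} (hX : Mesh X N) (hY : Mesh Y N) (hN : 0 < N)
    (hb : ContDiffOn ℝ 1 b (Icc 0 1)) (hc : ContinuousOn c (Icc 0 1)) (hε : 0 ≤ ε₁)
    (hγ : ∀ x ∈ Icc (0 : ℝ) 1, γ ≤ c x - 1 / 2 * ε₂ * derivWithin b (Icc 0 1) x)
    (hχ : PW X Y N χ) (h0 : ∀ z ∈ closedSquare \ openSquare, χ z = 0) :
    min 1 γ * energyNorm ε₁ χ ^ 2 ≤ bilin ε₁ ε₂ b c χ χ := by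
  have hL := hχ.L2 hX hY hN
  have hb' : ContinuousOn (derivWithin b (Icc 0 1)) (Icc 0 1) :=
    hb.continuousOn_derivWithin (uniqueDiffOn_Icc zero_lt_one) le_rfl
  have hconv := convection_by_parts hX hY hN hb hχ hχ h0
  have hcomm : ∫ z in openSquare, (b z.1 * χ z) * dx χ z
      = ∫ z in openSquare, (b z.1 * dx χ z) * χ z := by congr 1; ext z; ring
  rw [hcomm] at hconv
  have i1 : IntegrableOn (fun z => (derivWithin b (Icc 0 1) z.1 * χ z) * χ z) openSquare :=
    (L2.continuousOn_mul (continuousOn_comp_fst hb') hL).integrable_mul hL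
  have i2 : IntegrableOn (fun z => (c z.1 * χ z) * χ z) openSquare :=
    (L2.continuousOn_mul (continuousOn_comp_fst hc) hL).integrable_mul hL
  have hlow : γ * nrm χ ^ 2 ≤ (∫ z in openSquare, (c z.1 * χ z) * χ z)
      - (1 / 2 * ε₂) * ∫ z in openSquare, (derivWithin b (Icc 0 1) z.1 * χ z) * χ z := by
    rw [nrm_sq, ← integral_const_mul, ← integral_const_mul, ← integral_sub i2 (i1.const_mul _)]
    refine setIntegral_mono_on (hL.integrable_sq.const_mul γ) (i2.sub (i1.const_mul _))
      measurableSet_openSquare fun z hz => ?_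
    have := mul_le_mul_of_nonneg_right (hγ z.1 (openSquare_subset hz).1) (sq_nonneg (χ z))
    nlinarith
  rw [bilin_eq hX hY hN hb.continuousOn hc hχ hχ, energyNorm_sq hε (hχ.L2_dx hX hY hN)
    (hχ.L2_dy hX hY hN)]
  have g1 : ∫ z in openSquare, dx χ z * dx χ z = nrm (dx χ) ^ 2 := by
    rw [nrm_sq]; congr 1; ext z; ring
  have g2 : ∫ z in openSquare, dy χ z * dy χ z = nrm (dy χ) ^ 2 := by
    rw [nrm_sq]; congr 1; ext z; ring
  -- For e = χ the convection term occurs on both sides of the integration by parts, which produces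
  -- the factor 1/2.
  have hhalf : ∫ z in openSquare, (b z.1 * dx χ z) * χ z
      = -(1 / 2) * ∫ z in openSquare, (derivWithin b (Icc 0 1) z.1 * χ z) * χ z := by linarith
  rw [g1, g2, hhalf]
  have hm1 : min 1 γ ≤ 1 := min_le_left _ _
  have hm2 : min 1 γ ≤ γ := min_le_right _ _
  have p1 : 0 ≤ ε₁ * (nrm (dx χ) ^ 2 + nrm (dy χ) ^ 2) := by positivity
  have p2 : 0 ≤ nrm χ ^ 2 := by positivity
  nlinarith [mul_le_mul_of_nonneg_right hm1 p1, mul_le_mul_of_nonneg_right hm2 p2]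

/-- The exact solution satisfies the variational equation. -/
lemma bilin_solution {f u : ℝ × ℝ → ℝ} (hX : Mesh X N) (hY : Mesh Y N) (hN : 0 < N)
    (hb : ContinuousOn b (Icc 0 1)) (hc : ContinuousOn c (Icc 0 1))
    (hu : ContDiffOn ℝ 2 u closedSquare) (hsol : IsSolution ε₁ ε₂ b c f u) (hχ : PW X Y N χ)
    (h0 : ∀ z ∈ closedSquare \ openSquare, χ z = 0) :
    bilin ε₁ ε₂ b c u χ = ∫ z in openSquare, f z * χ z := by
  have hu2 : ContDiffOn ℝ ((1 + 1 : ℕ) : WithTop ℕ∞) u closedSquare := by exact_mod_cast hu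
  have hpx : ∀ e : ℝ × ℝ, ContDiffOn ℝ 1 (partialWithin e u) closedSquare := fun e => by
    exact_mod_cast ContDiffOn.partialWithin (e := e) hu2
  have hnhds : ∀ z ∈ openSquare, closedSquare ∈ nhds z := fun z hz =>
    Filter.mem_of_superset (isOpen_openSquare.mem_nhds hz) openSquare_subset
  have hdx : ∀ {g : ℝ × ℝ → ℝ}, ContDiffOn ℝ 1 g closedSquare → ∀ z ∈ openSquare,
      dx g z = Dx g z := fun {g} hg z hz =>
    ((hasDerivWithinAt_fst (hg.differentiableOn (by norm_num)) (openSquare_subset hz).1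
      (openSquare_subset hz).2).hasDerivAt (Icc_mem_nhds hz.1.1 hz.1.2)).deriv
  have hdy : ∀ {g : ℝ × ℝ → ℝ}, ContDiffOn ℝ 1 g closedSquare → ∀ z ∈ openSquare,
      dy g z = Dy g z := fun {g} hg z hz =>
    ((hasDerivWithinAt_snd (hg.differentiableOn (by norm_num)) (openSquare_subset hz).1
      (openSquare_subset hz).2).hasDerivAt (Icc_mem_nhds hz.2.1 hz.2.2)).deriv
  have hu1 : ContDiffOn ℝ 1 u closedSquare := hu.of_le (by norm_num)
  have hpw := PW.of_contDiffOn hX hY hu1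
  have hpwx := PW.of_contDiffOn hX hY (hpx (1, 0))
  have hpwy := PW.of_contDiffOn hX hY (hpx (0, 1))
  -- Green's formula in two halves, from the vanishing integrals of the x-derivative of u_x χ and of
  -- the y-derivative of u_y χ.
  have hgx := (hpwx.mul hχ).integral_dx_eq_zero hX hY hN fun z hz => by rw [h0 z hz, mul_zero]
  have hgy := (hpwy.mul hχ).integral_dy_eq_zero hX hY hN fun z hz => by rw [h0 z hz, mul_zero]
  have hL := hχ.L2 hX hY hN
  have ex : ∫ z in openSquare, dx u z * dx χ z
      = -∫ z in openSquare, dx (Dx u) z * χ z := by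
    have hae : dx (fun z => Dx u z * χ z) =ᵐ[volume.restrict openSquare]
        fun z => dx (Dx u) z * χ z + dx u z * dx χ z := by
      filter_upwards [ae_ocell hX hY hN, ae_restrict_mem measurableSet_openSquare]
        with z ⟨i, hi, j, hj, hz⟩ hzo
      rw [hdx hu1 z hzo]
      exact ((hpwx.hasDerivAt_dx hi hj hz).mul (hχ.hasDerivAt_dx hi hj hz)).deriv
    rw [integral_congr_ae hae, integral_add ((hpwx.L2_dx hX hY hN).integrable_mul hL)
      ((hpw.L2_dx hX hY hN).integrable_mul (hχ.L2_dx hX hY hN))] at hgx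
    linarith
  have ey : ∫ z in openSquare, dy u z * dy χ z
      = -∫ z in openSquare, dy (Dy u) z * χ z := by
    have hae : dy (fun z => Dy u z * χ z) =ᵐ[volume.restrict openSquare]
        fun z => dy (Dy u) z * χ z + dy u z * dy χ z := by
      filter_upwards [ae_ocell hX hY hN, ae_restrict_mem measurableSet_openSquare]
        with z ⟨i, hi, j, hj, hz⟩ hzo
      rw [hdy hu1 z hzo]
      exact ((hpwy.hasDerivAt_dy hi hj hz).mul (hχ.hasDerivAt_dy hi hj hz)).deriv
    rw [integral_congr_ae hae, integral_add ((hpwy.L2_dy hX hY hN).integrable_mul hL)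
      ((hpw.L2_dy hX hY hN).integrable_mul (hχ.L2_dy hX hY hN))] at hgy
    linarith
  have i1 : IntegrableOn (fun z => (b z.1 * dx u z) * χ z) openSquare :=
    (L2.continuousOn_mul (continuousOn_comp_fst hb) (hpw.L2_dx hX hY hN)).integrable_mul hL
  have i2 : IntegrableOn (fun z => (c z.1 * u z) * χ z) openSquare :=
    (L2.continuousOn_mul (continuousOn_comp_fst hc) (hpw.L2 hX hY hN)).integrable_mul hL
  have i3 := (hpwx.L2_dx hX hY hN).integrable_mul hL
  have i4 := (hpwy.L2_dy hX hY hN).integrable_mul hL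
  have i34 : IntegrableOn (fun z => -ε₁ * (dx (Dx u) z * χ z + dy (Dy u) z * χ z)) openSquare :=
    (i3.add i4).const_mul _
  have i12 : IntegrableOn (fun z => ε₂ * ((b z.1 * dx u z) * χ z) + (c z.1 * u z) * χ z)
      openSquare := (i1.const_mul _).add i2
  have hf : ∫ z in openSquare, f z * χ z
      = ∫ z in openSquare, -ε₁ * (dx (Dx u) z * χ z + dy (Dy u) z * χ z)
        + (ε₂ * ((b z.1 * dx u z) * χ z) + (c z.1 * u z) * χ z) := by
    refine setIntegral_congr_fun measurableSet_openSquare fun z hz => ?_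
    have hz' := openSquare_subset hz
    have m20 : mixedPartial 2 0 u z = Dx (Dx u) z := by
      rw [mixedPartial_eq (by exact_mod_cast hu) hz']; rfl
    have m02 : mixedPartial 0 2 u z = Dy (Dy u) z := by
      rw [mixedPartial_eq (by exact_mod_cast hu) hz']; rfl
    have m10 : mixedPartial 1 0 u z = Dx u z := by
      rw [mixedPartial_eq (by exact_mod_cast hu1) hz']; rfl
    rw [← hsol.equation z hz, m20, m02, m10, hdx (hpx _) z hz, hdy (hpx _) z hz, hdx hu1 z hz]
    ring
  rw [hf, integral_add i34 i12, integral_const_mul, integral_add i3 i4,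
    integral_add (i1.const_mul _) i2, integral_const_mul, bilin_eq hX hY hN hb hc hpw hχ, ex, ey]
  ring

/-- The bound of the bilinear form when the convection term is estimated directly for one part of
the first argument and after integration by parts for the other part. -/
lemma abs_bilin_le {e' : ℝ × ℝ → ℝ} {Bb Bb' Bc : ℝ} (hX : Mesh X N) (hY : Mesh Y N) (hN : 0 < N)
    (hb : ContDiffOn ℝ 1 b (Icc 0 1)) (hc : ContinuousOn c (Icc 0 1)) (hε : 0 < ε₁)
    (hε₂ : 0 ≤ ε₂) (hBb : ∀ x ∈ Icc (0 : ℝ) 1, |b x| ≤ Bb)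
    (hBb' : ∀ x ∈ Icc (0 : ℝ) 1, |derivWithin b (Icc 0 1) x| ≤ Bb')
    (hBc : ∀ x ∈ Icc (0 : ℝ) 1, |c x| ≤ Bc) (he : PW X Y N e) (he' : PW X Y N e')
    (hχ : PW X Y N χ) (h0 : ∀ z ∈ closedSquare \ openSquare, χ z = 0) :
    |bilin ε₁ ε₂ b c (fun z => e z + e' z) χ|
      ≤ ((1 + Bc) * sumNorm ε₁ (fun z => e z + e' z)
        + ε₂ * (Bb * nrm (dx e) + Bb * (nrm e' / √ε₁) + Bb' * nrm e')) * energyNorm ε₁ χ := by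
  have hL := hχ.L2 hX hY hN
  have hs := he.add he'
  have hb' : ContinuousOn (derivWithin b (Icc 0 1)) (Icc 0 1) :=
    hb.continuousOn_derivWithin (uniqueDiffOn_Icc zero_lt_one) le_rfl
  have hbc := continuousOn_comp_fst hb.continuousOn
  obtain ⟨n1, n2, n3⟩ := nrm_le_energyNorm hε.le (hχ.L2_dx hX hY hN) (hχ.L2_dy hX hY hN)
  have z0 : (0 : ℝ) ∈ Icc (0 : ℝ) 1 := by simp
  have hBb0 : 0 ≤ Bb := (abs_nonneg _).trans (hBb 0 z0)
  have hBb0' : 0 ≤ Bb' := (abs_nonneg _).trans (hBb' 0 z0)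
  have hBc0 : 0 ≤ Bc := (abs_nonneg _).trans (hBc 0 z0)
  have hE := energyNorm_nonneg ε₁ χ
  have hsq : 0 < √ε₁ := Real.sqrt_pos.2 hε
  have hmul : ∀ {h : ℝ → ℝ} {B : ℝ} {v : ℝ × ℝ → ℝ}, (∀ x ∈ Icc (0 : ℝ) 1, |h x| ≤ B) →
      L2 v → nrm (fun z => h z.1 * v z) ≤ B * nrm v := fun {h B v} hh hv =>
    nrm_le_of_abs_le ((abs_nonneg _).trans (hh 0 z0)) hv (by
      filter_upwards [ae_restrict_mem measurableSet_openSquare] with z hz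
      rw [abs_mul]
      exact mul_le_mul_of_nonneg_right (hh _ (openSquare_subset hz).1) (abs_nonneg _))
  have t1 := abs_integral_mul_le (hs.L2_dx hX hY hN) (hχ.L2_dx hX hY hN)
  have t2 := abs_integral_mul_le (hs.L2_dy hX hY hN) (hχ.L2_dy hX hY hN)
  have t3 : |∫ z in openSquare, (c z.1 * (e z + e' z)) * χ z|
      ≤ Bc * nrm (fun z => e z + e' z) * nrm χ :=
    (abs_integral_mul_le (L2.continuousOn_mul (continuousOn_comp_fst hc) (hs.L2 hX hY hN))
      hL).trans (mul_le_mul_of_nonneg_right (hmul hBc (hs.L2 hX hY hN)) (nrm_nonneg χ))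
  have t4 : |∫ z in openSquare, (b z.1 * dx e z) * χ z| ≤ Bb * nrm (dx e) * nrm χ :=
    (abs_integral_mul_le (L2.continuousOn_mul hbc (he.L2_dx hX hY hN)) hL).trans
      (mul_le_mul_of_nonneg_right (hmul hBb (he.L2_dx hX hY hN)) (nrm_nonneg χ))
  have t5 : |∫ z in openSquare, (b z.1 * e' z) * dx χ z| ≤ Bb * nrm e' * nrm (dx χ) :=
    (abs_integral_mul_le (L2.continuousOn_mul hbc (he'.L2 hX hY hN)) (hχ.L2_dx hX hY hN)).trans
      (mul_le_mul_of_nonneg_right (hmul hBb (he'.L2 hX hY hN)) (nrm_nonneg _))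
  have t6 : |∫ z in openSquare, (derivWithin b (Icc 0 1) z.1 * e' z) * χ z|
      ≤ Bb' * nrm e' * nrm χ :=
    (abs_integral_mul_le (L2.continuousOn_mul (continuousOn_comp_fst hb') (he'.L2 hX hY hN))
      hL).trans (mul_le_mul_of_nonneg_right (hmul hBb' (he'.L2 hX hY hN)) (nrm_nonneg χ))
  have hsplit : ∫ z in openSquare, (b z.1 * dx (fun z => e z + e' z) z) * χ z
      = (∫ z in openSquare, (b z.1 * dx e z) * χ z)
        + (-(∫ z in openSquare, (b z.1 * e' z) * dx χ z)
        - ∫ z in openSquare, (derivWithin b (Icc 0 1) z.1 * e' z) * χ z) := by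
    rw [← convection_by_parts hX hY hN hb he' hχ h0, ← integral_add
      ((L2.continuousOn_mul hbc (he.L2_dx hX hY hN)).integrable_mul hL)
      ((L2.continuousOn_mul hbc (he'.L2_dx hX hY hN)).integrable_mul hL)]
    refine integral_congr_ae ?_
    filter_upwards [he.dx_add he' hX hY hN] with z hz
    rw [hz]; ring
  have hdiff : ∀ {s t : ℝ}, √ε₁ * s ≤ energyNorm ε₁ χ → 0 ≤ t →
      ε₁ * (t * s) ≤ √ε₁ * t * energyNorm ε₁ χ := fun {s t} hs ht => by
    calc ε₁ * (t * s) = √ε₁ * t * (√ε₁ * s) := by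
          rw [show √ε₁ * t * (√ε₁ * s) = (√ε₁ * √ε₁) * (t * s) by ring, Real.mul_self_sqrt hε.le]
      _ ≤ _ := mul_le_mul_of_nonneg_left hs (by positivity)
  have d1 := hdiff n1 (nrm_nonneg (dx fun z => e z + e' z))
  have d2 := hdiff n2 (nrm_nonneg (dy fun z => e z + e' z))
  have d3 : Bc * nrm (fun z => e z + e' z) * nrm χ
      ≤ Bc * nrm (fun z => e z + e' z) * energyNorm ε₁ χ :=
    mul_le_mul_of_nonneg_left n3 (mul_nonneg hBc0 (nrm_nonneg _))
  have d4 : Bb * nrm (dx e) * nrm χ ≤ Bb * nrm (dx e) * energyNorm ε₁ χ :=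
    mul_le_mul_of_nonneg_left n3 (mul_nonneg hBb0 (nrm_nonneg _))
  -- The price of moving the derivative onto χ: the energy norm controls χ_x only with the weight
  -- √ε₁.
  have d5 : Bb * nrm e' * nrm (dx χ) ≤ Bb * (nrm e' / √ε₁) * energyNorm ε₁ χ := by
    have : nrm (dx χ) ≤ energyNorm ε₁ χ / √ε₁ := by rwa [le_div_iff₀ hsq, mul_comm]
    calc _ ≤ Bb * nrm e' * (energyNorm ε₁ χ / √ε₁) :=
          mul_le_mul_of_nonneg_left this (mul_nonneg hBb0 (nrm_nonneg _))
      _ = _ := by ring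
  have d6 : Bb' * nrm e' * nrm χ ≤ Bb' * nrm e' * energyNorm ε₁ χ :=
    mul_le_mul_of_nonneg_left n3 (mul_nonneg hBb0' (nrm_nonneg _))
  rw [bilin_eq hX hY hN hb.continuousOn hc hs hχ, hsplit]
  have habs : ∀ p q r s t v : ℝ, |ε₁ * (p + q) + (ε₂ * (r + (-s - t)) + v)|
      ≤ ε₁ * |p| + ε₁ * |q| + ε₂ * (|r| + |s| + |t|) + |v| := by
    intro p q r s t v
    have a1 := abs_le.1 (le_refl |p|)
    have a2 := abs_le.1 (le_refl |q|)
    have a3 := abs_le.1 (le_refl |r|)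
    have a4 := abs_le.1 (le_refl |s|)
    have a5 := abs_le.1 (le_refl |t|)
    have a6 := abs_le.1 (le_refl |v|)
    have k1 := mul_le_mul_of_nonneg_left a1.2 hε.le
    have k2 := mul_le_mul_of_nonneg_left a2.2 hε.le
    have k1' := mul_le_mul_of_nonneg_left a1.1 hε.le
    have k2' := mul_le_mul_of_nonneg_left a2.1 hε.le
    have k3 : ε₂ * (r + (-s - t)) ≤ ε₂ * (|r| + |s| + |t|) :=
      mul_le_mul_of_nonneg_left (by linarith) hε₂
    have k4 : ε₂ * (-(|r| + |s| + |t|)) ≤ ε₂ * (r + (-s - t)) :=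
      mul_le_mul_of_nonneg_left (by linarith) hε₂
    rw [abs_le]
    constructor <;> linarith
  refine (habs _ _ _ _ _ _).trans ?_
  have q1 := mul_le_mul_of_nonneg_left t1 hε.le
  have q2 := mul_le_mul_of_nonneg_left t2 hε.le
  have q3 := mul_le_mul_of_nonneg_left (add_le_add (add_le_add (t4.trans d4) (t5.trans d5))
    (t6.trans d6)) hε₂
  -- `q4`, `q5` and `q6` are the surplus terms which allow the common factor 1 + Bc in front of all
  -- three terms of `sumNorm`.
  have q4 : 0 ≤ nrm (fun z => e z + e' z) * energyNorm ε₁ χ := mul_nonneg (nrm_nonneg _) hE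
  have q5 : 0 ≤ Bc * (√ε₁ * nrm (dx fun z => e z + e' z) * energyNorm ε₁ χ) := by
    have := nrm_nonneg (dx fun z => e z + e' z)
    positivity
  have q6 : 0 ≤ Bc * (√ε₁ * nrm (dy fun z => e z + e' z) * energyNorm ε₁ χ) := by
    have := nrm_nonneg (dy fun z => e z + e' z)
    positivity
  unfold sumNorm
  nlinarith

end FE

end BakhvalovFEM
end

noncomputable section
namespace BakhvalovFEM

/-! ### Piecewise polynomials -/

/-- Piecewise polynomials of degree at most `k` in one variable. -/
def PP1 (k N : ℕ) (X : ℕ → ℝ) (p : ℝ → ℝ) : Prop :=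
  ∀ i < N, ∃ P : Polynomial ℝ, P.natDegree ≤ k ∧ ∀ x ∈ Icc (X i) (X (i + 1)), p x = P.eval x

/-- Piecewise polynomials of degree at most `k` in each of two variables. -/
def PP (k N : ℕ) (X Y : ℕ → ℝ) (w : ℝ × ℝ → ℝ) : Prop :=
  ∀ i < N, ∀ j < N, ∃ α : ℕ → ℕ → ℝ, ∀ z ∈ Icc (X i) (X (i + 1)) ×ˢ Icc (Y j) (Y (j + 1)),
    w z = ∑ l ∈ Finset.range (k + 1), ∑ r ∈ Finset.range (k + 1), α l r * z.1 ^ l * z.2 ^ r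

section PP

variable {k N : ℕ} {X Y : ℕ → ℝ} {w w' : ℝ × ℝ → ℝ}

lemma PP.add (h : PP k N X Y w) (h' : PP k N X Y w') : PP k N X Y (fun z => w z + w' z) := by
  intro i hi j hj
  obtain ⟨α, hα⟩ := h i hi j hj
  obtain ⟨α', hα'⟩ := h' i hi j hj
  refine ⟨fun l r => α l r + α' l r, fun z hz => ?_⟩
  beta_reduce
  rw [hα z hz, hα' z hz, ← Finset.sum_add_distrib]
  refine Finset.sum_congr rfl fun l _ => ?_
  rw [← Finset.sum_add_distrib]
  exact Finset.sum_congr rfl fun r _ => by ring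

lemma PP.const_mul (a : ℝ) (h : PP k N X Y w) : PP k N X Y (fun z => a * w z) := by
  intro i hi j hj
  obtain ⟨α, hα⟩ := h i hi j hj
  refine ⟨fun l r => a * α l r, fun z hz => ?_⟩
  beta_reduce
  rw [hα z hz, Finset.mul_sum]
  refine Finset.sum_congr rfl fun l _ => ?_
  rw [Finset.mul_sum]
  exact Finset.sum_congr rfl fun r _ => by ring

lemma PP.sub (h : PP k N X Y w) (h' : PP k N X Y w') : PP k N X Y (fun z => w z - w' z) := by
  have := h.add (h'.const_mul (-1))
  simpa [sub_eq_add_neg] using this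

lemma PP.sum {ι : Type*} (S : Finset ι) {F : ι → ℝ × ℝ → ℝ} (h : ∀ s ∈ S, PP k N X Y (F s)) :
    PP k N X Y (fun z => ∑ s ∈ S, F s z) := by
  classical
  induction S using Finset.induction_on with
  | empty => intro i _ j _; exact ⟨fun _ _ => 0, fun z _ => by simp⟩
  | insert a S ha ih =>
    simp only [Finset.sum_insert ha]
    exact (h a (Finset.mem_insert_self a S)).add
      (ih fun s hs => h s (Finset.mem_insert_of_mem hs))

lemma PP1.mul {p q : ℝ → ℝ} (hp : PP1 k N X p) (hq : PP1 k N Y q) :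
    PP k N X Y (fun z => p z.1 * q z.2) := by
  intro i hi j hj
  obtain ⟨P, hP, hP'⟩ := hp i hi
  obtain ⟨Q, hQ, hQ'⟩ := hq j hj
  refine ⟨fun l r => P.coeff l * Q.coeff r, fun z hz => ?_⟩
  beta_reduce
  rw [hP' z.1 hz.1, hQ' z.2 hz.2, Polynomial.eval_eq_sum_range' (Nat.lt_succ_of_le hP),
    Polynomial.eval_eq_sum_range' (Nat.lt_succ_of_le hQ), Finset.sum_mul_sum]
  exact Finset.sum_congr rfl fun l _ => Finset.sum_congr rfl fun r _ => by ring

/-- No matching condition across the edges is needed: `w` is a single function which equals a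
polynomial on each of finitely many closed cells, so the pieces agree on common edges. -/
lemma PP.continuousOn (h : PP k N X Y w) (hX : Mesh X N) (hY : Mesh Y N) (hN : 0 < N) :
    ContinuousOn w closedSquare := by
  have hcov : closedSquare ⊆ ⋃ q : Fin N × Fin N, cell X Y q.1 q.2 := by
    intro z hz
    obtain ⟨i, hi, hx⟩ := hX.exists_cell hz.1 hN
    obtain ⟨j, hj, hy⟩ := hY.exists_cell hz.2 hN
    exact mem_iUnion.2 ⟨(⟨i, hi⟩, ⟨j, hj⟩), hx, hy⟩
  refine (LocallyFinite.continuousOn_iUnion (locallyFinite_of_finite _)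
    (fun q => isClosed_Icc.prod isClosed_Icc) fun q => ?_).mono hcov
  obtain ⟨α, hα⟩ := h q.1 q.1.2 q.2 q.2.2
  refine ContinuousOn.congr (Continuous.continuousOn ?_) hα
  fun_prop

lemma PP.pw (h : PP k N X Y w) (hX : Mesh X N) (hY : Mesh Y N) (hN : 0 < N) : PW X Y N w := by
  refine ⟨h.continuousOn hX hY hN, fun i hi j hj => ?_⟩
  obtain ⟨α, hα⟩ := h i hi j hj
  refine ContDiffOn.congr (ContDiff.contDiffOn ?_) hα
  fun_prop

lemma vertexBasis_pp1 (hX : Mesh X N) (hk : 1 ≤ k) {i : ℕ} (hi : i ≤ N) :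
    PP1 k N X (vertexBasis X N k i) := by
  intro l hl
  refine ⟨if i = l then cellPoly (X l) (X (l + 1)) k 0 else
    if i = l + 1 then cellPoly (X l) (X (l + 1)) k k else 0, ?_, fun x hx => ?_⟩
  · split_ifs
    · exact cellPoly_degree_lt (hX.lt_succ l hl) hk (Nat.zero_le k)
    · exact cellPoly_degree_lt (hX.lt_succ l hl) hk le_rfl
    · simp
  · rw [vertexBasis_on_cell hX hk hl hi hx]
    split_ifs <;> simp

lemma basis1_pp1 (hX : Mesh X N) (hk : 1 ≤ k) {i s : ℕ} (hi : i < N) (hs : s ≤ k) :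
    PP1 k N X (basis1 X N k i s) := by
  rcases Nat.eq_zero_or_pos s with rfl | hs0
  · intro l hl
    obtain ⟨P, h1, h2⟩ := vertexBasis_pp1 hX hk hi.le l hl
    exact ⟨P, h1, fun x hx => by rw [basis1_zero, h2 x hx]⟩
  · intro l hl
    refine ⟨if l = i then cellPoly (X l) (X (l + 1)) k s else
      if l = i + 1 ∧ s = k then cellPoly (X l) (X (l + 1)) k 0 else 0, ?_, fun x hx => ?_⟩
    · split_ifs
      · exact cellPoly_degree_lt (hX.lt_succ l hl) hk hs
      · exact cellPoly_degree_lt (hX.lt_succ l hl) hk (Nat.zero_le k)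
      · simp
    · rw [basis1_on_cell hX hk hi (Finset.mem_Icc.2 ⟨hs0, hs⟩) hl hx]
      split_ifs <;> simp

lemma basis1_last_pp1 (hX : Mesh X N) (hk : 1 ≤ k) : PP1 k N X (basis1 X N k N 0) := by
  intro l hl
  obtain ⟨P, h1, h2⟩ := vertexBasis_pp1 hX hk (le_refl N) l hl
  exact ⟨P, h1, fun x hx => by rw [basis1_zero, h2 x hx]⟩

lemma interp_pp (hX : Mesh X N) (hY : Mesh Y N) (hk : 1 ≤ k) (v : ℝ × ℝ → ℝ) :
    PP k N X Y (interp X Y N k v) := by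
  have hb : ∀ {X : ℕ → ℝ}, Mesh X N → ∀ i ∈ Finset.range N, ∀ s ∈ Finset.range k,
      PP1 k N X (basis1 X N k i s) := fun hX i hi s hs =>
    basis1_pp1 hX hk (Finset.mem_range.1 hi) (Finset.mem_range.1 hs).le
  have hXN := basis1_last_pp1 hX hk
  have hYN := basis1_last_pp1 hY hk
  refine PP.add (PP.add (PP.sum _ fun i hi => PP.sum _ fun s hs => PP.add (PP.sum _ fun j hj =>
    PP.sum _ fun t ht => ?_) ?_) (PP.sum _ fun j hj => PP.sum _ fun t ht => ?_)) ?_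
  · exact PP.const_mul _ ((hb hX i hi s hs).mul (hb hY j hj t ht))
  · exact PP.const_mul _ ((hb hX i hi s hs).mul hYN)
  · exact PP.const_mul _ (hXN.mul (hb hY j hj t ht))
  · exact PP.const_mul _ (hXN.mul hYN)

lemma fullPart_pp1 (hY : Mesh Y N) (hk : 1 ≤ k) (g : ℝ → ℝ) : PP1 k N Y (fullPart Y N k g) :=
  fun j hj => ⟨_, cellInterp_natDegree (hY.lt_succ j hj) hk g,
    fun _ hy => sum_basis1 hY hk g hj hy⟩

lemma endPart_pp1 (hY : Mesh Y N) (hk : 1 ≤ k) (g : ℝ → ℝ) : PP1 k N Y (endPart Y N k g) := by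
  intro j hj
  have hab := hY.lt_succ j hj
  refine ⟨_, ?_, fun y hy => endPart_on_cell hY hk g hj hy⟩
  refine (Polynomial.natDegree_add_le _ _).trans (max_le ?_ ?_)
  · split_ifs
    · exact (Polynomial.natDegree_C_mul_le _ _).trans
        (cellPoly_degree_lt hab hk (Nat.zero_le k))
    · simp
  · split_ifs
    · exact (Polynomial.natDegree_C_mul_le _ _).trans (cellPoly_degree_lt hab hk le_rfl)
    · simp

lemma stripFun_pp (hX : Mesh X N) (hk : 1 ≤ k) {m : ℕ} (hm : m < N) {p : ℕ → ℝ → ℝ}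
    (hp : ∀ s, PP1 k N Y (p s)) : PP k N X Y (stripFun X N k m p) :=
  PP.sum _ fun s hs => (basis1_pp1 hX hk hm (Finset.mem_Icc.1 hs).2).mul (hp s)

lemma opP_pp (hX : Mesh X N) (hY : Mesh Y N) (hk : 1 ≤ k) (hN : 0 < N) (E : ℝ × ℝ → ℝ) :
    PP k N X Y (opP X Y N k E) := by
  rw [funext (opP_eq X Y N k E)]
  exact stripFun_pp hX hk (by omega) fun _ => fullPart_pp1 hY hk _

lemma opTheta_pp (hX : Mesh X N) (hY : Mesh Y N) (hk : 1 ≤ k) (hN : 0 < N) (E : ℝ × ℝ → ℝ) :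
    PP k N X Y (opTheta X Y N k E) := by
  rw [funext (opTheta_eq X Y N k E)]
  exact stripFun_pp hX hk (by omega) fun _ => endPart_pp1 hY hk _

end PP

/-! ### Layer functions on a mesh -/

/-- The mesh `X` is adapted to the layer function `ρ` of width `1 / A`. -/
structure LayerMesh (X : ℕ → ℝ) (N : ℕ) (A K : ℝ) (r : ℕ → ℝ) (ρ : ℝ → ℝ) : Prop where
  cell : ∀ i < N, LayerCell (X i) (X (i + 1)) A (K / N) K (r i) ρ
  cont : ContinuousOn ρ (Icc 0 1)
  int_le : ∫ x in Ioo (0 : ℝ) 1, ρ x ^ 2 ≤ K / A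

/-- The function with the value `c i` on the `i`-th open cell. -/
def stepFun (X : ℕ → ℝ) (N : ℕ) (c : ℕ → ℝ) (x : ℝ) : ℝ :=
  ∑ i ∈ Finset.range N, (Ioo (X i) (X (i + 1))).indicator (fun _ => c i) x

section LayerMesh

variable {X Y : ℕ → ℝ} {N k : ℕ} {A B K M : ℝ} {r q : ℕ → ℝ} {ρ ψ : ℝ → ℝ}

lemma stepFun_apply (hX : Mesh X N) (c : ℕ → ℝ) {i : ℕ} (hi : i < N) {x : ℝ}
    (hx : x ∈ Ioo (X i) (X (i + 1))) : stepFun X N c x = c i := by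
  rw [stepFun, Finset.sum_eq_single i]
  · rw [indicator_of_mem hx]
  · intro l hl hli
    refine indicator_of_notMem (fun hxl => ?_) _
    rcases lt_or_gt_of_ne hli with h | h
    · have := hX.le h hi.le
      linarith [hx.1, hxl.2]
    · have := hX.le h (Finset.mem_range.1 hl).le
      linarith [hx.2, hxl.1]
  · intro h; exact absurd (Finset.mem_range.2 hi) h

lemma integrableOn_stepFun (X : ℕ → ℝ) (N : ℕ) (c : ℕ → ℝ) :
    IntegrableOn (stepFun X N c) (Ioo 0 1) :=
  integrable_finsetSum _ fun _ _ => (integrable_const _).indicator measurableSet_Ioo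

lemma integral_stepFun (hX : Mesh X N) (c : ℕ → ℝ) :
    ∫ x in Ioo (0 : ℝ) 1, stepFun X N c x = ∑ i ∈ Finset.range N, c i * (X (i + 1) - X i) := by
  unfold stepFun
  rw [integral_finsetSum _ fun _ _ => (integrable_const _).indicator measurableSet_Ioo]
  refine Finset.sum_congr rfl fun i hi => ?_
  have hi' := Finset.mem_range.1 hi
  rw [setIntegral_indicator measurableSet_Ioo, inter_eq_self_of_subset_right
    (Ioo_subset_Ioo (hX.mem hi'.le).1 (hX.mem hi').2), setIntegral_const, Measure.real,
    Real.volume_Ioo, ENNReal.toReal_ofReal (sub_pos.2 (hX.lt_succ i hi')).le, smul_eq_mul, mul_comm]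

lemma integral_stepFun_nonneg (hX : Mesh X N) {c : ℕ → ℝ} (hc : ∀ i, 0 ≤ c i) :
    0 ≤ ∫ x in Ioo (0 : ℝ) 1, stepFun X N c x := by
  rw [integral_stepFun hX]
  exact Finset.sum_nonneg fun i hi => mul_nonneg (hc i)
    (sub_pos.2 (hX.lt_succ i (Finset.mem_range.1 hi))).le

lemma LayerMesh.A_pos (h : LayerMesh X N A K r ρ) (hN : 0 < N) : 0 < A := (h.cell 0 hN).A_pos

lemma LayerMesh.one_le_K (h : LayerMesh X N A K r ρ) (hN : 0 < N) : 1 ≤ K := (h.cell 0 hN).one_le_K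

lemma LayerMesh.integrableOn_sq (h : LayerMesh X N A K r ρ) :
    IntegrableOn (fun x => ρ x ^ 2) (Ioo 0 1) :=
  ((h.cont.pow 2).integrableOn_Icc).mono_set Ioo_subset_Icc_self

/-- The norm of a function which is bounded by the majorant of the derivative. -/
lemma LayerMesh.nrm_le (h : LayerMesh X N A K r ρ) (hX : Mesh X N) (hY : Mesh Y N) (hN : 0 < N)
    {C : ℝ} (hC : 0 ≤ C) {f : ℝ × ℝ → ℝ}
    (hf : ∀ i < N, ∀ j < N, ∀ z ∈ ocell X Y i j,
      |f z| ≤ C * layerDeriv A (K / N) (X (i + 1) - X i) (ρ z.1)) :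
    nrm f ≤ 2 * K * C * √A := by
  have hA := h.A_pos hN
  have hK := h.one_le_K hN
  have hN' : (1 : ℝ) ≤ N := by exact_mod_cast hN
  have hi1 : IntegrableOn (fun x => A ^ 2 * ρ x ^ 2) (Ioo 0 1) := h.integrableOn_sq.const_mul _
  have hi2 : IntegrableOn (fun x => (K / N) ^ 2 * A * stepFun X N (fun i => 1 / (X (i + 1) - X i)) x)
      (Ioo 0 1) := (integrableOn_stepFun X N _).const_mul _
  have hi : IntegrableOn (fun x => 2 * C ^ 2 * (A ^ 2 * ρ x ^ 2
      + (K / N) ^ 2 * A * stepFun X N (fun i => 1 / (X (i + 1) - X i)) x)) (Ioo 0 1) :=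
    (hi1.add hi2).const_mul _
  have hb := nrm_sq_le (f := f) (integrableOn_fst hi) (by
    filter_upwards [ae_ocell hX hY hN] with z ⟨i, hi, j, hj, hz⟩
    rw [stepFun_apply hX _ hi hz.1]
    have hh : 0 < X (i + 1) - X i := sub_pos.2 (hX.lt_succ i hi)
    have h1 := hf i hi j hj z hz
    have h2 : f z ^ 2 ≤ (C * layerDeriv A (K / N) (X (i + 1) - X i) (ρ z.1)) ^ 2 := by
      rw [← sq_abs]
      exact pow_le_pow_left₀ (abs_nonneg _) h1 2
    have h3 : √(A / (X (i + 1) - X i)) ^ 2 = A / (X (i + 1) - X i) :=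
      Real.sq_sqrt (by positivity)
    calc f z ^ 2 ≤ C ^ 2 * layerDeriv A (K / N) (X (i + 1) - X i) (ρ z.1) ^ 2 := by
          rw [← mul_pow]; exact h2
      _ ≤ C ^ 2 * (2 * ((A * ρ z.1) ^ 2 + ((K / N) * √(A / (X (i + 1) - X i))) ^ 2)) := by
          gcongr
          unfold layerDeriv
          exact add_sq_le
      _ = _ := by rw [mul_pow, mul_pow, h3]; ring)
  rw [integral_fst (fun x => 2 * C ^ 2 * (A ^ 2 * ρ x ^ 2
      + (K / N) ^ 2 * A * stepFun X N (fun i => 1 / (X (i + 1) - X i)) x)), integral_const_mul,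
    integral_add hi1 hi2, integral_const_mul, integral_const_mul, integral_stepFun hX] at hb
  -- Each cell contributes exactly 1, irrespective of its length. The second part of the majorant
  -- thus gives (K/N)² A N = K² A/N, the first gives at most A² K/A.
  have hsum : ∑ i ∈ Finset.range N, 1 / (X (i + 1) - X i) * (X (i + 1) - X i) = N := by
    rw [Finset.sum_congr rfl (g := fun _ => (1 : ℝ)) fun i hi => by
      have : 0 < X (i + 1) - X i := sub_pos.2 (hX.lt_succ i (Finset.mem_range.1 hi))
      field_simp]
    simp
  rw [hsum] at hb
  refine le_of_sq_le_sq (hb.trans ?_) (by positivity)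
  have hint := h.int_le
  have e1 : A ^ 2 * (∫ x in Ioo (0 : ℝ) 1, ρ x ^ 2) ≤ A * K := by
    calc _ ≤ A ^ 2 * (K / A) := by gcongr
      _ = A * K := by field_simp
  have e2 : (K / N) ^ 2 * A * N ≤ A * K ^ 2 := by
    have : (K / N) ^ 2 * A * N = A * K ^ 2 / N := by field_simp
    rw [this]
    exact div_le_self (by positivity) hN'
  have e3 : A * K ≤ A * K ^ 2 := by
    have : K ≤ K ^ 2 := by nlinarith
    gcongr
  calc _ ≤ 2 * C ^ 2 * (A * K ^ 2 + A * K ^ 2) := by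
        exact mul_le_mul_of_nonneg_left (add_le_add (e1.trans e3) e2) (by positivity)
    _ = (2 * K * C * √A) ^ 2 := by
        rw [mul_pow, Real.sq_sqrt hA.le]; ring

lemma nrm_swap (f : ℝ × ℝ → ℝ) : nrm (fun z => f z.swap) = nrm f := by
  rw [nrm, nrm, integral_swap (fun z => f z ^ 2)]

lemma LayerMesh.nrm_le_snd (h : LayerMesh Y N B K q ψ) (hX : Mesh X N) (hY : Mesh Y N)
    (hN : 0 < N) {C : ℝ} (hC : 0 ≤ C) {f : ℝ × ℝ → ℝ}
    (hf : ∀ i < N, ∀ j < N, ∀ z ∈ ocell X Y i j,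
      |f z| ≤ C * layerDeriv B (K / N) (Y (j + 1) - Y j) (ψ z.2)) :
    nrm f ≤ 2 * K * C * √B := by
  rw [← nrm_swap]
  exact h.nrm_le hY hX hN hC fun j hj i hi z hz => hf i hi j hj z.swap ⟨hz.2, hz.1⟩

/-! ### Interpolation errors on the mesh -/

lemma hasDerivAt_interp (hX : Mesh X N) (hY : Mesh Y N) (hk : 1 ≤ k) (v : ℝ × ℝ → ℝ) {i j : ℕ}
    (hi : i < N) (hj : j < N) {z : ℝ × ℝ} (hz : z ∈ ocell X Y i j) :
    dx (interp X Y N k v) z = (cellInterp (X i) (X (i + 1)) k (fun x' =>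
        (cellInterp (Y j) (Y (j + 1)) k (fun y => v (x', y))).eval z.2)).derivative.eval z.1 := by
  have : (fun x => interp X Y N k v (x, z.2)) =ᶠ[nhds z.1] fun x =>
      (cellInterp (X i) (X (i + 1)) k (fun x' =>
        (cellInterp (Y j) (Y (j + 1)) k (fun y => v (x', y))).eval z.2)).eval x := by
    filter_upwards [isOpen_Ioo.mem_nhds hz.1] with x hx
    exact interp_on_cell hX hY hk v hi hj (Ioo_subset_Icc_self hx) (Ioo_subset_Icc_self hz.2)
  rw [dx, this.deriv_eq, Polynomial.deriv]

lemma hasDerivAt_interp_snd (hX : Mesh X N) (hY : Mesh Y N) (hk : 1 ≤ k) (v : ℝ × ℝ → ℝ) {i j : ℕ}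
    (hi : i < N) (hj : j < N) {z : ℝ × ℝ} (hz : z ∈ ocell X Y i j) :
    dy (interp X Y N k v) z = (cellInterp (Y j) (Y (j + 1)) k (fun y' =>
        (cellInterp (X i) (X (i + 1)) k (fun x => v (x, y'))).eval z.1)).derivative.eval z.2 := by
  have : (fun y => interp X Y N k v (z.1, y)) =ᶠ[nhds z.2] fun y =>
      (cellInterp (Y j) (Y (j + 1)) k (fun y' =>
        (cellInterp (X i) (X (i + 1)) k (fun x => v (x, y'))).eval z.1)).eval y := by
    filter_upwards [isOpen_Ioo.mem_nhds hz.2] with y hy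
    rw [interp_on_cell hX hY hk v hi hj (Ioo_subset_Icc_self hz.1) (Ioo_subset_Icc_self hy),
      tensorInterp_flip]
    rfl
  rw [dy, this.deriv_eq, Polynomial.deriv]

/-- The derivatives of a function on the closed square. -/
abbrev jetOf (g : ℝ × ℝ → ℝ) (i j : ℕ) (x y : ℝ) : ℝ := Dx^[i] (Dy^[j] g) (x, y)

/-- A smooth function with the derivative bounds of a product of layers. -/
structure LayerPart (k : ℕ) (M A B : ℝ) (ρ ψ : ℝ → ℝ) (g : ℝ × ℝ → ℝ) : Prop where
  smooth : ContDiffOn ℝ ((k + 1 : ℕ) : WithTop ℕ∞) g closedSquare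
  bound : LayerBound (k + 1) M A B ρ ψ (jetOf g)
  nonneg : 0 ≤ M

variable {g : ℝ × ℝ → ℝ}

lemma LayerPart.pw (hg : LayerPart k M A B ρ ψ g) (hX : Mesh X N) (hY : Mesh Y N) : PW X Y N g :=
  PW.of_contDiffOn hX hY (hg.smooth.of_le (by norm_cast; omega))

lemma LayerPart.pw_error (hg : LayerPart k M A B ρ ψ g) (hX : Mesh X N) (hY : Mesh Y N)
    (hk : 1 ≤ k) (hN : 0 < N) : PW X Y N (fun z => interp X Y N k g z - g z) :=
  ((interp_pp hX hY hk g).pw hX hY hN).sub (hg.pw hX hY)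

/-- The maximum norm of the interpolation error. -/
lemma LayerPart.abs_error_le (hg : LayerPart k M A B ρ ψ g) (hX : Mesh X N) (hY : Mesh Y N)
    (hk : 1 ≤ k) (hx : LayerMesh X N A K r ρ) (hy : LayerMesh Y N B K q ψ)
    {i j : ℕ} (hi : i < N) (hj : j < N) {z : ℝ × ℝ} (hz : z ∈ cell X Y i j) :
    |interp X Y N k g z - g z| ≤ 4 * interpConst k ^ 2 * M * (K / N) ^ (k + 1) := by
  have := tensor_error (hx.cell i hi) (hy.cell j hj) hk (hX.cell_subset hi) (hY.cell_subset hj)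
    (jet_of_contDiffOn hg.smooth) hg.nonneg hg.bound hz.1 hz.2
  rw [abs_sub_comm, ← Prod.mk.eta (p := z), interp_on_cell hX hY hk g hi hj hz.1 hz.2]
  exact this

lemma LayerPart.nrm_error_le (hg : LayerPart k M A B ρ ψ g) (hX : Mesh X N) (hY : Mesh Y N)
    (hk : 1 ≤ k) (hN : 0 < N) (hx : LayerMesh X N A K r ρ) (hy : LayerMesh Y N B K q ψ) :
    nrm (fun z => interp X Y N k g z - g z) ≤ 4 * interpConst k ^ 2 * M * (K / N) ^ (k + 1) := by
  have hM := hg.nonneg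
  have hK := hx.one_le_K hN
  refine nrm_le_of_bound (by positivity) ?_
  filter_upwards [ae_ocell hX hY hN] with z ⟨i, hi, j, hj, hz⟩
  exact hg.abs_error_le hX hY hk hx hy hi hj (ocell_subset X Y i j hz)

lemma LayerPart.nrm_dx_error_le (hg : LayerPart k M A B ρ ψ g) (hX : Mesh X N) (hY : Mesh Y N)
    (hk : 1 ≤ k) (hN : 0 < N) (hx : LayerMesh X N A K r ρ) (hy : LayerMesh Y N B K q ψ) :
    nrm (dx fun z => interp X Y N k g z - g z)
      ≤ 2 * K * (3 * interpConst k ^ 2 * K * M * (K / N) ^ k) * √A := by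
  have hM := hg.nonneg
  have hK := hx.one_le_K hN
  refine hx.nrm_le hX hY hN (by positivity) fun i hi j hj z hz => ?_
  have hpw := hg.pw hX hY (k := k)
  have hpi := (interp_pp hX hY hk g).pw hX hY hN
  have hz' := ocell_subset X Y i j hz
  have hzs := cell_subset hX hY hi hj hz'
  have hd : dx g z = jetOf g 1 0 z.1 z.2 :=
    ((hasDerivWithinAt_fst (hg.smooth.differentiableOn (by norm_cast)) hzs.1 hzs.2).hasDerivAt
      (Icc_mem_nhds ((hX.mem hi.le).1.trans_lt hz.1.1) (hz.1.2.trans_le (hX.mem hi).2))).deriv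
  have he : dx (fun z => interp X Y N k g z - g z) z = dx (interp X Y N k g) z - dx g z :=
    ((hpi.hasDerivAt_dx hi hj hz).sub (hpw.hasDerivAt_dx hi hj hz)).deriv
  rw [he, hasDerivAt_interp hX hY hk g hi hj hz, hd, abs_sub_comm]
  exact tensor_deriv_error (hx.cell i hi) (hy.cell j hj) hk (hX.cell_subset hi)
    (hY.cell_subset hj) (jet_of_contDiffOn hg.smooth) hg.nonneg hg.bound hz'.1 hz'.2

lemma LayerPart.nrm_dy_error_le (hg : LayerPart k M A B ρ ψ g) (hX : Mesh X N) (hY : Mesh Y N)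
    (hk : 1 ≤ k) (hN : 0 < N) (hx : LayerMesh X N A K r ρ) (hy : LayerMesh Y N B K q ψ) :
    nrm (dy fun z => interp X Y N k g z - g z)
      ≤ 2 * K * (3 * interpConst k ^ 2 * K * M * (K / N) ^ k) * √B := by
  have hM := hg.nonneg
  have hK := hx.one_le_K hN
  refine hy.nrm_le_snd hX hY hN (by positivity) fun i hi j hj z hz => ?_
  have hpw := hg.pw hX hY (k := k)
  have hpi := (interp_pp hX hY hk g).pw hX hY hN
  have hz' := ocell_subset X Y i j hz
  have hzs := cell_subset hX hY hi hj hz'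
  have hd : dy g z = jetOf g 0 1 z.1 z.2 :=
    ((hasDerivWithinAt_snd (hg.smooth.differentiableOn (by norm_cast)) hzs.1 hzs.2).hasDerivAt
      (Icc_mem_nhds ((hY.mem hj.le).1.trans_lt hz.2.1) (hz.2.2.trans_le (hY.mem hj).2))).deriv
  have he : dy (fun z => interp X Y N k g z - g z) z = dy (interp X Y N k g) z - dy g z :=
    ((hpi.hasDerivAt_dy hi hj hz).sub (hpw.hasDerivAt_dy hi hj hz)).deriv
  rw [he, hasDerivAt_interp_snd hX hY hk g hi hj hz, hd, abs_sub_comm]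
  exact tensor_deriv_error (hy.cell j hj) (hx.cell i hi) hk (hY.cell_subset hj)
    (hX.cell_subset hi) (jet_of_contDiffOn hg.smooth).flip hg.nonneg hg.bound.flip hz'.2 hz'.1

end LayerMesh

end BakhvalovFEM
end

noncomputable section
namespace BakhvalovFEM

/-! ### The correction of the interpolant in the transition region -/

section Strip

variable {X Y : ℕ → ℝ} {N k m : ℕ} {P : ℝ} {p : ℕ → ℝ → ℝ}

/-- The indicator of the two cells which meet the interior of the support of the basis functions
of the nodes `x_m^s`, `1 ≤ s ≤ k`. -/
def stripInd (m i : ℕ) : ℝ := if i = m ∨ i = m + 1 then 1 else 0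

lemma stripInd_nonneg (m i : ℕ) : 0 ≤ stripInd m i := by unfold stripInd; split_ifs <;> norm_num

lemma stripInd_le_one (m i : ℕ) : stripInd m i ≤ 1 := by unfold stripInd; split_ifs <;> norm_num

/-- The polynomial which represents the basis function of `x_m^s` on the `l`-th cell. -/
def stripPoly (X : ℕ → ℝ) (k m s l : ℕ) : Polynomial ℝ :=
  if l = m then cellPoly (X l) (X (l + 1)) k s
  else if l = m + 1 ∧ s = k then cellPoly (X l) (X (l + 1)) k 0 else 0

lemma basis1_eq_stripPoly (hX : Mesh X N) (hk : 1 ≤ k) (hm : m < N) {s l : ℕ}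
    (hs : s ∈ Finset.Icc 1 k) (hl : l < N) {x : ℝ} (hx : x ∈ Icc (X l) (X (l + 1))) :
    basis1 X N k m s x = (stripPoly X k m s l).eval x := by
  rw [basis1_on_cell hX hk hm hs hl hx, stripPoly]
  split_ifs <;> simp

lemma stripPoly_bound (hX : Mesh X N) (hk : 1 ≤ k) {s l : ℕ} (hs : s ∈ Finset.Icc 1 k) (hl : l < N)
    {x : ℝ} (hx : x ∈ Icc (X l) (X (l + 1))) :
    |(stripPoly X k m s l).eval x| ≤ basisConst k * stripInd m l ∧
      |(stripPoly X k m s l).derivative.eval x|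
        ≤ basisConst k * (stripInd m l / (X (l + 1) - X l)) := by
  have hb := one_le_basisConst k
  have hh := hX.lt_succ l hl
  have hh' : 0 < X (l + 1) - X l := sub_pos.2 hh
  unfold stripPoly stripInd
  by_cases h1 : l = m
  · rw [if_pos h1, if_pos (Or.inl h1), mul_one, mul_one_div]
    exact cellPoly_bound hh hk (Finset.mem_Icc.1 hs).2 hx
  · rw [if_neg h1]
    by_cases h2 : l = m + 1
    · rw [if_pos (Or.inr h2), mul_one, mul_one_div]
      split_ifs
      · exact cellPoly_bound hh hk (Nat.zero_le k) hx
      · simp only [Polynomial.eval_zero, abs_zero, Polynomial.derivative_zero]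
        constructor <;> positivity
    · rw [if_neg (by tauto), if_neg (by tauto)]
      simp

lemma sum_basisConst_le {F : ℕ → ℝ} {D : ℝ} (hD : 0 ≤ D)
    (hF : ∀ s ∈ Finset.Icc 1 k, |F s| ≤ basisConst k * D) :
    |∑ s ∈ Finset.Icc 1 k, F s| ≤ interpConst k * D := by
  have hb := one_le_basisConst k
  calc _ ≤ ∑ s ∈ Finset.Icc 1 k, |F s| := Finset.abs_sum_le_sum_abs _ _
    _ ≤ ∑ _s ∈ Finset.Icc 1 k, basisConst k * D := Finset.sum_le_sum hF
    _ = k * (basisConst k * D) := by simp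
    _ ≤ (k + 1) * (basisConst k * D) := by gcongr; linarith
    _ = interpConst k * D := by rw [interpConst]; ring

lemma stripFun_bound (hX : Mesh X N) (hk : 1 ≤ k) (hm : m < N) (hP : 0 ≤ P) {i : ℕ} (hi : i < N)
    {z : ℝ × ℝ} (hz : z.1 ∈ Icc (X i) (X (i + 1))) (hp : ∀ s ∈ Finset.Icc 1 k, |p s z.2| ≤ P) :
    |stripFun X N k m p z| ≤ interpConst k * (stripInd m i * P) := by
  have h0 := stripInd_nonneg m i
  have hb := one_le_basisConst k
  refine sum_basisConst_le (by positivity) fun s hs => ?_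
  rw [basis1_eq_stripPoly hX hk hm hs hi hz, abs_mul, ← mul_assoc]
  exact mul_le_mul (stripPoly_bound hX hk hs hi hz).1 (hp s hs) (abs_nonneg _) (by positivity)

lemma dx_stripFun_bound (hX : Mesh X N) (hk : 1 ≤ k) (hm : m < N) (hP : 0 ≤ P) {i : ℕ} (hi : i < N)
    {z : ℝ × ℝ} (hz : z.1 ∈ Ioo (X i) (X (i + 1))) (hp : ∀ s ∈ Finset.Icc 1 k, |p s z.2| ≤ P) :
    |dx (stripFun X N k m p) z| ≤ interpConst k * (stripInd m i / (X (i + 1) - X i) * P) := by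
  have h0 := stripInd_nonneg m i
  have hb := one_le_basisConst k
  have hh' : 0 < X (i + 1) - X i := sub_pos.2 (hX.lt_succ i hi)
  have hd : dx (stripFun X N k m p) z
      = ∑ s ∈ Finset.Icc 1 k, (stripPoly X k m s i).derivative.eval z.1 * p s z.2 := by
    refine HasDerivAt.deriv ?_
    have : (fun x => stripFun X N k m p (x, z.2)) =ᶠ[nhds z.1]
        fun x => ∑ s ∈ Finset.Icc 1 k, (stripPoly X k m s i).eval x * p s z.2 := by
      filter_upwards [isOpen_Ioo.mem_nhds hz] with x hx
      exact Finset.sum_congr rfl fun s hs => by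
        rw [basis1_eq_stripPoly hX hk hm hs hi (Ioo_subset_Icc_self hx)]
    refine HasDerivAt.congr_of_eventuallyEq ?_ this
    exact HasDerivAt.fun_sum fun s _ => (Polynomial.hasDerivAt _ _).mul_const _
  rw [hd]
  refine sum_basisConst_le (by positivity) fun s hs => ?_
  rw [abs_mul, ← mul_assoc]
  exact mul_le_mul (stripPoly_bound hX hk hs hi (Ioo_subset_Icc_self hz)).2 (hp s hs)
    (abs_nonneg _) (by positivity)

lemma dy_stripFun_bound (hX : Mesh X N) (hk : 1 ≤ k) (hm : m < N) (hP : 0 ≤ P) {i : ℕ} (hi : i < N)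
    {z : ℝ × ℝ} (hz : z.1 ∈ Icc (X i) (X (i + 1))) {p' : ℕ → ℝ}
    (hp : ∀ s ∈ Finset.Icc 1 k, HasDerivAt (p s) (p' s) z.2)
    (hp' : ∀ s ∈ Finset.Icc 1 k, |p' s| ≤ P) :
    |dy (stripFun X N k m p) z| ≤ interpConst k * (stripInd m i * P) := by
  have h0 := stripInd_nonneg m i
  have hb := one_le_basisConst k
  have hd : dy (stripFun X N k m p) z = ∑ s ∈ Finset.Icc 1 k, basis1 X N k m s z.1 * p' s := by
    have : HasDerivAt (fun y => ∑ s ∈ Finset.Icc 1 k, basis1 X N k m s z.1 * p s y)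
        (∑ s ∈ Finset.Icc 1 k, basis1 X N k m s z.1 * p' s) z.2 :=
      HasDerivAt.fun_sum fun s hs => (hp s hs).const_mul _
    exact this.deriv
  rw [hd]
  refine sum_basisConst_le (by positivity) fun s hs => ?_
  rw [basis1_eq_stripPoly hX hk hm hs hi hz, abs_mul, ← mul_assoc]
  exact mul_le_mul (stripPoly_bound hX hk hs hi hz).1 (hp' s hs) (abs_nonneg _) (by positivity)

/-- The indicator of the first and the last cell. -/
def endInd (N j : ℕ) : ℝ := if j = 0 ∨ j + 1 = N then 1 else 0

lemma endInd_nonneg (N j : ℕ) : 0 ≤ endInd N j := by unfold endInd; split_ifs <;> norm_num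

lemma endInd_le_one (N j : ℕ) : endInd N j ≤ 1 := by unfold endInd; split_ifs <;> norm_num

/-- The factor 2 allows for a mesh with a single cell, on which both end contributions are present.
-/
lemma endPart_bound (hY : Mesh Y N) (hk : 1 ≤ k) {g : ℝ → ℝ} (hP : 0 ≤ P) (h0 : |g (Y 0)| ≤ P)
    (h1 : |g (Y N)| ≤ P) {j : ℕ} (hj : j < N) {y : ℝ} (hy : y ∈ Icc (Y j) (Y (j + 1))) :
    |endPart Y N k g y| ≤ 2 * interpConst k * P * endInd N j := by
  have hab := hY.lt_succ j hj
  have hΛ : basisConst k ≤ interpConst k := by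
    have := one_le_basisConst k
    unfold interpConst
    have : (0 : ℝ) ≤ k := k.cast_nonneg
    nlinarith
  have hb := one_le_basisConst k
  rw [endPart_on_cell hY hk g hj hy, Polynomial.eval_add]
  have e : ∀ {a s}, |a| ≤ P → s ≤ k →
      |(Polynomial.C a * cellPoly (Y j) (Y (j + 1)) k s).eval y| ≤ interpConst k * P := by
    intro a s ha hs
    rw [Polynomial.eval_mul, Polynomial.eval_C, abs_mul, mul_comm]
    exact mul_le_mul ((cellPoly_bound hab hk hs hy).1.trans hΛ) ha (abs_nonneg _) (by linarith)
  have hΛP : 0 ≤ interpConst k * P := by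
    have := one_le_interpConst k
    positivity
  unfold endInd
  by_cases h2 : j = 0
  · rw [if_pos h2, if_pos (Or.inl h2)]
    split_ifs
    · linarith [abs_add_le ((Polynomial.C (g (Y 0)) * cellPoly (Y j) (Y (j + 1)) k 0).eval y)
        ((Polynomial.C (g (Y N)) * cellPoly (Y j) (Y (j + 1)) k k).eval y), e h0 (Nat.zero_le k),
        e h1 le_rfl]
    · rw [Polynomial.eval_zero, add_zero]
      linarith [e h0 (Nat.zero_le k)]
  · rw [if_neg h2, Polynomial.eval_zero, zero_add]
    split_ifs
    · linarith [e h1 le_rfl]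
    · tauto
    · tauto
    · simp

lemma endPart_hasDerivAt (hY : Mesh Y N) (hk : 1 ≤ k) {g : ℝ → ℝ} (hP : 0 ≤ P)
    (h0 : |g (Y 0)| ≤ P) (h1 : |g (Y N)| ≤ P) {j : ℕ} (hj : j < N) {y : ℝ}
    (hy : y ∈ Ioo (Y j) (Y (j + 1))) :
    ∃ d, HasDerivAt (endPart Y N k g) d y ∧
      |d| ≤ 2 * interpConst k * P * endInd N j / (Y (j + 1) - Y j) := by
  have hab := hY.lt_succ j hj
  have hh : 0 < Y (j + 1) - Y j := sub_pos.2 hab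
  have hΛ : basisConst k ≤ interpConst k := by
    have := one_le_basisConst k
    unfold interpConst
    have : (0 : ℝ) ≤ k := k.cast_nonneg
    nlinarith
  have hb := one_le_basisConst k
  refine ⟨_, (Polynomial.hasDerivAt _ y).congr_of_eventuallyEq (by
    filter_upwards [isOpen_Ioo.mem_nhds hy] with t ht
    exact endPart_on_cell hY hk g hj (Ioo_subset_Icc_self ht)), ?_⟩
  have hy' := Ioo_subset_Icc_self hy
  rw [Polynomial.derivative_add, Polynomial.eval_add]
  have e : ∀ {a s}, |a| ≤ P → s ≤ k →
      |(Polynomial.derivative (Polynomial.C a * cellPoly (Y j) (Y (j + 1)) k s)).eval y|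
        ≤ interpConst k * P / (Y (j + 1) - Y j) := by
    intro a s ha hs
    rw [Polynomial.derivative_C_mul, Polynomial.eval_mul, Polynomial.eval_C, abs_mul, mul_comm,
      mul_div_right_comm]
    exact mul_le_mul ((cellPoly_bound hab hk hs hy').2.trans
      (div_le_div_of_nonneg_right hΛ hh.le)) ha (abs_nonneg _) (div_nonneg (by linarith) hh.le)
  have hΛP : 0 ≤ interpConst k * P / (Y (j + 1) - Y j) := by
    have := one_le_interpConst k
    positivity
  have htwo : 2 * interpConst k * P * 1 / (Y (j + 1) - Y j)
      = 2 * (interpConst k * P / (Y (j + 1) - Y j)) := by ring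
  unfold endInd
  by_cases h2 : j = 0
  · rw [if_pos h2, if_pos (Or.inl h2), htwo]
    split_ifs
    · refine (abs_add_le _ _).trans ?_
      linarith [e h0 (Nat.zero_le k), e h1 le_rfl]
    · rw [Polynomial.derivative_zero, Polynomial.eval_zero, add_zero]
      linarith [e h0 (Nat.zero_le k)]
  · rw [if_neg h2, Polynomial.derivative_zero, Polynomial.eval_zero, zero_add]
    split_ifs
    · rw [htwo]
      linarith [e h1 le_rfl]
    · tauto
    · tauto
    · simp

end Strip

/-- The properties of the mesh near the transition point `X m` to a layer at `x = 1`. -/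
structure Transition (X Y : ℕ → ℝ) (N m : ℕ) (A B K : ℝ) (r : ℕ → ℝ) (ρ : ℝ → ℝ) : Prop where
  lt : m + 1 < N
  one_le_A : 1 ≤ A
  B_pos : 0 < B
  low : ∀ i, i = m ∨ i = m + 1 → 1 ≤ K * A * (X (i + 1) - X i)
  up : ∀ i, i = m ∨ i = m + 1 → X (i + 1) - X i ≤ K / N
  up_m : X (m + 1) - X m ≤ K / √A
  up_succ : X (m + 1 + 1) - X (m + 1) ≤ K / A
  left : ∀ x ∈ Icc 0 (X m), ρ x ≤ 1 / A ∧ ρ x ≤ K / N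
  mid : ∀ x ∈ Icc (X m) (X (m + 1)), ρ x ≤ K / N
  fine : ∀ i, m < i → i < N → A * (X (i + 1) - X i) * r i ≤ K / N ∧
    ∀ x ∈ Icc (X i) (X (i + 1)), r i ≤ K * ρ x
  end_low : ∀ j < N, (j = 0 ∨ j + 1 = N) → 1 ≤ K * N * B * (Y (j + 1) - Y j)
  end_up : ∀ j < N, (j = 0 ∨ j + 1 = N) → Y (j + 1) - Y j ≤ K / B
  ratio : 1 / B ≤ K / √A

section Correction

variable {X Y : ℕ → ℝ} {N k m : ℕ} {A B B' K M : ℝ} {r q : ℕ → ℝ} {ρ ψ : ℝ → ℝ}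
  {E : ℝ × ℝ → ℝ}

lemma LayerPart.abs_le (hE : LayerPart k M A B ρ ψ E) {x y t : ℝ} (hx : x ∈ Icc (0 : ℝ) 1)
    (hy : y ∈ Icc (0 : ℝ) 1) (hρ : 0 ≤ ρ x) (hρt : ρ x ≤ t) (hψ : 0 ≤ ψ y) (hψ1 : ψ y ≤ 1) :
    |E (x, y)| ≤ M * t ^ (k + 1) := by
  have h := hE.bound 0 0 (by omega) x hx y hy
  have hM := hE.nonneg
  simp only [jetOf, Function.iterate_zero, id, pow_zero, one_mul] at h
  refine h.trans (mul_le_mul_of_nonneg_left ?_ hM)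
  calc _ ≤ ρ x ^ (k + 1) * 1 := by
        gcongr
        exact pow_le_one₀ hψ hψ1
    _ ≤ t ^ (k + 1) := by rw [mul_one]; gcongr

lemma LayerMesh.nonneg (h : LayerMesh X N A K r ρ) (hX : Mesh X N) (hN : 0 < N) {x : ℝ}
    (hx : x ∈ Icc (0 : ℝ) 1) : 0 ≤ ρ x ∧ ρ x ≤ 1 := by
  obtain ⟨i, hi, hxi⟩ := hX.exists_cell hx hN
  exact ⟨(h.cell i hi).nonneg x hxi, ((h.cell i hi).le x hxi).trans (h.cell i hi).r_le_one⟩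

lemma strip_node_mem (hX : Mesh X N) (hk : 1 ≤ k) (hm : m < N) {s : ℕ} (hs : s ∈ Finset.Icc 1 k) :
    node X k m s ∈ Icc (X m) (X (m + 1)) :=
  cellNode_mem (hX.lt_succ m hm) hk (Finset.mem_Icc.1 hs).2

section

variable (hE : LayerPart k M A B ρ ψ E) (hX : Mesh X N) (hY : Mesh Y N) (hk : 1 ≤ k)
  (hx : LayerMesh X N A K r ρ) (hy : LayerMesh Y N B K q ψ)
  (hT : Transition X Y N m A B' K r ρ)

include hE hX hY hk hx hy hT

/-- The nodal values removed by P lie in the cell behind the transition point, where ρ ≤ K/N; so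
they are already of the optimal order k + 1. -/
lemma strip_value_bound {s : ℕ} (hs : s ∈ Finset.Icc 1 k) {y : ℝ} (hyy : y ∈ Icc (0 : ℝ) 1) :
    |E (node X k m s, y)| ≤ M * (K / N) ^ (k + 1) := by
  have hN : 0 < N := by have := hT.lt; omega
  have hm : m < N := by have := hT.lt; omega
  have hmem := strip_node_mem hX hk hm hs
  have h01 := hX.cell_subset hm hmem
  have hψ := hy.nonneg hY hN hyy
  exact hE.abs_le h01 hyy (hx.nonneg hX hN h01).1 (hT.mid _ hmem) hψ.1 hψ.2

lemma fullPart_bound {s : ℕ} (hs : s ∈ Finset.Icc 1 k) {j : ℕ} (hj : j < N) {y : ℝ}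
    (hyy : y ∈ Icc (Y j) (Y (j + 1))) :
    |fullPart Y N k (fun y => E (node X k m s, y)) y|
      ≤ interpConst k * (M * (K / N) ^ (k + 1)) := by
  have e : fullPart Y N k (fun y => E (node X k m s, y)) y = _ :=
    sum_basis1 hY hk (fun y => E (node X k m s, y)) hj hyy
  rw [e]
  exact cellInterp_bound (hY.lt_succ j hj) hk (fun t ht =>
    strip_value_bound hE hX hY hk hx hy hT hs
      (hY.cell_subset hj (cellNode_mem (hY.lt_succ j hj) hk ht))) hyy

/-- A one-dimensional stability bound on the line x = x_m^s: the jet bounds of order 0 and 1 in y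
supply the nodal values and the increments, both carrying the factor (K/N)^(k+1) that comes from x.
-/
lemma fullPart_hasDerivAt {s : ℕ} (hs : s ∈ Finset.Icc 1 k) {j : ℕ} (hj : j < N) {y : ℝ}
    (hyy : y ∈ Ioo (Y j) (Y (j + 1))) :
    ∃ d, HasDerivAt (fullPart Y N k (fun y => E (node X k m s, y))) d y ∧
      |d| ≤ interpConst k * K * (M * (K / N) ^ (k + 1))
        * layerDeriv B (K / N) (Y (j + 1) - Y j) (ψ y) := by
  have hN : 0 < N := by have := hT.lt; omega
  have hm : m < N := by have := hT.lt; omega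
  have hM := hE.nonneg
  have hK := hx.one_le_K hN
  have hB := hy.A_pos hN
  have hc := hy.cell j hj
  have hmem := strip_node_mem hX hk hm hs
  have h01 := hX.cell_subset hm hmem
  have hsub := hY.cell_subset hj
  have hρ0 := (hx.nonneg hX hN h01).1
  have hρ := hT.mid _ hmem
  have hq := hc.r_nonneg
  refine ⟨_, ((cellInterp (Y j) (Y (j + 1)) k (fun y => E (node X k m s, y))).hasDerivAt
    y).congr_of_eventuallyEq (by
      filter_upwards [isOpen_Ioo.mem_nhds hyy] with t ht
      exact sum_basis1 hY hk (fun y => E (node X k m s, y)) hj (Ioo_subset_Icc_self ht)), ?_⟩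
  have hb : ∀ j' ≤ 1, ∀ t ∈ Icc (Y j) (Y (j + 1)), |jetOf E 0 j' (node X k m s) t|
      ≤ M * (K / N) ^ (k + 1) * (B ^ j' * q j ^ (k + 1)) := by
    intro j' hj' t ht
    have h1 := hc.nonneg t ht
    have h2 := hc.le t ht
    refine (hE.bound 0 j' (by omega) _ h01 t (hsub ht)).trans ?_
    rw [pow_zero, one_mul, mul_assoc]
    gcongr
  refine hc.interp_deriv_bound hk (by positivity) (fun t ht => ?_) (fun t ht => ?_)
    (Ioo_subset_Icc_self hyy)
  · have := hb 0 (by omega) _ (cellNode_mem hc.lt hk ht)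
    rw [pow_zero, one_mul] at this
    exact this
  · have hjet := jet_of_contDiffOn hE.smooth
    have ht' := cellNode_mem hc.lt hk ht
    have := (convex_Icc (Y j) (Y (j + 1))).norm_image_sub_le_of_norm_hasDerivWithin_le
      (f := fun t => E (node X k m s, t)) (f' := fun t => jetOf E 0 1 (node X k m s) t)
      (fun t ht => (hjet.deriv_snd 0 0 (by omega) _ h01 t (hsub ht)).mono hsub)
      (fun t ht => hb 1 le_rfl t ht) (left_mem_Icc.2 hc.lt.le) ht'
    rw [Real.norm_eq_abs, Real.norm_eq_abs, pow_one] at this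
    have hh := hc.h_pos
    calc _ ≤ _ := this
      _ ≤ M * (K / N) ^ (k + 1) * (B * q j ^ (k + 1)) * (Y (j + 1) - Y j) := by
        gcongr
        rw [abs_le]; constructor <;> linarith [ht'.1, ht'.2]
      _ = _ := by ring

lemma opP_bound (hmN : m = 3 * (N / 4)) {i j : ℕ} (hi : i < N) (hj : j < N) {z : ℝ × ℝ}
    (hz : z ∈ cell X Y i j) :
    |opP X Y N k E z| ≤ interpConst k ^ 2 * (M * (K / N) ^ (k + 1)) * stripInd m i := by
  have hN : 0 < N := by have := hT.lt; omega
  have hm : m < N := by have := hT.lt; omega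
  have hM := hE.nonneg
  have hK := hx.one_le_K hN
  have hΛ := one_le_interpConst k
  rw [opP_eq, ← hmN]
  refine (stripFun_bound hX hk hm (P := interpConst k * (M * (K / N) ^ (k + 1))) (by positivity) hi
    hz.1 fun s hs => fullPart_bound hE hX hY hk hx hy hT hs hj hz.2).trans (le_of_eq ?_)
  ring

lemma opTheta_bound (hmN : m = 3 * (N / 4)) {i j : ℕ} (hi : i < N) (hj : j < N) {z : ℝ × ℝ}
    (hz : z ∈ cell X Y i j) :
    |opTheta X Y N k E z|
      ≤ 2 * interpConst k ^ 2 * (M * (K / N) ^ (k + 1)) * stripInd m i * endInd N j := by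
  have hN : 0 < N := by have := hT.lt; omega
  have hm : m < N := by have := hT.lt; omega
  have hM := hE.nonneg
  have hK := hx.one_le_K hN
  have hΛ := one_le_interpConst k
  have hend := endInd_nonneg N j
  rw [opTheta_eq, ← hmN]
  refine (stripFun_bound hX hk hm (P := 2 * interpConst k * (M * (K / N) ^ (k + 1)) * endInd N j)
    (by positivity) hi hz.1 fun s hs => endPart_bound hY hk (by positivity)
      (strip_value_bound hE hX hY hk hx hy hT hs (hY.mem (Nat.zero_le N)))
      (strip_value_bound hE hX hY hk hx hy hT hs (hY.mem le_rfl)) hj hz.2).trans (le_of_eq ?_)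
  ring

lemma nrm_opP_opTheta_le (hmN : m = 3 * (N / 4)) :
    nrm (opP X Y N k E) ≤ 2 * interpConst k ^ 2 * (M * (K / N) ^ (k + 1)) ∧
      nrm (opTheta X Y N k E) ≤ 2 * interpConst k ^ 2 * (M * (K / N) ^ (k + 1)) := by
  have hN : 0 < N := by have := hT.lt; omega
  have hM := hE.nonneg
  have hK := hx.one_le_K hN
  have hΛ := one_le_interpConst k
  have h0 : 0 ≤ interpConst k ^ 2 * (M * (K / N) ^ (k + 1)) := by positivity
  constructor
  · refine nrm_le_of_bound (by positivity) ?_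
    filter_upwards [ae_ocell hX hY hN] with z ⟨i, hi, j, hj, hz⟩
    refine (opP_bound hE hX hY hk hx hy hT hmN hi hj (ocell_subset X Y i j hz)).trans ?_
    have := mul_le_mul_of_nonneg_left (stripInd_le_one m i) h0
    linarith
  · refine nrm_le_of_bound (by positivity) ?_
    filter_upwards [ae_ocell hX hY hN] with z ⟨i, hi, j, hj, hz⟩
    refine (opTheta_bound hE hX hY hk hx hy hT hmN hi hj (ocell_subset X Y i j hz)).trans ?_
    have h1 : stripInd m i * endInd N j ≤ 1 :=
      mul_le_one₀ (stripInd_le_one m i) (endInd_nonneg N j) (endInd_le_one N j)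
    have := mul_le_mul_of_nonneg_left h1 h0
    linarith

omit hE hY hk hy in
/-- A function which is bounded by `C / h_i` on the two cells of the strip. -/
lemma nrm_le_of_strip_inv (hY : Mesh Y N) {C : ℝ} (hC : 0 ≤ C) {f : ℝ × ℝ → ℝ}
    (hf : ∀ i < N, ∀ j < N, ∀ z ∈ ocell X Y i j,
      |f z| ≤ C * (stripInd m i / (X (i + 1) - X i))) :
    nrm f ≤ 2 * K * C * √A := by
  have hN : 0 < N := by have := hT.lt; omega
  have hK := hx.one_le_K hN
  have hA := hx.A_pos hN
  have hi : IntegrableOn (fun x => C ^ 2 * stepFun X N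
      (fun i => (stripInd m i / (X (i + 1) - X i)) ^ 2) x) (Ioo 0 1) :=
    (integrableOn_stepFun X N _).const_mul _
  have hb := nrm_sq_le (f := f) (integrableOn_fst hi) (by
    filter_upwards [ae_ocell hX hY hN] with z ⟨i, hi, j, hj, hz⟩
    rw [stepFun_apply hX _ hi hz.1, ← sq_abs, ← mul_pow]
    exact pow_le_pow_left₀ (abs_nonneg _) (hf i hi j hj z hz) 2)
  rw [integral_fst (fun x => C ^ 2 * stepFun X N
      (fun i => (stripInd m i / (X (i + 1) - X i)) ^ 2) x), integral_const_mul,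
    integral_stepFun hX] at hb
  refine le_of_sq_le_sq (hb.trans ?_) (by positivity)
  have hsum : ∑ i ∈ Finset.range N, (stripInd m i / (X (i + 1) - X i)) ^ 2 * (X (i + 1) - X i)
      ≤ ∑ i ∈ Finset.range N, ((if i = m then K * A else 0) + if i = m + 1 then K * A else 0) := by
    refine Finset.sum_le_sum fun i hi => ?_
    have hh : 0 < X (i + 1) - X i := sub_pos.2 (hX.lt_succ i (Finset.mem_range.1 hi))
    -- The two cells of the strip have length at least 1/(K A), so the squared inverse estimate
    -- integrates to 1/h ≤ K A on each of them.
    have hlow : (i = m ∨ i = m + 1) →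
        (1 / (X (i + 1) - X i)) ^ 2 * (X (i + 1) - X i) ≤ K * A := fun h => by
      have := hT.low i h
      have e : (1 / (X (i + 1) - X i)) ^ 2 * (X (i + 1) - X i) = 1 / (X (i + 1) - X i) := by
        field_simp
      rw [e, div_le_iff₀ hh]
      exact this
    unfold stripInd
    by_cases h1 : i = m
    · rw [if_pos (Or.inl h1), if_pos h1, if_neg (by omega), add_zero]
      exact hlow (Or.inl h1)
    · by_cases h2 : i = m + 1
      · rw [if_pos (Or.inr h2), if_neg h1, if_pos h2, zero_add]
        exact hlow (Or.inr h2)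
      · rw [if_neg (by tauto), if_neg h1, if_neg h2]
        simp
  rw [Finset.sum_add_distrib, Finset.sum_ite_eq', Finset.sum_ite_eq',
    if_pos (Finset.mem_range.2 (by have := hT.lt; omega)),
    if_pos (Finset.mem_range.2 (by have := hT.lt; omega))] at hsum
  calc _ ≤ C ^ 2 * (K * A + K * A) := mul_le_mul_of_nonneg_left hsum (by positivity)
    _ = C ^ 2 * A * (2 * K) := by ring
    _ ≤ C ^ 2 * A * (4 * K ^ 2) := mul_le_mul_of_nonneg_left (by nlinarith) (by positivity)
    _ = (2 * K * C * √A) ^ 2 := by rw [mul_pow, Real.sq_sqrt hA.le]; ring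

lemma nrm_dx_opP_opTheta_le (hmN : m = 3 * (N / 4)) :
    nrm (dx (opP X Y N k E)) ≤ 2 * K * (2 * interpConst k ^ 2 * (M * (K / N) ^ (k + 1))) * √A ∧
      nrm (dx (opTheta X Y N k E))
        ≤ 2 * K * (2 * interpConst k ^ 2 * (M * (K / N) ^ (k + 1))) * √A := by
  have hN : 0 < N := by have := hT.lt; omega
  have hm : m < N := by have := hT.lt; omega
  have hM := hE.nonneg
  have hK := hx.one_le_K hN
  have hΛ := one_le_interpConst k
  have h0 : 0 ≤ interpConst k ^ 2 * (M * (K / N) ^ (k + 1)) := by positivity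
  constructor
  · refine nrm_le_of_strip_inv hX hx hT hY (by positivity) fun i hi j hj z hz => ?_
    have hh : 0 < X (i + 1) - X i := sub_pos.2 (hX.lt_succ i hi)
    have hn : 0 ≤ stripInd m i / (X (i + 1) - X i) := div_nonneg (stripInd_nonneg m i) hh.le
    rw [funext (opP_eq X Y N k E), ← hmN]
    refine (dx_stripFun_bound hX hk hm (P := interpConst k * (M * (K / N) ^ (k + 1)))
      (by positivity) hi hz.1 fun s hs => fullPart_bound hE hX hY hk hx hy hT hs hj
        (Ioo_subset_Icc_self hz.2)).trans ?_
    have := mul_nonneg h0 hn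
    nlinarith
  · refine nrm_le_of_strip_inv hX hx hT hY (by positivity) fun i hi j hj z hz => ?_
    have hh : 0 < X (i + 1) - X i := sub_pos.2 (hX.lt_succ i hi)
    have hn : 0 ≤ stripInd m i / (X (i + 1) - X i) := div_nonneg (stripInd_nonneg m i) hh.le
    rw [funext (opTheta_eq X Y N k E), ← hmN]
    refine (dx_stripFun_bound hX hk hm (P := 2 * interpConst k * (M * (K / N) ^ (k + 1)))
      (by positivity) hi hz.1 fun s hs => (endPart_bound hY hk (by positivity)
      (strip_value_bound hE hX hY hk hx hy hT hs (hY.mem (Nat.zero_le N)))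
      (strip_value_bound hE hX hY hk hx hy hT hs (hY.mem le_rfl)) hj
        (Ioo_subset_Icc_self hz.2)).trans ?_).trans (le_of_eq ?_)
    · exact mul_le_of_le_one_right (by positivity) (endInd_le_one N j)
    · ring

end

end Correction

end BakhvalovFEM
end

/-! ### The y-derivative of the correction and the L² error of the modified interpolant -/

noncomputable section
namespace BakhvalovFEM

lemma integrableOn_mul_prod {f g : ℝ → ℝ} (hf : IntegrableOn f (Ioo 0 1))
    (hg : IntegrableOn g (Ioo 0 1)) :
    IntegrableOn (fun z : ℝ × ℝ => f z.1 * g z.2) openSquare := by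
  have := Integrable.mul_prod hf hg
  rwa [Measure.prod_restrict] at this

lemma integral_mul_prod (f g : ℝ → ℝ) :
    ∫ z in openSquare, f z.1 * g z.2 = (∫ x in Ioo (0 : ℝ) 1, f x) * ∫ y in Ioo (0 : ℝ) 1, g y :=
  setIntegral_prod_mul f g _ _

/-- A sum with at most two nonzero terms. -/
lemma sum_le_two_mul {N a b : ℕ} {D : ℝ} {F : ℕ → ℝ} (ha : a < N) (hb : b < N) (hD : 0 ≤ D)
    (hF : ∀ j < N, (j = a ∨ j = b) → F j ≤ D) (hF0 : ∀ j < N, ¬(j = a ∨ j = b) → F j ≤ 0) :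
    ∑ j ∈ Finset.range N, F j ≤ 2 * D := by
  have : ∑ j ∈ Finset.range N, F j
      ≤ ∑ j ∈ Finset.range N, ((if j = a then D else 0) + if j = b then D else 0) := by
    refine Finset.sum_le_sum fun j hj => ?_
    have hj' := Finset.mem_range.1 hj
    by_cases h1 : j = a
    · rw [if_pos h1]
      have := hF j hj' (Or.inl h1)
      split_ifs <;> linarith
    · by_cases h2 : j = b
      · rw [if_neg h1, if_pos h2, zero_add]
        exact hF j hj' (Or.inr h2)
      · rw [if_neg h1, if_neg h2, add_zero]
        exact hF0 j hj' (by tauto)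
  rw [Finset.sum_add_distrib, Finset.sum_ite_eq', Finset.sum_ite_eq',
    if_pos (Finset.mem_range.2 ha), if_pos (Finset.mem_range.2 hb)] at this
  linarith

section Correction

variable {X Y : ℕ → ℝ} {N k m : ℕ} {A B B' K M : ℝ} {r q : ℕ → ℝ} {ρ ψ : ℝ → ℝ}
  {E : ℝ × ℝ → ℝ}

variable (hE : LayerPart k M A B ρ ψ E) (hX : Mesh X N) (hY : Mesh Y N) (hk : 1 ≤ k)
  (hx : LayerMesh X N A K r ρ) (hy : LayerMesh Y N B K q ψ)
  (hT : Transition X Y N m A B' K r ρ)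

include hE hX hY hk hx hy hT

lemma nrm_dy_opP_le (hmN : m = 3 * (N / 4)) :
    nrm (dy (opP X Y N k E))
      ≤ 2 * K * (interpConst k ^ 2 * K * (M * (K / N) ^ (k + 1))) * √B := by
  have hN : 0 < N := by have := hT.lt; omega
  have hm : m < N := by have := hT.lt; omega
  have hM := hE.nonneg
  have hK := hx.one_le_K hN
  have hΛ := one_le_interpConst k
  refine hy.nrm_le_snd hX hY hN (by positivity) fun i hi j hj z hz => ?_
  have hL := (hy.cell j hj).layerDeriv_nonneg (Ioo_subset_Icc_self hz.2)
  rw [funext (opP_eq X Y N k E), ← hmN]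
  have := fun s (hs : s ∈ Finset.Icc 1 k) =>
    fullPart_hasDerivAt hE hX hY hk hx hy hT hs hj hz.2
  choose! p' hp' hb using this
  refine (dy_stripFun_bound hX hk hm (by positivity) hi (Ioo_subset_Icc_self hz.1) hp' hb).trans ?_
  have h1 := stripInd_le_one m i
  calc _ ≤ interpConst k * (1 * (interpConst k * K * (M * (K / N) ^ (k + 1))
        * layerDeriv B (K / N) (Y (j + 1) - Y j) (ψ z.2))) := by gcongr
    _ = _ := by ring

/-- The inverse estimate on the first and the last cell in y costs K N B', but the function lives on
a strip of width at most 2K/N in x, so the powers of N cancel. -/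
lemma nrm_dy_opTheta_le (hmN : m = 3 * (N / 4)) :
    nrm (dy (opTheta X Y N k E))
      ≤ 2 * K * (2 * interpConst k ^ 2 * (M * (K / N) ^ (k + 1))) * √B' := by
  have hN : 0 < N := by have := hT.lt; omega
  have hm : m < N := by have := hT.lt; omega
  have hM := hE.nonneg
  have hK := hx.one_le_K hN
  have hΛ := one_le_interpConst k
  have hB' := hT.B_pos
  set C := 2 * interpConst k ^ 2 * (M * (K / N) ^ (k + 1)) with hC
  have hC0 : 0 ≤ C := by positivity
  have hi1 : IntegrableOn (fun x => C ^ 2 * stepFun X N (stripInd m) x) (Ioo 0 1) :=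
    (integrableOn_stepFun X N _).const_mul _
  have hi2 := integrableOn_stepFun Y N (fun j => (endInd N j / (Y (j + 1) - Y j)) ^ 2)
  have hb := nrm_sq_le (f := dy (opTheta X Y N k E)) (integrableOn_mul_prod hi1 hi2) (by
    filter_upwards [ae_ocell hX hY hN] with z ⟨i, hi, j, hj, hz⟩
    rw [stepFun_apply hX _ hi hz.1, stepFun_apply hY _ hj hz.2]
    have hl : 0 < Y (j + 1) - Y j := sub_pos.2 (hY.lt_succ j hj)
    have hend := endInd_nonneg N j
    have hst := stripInd_nonneg m i
    have := fun s (hs : s ∈ Finset.Icc 1 k) =>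
      endPart_hasDerivAt hY hk (g := fun y => E (node X k m s, y)) (P := M * (K / N) ^ (k + 1))
        (by positivity)
        (strip_value_bound hE hX hY hk hx hy hT hs (hY.mem (Nat.zero_le N)))
        (strip_value_bound hE hX hY hk hx hy hT hs (hY.mem le_rfl)) hj hz.2
    choose! p' hp' hpb using this
    have h1 := dy_stripFun_bound hX hk hm (by positivity) hi (Ioo_subset_Icc_self hz.1) hp' hpb
    rw [← sq_abs, funext (opTheta_eq X Y N k E), ← hmN]
    calc _ ≤ (interpConst k * (stripInd m i * (2 * interpConst k * (M * (K / N) ^ (k + 1))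
          * endInd N j / (Y (j + 1) - Y j)))) ^ 2 := pow_le_pow_left₀ (abs_nonneg _) h1 2
      _ = C ^ 2 * stripInd m i ^ 2 * (endInd N j / (Y (j + 1) - Y j)) ^ 2 := by
        rw [hC]; ring
      _ ≤ C ^ 2 * stripInd m i * (endInd N j / (Y (j + 1) - Y j)) ^ 2 := by
        gcongr
        exact pow_le_of_le_one hst (stripInd_le_one m i) two_ne_zero)
  rw [integral_mul_prod (fun x => C ^ 2 * stepFun X N (stripInd m) x), integral_const_mul,
    integral_stepFun hX, integral_stepFun hY] at hb
  refine le_of_sq_le_sq (hb.trans ?_) (by positivity)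
  have hs1 : ∑ i ∈ Finset.range N, stripInd m i * (X (i + 1) - X i) ≤ 2 * (K / N) := by
    refine sum_le_two_mul hm hT.lt (by positivity) (fun i hi h => ?_) (fun i hi h => ?_)
    · rw [stripInd, if_pos h, one_mul]
      exact hT.up i h
    · rw [stripInd, if_neg h, zero_mul]
  have hs2 : ∑ j ∈ Finset.range N, (endInd N j / (Y (j + 1) - Y j)) ^ 2 * (Y (j + 1) - Y j)
      ≤ 2 * (K * N * B') := by
    refine sum_le_two_mul hN (Nat.sub_lt hN one_pos) (by positivity) (fun j hj h => ?_)
      (fun j hj h => ?_)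
    · have hl : 0 < Y (j + 1) - Y j := sub_pos.2 (hY.lt_succ j hj)
      have h' : j = 0 ∨ j + 1 = N := by omega
      rw [endInd, if_pos h', show (1 / (Y (j + 1) - Y j)) ^ 2 * (Y (j + 1) - Y j)
        = 1 / (Y (j + 1) - Y j) by field_simp, div_le_iff₀ hl]
      exact hT.end_low j hj h'
    · rw [endInd, if_neg (by omega)]
      simp
  have hs2' : 0 ≤ ∑ j ∈ Finset.range N,
      (endInd N j / (Y (j + 1) - Y j)) ^ 2 * (Y (j + 1) - Y j) :=
    Finset.sum_nonneg fun j hj => mul_nonneg (sq_nonneg _)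
      (sub_pos.2 (hY.lt_succ j (Finset.mem_range.1 hj))).le
  calc _ ≤ C ^ 2 * (2 * (K / N)) * (2 * (K * N * B')) := by gcongr
    _ = (2 * K * C * √B') ^ 2 := by
      rw [mul_pow _ (√B'), Real.sq_sqrt hB'.le]
      field_simp

omit hT in
/-- The interpolation error on a cell on which the layer is resolved. -/
lemma fine_error {i j : ℕ} (hi : i < N) (hj : j < N)
    (hfine : A * (X (i + 1) - X i) * r i ≤ K / N ∧ ∀ x ∈ Icc (X i) (X (i + 1)), r i ≤ K * ρ x)
    {z : ℝ × ℝ} (hz : z ∈ cell X Y i j) :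
    |interp X Y N k E z - E z| ≤ 4 * interpConst k ^ 2 * M * K * (K / N) ^ k * ρ z.1 := by
  have hN : 0 < N := by omega
  have hM := hE.nonneg
  have hK := hx.one_le_K hN
  have hΛ := one_le_interpConst k
  have hcx := hx.cell i hi
  have hcy := hy.cell j hj
  have hA := hcx.A_pos
  have hr := hcx.r_nonneg
  have hh := hcx.h_pos
  have hab := hX.cell_subset hi
  have hcd := hY.cell_subset hj
  have hV := jet_of_contDiffOn hE.smooth
  obtain ⟨x, y⟩ := z
  obtain ⟨hxx, hyy⟩ := hz
  -- Deliberately only of order k: the remaining factor `r i` is kept and turned into K ρ, because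
  -- the L² norm of ρ supplies the gain A^{-1/2}.
  have e1 : |jetOf E 0 0 x y - (cellInterp (X i) (X (i + 1)) k (fun x => jetOf E 0 0 x y)).eval x|
      ≤ 2 * M * (K / N) ^ k * r i := by
    have h1 := interp_error_self hcx.lt hk (G := fun n x => jetOf E n 0 x y)
      (M := M * (A ^ k * r i ^ (k + 1)))
      (fun n hn x hx => (hV.deriv_fst n 0 (by omega) x (hab hx) y (hcd hyy)).mono hab)
      (fun x hx => by
        refine (hE.bound k 0 (by omega) x (hab hx) y (hcd hyy)).trans ?_
        have h1 := hcx.nonneg x hx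
        have h2 := hcx.le x hx
        have h3 : ψ y ^ (k + 1) ≤ 1 :=
          pow_le_one₀ (hcy.nonneg y hyy) ((hcy.le y hyy).trans hcy.r_le_one)
        have h4 := pow_nonneg (hcy.nonneg y hyy) (k + 1)
        rw [pow_zero, one_mul]
        calc _ ≤ M * (A ^ k * r i ^ (k + 1) * 1) := by gcongr
          _ = _ := by rw [mul_one]) hxx
    calc _ ≤ _ := h1
      _ = 2 * M * (A * (X (i + 1) - X i) * r i) ^ k * r i := by rw [mul_pow, mul_pow]; ring
      _ ≤ 2 * M * (K / N) ^ k * r i := by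
        gcongr
        exact hfine.1
  have e2 := cellInterp_bound hcx.lt hk
    (g := fun x' => jetOf E 0 0 x' y - (cellInterp (Y j) (Y (j + 1)) k (jetOf E 0 0 x')).eval y)
    (M := 2 * interpConst k * (M * r i) * (K / N) ^ k) (fun s hs => by
      have hm := cellNode_mem hcx.lt hk hs
      refine (snd_interp_error hcy hk hcd hV hM hE.bound (Or.inl rfl) (hab hm) (hcx.nonneg _ hm)
        hyy).trans ?_
      have h1 := hcx.nonneg _ hm
      have h2 := hcx.le _ hm
      have h3 := pow_le_of_le_one h1 (h2.trans hcx.r_le_one) (Nat.succ_ne_zero k)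
      gcongr
      exact h3.trans h2) hxx
  rw [← cellInterp_sub, Polynomial.eval_sub] at e2
  have hr' := hfine.2 x hxx
  rw [interp_on_cell hX hY hk E hi hj hxx hyy, abs_sub_comm]
  calc _ = |(jetOf E 0 0 x y - (cellInterp (X i) (X (i + 1)) k (fun x => jetOf E 0 0 x y)).eval x)
          + ((cellInterp (X i) (X (i + 1)) k (fun x' => jetOf E 0 0 x' y)).eval x
            - (cellInterp (X i) (X (i + 1)) k (fun x' =>
              (cellInterp (Y j) (Y (j + 1)) k (jetOf E 0 0 x')).eval y)).eval x)| := by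
        congr 1
        exact (sub_add_sub_cancel _ _ _).symm
    _ ≤ 2 * M * (K / N) ^ k * r i
        + interpConst k * (2 * interpConst k * (M * r i) * (K / N) ^ k) :=
      (abs_add_le _ _).trans (add_le_add e1 e2)
    _ = (2 + 2 * interpConst k ^ 2) * M * (K / N) ^ k * r i := by ring
    _ ≤ 4 * interpConst k ^ 2 * M * (K / N) ^ k * r i := by
      gcongr
      nlinarith
    _ ≤ 4 * interpConst k ^ 2 * M * (K / N) ^ k * (K * ρ x) := by gcongr
    _ = _ := by ring

omit hE hx hy in
-- On the cell behind the transition point P removes all nodes except those with s = 0, so only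
-- values of E on the line x = X m remain; there ρ ≤ 1/A.
lemma interp_sub_opP_on_strip (hmN : m = 3 * (N / 4)) {j : ℕ} (hj : j < N) {z : ℝ × ℝ}
    (hz : z ∈ cell X Y m j) :
    interp X Y N k E z - opP X Y N k E z
      = (cellInterp (Y j) (Y (j + 1)) k (fun y => E (X m, y))).eval z.2
        * (cellPoly (X m) (X (m + 1)) k 0).eval z.1 := by
  have hm : m < N := by have := hT.lt; omega
  have h1 : opP X Y N k E z = ∑ s ∈ Finset.Icc 1 k,
      (cellInterp (Y j) (Y (j + 1)) k (fun y => E (node X k m s, y))).eval z.2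
        * (cellPoly (X m) (X (m + 1)) k s).eval z.1 := by
    rw [opP_eq, ← hmN]
    refine Finset.sum_congr rfl fun s hs => ?_
    rw [basis1_on_cell hX hk hm hs hm hz.1, if_pos rfl, mul_comm]
    congr 1
    exact sum_basis1 hY hk (fun y => E (node X k m s, y)) hj hz.2
  have h2 := interp_on_cell hX hY hk E hm hj hz.1 hz.2
  rw [Prod.mk.eta] at h2
  rw [h1, h2, tensorInterp, cellInterp_eval, Finset.sum_range_succ']
  have h3 : ∀ f : ℕ → ℝ, ∑ s ∈ Finset.Icc 1 k, f s = ∑ s ∈ Finset.range k, f (s + 1) := fun f => by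
    rw [show Finset.Icc 1 k = Finset.Ico 1 (k + 1) by ext; simp,
      Finset.sum_Ico_eq_sum_range]
    simp [add_comm]
  rw [h3, cellNode_zero, add_comm]
  exact add_sub_cancel_right _ _

/-- The pointwise error of the modified interpolant. -/
lemma opPi_error (hmN : m = 3 * (N / 4)) {i j : ℕ} (hi : i < N) (hj : j < N) {z : ℝ × ℝ}
    (hz : z ∈ cell X Y i j) :
    |opPi X Y N k E z - E z| ≤ 4 * interpConst k ^ 2 * M * K * (K / N) ^ k
      * (ρ z.1 + 1 / A + K / N * (if i = m + 1 then 1 else 0)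
        + K / N * (if i = m then 1 else 0) * endInd N j) := by
  have hN : 0 < N := by omega
  have hm : m < N := by have := hT.lt; omega
  have hM := hE.nonneg
  have hK := hx.one_le_K hN
  have hA := hx.A_pos hN
  have hΛ := one_le_interpConst k
  have hΛb : basisConst k ≤ interpConst k := by
    have := one_le_basisConst k
    unfold interpConst
    have : (0 : ℝ) ≤ k := k.cast_nonneg
    nlinarith
  have hend := endInd_nonneg N j
  have h01x := hX.cell_subset hi hz.1
  have h01y := hY.cell_subset hj hz.2
  have hρ := (hx.nonneg hX hN h01x).1
  have hψ := hy.nonneg hY hN h01y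
  have hQ := opP_bound hE hX hY hk hx hy hT hmN hi hj hz
  have hΘ := opTheta_bound hE hX hY hk hx hy hT hmN hi hj hz
  set κ := K / (N : ℝ) with hκ
  have hκ0 : 0 < κ := by positivity
  set C := 4 * interpConst k ^ 2 * M * K * κ ^ k with hC
  have hC0 : 0 ≤ C := by positivity
  have hDC : 3 * interpConst k ^ 2 * (M * κ ^ (k + 1)) ≤ C * κ := by
    calc _ = 3 * interpConst k ^ 2 * M * 1 * κ ^ k * κ := by ring
      _ ≤ C * κ := by
        rw [hC]
        gcongr
        norm_num
  have hpow : ∀ {x : ℝ}, x ∈ Icc (0 : ℝ) 1 → ρ x ≤ κ → ρ x ^ (k + 1) ≤ κ ^ k * ρ x := by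
    intro x hx01 h
    have := (hx.nonneg hX hN hx01).1
    rw [pow_succ]
    gcongr
  have hM4 : ∀ t : ℝ, 0 ≤ t → interpConst k ^ 2 * (M * (κ ^ k * t)) ≤ C * t := by
    intro t ht
    rw [hC]
    have : 1 * interpConst k ^ 2 * M * 1 * κ ^ k ≤ 4 * interpConst k ^ 2 * M * K * κ ^ k := by
      gcongr
      norm_num
    nlinarith
  have hEz : ρ z.1 ≤ κ → |E z| ≤ C * ρ z.1 := fun h => by
    have h1 := hE.abs_le h01x h01y hρ le_rfl hψ.1 hψ.2
    rw [Prod.mk.eta] at h1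
    have h2 := hM4 (ρ z.1) hρ
    have h3 := mul_le_mul_of_nonneg_left (hpow h01x h) hM
    have h4 : M * (κ ^ k * ρ z.1) ≤ interpConst k ^ 2 * (M * (κ ^ k * ρ z.1)) :=
      le_mul_of_one_le_left (by positivity) (one_le_pow₀ hΛ)
    linarith
  have hA1 : 0 ≤ C * (1 / A) := by positivity
  -- Left of the transition point k factors ρ are bounded by κ and the last one by 1/A.
  have hleft : ∀ x ∈ Icc 0 (X m), ∀ y ∈ Icc (0 : ℝ) 1, |E (x, y)| ≤ M * (κ ^ k * (1 / A)) := by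
    intro x hx0 y hy0
    have h01 : x ∈ Icc (0 : ℝ) 1 := ⟨hx0.1, hx0.2.trans (hX.mem hm.le).2⟩
    have hρx := (hx.nonneg hX hN h01).1
    have hψy := hy.nonneg hY hN hy0
    refine (hE.abs_le h01 hy0 hρx le_rfl hψy.1 hψy.2).trans ?_
    have := hpow h01 (hT.left x hx0).2
    have := (hT.left x hx0).1
    calc M * ρ x ^ (k + 1) ≤ M * (κ ^ k * ρ x) := by gcongr
      _ ≤ _ := by gcongr
  rw [opPi]
  rcases lt_trichotomy i m with h | rfl | h
  -- Left of the transition point the correction is absent, and the interpolant and E are both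
  -- negligible.
  · have hs : stripInd m i = 0 := by rw [stripInd, if_neg (by omega)]
    rw [hs, mul_zero] at hQ
    rw [hs, mul_zero, zero_mul] at hΘ
    have hXm : X (i + 1) ≤ X m := hX.le h hm.le
    have h1 : |interp X Y N k E z| ≤ interpConst k ^ 2 * (M * (κ ^ k * (1 / A))) := by
      have h2 := interp_on_cell hX hY hk E hi hj hz.1 hz.2
      rw [Prod.mk.eta] at h2
      rw [h2]
      refine tensorInterp_bound (hX.lt_succ i hi) (hY.lt_succ j hj) hk (fun s hs t ht => ?_) hz.1 hz.2
      have hmx := cellNode_mem (hX.lt_succ i hi) hk hs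
      have hmy := cellNode_mem (hY.lt_succ j hj) hk ht
      exact hleft _ ⟨(hX.cell_subset hi hmx).1, hmx.2.trans hXm⟩ _ (hY.cell_subset hj hmy)
    have h2 := hEz (hT.left z.1 ⟨h01x.1, hz.1.2.trans hXm⟩).2
    have h3 := hM4 (1 / A) (by positivity)
    rw [if_neg (by omega), if_neg (by omega), abs_nonpos_iff.1 hQ, abs_nonpos_iff.1 hΘ]
    have := abs_sub (interp X Y N k E z) (E z)
    simp only [sub_zero, add_zero, mul_zero, zero_mul, mul_add]
    linarith
  -- On the critical cell E is bounded by C ρ, the interpolant without P by C/A, and Θ lives only on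
  -- the two end cells in y.
  · have h1 := interp_sub_opP_on_strip (E := E) hX hY hk hT hmN hj hz
    rw [h1, if_neg (by omega), if_pos rfl]
    rw [stripInd, if_pos (Or.inl rfl), mul_one] at hΘ
    have h2 := hEz (hT.mid _ hz.1)
    have h3 := hM4 (1 / A) (by positivity)
    have h4 : |(cellInterp (Y j) (Y (j + 1)) k (fun y => E (X i, y))).eval z.2
        * (cellPoly (X i) (X (i + 1)) k 0).eval z.1| ≤ C * (1 / A) := by
      have h5 := cellInterp_bound (hY.lt_succ j hj) hk (g := fun y => E (X i, y)) (fun t ht =>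
        hleft (X i) ⟨(hX.mem hi.le).1, le_rfl⟩ _
          (hY.cell_subset hj (cellNode_mem (hY.lt_succ j hj) hk ht))) hz.2
      have h6 := (cellPoly_bound (hX.lt_succ i hi) hk (Nat.zero_le k) hz.1).1.trans hΛb
      rw [abs_mul]
      calc _ ≤ interpConst k * (M * (κ ^ k * (1 / A))) * interpConst k := by gcongr
        _ = interpConst k ^ 2 * (M * (κ ^ k * (1 / A))) := by ring
        _ ≤ _ := h3
    have h7 : 2 * interpConst k ^ 2 * (M * κ ^ (k + 1)) * endInd N j ≤ C * (κ * endInd N j) := by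
      have h0 : 0 ≤ interpConst k ^ 2 * (M * κ ^ (k + 1)) := by positivity
      rw [← mul_assoc C]
      exact mul_le_mul_of_nonneg_right (by linarith) hend
    have h8 : ∀ a b c : ℝ, |a + b - c| ≤ |a| + |b| + |c| := fun a b c =>
      (abs_sub _ _).trans (add_le_add_left (abs_add_le _ _) _)
    refine (h8 _ _ _).trans ?_
    simp only [mul_one, mul_zero, add_zero, mul_add]
    linarith
  -- Inside the layer the mesh resolves E. The basis function of the node X (m + 1) extends into
  -- cell m + 1, so P and Θ still contribute there.
  · have h1 := fine_error hE hX hY hk hx hy hi hj (hT.fine i h hi) hz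
    have h8 : ∀ a b c d : ℝ, |a - b + c - d| ≤ |a - d| + |b| + |c| := fun a b c d => by
      rw [show a - b + c - d = (a - d) + -b + c by ring]
      exact (abs_add_le _ _).trans (add_le_add_left ((abs_add_le _ _).trans (by rw [abs_neg])) _)
    refine (h8 _ _ _ _).trans ?_
    rw [if_neg (by omega : ¬ i = m)]
    by_cases h9 : i = m + 1
    · rw [stripInd, if_pos (Or.inr h9), mul_one] at hQ hΘ
      have h10 : 2 * interpConst k ^ 2 * (M * κ ^ (k + 1)) * endInd N j
          ≤ 2 * interpConst k ^ 2 * (M * κ ^ (k + 1)) :=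
        mul_le_of_le_one_right (by positivity) (endInd_le_one N j)
      rw [if_pos h9]
      simp only [mul_one, mul_zero, add_zero, zero_mul, mul_add]
      linarith
    · have hs : stripInd m i = 0 := by rw [stripInd, if_neg (by omega)]
      rw [hs, mul_zero] at hQ
      rw [hs, mul_zero, zero_mul] at hΘ
      rw [if_neg h9]
      simp only [mul_zero, add_zero, zero_mul, mul_add]
      linarith

/-- Every term of the pointwise bound has a squared integral of order 1/A: ρ by its decay, the
constant 1/A because A ≥ 1, the cell m + 1 by its width K/A, and the end cells of the strip by their
area, at most (K/√A) · 2K/B' with 1/B' ≤ K/√A. The factor A^{-1/2} is what the convection term needs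
after integration by parts. -/
lemma nrm_opPi_error_le (hmN : m = 3 * (N / 4)) :
    nrm (fun z => opPi X Y N k E z - E z)
      ≤ 6 * K ^ 3 * (4 * interpConst k ^ 2 * M * K * (K / N) ^ k) / √A := by
  have hm : m < N := by have := hT.lt; omega
  have hN : 0 < N := by omega
  have hM := hE.nonneg
  have hK := hx.one_le_K hN
  have hA := hx.A_pos hN
  have hA1 := hT.one_le_A
  have hB' := hT.B_pos
  have hN1 : (1 : ℝ) ≤ N := by exact_mod_cast hN
  have hΛ := one_le_interpConst k
  set κ := K / (N : ℝ) with hκ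
  have hκ0 : 0 < κ := by positivity
  have hκK : κ ≤ K := div_le_self (by linarith) hN1
  set C := 4 * interpConst k ^ 2 * M * K * κ ^ k with hC
  have hC0 : 0 ≤ C := by positivity
  have hi0 : IntegrableOn (fun x => ρ x ^ 2 + (1 / A) ^ 2) (Ioo 0 1) :=
    hx.integrableOn_sq.add (integrable_const _)
  have hi1 : IntegrableOn (fun x => ρ x ^ 2 + (1 / A) ^ 2
      + κ ^ 2 * stepFun X N (fun i => if i = m + 1 then 1 else 0) x) (Ioo 0 1) :=
    hi0.add ((integrableOn_stepFun X N _).const_mul _)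
  have hi2 := integrableOn_stepFun X N (fun i => if i = m then 1 else 0)
  have hi3 := integrableOn_stepFun Y N (endInd N)
  have hF1 := integrableOn_fst hi1
  have hF2 := (integrableOn_mul_prod hi2 hi3).const_mul (κ ^ 2)
  have hb := nrm_sq_le (f := fun z => opPi X Y N k E z - E z)
    ((hF1.add hF2).const_mul (4 * C ^ 2)) (by
    filter_upwards [ae_ocell hX hY hN] with z ⟨i, hi, j, hj, hz⟩
    simp only [Pi.add_apply]
    rw [stepFun_apply hX _ hi hz.1, stepFun_apply hX _ hi hz.1, stepFun_apply hY _ hj hz.2,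
      ← sq_abs]
    have h1 : |opPi X Y N k E z - E z| ≤ C * (ρ z.1 + 1 / A + κ * (if i = m + 1 then 1 else 0)
        + κ * (if i = m then 1 else 0) * endInd N j) :=
      opPi_error hE hX hY hk hx hy hT hmN hi hj (ocell_subset X Y i j hz)
    have hind : ∀ P : Prop, [Decidable P] → (if P then (1 : ℝ) else 0) ^ 2 = if P then 1 else 0 := by
      intro P _; split_ifs <;> norm_num
    have hend : endInd N j ^ 2 = endInd N j := hind _
    have h4 : ∀ a b c d : ℝ, (a + b + c + d) ^ 2 ≤ 4 * (a ^ 2 + b ^ 2 + c ^ 2 + d ^ 2) := by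
      intro a b c d
      nlinarith [sq_nonneg (a - b), sq_nonneg (a - c), sq_nonneg (a - d), sq_nonneg (b - c),
        sq_nonneg (b - d), sq_nonneg (c - d)]
    refine (pow_le_pow_left₀ (abs_nonneg _) h1 2).trans ?_
    rw [mul_pow, mul_comm 4 (C ^ 2), mul_assoc (C ^ 2)]
    refine mul_le_mul_of_nonneg_left ((h4 _ _ _ _).trans (le_of_eq ?_)) (by positivity)
    rw [mul_pow κ, mul_pow (κ * _), mul_pow κ, hind, hind, hend]
    ring)
  have hI1 : ∫ x in Ioo (0 : ℝ) 1, (ρ x ^ 2 + (1 / A) ^ 2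
      + κ ^ 2 * stepFun X N (fun i => if i = m + 1 then 1 else 0) x)
        ≤ K / A + (1 / A) ^ 2 + κ ^ 2 * (K / A) := by
    rw [integral_add hi0 ((integrableOn_stepFun X N _).const_mul _), integral_add hx.integrableOn_sq
      (integrable_const _), integral_const_mul, integral_stepFun hX]
    have := hx.int_le
    have h2 : ∑ i ∈ Finset.range N, (if i = m + 1 then (1 : ℝ) else 0) * (X (i + 1) - X i)
        ≤ K / A := by
      simp only [ite_mul, one_mul, zero_mul, Finset.sum_ite_eq']
      rw [if_pos (Finset.mem_range.2 hT.lt)]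
      exact hT.up_succ
    have h3 : ∫ _x in Ioo (0 : ℝ) 1, (1 / A) ^ 2 = (1 / A) ^ 2 := by simp
    rw [h3]
    gcongr
  have hI2 : ∫ z in openSquare, stepFun X N (fun i => if i = m then 1 else 0) z.1
      * stepFun Y N (endInd N) z.2 ≤ K / √A * (2 * (K / B')) := by
    rw [integral_mul_prod, integral_stepFun hX, integral_stepFun hY]
    have h2 : ∑ i ∈ Finset.range N, (if i = m then (1 : ℝ) else 0) * (X (i + 1) - X i)
        ≤ K / √A := by
      simp only [ite_mul, one_mul, zero_mul, Finset.sum_ite_eq']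
      rw [if_pos (Finset.mem_range.2 hm)]
      exact hT.up_m
    have h3 : ∑ j ∈ Finset.range N, endInd N j * (Y (j + 1) - Y j) ≤ 2 * (K / B') := by
      refine sum_le_two_mul hN (Nat.sub_lt hN one_pos) (by positivity) (fun j hj h => ?_)
        (fun j hj h => ?_)
      · have h' : j = 0 ∨ j + 1 = N := by omega
        rw [endInd, if_pos h', one_mul]
        exact hT.end_up j hj h'
      · rw [endInd, if_neg (by omega), zero_mul]
    have h4 : 0 ≤ ∑ j ∈ Finset.range N, endInd N j * (Y (j + 1) - Y j) :=
      Finset.sum_nonneg fun j hj => mul_nonneg (endInd_nonneg N j)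
        (sub_pos.2 (hY.lt_succ j (Finset.mem_range.1 hj))).le
    gcongr
  rw [integral_const_mul] at hb
  simp only [Pi.add_apply] at hb
  rw [integral_add hF1 hF2, integral_const_mul, integral_fst (fun x => ρ x ^ 2 + (1 / A) ^ 2
      + κ ^ 2 * stepFun X N (fun i => if i = m + 1 then 1 else 0) x)] at hb
  refine le_of_sq_le_sq (hb.trans ?_) (by positivity)
  have hI4 : 0 ≤ ∫ z in openSquare, stepFun X N (fun i => if i = m then 1 else 0) z.1
      * stepFun Y N (endInd N) z.2 := by
    rw [integral_mul_prod (stepFun X N fun i => if i = m then 1 else 0) (stepFun Y N (endInd N))]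
    refine mul_nonneg (integral_stepFun_nonneg hX fun i => ?_)
      (integral_stepFun_nonneg hY fun j => endInd_nonneg N j)
    split_ifs <;> norm_num
  have hI3 : K / √A * (2 * (K / B')) ≤ 2 * K ^ 3 / A := by
    calc _ = 2 * K ^ 2 / √A * (1 / B') := by ring
      _ ≤ 2 * K ^ 2 / √A * (K / √A) := by
        have := hT.ratio
        gcongr
      _ = 2 * K ^ 3 / (√A * √A) := by ring
      _ = _ := by rw [Real.mul_self_sqrt hA.le]
  have hA2 : (1 / A) ^ 2 ≤ 1 / A := by
    have : 1 / A ≤ 1 := by rw [div_le_one hA]; exact hA1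
    exact pow_le_of_le_one (by positivity) this two_ne_zero
  -- All powers of K are raised to K^6; the generous constant 9 makes 4 · 9 · K^6 the square of 6
  -- K^3.
  have hK6 : ∀ n ≤ 6, K ^ n ≤ K ^ 6 := fun n hn => pow_le_pow_right₀ hK hn
  have hκ2 : κ ^ 2 ≤ K ^ 2 := by gcongr
  calc _ ≤ 4 * C ^ 2 * ((K / A + 1 / A + K ^ 2 * (K / A)) + K ^ 2 * (2 * K ^ 3 / A)) := by
        refine mul_le_mul_of_nonneg_left (add_le_add (hI1.trans ?_) ?_) (by positivity)
        · gcongr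
        · exact mul_le_mul hκ2 (hI2.trans hI3) hI4 (by positivity)
    _ = 4 * C ^ 2 * (K ^ 1 + K ^ 0 + K ^ 3 + 2 * K ^ 5) / A := by ring
    _ ≤ 4 * C ^ 2 * (9 * K ^ 6) / A := by
        gcongr
        linarith [hK6 1 (by norm_num), hK6 0 (by norm_num), hK6 3 (by norm_num),
          hK6 5 (by norm_num), hK6 6 (by norm_num)]
    _ = (6 * K ^ 3 * C / √A) ^ 2 := by
        rw [div_pow, Real.sq_sqrt hA.le]
        ring

end Correction

end BakhvalovFEM
end

noncomputable section
namespace BakhvalovFEM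

/-! ### The Bakhvalov-type mesh -/

/-- The argument of the logarithm in the mesh generating function. -/
def layerArg (μ : ℝ) (N i : ℕ) : ℝ := 1 - 4 * (1 - μ⁻¹) * ((i : ℝ) / N)

/-- The increment of `layerArg`. -/
def layerStep (μ : ℝ) (N : ℕ) : ℝ := 4 * (1 - μ⁻¹) / N

/-- The `(k + 1)`-st root of the boundary layer function `exp (-q x)`. -/
def layerFun (k : ℕ) (q x : ℝ) : ℝ := Real.exp (-(q * x) / (k + 1))

lemma layerFun_pow (k : ℕ) (q x : ℝ) : layerFun k q x ^ (k + 1) = Real.exp (-(q * x)) := by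
  rw [layerFun, ← Real.exp_nat_mul]
  congr 1
  push_cast
  field_simp

lemma layerFun_pos (k : ℕ) (q x : ℝ) : 0 < layerFun k q x := Real.exp_pos _

lemma layerFun_anti {k : ℕ} {q x y : ℝ} (hq : 0 ≤ q) (hxy : x ≤ y) :
    layerFun k q y ≤ layerFun k q x := by
  unfold layerFun
  gcongr

lemma layerFun_le_one {k : ℕ} {q x : ℝ} (hq : 0 ≤ q) (hx : 0 ≤ x) : layerFun k q x ≤ 1 := by
  refine Real.exp_le_one_iff.2 (div_nonpos_of_nonpos_of_nonneg ?_ (by positivity))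
  have := mul_nonneg hq hx
  linarith

lemma layerFun_comparable {k : ℕ} {q x y : ℝ} (hq : 0 ≤ q) (hxy : x ≤ y) :
    layerFun k q x ≤ Real.exp (q * (y - x)) * layerFun k q y := by
  unfold layerFun
  rw [← Real.exp_add, Real.exp_le_exp]
  have h1 : 0 ≤ q * (y - x) := mul_nonneg hq (sub_nonneg.2 hxy)
  have h2 : q * (y - x) / (k + 1) ≤ q * (y - x) := div_le_self h1 (by linarith [k.cast_nonneg (α := ℝ)])
  have h3 : -(q * x) / (k + 1) = q * (y - x) / (k + 1) + -(q * y) / ((k : ℝ) + 1) := by ring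
  linarith

lemma continuous_layerFun (k : ℕ) (q : ℝ) : Continuous (layerFun k q) := by
  unfold layerFun
  fun_prop

/-- The square is an exponential with rate 2q/(k + 1), so its integral is at most half of the stated
bound. -/
lemma integral_layerFun_sq_le (k : ℕ) {q : ℝ} (hq : 0 < q) :
    ∫ x in Ioo (0 : ℝ) 1, layerFun k q x ^ 2 ≤ (k + 1) / q := by
  set a : ℝ := 2 * q / (k + 1) with ha
  have ha0 : 0 < a := by positivity
  have e : ∀ x, layerFun k q x ^ 2 = Real.exp (-(a * x)) := fun x => by
    rw [layerFun, ← Real.exp_nat_mul]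
    congr 1
    rw [ha]
    push_cast
    ring
  simp_rw [e]
  rw [← integral_Ioc_eq_integral_Ioo, ← intervalIntegral.integral_of_le zero_le_one]
  have hd : ∀ x ∈ uIcc (0 : ℝ) 1,
      HasDerivAt (fun x => -(Real.exp (-(a * x)) / a)) (Real.exp (-(a * x))) x := by
    intro x _
    have h := ((((hasDerivAt_id x).const_mul a).neg.exp).div_const a).neg
    refine h.congr_deriv ?_
    simp only [id, mul_one, mul_neg, neg_div, neg_neg]
    exact mul_div_cancel_right₀ _ ha0.ne'
  rw [intervalIntegral.integral_eq_sub_of_hasDerivAt hd (by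
    apply Continuous.intervalIntegrable; fun_prop)]
  have h1 : 0 < Real.exp (-(a * 1)) / a := by positivity
  have h2 : 1 / a ≤ (k + 1) / q := by
    rw [ha, one_div_div]
    gcongr
    linarith
  simp only [mul_zero, neg_zero, Real.exp_zero]
  linarith

section Arg

variable {μ : ℝ} {n N i : ℕ}

lemma layerArg_zero (μ : ℝ) (N : ℕ) : layerArg μ N 0 = 1 := by simp [layerArg]

lemma layerArg_succ (μ : ℝ) (N i : ℕ) : layerArg μ N (i + 1) = layerArg μ N i - layerStep μ N := by
  simp only [layerArg, layerStep]
  push_cast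
  ring

lemma layerStep_pos (hμ : 1 < μ) (hN : 0 < N) : 0 < layerStep μ N := by
  have : μ⁻¹ < 1 := inv_lt_one_of_one_lt₀ hμ
  have : 0 < 1 - μ⁻¹ := by linarith
  unfold layerStep
  positivity

lemma layerStep_le (hμ : 1 < μ) : layerStep μ N ≤ 4 / N := by
  have : 0 < μ⁻¹ := by positivity
  unfold layerStep
  gcongr
  linarith

lemma layerArg_quarter (hN : N = 4 * n) (hn : 0 < n) : layerArg μ N n = μ⁻¹ := by
  have : (n : ℝ) ≠ 0 := by positivity
  rw [layerArg, hN]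
  push_cast
  field_simp
  ring

lemma layerArg_anti (hμ : 1 < μ) {i j : ℕ} (hij : i ≤ j) : layerArg μ N j ≤ layerArg μ N i := by
  have : μ⁻¹ < 1 := inv_lt_one_of_one_lt₀ hμ
  have h2 : 0 ≤ 4 * (1 - μ⁻¹) := by linarith
  unfold layerArg
  gcongr

lemma layerArg_mem (hμ : 1 < μ) (hN : N = 4 * n) (hn : 0 < n) (hi : i ≤ n) :
    μ⁻¹ ≤ layerArg μ N i ∧ layerArg μ N i ≤ 1 := by
  constructor
  · rw [← layerArg_quarter hN hn]
    exact layerArg_anti hμ hi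
  · rw [← layerArg_zero μ N]
    exact layerArg_anti hμ (Nat.zero_le i)

end Arg

section MeshX

variable {τ p μ₀ μ₁ : ℝ} {n N : ℕ}

lemma meshX_left (hN : N = 4 * n) {i : ℕ} (hi : i ≤ n) :
    meshX τ p μ₀ μ₁ N i = τ / (p * μ₀) * -Real.log (layerArg μ₀ N i) := by
  rw [meshX, if_pos (by omega), layerArg]

lemma meshX_quarter (hN : N = 4 * n) (hn : 0 < n) :
    meshX τ p μ₀ μ₁ N n = sigmaX τ p μ₀ := by
  rw [meshX_left hN le_rfl, layerArg_quarter hN hn, Real.log_inv, neg_neg, sigmaX]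

lemma meshX_middle (hN : N = 4 * n) (hn : 0 < n) {i : ℕ} (hi : n ≤ i) (hi' : i ≤ 3 * n) :
    meshX τ p μ₀ μ₁ N i
      = sigmaX τ p μ₀ + 2 * ((i : ℝ) / N - 1 / 4) * (1 - sigmaX τ p μ₀ - sigmaX τ p μ₁) := by
  rcases hi.eq_or_lt with rfl | h
  · rw [meshX_quarter hN hn, hN]
    have : (n : ℝ) ≠ 0 := by positivity
    push_cast
    field_simp
    ring
  · rw [meshX, if_neg (by omega), if_pos (by omega)]

/-- Reflection at x = 1/2 exchanges μ₀ and μ₁. Everything about the layer at x = 1 is thereby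
deduced from the layer at x = 0. -/
lemma meshX_reflect (hN : N = 4 * n) (hn : 0 < n) {i : ℕ} (hi : i ≤ N) :
    meshX τ p μ₀ μ₁ N i = 1 - meshX τ p μ₁ μ₀ N (N - i) := by
  have hN0 : (N : ℝ) ≠ 0 := by
    have : 0 < N := by omega
    positivity
  have hcast : ((N - i : ℕ) : ℝ) / N = 1 - (i : ℝ) / N := by
    rw [Nat.cast_sub hi]
    field_simp
  rcases le_or_gt i n with h1 | h1
  -- For i = n the reflected index 3n falls under the middle formula, so the agreement of the two
  -- formulas at the transition point is checked separately.
  · rcases h1.eq_or_lt with rfl | h1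
    · rw [meshX_quarter hN hn, meshX_middle hN hn (by omega) (by omega), hcast, hN]
      have : (i : ℝ) ≠ 0 := by positivity
      push_cast
      field_simp
      ring
    · rw [meshX, if_pos (by omega), meshX, if_neg (by omega), if_neg (by omega), hcast]
      ring_nf
  · rcases le_or_gt i (3 * n) with h2 | h2
    · rw [meshX_middle hN hn h1.le h2, meshX_middle hN hn (by omega) (by omega), hcast]
      ring
    · rw [meshX, if_neg (by omega), if_neg (by omega), meshX_left hN (by omega), layerArg, hcast]

lemma meshX_left_sub (hμ : 1 < μ₀) (hN : N = 4 * n) {i : ℕ} (hi : i < n) :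
    meshX τ p μ₀ μ₁ N (i + 1) - meshX τ p μ₀ μ₁ N i
      = τ / (p * μ₀) * Real.log (layerArg μ₀ N i / layerArg μ₀ N (i + 1)) := by
  have hn : 0 < n := by omega
  have hμ0 : 0 < μ₀⁻¹ := by positivity
  have h1 := (layerArg_mem hμ hN hn hi.le).1
  have h2 := (layerArg_mem hμ hN hn (i := i + 1) hi).1
  rw [meshX_left hN hi.le, meshX_left hN hi, Real.log_div (by linarith) (by linarith)]
  ring

/-- These are the inequalities 1 - 1/t ≤ log t ≤ t - 1 for the ratio t of consecutive arguments.
They show that a layer cell, measured in units of the layer width, has size about the step divided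
by the argument. -/
lemma log_layerArg_bounds {μ : ℝ} (hμ : 1 < μ) (hN : N = 4 * n) {i : ℕ} (hi : i < n) :
    layerStep μ N / layerArg μ N i ≤ Real.log (layerArg μ N i / layerArg μ N (i + 1)) ∧
      Real.log (layerArg μ N i / layerArg μ N (i + 1)) ≤ layerStep μ N / layerArg μ N (i + 1) := by
  have hn : 0 < n := by omega
  have hμ0 : 0 < μ⁻¹ := by positivity
  have h1 : 0 < layerArg μ N i := by linarith [(layerArg_mem hμ hN hn hi.le).1]
  have h2 : 0 < layerArg μ N (i + 1) := by linarith [(layerArg_mem hμ hN hn (i := i + 1) hi).1]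
  have h3 := layerArg_succ μ N i
  constructor
  · refine le_trans (le_of_eq ?_) (Real.one_sub_inv_le_log_of_pos (by positivity))
    rw [inv_div, eq_sub_iff_add_eq, ← add_div, div_eq_one_iff_eq h1.ne']
    linarith
  · refine (Real.log_le_sub_one_of_pos (by positivity)).trans (le_of_eq ?_)
    rw [div_sub_one h2.ne']
    congr 1
    linarith

lemma meshX_left_sub_bounds (hp : 0 < p) (hτ : 0 < τ) (hμ : 1 < μ₀) (hN : N = 4 * n) {i : ℕ}
    (hi : i < n) :
    τ / p * (layerStep μ₀ N / layerArg μ₀ N i)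
        ≤ μ₀ * (meshX τ p μ₀ μ₁ N (i + 1) - meshX τ p μ₀ μ₁ N i) ∧
      μ₀ * (meshX τ p μ₀ μ₁ N (i + 1) - meshX τ p μ₀ μ₁ N i)
        ≤ τ / p * (layerStep μ₀ N / layerArg μ₀ N (i + 1)) := by
  have hb := log_layerArg_bounds hμ hN hi
  have e : μ₀ * (τ / (p * μ₀) * Real.log (layerArg μ₀ N i / layerArg μ₀ N (i + 1)))
      = τ / p * Real.log (layerArg μ₀ N i / layerArg μ₀ N (i + 1)) := by
    field_simp
  rw [meshX_left_sub hμ hN hi, e]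
  have : 0 ≤ τ / p := by positivity
  exact ⟨mul_le_mul_of_nonneg_left hb.1 this, mul_le_mul_of_nonneg_left hb.2 this⟩

lemma meshX_left_lt (hp : 0 < p) (hτ : 0 < τ) (hμ : 1 < μ₀) (hN : N = 4 * n) {i : ℕ} (hi : i < n) :
    meshX τ p μ₀ μ₁ N i < meshX τ p μ₀ μ₁ N (i + 1) := by
  have hn : 0 < n := by omega
  have hμ0 : 0 < μ₀⁻¹ := by positivity
  have h1 : 0 < layerArg μ₀ N i := by linarith [(layerArg_mem hμ hN hn hi.le).1]
  have h2 := layerStep_pos (N := N) hμ (by omega)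
  have h3 := (meshX_left_sub_bounds (μ₁ := μ₁) hp hτ hμ hN hi).1
  have h4 : 0 < τ / p * (layerStep μ₀ N / layerArg μ₀ N i) := by positivity
  have := pos_of_mul_pos_right (h4.trans_le h3) (by linarith)
  linarith

lemma meshX_mesh (hp : 0 < p) (hτ : 0 < τ) (hμ₀ : 1 < μ₀) (hμ₁ : 1 < μ₁) (hN : N = 4 * n)
    (hn : 0 < n) (hσ₀ : sigmaX τ p μ₀ ≤ 1 / 4) (hσ₁ : sigmaX τ p μ₁ ≤ 1 / 4) :
    Mesh (meshX τ p μ₀ μ₁ N) N where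
  zero := by rw [meshX_left hN (Nat.zero_le n), layerArg_zero]; simp
  last := by
    rw [meshX_reflect hN hn le_rfl, Nat.sub_self, meshX_left hN (Nat.zero_le n), layerArg_zero]
    simp
  lt_succ i hi := by
    rcases lt_or_ge i n with h1 | h1
    · exact meshX_left_lt hp hτ hμ₀ hN h1
    · rcases lt_or_ge i (3 * n) with h2 | h2
      · rw [meshX_middle hN hn h1 h2.le, meshX_middle hN hn (by omega) (by omega)]
        have hN0 : (0 : ℝ) < N := by
          have : 0 < N := by omega
          positivity
        have : (i : ℝ) / N < ((i + 1 : ℕ) : ℝ) / N := by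
          gcongr
          linarith
        have h3 : 0 < 1 - sigmaX τ p μ₀ - sigmaX τ p μ₁ := by linarith
        gcongr
      · rw [meshX_reflect hN hn hi.le, meshX_reflect hN hn (i := i + 1) hi]
        have h3 := meshX_left_lt (μ₁ := μ₀) hp hτ hμ₁ hN (i := N - (i + 1)) (by omega)
        rw [show N - (i + 1) + 1 = N - i by omega] at h3
        linarith

/-- Along the layer part of the mesh the layer function is bounded by `layerArg`. -/
lemma layerFun_meshX_le {k : ℕ} (hp : 0 < p) (hτ : (k : ℝ) + 1 ≤ τ) (hμ : 1 < μ₀) (hN : N = 4 * n)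
    (hn : 0 < n) {i : ℕ} (hi : i ≤ n) :
    layerFun k (p * μ₀) (meshX τ p μ₀ μ₁ N i) ≤ layerArg μ₀ N i := by
  have hμ0 : 0 < μ₀⁻¹ := by positivity
  have h1 := layerArg_mem hμ hN hn hi
  have h2 : 0 < layerArg μ₀ N i := by linarith
  have hl : Real.log (layerArg μ₀ N i) ≤ 0 := Real.log_nonpos h2.le h1.2
  -- The layer function at x_i is the power τ/(k + 1) of the argument of the logarithm. The argument
  -- is at most 1 and the exponent at least 1, so the power is at most the argument.
  have e : -(p * μ₀ * meshX τ p μ₀ μ₁ N i) / (k + 1)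
      = τ / (k + 1) * Real.log (layerArg μ₀ N i) := by
    rw [meshX_left hN hi]
    field_simp
  have hk : (0 : ℝ) < k + 1 := by positivity
  have h3 : 1 ≤ τ / (k + 1) := by rwa [one_le_div hk]
  rw [layerFun, e]
  calc _ ≤ Real.exp (Real.log (layerArg μ₀ N i)) := by
        rw [Real.exp_le_exp]
        nlinarith
    _ = _ := Real.exp_log h2

end MeshX

end BakhvalovFEM
end

noncomputable section
namespace BakhvalovFEM

/-! ### The mesh resolves the layers -/

lemma LayerCell.reflect {a b A κ K r : ℝ} {ρ : ℝ → ℝ} (h : LayerCell a b A κ K r ρ) :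
    LayerCell (1 - b) (1 - a) A κ K r (fun x => ρ (1 - x)) := by
  have e : (1 - a) - (1 - b) = b - a := by ring
  have hm : ∀ x ∈ Icc (1 - b) (1 - a), 1 - x ∈ Icc a b := fun x hx =>
    ⟨by linarith [hx.2], by linarith [hx.1]⟩
  exact
    { lt := by linarith [h.lt]
      A_pos := h.A_pos
      one_le_K := h.one_le_K
      r_nonneg := h.r_nonneg
      r_le_one := h.r_le_one
      min_le := by rw [e]; exact h.min_le
      nonneg := fun x hx => h.nonneg _ (hm x hx)
      le := fun x hx => h.le _ (hm x hx)
      comparable := fun hA x hx => h.comparable (by rwa [e] at hA) _ (hm x hx) }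

lemma LayerMesh.reflect {X X' : ℕ → ℝ} {N : ℕ} {A K : ℝ} {r : ℕ → ℝ} {ρ : ℝ → ℝ}
    (h : LayerMesh X' N A K r ρ) (hX : ∀ i ≤ N, X i = 1 - X' (N - i)) :
    LayerMesh X N A K (fun i => r (N - 1 - i)) (fun x => ρ (1 - x)) where
  cell i hi := by
    have := (h.cell (N - 1 - i) (by omega)).reflect
    rw [hX i hi.le, hX (i + 1) hi, show N - i = N - 1 - i + 1 by omega,
      show N - (i + 1) = N - 1 - i by omega]
    exact this
  cont := h.cont.comp (by fun_prop) fun x hx => ⟨by linarith [hx.2], by linarith [hx.1]⟩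
  int_le := by
    have e := intervalIntegral.integral_comp_sub_left (a := 0) (b := 1) (fun x => ρ x ^ 2) 1
    have := h.int_le
    rw [← integral_Ioc_eq_integral_Ioo, ← intervalIntegral.integral_of_le zero_le_one] at this ⊢
    rw [e]
    simpa using this

/-- The constant function `1` as a layer function. -/
lemma LayerMesh.one {X : ℕ → ℝ} {N : ℕ} {K : ℝ} (hX : Mesh X N) (hK : 1 ≤ K)
    (hh : ∀ i < N, X (i + 1) - X i ≤ K / N) :
    LayerMesh X N 1 K (fun _ => 1) (fun _ => 1) where
  cell i hi :=
    { lt := hX.lt_succ i hi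
      A_pos := one_pos
      one_le_K := hK
      r_nonneg := zero_le_one
      r_le_one := le_rfl
      min_le := by
        rw [one_mul, mul_one]
        exact (min_le_right _ _).trans (hh i hi)
      nonneg := fun _ _ => zero_le_one
      le := fun _ _ => le_rfl
      comparable := fun _ _ _ => by rwa [mul_one] }
  cont := continuousOn_const
  int_le := by simpa using hK

/-- The size of the constants in the mesh estimates. -/
structure MeshConst (k : ℕ) (τ p κ₀ ω K : ℝ) : Prop where
  eight : 8 ≤ K
  tau : 8 * (τ / p) ≤ K
  exp : Real.exp (p + τ) ≤ K
  inv : 1 / κ₀ ≤ K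
  int : (k + 1) / p ≤ K
  omega : p / ω ≤ K

section MeshX

variable {τ p μ₀ μ₁ κ₀ ω K : ℝ} {k n N : ℕ}

/-- The argument never falls below 1/μ₀, which cancels the factor μ₀ in front of the mesh size. -/
lemma meshX_left_sub_le (hC : MeshConst k τ p κ₀ ω K) (hp : 0 < p) (hτ : 0 < τ) (hμ : 1 < μ₀)
    (hN : N = 4 * n) {i : ℕ} (hi : i < n) :
    meshX τ p μ₀ μ₁ N (i + 1) - meshX τ p μ₀ μ₁ N i ≤ K / N := by
  have h1 := (meshX_left_sub_bounds (μ₁ := μ₁) hp hτ hμ hN hi).2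
  have h2 := (layerArg_mem hμ hN (by omega) (i := i + 1) hi).1
  have h3 := layerStep_le (N := N) hμ
  have h4 := layerStep_pos (N := N) hμ (by omega)
  have hμ' : 0 < μ₀⁻¹ := by positivity
  have h5 : τ / p * (layerStep μ₀ N / layerArg μ₀ N (i + 1)) ≤ μ₀ * (K / N) := by
    calc _ ≤ τ / p * (4 / N / μ₀⁻¹) := by gcongr
      _ = μ₀ * (4 * (τ / p) / N) := by field_simp
      _ ≤ _ := by
        have := hC.tau
        have : 0 ≤ τ / p := by positivity
        gcongr
        linarith
  exact le_of_mul_le_mul_left (h1.trans h5) (by linarith)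

/-- The mesh sizes. -/
lemma meshX_sub_le (hC : MeshConst k τ p κ₀ ω K) (hp : 0 < p) (hτ : 0 < τ) (hμ₀ : 1 < μ₀)
    (hμ₁ : 1 < μ₁) (hN : N = 4 * n) (hn : 0 < n) (hσ₀ : 0 ≤ sigmaX τ p μ₀)
    (hσ₁ : 0 ≤ sigmaX τ p μ₁) {i : ℕ} (hi : i < N) :
    meshX τ p μ₀ μ₁ N (i + 1) - meshX τ p μ₀ μ₁ N i ≤ K / N := by
  have hN0 : (0 : ℝ) < N := by
    have : 0 < N := by omega
    positivity
  have h8 := hC.eight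
  rcases lt_or_ge i n with h1 | h1
  · exact meshX_left_sub_le hC hp hτ hμ₀ hN h1
  · rcases lt_or_ge i (3 * n) with h2 | h2
    · rw [meshX_middle hN hn h1 h2.le, meshX_middle hN hn (by omega) (by omega)]
      have : sigmaX τ p μ₀ + 2 * (((i + 1 : ℕ) : ℝ) / N - 1 / 4)
          * (1 - sigmaX τ p μ₀ - sigmaX τ p μ₁) - (sigmaX τ p μ₀ + 2 * ((i : ℝ) / N - 1 / 4)
          * (1 - sigmaX τ p μ₀ - sigmaX τ p μ₁))
          = 2 / N * (1 - sigmaX τ p μ₀ - sigmaX τ p μ₁) := by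
        push_cast
        field_simp
        ring
      rw [this]
      calc _ ≤ 2 / (N : ℝ) * 1 := by
            gcongr
            linarith
        _ ≤ K / N := by
          rw [mul_one]
          gcongr
          linarith
    · have h3 := meshX_left_sub_le (μ₁ := μ₀) hC hp hτ hμ₁ hN (i := N - (i + 1)) (by omega)
      rw [meshX_reflect hN hn hi.le, meshX_reflect hN hn (i := i + 1) hi]
      rw [show N - (i + 1) + 1 = N - i by omega] at h3
      linarith

lemma sigmaX_nonneg (hp : 0 < p) (hτ : 0 < τ) (hμ : 1 < μ₀) : 0 ≤ sigmaX τ p μ₀ := by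
  have := Real.log_nonneg hμ.le
  unfold sigmaX
  positivity

/-- The mesh and the layer at the left end of the interval. -/
lemma meshX_layerMesh (hC : MeshConst k τ p κ₀ ω K) (hp : 0 < p) (hτ : (k : ℝ) + 1 ≤ τ)
    (hμ₀ : 1 < μ₀) (hκ₀ : 0 < κ₀) (hκ : κ₀ * N ≤ μ₀) (hN : N = 4 * n)
    (hn : 0 < n) (hX : Mesh (meshX τ p μ₀ μ₁ N) N) :
    LayerMesh (meshX τ p μ₀ μ₁ N) N μ₀ K
      (fun i => layerFun k (p * μ₀) (meshX τ p μ₀ μ₁ N i)) (layerFun k (p * μ₀)) where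
  cell i hi := by
    have hN0 : (0 : ℝ) < N := by
      have : 0 < N := by omega
      positivity
    have hτ0 : 0 < τ := by linarith [k.cast_nonneg (α := ℝ)]
    have hq : 0 ≤ p * μ₀ := by positivity
    have h8 := hC.eight
    have hh := sub_pos.2 (hX.lt_succ i hi)
    have hρ := layerFun_pos k (p * μ₀) (meshX τ p μ₀ μ₁ N i)
    exact
      { lt := hX.lt_succ i hi
        A_pos := by linarith
        one_le_K := by linarith
        r_nonneg := hρ.le
        r_le_one := layerFun_le_one hq (hX.mem hi.le).1
        min_le := by
          rcases lt_or_ge i n with h1 | h1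
          · have hg := layerArg_mem hμ₀ hN hn h1.le
            have hg' := layerArg_mem hμ₀ hN hn (i := i + 1) h1
            have hr := layerFun_meshX_le (μ₁ := μ₁) hp hτ hμ₀ hN hn h1.le
            have hμ0 : 0 < μ₀⁻¹ := by positivity
            -- If the argument g is at most 8/N, then so is the layer function. Otherwise one step,
            -- at most 4/N, does not even halve g, and the factors g in the mesh size and in the
            -- layer function cancel.
            rcases le_total (layerArg μ₀ N i) (8 / N) with h2 | h2
            · calc _ ≤ 1 * (8 / (N : ℝ)) := by
                    gcongr
                    · exact min_le_left _ _
                    · exact hr.trans h2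
                _ ≤ K / N := by rw [one_mul]; gcongr
            · have h3 := (meshX_left_sub_bounds (μ₁ := μ₁) hp hτ0 hμ₀ hN h1).2
              have h4 := layerStep_le (N := N) hμ₀
              have h5 := layerArg_succ μ₀ N i
              have h6 := layerStep_pos (N := N) hμ₀ (by omega)
              have h7 : layerArg μ₀ N i ≤ 2 * layerArg μ₀ N (i + 1) := by
                have : (8 : ℝ) / N = 2 * (4 / N) := by ring
                linarith
              have h9 : 0 < layerArg μ₀ N (i + 1) := by linarith [hg'.1]
              calc _ ≤ τ / p * (layerStep μ₀ N / layerArg μ₀ N (i + 1))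
                      * (2 * layerArg μ₀ N (i + 1)) :=
                    mul_le_mul ((min_le_right _ _).trans h3) (hr.trans h7) hρ.le (by positivity)
                _ = 2 * (τ / p) * layerStep μ₀ N := by field_simp
                _ ≤ 2 * (τ / p) * (4 / N) := by gcongr
                _ = 8 * (τ / p) / N := by ring
                _ ≤ K / N := by
                  gcongr
                  exact hC.tau
          -- Beyond the transition point the layer function is at most 1/μ₀, which is O(1/N) because
          -- κ₀ N ≤ μ₀.
          · have h2 := layerFun_meshX_le (μ₁ := μ₁) hp hτ hμ₀ hN hn le_rfl
            rw [layerArg_quarter hN hn] at h2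
            have h3 := layerFun_anti (k := k) hq (hX.le h1 hi.le)
            calc _ ≤ 1 * μ₀⁻¹ := mul_le_mul (min_le_left _ _) (h3.trans h2) hρ.le zero_le_one
              _ ≤ (κ₀ * N)⁻¹ := by
                rw [one_mul]
                gcongr
              _ = 1 / κ₀ / N := by field_simp
              _ ≤ K / N := by
                gcongr
                exact hC.inv
        nonneg := fun x _ => (layerFun_pos k _ x).le
        le := fun x hx => layerFun_anti hq hx.1
        comparable := fun hA x hx => by
          refine (layerFun_comparable hq hx.1).trans ?_
          refine mul_le_mul_of_nonneg_right (le_trans ?_ hC.exp) (layerFun_pos k _ x).le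
          rw [Real.exp_le_exp]
          have h1 : μ₀ * (x - meshX τ p μ₀ μ₁ N i) ≤ 1 :=
            (mul_le_mul_of_nonneg_left (by linarith [hx.2]) (by linarith)).trans hA
          nlinarith }
  cont := (continuous_layerFun k _).continuousOn
  int_le := by
    have hμ : 0 < μ₀ := by linarith
    refine (integral_layerFun_sq_le k (by positivity)).trans ?_
    rw [← div_div]
    gcongr
    exact hC.int

/-- The mesh sizes near the transition point. -/
lemma meshX_transition_cells (hp : 0 < p) (hp1 : p < 1) (hτ : (k : ℝ) + 1 ≤ τ) (hμN : N ≤ μ₀)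
    (hN : N = 4 * n) (hn : 2 ≤ n) :
    1 / 3 ≤ μ₀ * (meshX τ p μ₀ μ₁ N (n - 1 + 1) - meshX τ p μ₀ μ₁ N (n - 1)) ∧
      1 / 3 ≤ μ₀ * (meshX τ p μ₀ μ₁ N (n - 2 + 1) - meshX τ p μ₀ μ₁ N (n - 2)) ∧
      √μ₀ * (meshX τ p μ₀ μ₁ N (n - 1 + 1) - meshX τ p μ₀ μ₁ N (n - 1)) ≤ 2 * (τ / p) ∧
      μ₀ * (meshX τ p μ₀ μ₁ N (n - 2 + 1) - meshX τ p μ₀ μ₁ N (n - 2)) ≤ τ / p ∧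
      μ₀⁻¹ ≤ layerStep μ₀ N ∧ layerArg μ₀ N (n - 1) = μ₀⁻¹ + layerStep μ₀ N := by
  have hn0 : 0 < n := by omega
  have hN8 : 8 ≤ N := by omega
  have hN8' : (8 : ℝ) ≤ N := by exact_mod_cast hN8
  have hN0 : (0 : ℝ) < N := by linarith
  have hμ₁ : 1 < μ₀ := by linarith
  have hμ0 : 0 < μ₀ := by linarith
  have hτ0 : 0 < τ := by linarith [k.cast_nonneg (α := ℝ)]
  have hτ1 : 1 ≤ τ := by linarith [k.cast_nonneg (α := ℝ)]
  have hτp : 1 ≤ τ / p := by rw [one_le_div hp]; linarith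
  have hgn : layerArg μ₀ N (n - 1 + 1) = μ₀⁻¹ := by
    rw [Nat.sub_add_cancel (by omega), layerArg_quarter hN hn0]
  have hgn1 : layerArg μ₀ N (n - 1) = μ₀⁻¹ + layerStep μ₀ N := by
    have := layerArg_succ μ₀ N (n - 1)
    linarith
  have hgn1' : layerArg μ₀ N (n - 2 + 1) = μ₀⁻¹ + layerStep μ₀ N := by
    rw [show n - 2 + 1 = n - 1 by omega, hgn1]
  have hgn2 : layerArg μ₀ N (n - 2) = μ₀⁻¹ + 2 * layerStep μ₀ N := by
    have := layerArg_succ μ₀ N (n - 2)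
    linarith
  have b1 := (meshX_left_sub_bounds (μ₁ := μ₁) hp hτ0 hμ₁ hN (i := n - 1) (by omega)).1
  have b2 := meshX_left_sub_bounds (μ₁ := μ₁) hp hτ0 hμ₁ hN (i := n - 2) (by omega)
  have b3 := meshX_left_sub (τ := τ) (p := p) (μ₁ := μ₁) hμ₁ hN (i := n - 1) (by omega)
  rw [hgn1] at b1
  rw [hgn1', hgn2] at b2
  rw [hgn1, hgn] at b3
  have hd4 : layerStep μ₀ N ≤ 4 / N := layerStep_le hμ₁
  have h4N : (4 : ℝ) / N ≤ 1 / 2 := by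
    rw [div_le_div_iff₀ hN0 two_pos]
    linarith
  -- Equivalent to N ≤ 4(μ₀ - 1), which follows from μ₀ ≥ N ≥ 8. So near the transition point the
  -- step dominates the last argument 1/μ₀.
  have hdμ : 1 ≤ layerStep μ₀ N * μ₀ := by
    have : layerStep μ₀ N * μ₀ = 4 * (μ₀ - 1) / N := by rw [layerStep]; field_simp
    rw [this, one_le_div hN0]
    linarith
  have hd0 : 0 < layerStep μ₀ N := layerStep_pos hμ₁ (by omega)
  generalize layerStep μ₀ N = d at *
  have hμi : 0 < μ₀⁻¹ := by positivity
  have hμid : μ₀⁻¹ ≤ d := by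
    rw [inv_le_iff_one_le_mul₀ hμ0]
    linarith
  have e1 : 1 / 3 ≤ d / (μ₀⁻¹ + d) := by
    rw [div_le_div_iff₀ (by norm_num) (by positivity)]
    linarith
  have e2 : 1 / 3 ≤ d / (μ₀⁻¹ + 2 * d) := by
    rw [div_le_div_iff₀ (by norm_num) (by positivity)]
    linarith
  have e3 : d / (μ₀⁻¹ + d) ≤ 1 := by
    rw [div_le_one (by positivity)]
    linarith
  refine ⟨?_, ?_, ?_, ?_, hμid, hgn1⟩
  · refine le_trans ?_ b1
    calc (1 : ℝ) / 3 = 1 * (1 / 3) := by ring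
      _ ≤ _ := by gcongr
  · refine le_trans ?_ b2.1
    calc (1 : ℝ) / 3 = 1 * (1 / 3) := by ring
      _ ≤ _ := by gcongr
  · rw [b3]
    have h1 : (μ₀⁻¹ + d) / μ₀⁻¹ ≤ μ₀ := by
      rw [div_le_iff₀ hμi, mul_inv_cancel₀ hμ0.ne']
      have : μ₀⁻¹ ≤ 1 / 2 := by
        rw [inv_le_comm₀ hμ0 (by norm_num)]
        linarith
      linarith
    -- The width of the last layer cell is of order log(1 + d μ₀)/μ₀, which no multiple of 1/μ₀
    -- bounds uniformly. Since log μ₀ = 2 log √μ₀ ≤ 2√μ₀, it is still O(1/√μ₀).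
    have h2 : Real.log ((μ₀⁻¹ + d) / μ₀⁻¹) ≤ 2 * √μ₀ := by
      refine (Real.log_le_log (by positivity) h1).trans ?_
      have h3 := Real.log_le_sub_one_of_pos (Real.sqrt_pos.2 hμ0)
      rw [Real.log_sqrt hμ0.le] at h3
      linarith
    calc _ ≤ √μ₀ * (τ / (p * μ₀) * (2 * √μ₀)) := by gcongr
      _ = 2 * (τ / p) * (√μ₀ * √μ₀ / μ₀) := by field_simp
      _ = 2 * (τ / p) := by rw [Real.mul_self_sqrt hμ0.le, div_self hμ0.ne', mul_one]
  · refine b2.2.trans ?_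
    calc _ ≤ τ / p * 1 := by gcongr
      _ = τ / p := mul_one _

/-- The mesh is fine with respect to the layer away from the transition point. -/
lemma meshX_fine (hp : 0 < p) (hτ : (k : ℝ) + 1 ≤ τ) (hμ₀ : 1 < μ₀) (hN : N = 4 * n)
    (hg : μ₀⁻¹ ≤ layerStep μ₀ N) {l : ℕ} (hl : l + 1 < n) :
    μ₀ * (meshX τ p μ₀ μ₁ N (l + 1) - meshX τ p μ₀ μ₁ N l)
        * layerFun k (p * μ₀) (meshX τ p μ₀ μ₁ N l) ≤ 8 * (τ / p) / N ∧
      ∀ x ∈ Icc (meshX τ p μ₀ μ₁ N l) (meshX τ p μ₀ μ₁ N (l + 1)),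
        layerFun k (p * μ₀) (meshX τ p μ₀ μ₁ N l)
          ≤ Real.exp (p + τ) * layerFun k (p * μ₀) x := by
  have hn0 : 0 < n := by omega
  have hμ0 : 0 < μ₀ := by linarith
  have hμi : 0 < μ₀⁻¹ := by positivity
  have hτ0 : 0 < τ := by linarith [k.cast_nonneg (α := ℝ)]
  have hq : 0 ≤ p * μ₀ := by positivity
  have hb := (meshX_left_sub_bounds (μ₁ := μ₁) hp hτ0 hμ₀ hN (i := l) (by omega)).2
  have hr := layerFun_meshX_le (k := k) (μ₁ := μ₁) hp hτ hμ₀ hN hn0 (i := l) (by omega)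
  have hρ := layerFun_pos k (p * μ₀) (meshX τ p μ₀ μ₁ N l)
  have hs := layerArg_succ μ₀ N l
  have hs' := layerArg_succ μ₀ N (l + 1)
  have hmem := (layerArg_mem hμ₀ hN hn0 (i := l + 1 + 1) hl).1
  have hd4 : layerStep μ₀ N ≤ 4 / N := layerStep_le hμ₀
  have hd0 : 0 < layerStep μ₀ N := layerStep_pos hμ₀ (by omega)
  generalize layerArg μ₀ N (l + 1) = g at *
  generalize layerStep μ₀ N = d at *
  -- At least one further step to the right is possible, so the argument at l + 1 is at least `d`
  -- and the argument at l at most twice as large. This fails for the cell next to the transition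
  -- point, which is excluded.
  have hg0 : d ≤ g := by linarith
  have hgp : 0 < g := by linarith
  constructor
  · calc _ ≤ τ / p * (d / g) * (2 * g) := mul_le_mul hb (by linarith) hρ.le (by positivity)
      _ = 2 * (τ / p) * d := by field_simp
      _ ≤ 2 * (τ / p) * (4 / N) := by gcongr
      _ = 8 * (τ / p) / N := by ring
  · intro x hx
    refine (layerFun_comparable hq hx.1).trans ?_
    refine mul_le_mul_of_nonneg_right ?_ (layerFun_pos k _ _).le
    rw [Real.exp_le_exp]
    have h2 : d / g ≤ 1 := by rwa [div_le_one hgp]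
    calc _ ≤ p * (μ₀ * (meshX τ p μ₀ μ₁ N (l + 1) - meshX τ p μ₀ μ₁ N l)) := by
          rw [← mul_assoc]
          gcongr
          exact hx.2
      _ ≤ p * (τ / p * 1) := mul_le_mul_of_nonneg_left
        (hb.trans (mul_le_mul_of_nonneg_left h2 (by positivity))) hp.le
      _ = τ := by field_simp
      _ ≤ p + τ := by linarith

/-- The size of the first and the last cell of a mesh with two equal layers. -/
lemma meshX_end (hp : 0 < p) (hτ : (k : ℝ) + 1 ≤ τ) (hμ₀ : 1 < μ₀) (hω : ω ≤ 1 - μ₀⁻¹)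
    (hN : N = 4 * n) (hn : 2 ≤ n) {j : ℕ} (hj : j < N) (h : j = 0 ∨ j + 1 = N) :
    τ / p * (4 * ω / N) ≤ μ₀ * (meshX τ p μ₀ μ₀ N (j + 1) - meshX τ p μ₀ μ₀ N j) ∧
      μ₀ * (meshX τ p μ₀ μ₀ N (j + 1) - meshX τ p μ₀ μ₀ N j) ≤ τ / p := by
  have hn0 : 0 < n := by omega
  have hN8 : 8 ≤ N := by omega
  have hN8' : (8 : ℝ) ≤ N := by exact_mod_cast hN8
  have hτ0 : 0 < τ := by linarith [k.cast_nonneg (α := ℝ)]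
  have e : meshX τ p μ₀ μ₀ N (j + 1) - meshX τ p μ₀ μ₀ N j
      = meshX τ p μ₀ μ₀ N (0 + 1) - meshX τ p μ₀ μ₀ N 0 := by
    rcases h with rfl | h
    · rfl
    · rw [meshX_reflect hN hn0 hj.le, meshX_reflect hN hn0 (i := j + 1) hj,
        show N - j = 0 + 1 by omega, show N - (j + 1) = 0 by omega]
      ring
  have bY := meshX_left_sub_bounds (μ₁ := μ₀) hp hτ0 hμ₀ hN (i := 0) (by omega)
  rw [layerArg_succ, layerArg_zero, div_one, ← e] at bY
  have hd4 : layerStep μ₀ N ≤ 4 / N := layerStep_le hμ₀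
  have h4N : (4 : ℝ) / N ≤ 1 / 2 := by
    rw [div_le_div_iff₀ (by linarith) two_pos]
    linarith
  constructor
  · refine le_trans ?_ bY.1
    unfold layerStep
    gcongr
  · refine bY.2.trans ?_
    have h1 : layerStep μ₀ N / (1 - layerStep μ₀ N) ≤ 1 := by
      rw [div_le_one (by linarith)]
      linarith
    calc _ ≤ τ / p * 1 := by gcongr
      _ = τ / p := mul_one _

end MeshX

/-- The mesh near the transition point to the layer at the right end of the interval. -/
lemma meshX_transition {τ p δ μ₀ μ₁ κ₀ ω κ₀' ω' B K : ℝ} {k n N : ℕ}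
    (hC : MeshConst k τ p κ₀ ω K) (hC' : MeshConst k τ δ κ₀' ω' K)
    (hp : 0 < p) (hp1 : p < 1) (hδ : 0 < δ) (hτ : (k : ℝ) + 1 ≤ τ) (hμN : N ≤ μ₁)
    (hN : N = 4 * n) (hn : 2 ≤ n) (hB : 1 < B) (hω : 0 < ω') (hBω : ω' ≤ 1 - B⁻¹)
    (hratio : 1 / B ≤ K / √μ₁) :
    Transition (meshX τ p μ₀ μ₁ N) (meshX τ δ B B N) N (3 * n) μ₁ B K
      (fun i => layerFun k (p * μ₁) (meshX τ p μ₁ μ₀ N (N - 1 - i)))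
      (fun x => layerFun k (p * μ₁) (1 - x)) := by
  have hn0 : 0 < n := by omega
  have hN8 : 8 ≤ N := by omega
  have hN8' : (8 : ℝ) ≤ N := by exact_mod_cast hN8
  have hN0 : (0 : ℝ) < N := by linarith
  have hμ₁ : 1 < μ₁ := by linarith
  have hμ0 : 0 < μ₁ := by linarith
  have hB0 : 0 < B := by linarith
  have hτ0 : 0 < τ := by linarith [k.cast_nonneg (α := ℝ)]
  have hτ1 : 1 ≤ τ := by linarith [k.cast_nonneg (α := ℝ)]
  have hτp : 0 < τ / p := by positivity
  have hτδ : 0 < τ / δ := by positivity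
  have h8 := hC.eight
  have htau := hC.tau
  have htau' := hC'.tau
  have hq : 0 ≤ p * μ₁ := by positivity
  have hrefl : ∀ i ≤ N, meshX τ p μ₀ μ₁ N i = 1 - meshX τ p μ₁ μ₀ N (N - i) :=
    fun i hi => meshX_reflect hN hn0 hi
  have hcell : ∀ i < N, meshX τ p μ₀ μ₁ N (i + 1) - meshX τ p μ₀ μ₁ N i
      = meshX τ p μ₁ μ₀ N (N - 1 - i + 1) - meshX τ p μ₁ μ₀ N (N - 1 - i) := fun i hi => by
    rw [hrefl i hi.le, hrefl (i + 1) hi, show N - 1 - i + 1 = N - i by omega,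
      show N - 1 - i = N - (i + 1) by omega]
    ring
  obtain ⟨t1, t2, t3, t4, t5, t6⟩ := meshX_transition_cells (μ₁ := μ₀) hp hp1 hτ hμN hN hn
  have hcm := hcell (3 * n) (by omega)
  have hcm1 := hcell (3 * n + 1) (by omega)
  rw [show N - 1 - 3 * n = n - 1 by omega] at hcm
  rw [show N - 1 - (3 * n + 1) = n - 2 by omega] at hcm1
  rw [← hcm] at t1 t3
  rw [← hcm1] at t2 t4
  have hsq : 0 < √μ₁ := Real.sqrt_pos.2 hμ0
  have hsq1 : 1 ≤ √μ₁ := by rw [Real.one_le_sqrt]; exact hμ₁.le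
  have hright : ∀ i ≤ N, ∀ x, x ≤ meshX τ p μ₀ μ₁ N i →
      meshX τ p μ₁ μ₀ N (N - i) ≤ 1 - x := fun i hi x hx => by
    have := hrefl i hi
    linarith
  have h4 : layerStep μ₁ N ≤ 4 / N := layerStep_le hμ₁
  have hup : ∀ i, i = 3 * n ∨ i = 3 * n + 1 →
      meshX τ p μ₀ μ₁ N (i + 1) - meshX τ p μ₀ μ₁ N i ≤ K / N := by
    intro i hi
    rw [hcell i (by omega)]
    exact meshX_left_sub_le hC hp hτ0 hμ₁ hN (by omega)
  refine ⟨by omega, hμ₁.le, hB0, ?_, hup, ?_, ?_, ?_, ?_, ?_, ?_, ?_, hratio⟩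
  · rintro i (rfl | rfl) <;> rw [mul_assoc] <;> nlinarith
  · rw [le_div_iff₀ hsq, mul_comm]
    linarith
  · rw [le_div_iff₀ hμ0, mul_comm]
    linarith
  · intro x hx
    have h1 := hright (3 * n) (by omega) x hx.2
    rw [show N - 3 * n = n by omega] at h1
    -- The transition point is the reflection of node n, where the argument is 1/μ₁ ≤ 1/N.
    have h2 := layerFun_meshX_le (k := k) (μ₁ := μ₀) hp hτ hμ₁ hN hn0 le_rfl
    rw [layerArg_quarter hN hn0] at h2
    have h3 := (layerFun_anti (k := k) hq h1).trans h2
    refine ⟨by rwa [one_div], h3.trans ?_⟩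
    calc μ₁⁻¹ ≤ (N : ℝ)⁻¹ := by gcongr
      _ = 1 / N := by rw [one_div]
      _ ≤ K / N := by
        gcongr
        linarith
  · intro x hx
    have h1 := hright (3 * n + 1) (by omega) x hx.2
    rw [show N - (3 * n + 1) = n - 1 by omega] at h1
    -- The right end of the critical cell is the reflection of node n - 1, where the argument is
    -- 1/μ₁ + d ≤ 2d ≤ 8/N.
    have h2 := layerFun_meshX_le (k := k) (μ₁ := μ₀) hp hτ hμ₁ hN hn0 (i := n - 1) (by omega)
    refine ((layerFun_anti (k := k) hq h1).trans h2).trans ?_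
    calc _ ≤ 2 * (4 / (N : ℝ)) := by linarith
      _ = 8 / N := by ring
      _ ≤ K / N := by gcongr
  · intro i hi hiN
    have hf := meshX_fine (μ₁ := μ₀) hp hτ hμ₁ hN t5 (l := N - 1 - i) (by omega)
    rw [hcell i hiN]
    refine ⟨hf.1.trans (by gcongr), fun x hx => ?_⟩
    refine (hf.2 (1 - x) ?_).trans
      (mul_le_mul_of_nonneg_right hC.exp (layerFun_pos k _ _).le)
    rw [hrefl i hiN.le, hrefl (i + 1) hiN] at hx
    rw [show N - 1 - i + 1 = N - i by omega, show N - 1 - i = N - (i + 1) by omega]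
    constructor <;> linarith [hx.1, hx.2]
  · intro j hj h
    have hend := (meshX_end hδ hτ hB hBω hN hn hj h).1
    rw [mul_assoc]
    -- The middle expression equals 4τ, which is at least 1; the factor δ/ω' is then absorbed in K.
    calc (1 : ℝ) ≤ δ / ω' * N * (τ / δ * (4 * ω' / N)) := by
            have : δ / ω' * N * (τ / δ * (4 * ω' / N)) = 4 * τ := by field_simp
            linarith
      _ ≤ _ := by
        have := hC'.omega
        gcongr
  · intro j hj h
    have hend := (meshX_end hδ hτ hB hBω hN hn hj h).2
    rw [le_div_iff₀ hB0, mul_comm]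
    linarith

end BakhvalovFEM
end

noncomputable section
namespace BakhvalovFEM

/-! ### The interpolant belongs to the finite element space -/

section Interpolant

variable {X Y : ℕ → ℝ} {N k m : ℕ} {v w : ℝ × ℝ → ℝ} {z : ℝ × ℝ}

lemma exists_cell (hX : Mesh X N) (hY : Mesh Y N) (hN : 0 < N) (hz : z ∈ closedSquare) :
    ∃ i < N, ∃ j < N, z ∈ cell X Y i j := by
  obtain ⟨i, hi, h1⟩ := hX.exists_cell hz.1 hN
  obtain ⟨j, hj, h2⟩ := hY.exists_cell hz.2 hN
  exact ⟨i, hi, j, hj, h1, h2⟩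

lemma interp_eq_sum (hX : Mesh X N) (hY : Mesh Y N) (hk : 1 ≤ k) {i j : ℕ} (hi : i < N)
    (hj : j < N) (hz : z ∈ cell X Y i j) (v : ℝ × ℝ → ℝ) :
    interp X Y N k v z = ∑ s ∈ Finset.range (k + 1), ∑ t ∈ Finset.range (k + 1),
      v (cellNode (X i) (X (i + 1)) k s, cellNode (Y j) (Y (j + 1)) k t)
        * (cellPoly (X i) (X (i + 1)) k s).eval z.1 * (cellPoly (Y j) (Y (j + 1)) k t).eval z.2 := by
  have := interp_on_cell hX hY hk v hi hj hz.1 hz.2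
  rwa [tensorInterp_eq_sum, Prod.mk.eta] at this

lemma interp_congr (hX : Mesh X N) (hY : Mesh Y N) (hk : 1 ≤ k) (hN : 0 < N)
    (h : EqOn v w closedSquare) (hz : z ∈ closedSquare) :
    interp X Y N k v z = interp X Y N k w z := by
  obtain ⟨i, hi, j, hj, hz⟩ := exists_cell hX hY hN hz
  rw [interp_eq_sum hX hY hk hi hj hz, interp_eq_sum hX hY hk hi hj hz]
  refine Finset.sum_congr rfl fun s hs => Finset.sum_congr rfl fun t ht => ?_
  rw [h ⟨hX.cell_subset hi (cellNode_mem (hX.lt_succ i hi) hk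
    (Nat.lt_succ_iff.1 (Finset.mem_range.1 hs))), hY.cell_subset hj
    (cellNode_mem (hY.lt_succ j hj) hk (Nat.lt_succ_iff.1 (Finset.mem_range.1 ht)))⟩]

lemma interp_add (hX : Mesh X N) (hY : Mesh Y N) (hk : 1 ≤ k) (hN : 0 < N)
    (hz : z ∈ closedSquare) :
    interp X Y N k (fun z => v z + w z) z = interp X Y N k v z + interp X Y N k w z := by
  obtain ⟨i, hi, j, hj, hz⟩ := exists_cell hX hY hN hz
  simp only [interp_eq_sum hX hY hk hi hj hz, ← Finset.sum_add_distrib, add_mul]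

lemma cellInterp_eval_left {a b : ℝ} (hab : a < b) (hk : 1 ≤ k) (g : ℝ → ℝ) :
    (cellInterp a b k g).eval a = g a := by
  have := cellInterp_eval_node hab hk g (Nat.zero_le k)
  rwa [cellNode_zero] at this

lemma cellInterp_eval_right {a b : ℝ} (hab : a < b) (hk : 1 ≤ k) (g : ℝ → ℝ) :
    (cellInterp a b k g).eval b = g b := by
  have := cellInterp_eval_node hab hk g le_rfl
  rwa [cellNode_last a b hk] at this

lemma not_mem_openSquare (hz : z ∈ closedSquare \ openSquare) :
    (z.1 = 0 ∨ z.1 = 1) ∨ (z.2 = 0 ∨ z.2 = 1) := by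
  by_contra h
  push Not at h
  obtain ⟨⟨h1, h2⟩, h3, h4⟩ := h
  exact hz.2 ⟨⟨hz.1.1.1.lt_of_ne h1.symm, hz.1.1.2.lt_of_ne h2⟩,
    hz.1.2.1.lt_of_ne h3.symm, hz.1.2.2.lt_of_ne h4⟩

lemma mem_boundary {x y : ℝ} (hx : x ∈ Icc (0 : ℝ) 1) (hy : y ∈ Icc (0 : ℝ) 1)
    (h : (x = 0 ∨ x = 1) ∨ (y = 0 ∨ y = 1)) : (x, y) ∈ closedSquare \ openSquare := by
  refine ⟨⟨hx, hy⟩, fun h' => ?_⟩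
  obtain ⟨⟨h1, h2⟩, h3, h4⟩ := h'
  rcases h with (h | h) | (h | h) <;> simp_all

/-- The first and the last cell contain the end points. -/
lemma Mesh.exists_end_cell (hX : Mesh X N) (hN : 0 < N) {x : ℝ} (hx : x = 0 ∨ x = 1) :
    ∃ i < N, x ∈ Icc (X i) (X (i + 1)) ∧ ((i = 0 ∧ X i = x) ∨ (i + 1 = N ∧ X (i + 1) = x)) := by
  rcases hx with rfl | rfl
  · exact ⟨0, hN, ⟨hX.zero.le, hX.zero ▸ (hX.lt_succ 0 hN).le⟩, Or.inl ⟨rfl, hX.zero⟩⟩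
  · obtain ⟨n, rfl⟩ : ∃ n, N = n + 1 := ⟨N - 1, by omega⟩
    exact ⟨n, by omega, ⟨hX.last ▸ (hX.lt_succ n (by omega)).le, hX.last.ge⟩,
      Or.inr ⟨rfl, hX.last⟩⟩

/-- Interpolation at the end points is exact. -/
lemma Mesh.cellInterp_end (hX : Mesh X N) (hk : 1 ≤ k) {i : ℕ} (hi : i < N) {x : ℝ}
    (h : (i = 0 ∧ X i = x) ∨ (i + 1 = N ∧ X (i + 1) = x)) (g : ℝ → ℝ) :
    (cellInterp (X i) (X (i + 1)) k g).eval x = g x := by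
  rcases h with ⟨_, rfl⟩ | ⟨_, rfl⟩
  · exact cellInterp_eval_left (hX.lt_succ i hi) hk g
  · exact cellInterp_eval_right (hX.lt_succ i hi) hk g

/-- On a side of the square the interpolant reduces to the one-dimensional interpolant of the values
of `v` on that side. -/
lemma interp_boundary (hX : Mesh X N) (hY : Mesh Y N) (hk : 1 ≤ k) (hN : 0 < N)
    (hv : ∀ z ∈ closedSquare \ openSquare, v z = 0) (hz : z ∈ closedSquare \ openSquare) :
    interp X Y N k v z = 0 := by
  obtain ⟨x, y⟩ := z
  obtain ⟨i, hi, j, hj, hzc⟩ := exists_cell hX hY hN hz.1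
  rcases not_mem_openSquare hz with h | h
  · obtain ⟨i, hi, hxi, hend⟩ := hX.exists_end_cell hN h
    rw [interp_on_cell hX hY hk v hi hj hxi hzc.2, tensorInterp, hX.cellInterp_end hk hi hend,
      cellInterp_eval]
    refine Finset.sum_eq_zero fun t ht => ?_
    rw [hv _ (mem_boundary hz.1.1 (hY.cell_subset hj (cellNode_mem (hY.lt_succ j hj) hk
      (Nat.lt_succ_iff.1 (Finset.mem_range.1 ht)))) (Or.inl h)), zero_mul]
  · obtain ⟨j, hj, hyj, hend⟩ := hY.exists_end_cell hN h
    rw [interp_on_cell hX hY hk v hi hj hzc.1 hyj, tensorInterp_flip, tensorInterp,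
      hY.cellInterp_end hk hj hend, cellInterp_eval]
    refine Finset.sum_eq_zero fun t ht => ?_
    rw [hv _ (mem_boundary (hX.cell_subset hi (cellNode_mem (hX.lt_succ i hi) hk
      (Nat.lt_succ_iff.1 (Finset.mem_range.1 ht)))) hz.1.2 (Or.inr h)), zero_mul]

/-- On the vertical sides the strip functions vanish, since the two strip cells do not reach the
sides with a nonzero value. On the horizontal sides the factors of P and Θ in y coincide. Hence Πu
inherits the zero boundary values of u^I. -/
lemma opP_sub_opTheta_boundary (hX : Mesh X N) (hY : Mesh Y N) (hk : 1 ≤ k) (hN : 8 ≤ N)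
    (E : ℝ × ℝ → ℝ) (hz : z ∈ closedSquare \ openSquare) :
    opP X Y N k E z - opTheta X Y N k E z = 0 := by
  have hN0 : 0 < N := by omega
  have hm : 3 * (N / 4) < N := by omega
  have hm0 : 0 < 3 * (N / 4) := by omega
  rw [opP_eq, opTheta_eq, stripFun, stripFun, ← Finset.sum_sub_distrib]
  refine Finset.sum_eq_zero fun s hs => ?_
  rw [← mul_sub]
  rcases not_mem_openSquare hz with h | h
  · obtain ⟨i, hi, hxi, hend⟩ := hX.exists_end_cell hN0 h
    have : basis1 X N k (3 * (N / 4)) s z.1 = 0 := by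
      rw [basis1_on_cell hX hk hm hs hi hxi]
      rcases hend with ⟨h0, _⟩ | ⟨h1, h1'⟩
      · rw [if_neg (by omega), if_neg (by omega)]
      · rw [if_neg (by omega), ← h1', cellPoly_right (hX.lt_succ i hi) hk,
          if_neg (by omega : ¬0 = k), ite_self]
    rw [this, zero_mul]
  · obtain ⟨j, hj, hyj, hend⟩ := hY.exists_end_cell hN0 h
    set g : ℝ → ℝ := fun y => E (node X k (3 * (N / 4)) s, y)
    have h1 : fullPart Y N k g z.2 = g z.2 :=
      (sum_basis1 hY hk g hj hyj).trans (hY.cellInterp_end hk hj hend g)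
    have h2 : endPart Y N k g z.2 = g z.2 := by
      rw [endPart]
      rcases h with h | h <;> rw [h]
      · rw [(basis1_at_node_zero hY hk hN0).1, (basis1_at_node_zero hY hk hN0).2, hY.zero]
        ring
      · rw [(basis1_at_node_one hY hk hN0).1, (basis1_at_node_one hY hk hN0).2, hY.last]
        ring
    rw [h1, h2, sub_self, mul_zero]

end Interpolant

/-! ### Functions which agree on the closed square -/

section Congr

variable {v w χ : ℝ × ℝ → ℝ} {ε₁ ε₂ : ℝ} {b c : ℝ → ℝ}

lemma dx_congr (h : EqOn v w closedSquare) {z : ℝ × ℝ} (hz : z ∈ openSquare) : dx v z = dx w z := by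
  refine Filter.EventuallyEq.deriv_eq ?_
  filter_upwards [isOpen_Ioo.mem_nhds hz.1] with x hx
  exact h (openSquare_subset ⟨hx, hz.2⟩)

lemma dy_congr (h : EqOn v w closedSquare) {z : ℝ × ℝ} (hz : z ∈ openSquare) : dy v z = dy w z := by
  refine Filter.EventuallyEq.deriv_eq ?_
  filter_upwards [isOpen_Ioo.mem_nhds hz.2] with y hy
  exact h (openSquare_subset ⟨hz.1, hy⟩)

lemma energyNorm_congr (h : EqOn v w closedSquare) : energyNorm ε₁ v = energyNorm ε₁ w := by
  unfold energyNorm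
  refine congrArg Real.sqrt (congrArg₂ (· + ·) (congrArg (ε₁ * ·) ?_) ?_)
  · exact setIntegral_congr_fun measurableSet_openSquare fun z hz => by
      simp only [dx_congr h hz, dy_congr h hz]
  · exact setIntegral_congr_fun measurableSet_openSquare fun z hz => by
      simp only [h (openSquare_subset hz)]

lemma bilin_congr (h : EqOn v w closedSquare) :
    bilin ε₁ ε₂ b c v χ = bilin ε₁ ε₂ b c w χ := by
  unfold bilin
  refine congrArg₂ (· + ·) (congrArg (ε₁ * ·) ?_) ?_
  · exact setIntegral_congr_fun measurableSet_openSquare fun z hz => by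
      simp only [dx_congr h hz, dy_congr h hz]
  · exact setIntegral_congr_fun measurableSet_openSquare fun z hz => by
      simp only [dx_congr h hz, h (openSquare_subset hz)]

end Congr

end BakhvalovFEM
end

noncomputable section
namespace BakhvalovFEM

/-! ### The error of the finite element method in terms of the interpolation errors -/

section Errors

variable {X Y : ℕ → ℝ} {N k : ℕ} {ε₁ ε₂ T T' : ℝ} {v w : ℝ × ℝ → ℝ}

/-- A bound of the energy norm of `w`. -/
structure SumError (X Y : ℕ → ℝ) (N : ℕ) (ε₁ T : ℝ) (w : ℝ × ℝ → ℝ) : Prop where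
  pw : PW X Y N w
  le : sumNorm ε₁ w ≤ T

/-- The bounds of an error whose convective term is estimated directly. -/
structure DirectError (X Y : ℕ → ℝ) (N : ℕ) (ε₁ ε₂ T : ℝ) (w : ℝ × ℝ → ℝ) : Prop
    extends SumError X Y N ε₁ T w where
  conv : ε₂ * nrm (dx w) ≤ T

/-- The bounds of an error whose convective term is estimated after integration by parts. -/
structure WeakError (X Y : ℕ → ℝ) (N : ℕ) (ε₁ ε₂ T : ℝ) (w : ℝ × ℝ → ℝ) : Prop
    extends SumError X Y N ε₁ T w where
  inv : ε₂ * (nrm w / √ε₁) ≤ T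
  low : ε₂ * nrm w ≤ T

lemma SumError.add (hX : Mesh X N) (hY : Mesh Y N) (hN : 0 < N) (hv : SumError X Y N ε₁ T v)
    (hw : SumError X Y N ε₁ T' w) : SumError X Y N ε₁ (T + T') (fun z => v z + w z) :=
  ⟨hv.pw.add hw.pw, (sumNorm_add_le hv.pw hw.pw hX hY hN).trans (add_le_add hv.le hw.le)⟩

lemma sumNorm_neg (ε₁ : ℝ) (w : ℝ × ℝ → ℝ) : sumNorm ε₁ (fun z => -w z) = sumNorm ε₁ w := by
  have h1 : dx (fun z => -w z) = fun z => -dx w z := by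
    ext z
    exact deriv.fun_neg
  have h2 : dy (fun z => -w z) = fun z => -dy w z := by
    ext z
    exact deriv.fun_neg
  rw [sumNorm, sumNorm, h1, h2, nrm_neg, nrm_neg, nrm_neg]

lemma PW.neg (h : PW X Y N w) : PW X Y N (fun z => -w z) :=
  ⟨h.cont.neg, fun i hi j hj => (h.smooth i hi j hj).neg⟩

lemma SumError.neg (h : SumError X Y N ε₁ T w) : SumError X Y N ε₁ T (fun z => -w z) :=
  ⟨h.pw.neg, (sumNorm_neg ε₁ w).le.trans h.le⟩

lemma DirectError.add (hX : Mesh X N) (hY : Mesh Y N) (hN : 0 < N) (hε₂ : 0 ≤ ε₂)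
    (hv : DirectError X Y N ε₁ ε₂ T v) (hw : DirectError X Y N ε₁ ε₂ T' w) :
    DirectError X Y N ε₁ ε₂ (T + T') (fun z => v z + w z) where
  toSumError := hv.toSumError.add hX hY hN hw.toSumError
  conv := by
    rw [nrm_congr (hv.pw.dx_add hw.pw hX hY hN)]
    have := mul_le_mul_of_nonneg_left
      (nrm_add_le (hv.pw.L2_dx hX hY hN) (hw.pw.L2_dx hX hY hN)) hε₂
    linarith [hv.conv, hw.conv]

lemma WeakError.add (hX : Mesh X N) (hY : Mesh Y N) (hN : 0 < N) (hε₂ : 0 ≤ ε₂)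
    (hv : WeakError X Y N ε₁ ε₂ T v) (hw : WeakError X Y N ε₁ ε₂ T' w) :
    WeakError X Y N ε₁ ε₂ (T + T') (fun z => v z + w z) where
  toSumError := hv.toSumError.add hX hY hN hw.toSumError
  inv := by
    have h1 := nrm_add_le (hv.pw.L2 hX hY hN) (hw.pw.L2 hX hY hN)
    have h2 := mul_le_mul_of_nonneg_left (div_le_div_of_nonneg_right h1 (Real.sqrt_nonneg ε₁)) hε₂
    rw [add_div] at h2
    linarith [hv.inv, hw.inv]
  low := by
    have := mul_le_mul_of_nonneg_left (nrm_add_le (hv.pw.L2 hX hY hN) (hw.pw.L2 hX hY hN)) hε₂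
    linarith [hv.low, hw.low]

/-- A crude triangle inequality obtained through `sumNorm`, whose three terms are each at most the
energy norm; hence the factor 3. -/
lemma energyNorm_add_le (hX : Mesh X N) (hY : Mesh Y N) (hN : 0 < N) (hε : 0 ≤ ε₁)
    (hv : PW X Y N v) (hw : SumError X Y N ε₁ T w) :
    energyNorm ε₁ (fun z => v z + w z) ≤ 3 * energyNorm ε₁ v + T := by
  have hs := hv.add hw.pw
  have h1 := energyNorm_le_sumNorm hε (hs.L2_dx hX hY hN) (hs.L2_dy hX hY hN)
  have h2 := sumNorm_add_le (ε₁ := ε₁) hv hw.pw hX hY hN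
  obtain ⟨n1, n2, n3⟩ := nrm_le_energyNorm hε (hv.L2_dx hX hY hN) (hv.L2_dy hX hY hN)
  have h3 : sumNorm ε₁ v ≤ 3 * energyNorm ε₁ v := by
    unfold sumNorm
    linarith
  linarith [hw.le]

/-- The error estimate for the difference of a finite element function and the finite element
solution. -/
lemma energy_estimate {b c : ℝ → ℝ} {f u uN e e' : ℝ × ℝ → ℝ} {Bb Bb' Bc γ : ℝ}
    (hX : Mesh X N) (hY : Mesh Y N) (hN : 0 < N)
    (hb : ContDiffOn ℝ 1 b (Icc 0 1)) (hc : ContinuousOn c (Icc 0 1)) (hε : 0 < ε₁)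
    (hε₂ : 0 ≤ ε₂) (hBb : ∀ x ∈ Icc (0 : ℝ) 1, |b x| ≤ Bb)
    (hBb' : ∀ x ∈ Icc (0 : ℝ) 1, |derivWithin b (Icc 0 1) x| ≤ Bb')
    (hBc : ∀ x ∈ Icc (0 : ℝ) 1, |c x| ≤ Bc) (hγ : 0 < γ)
    (hcoer : ∀ x ∈ Icc (0 : ℝ) 1, γ ≤ c x - 1 / 2 * ε₂ * derivWithin b (Icc 0 1) x)
    (hu : ContDiffOn ℝ 2 u closedSquare) (hsol : IsSolution ε₁ ε₂ b c f u)
    (huN : IsFESolution k N X Y ε₁ ε₂ b c f uN) {v : ℝ × ℝ → ℝ} (hv : InFESpace k N X Y v)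
    (he : DirectError X Y N ε₁ ε₂ T e) (he' : WeakError X Y N ε₁ ε₂ T' e')
    (heq : EqOn (fun z => v z - u z) (fun z => e z + e' z) closedSquare) :
    energyNorm ε₁ (fun z => v z - uN z)
      ≤ ((1 + Bc) * (T + T') + (Bb * T + Bb * T' + Bb' * T')) / min 1 γ := by
  have z0 : (0 : ℝ) ∈ Icc (0 : ℝ) 1 := by simp
  have hBb0 : 0 ≤ Bb := (abs_nonneg _).trans (hBb 0 z0)
  have hBb0' : 0 ≤ Bb' := (abs_nonneg _).trans (hBb' 0 z0)
  have hBc0 : 0 ≤ Bc := (abs_nonneg _).trans (hBc 0 z0)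
  have hχs := hv.sub huN.1
  set χ : ℝ × ℝ → ℝ := fun z => v z - uN z with hχ
  have hχp := hχs.pw
  have h0 := hχs.boundary
  have hup : PW X Y N u := PW.of_contDiffOn hX hY (hu.of_le (by norm_num))
  -- Galerkin orthogonality: u and u^N satisfy the same equation against χ, so u^N may be replaced
  -- by u in the first argument.
  have hbil : bilin ε₁ ε₂ b c χ χ = bilin ε₁ ε₂ b c (fun z => e z + e' z) χ := by
    rw [← bilin_congr heq, bilin_sub hX hY hN hb.continuousOn hc hv.pw hup hχp,
      bilin_solution hX hY hN hb.continuousOn hc hu hsol hχp h0, ← huN.2 χ hχs]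
    exact bilin_sub hX hY hN hb.continuousOn hc hv.pw huN.1.pw hχp
  have h1 := bilin_coercive hX hY hN hb hc hε.le hcoer hχp h0
  have h2 := abs_bilin_le hX hY hN hb hc hε hε₂ hBb hBb' hBc he.pw he'.pw hχp h0
  rw [← hbil] at h2
  have h3 := (sumNorm_add_le (ε₁ := ε₁) he.pw he'.pw hX hY hN).trans (add_le_add he.le he'.le)
  have hE := energyNorm_nonneg ε₁ χ
  have h4 : (1 + Bc) * sumNorm ε₁ (fun z => e z + e' z)
      + ε₂ * (Bb * nrm (dx e) + Bb * (nrm e' / √ε₁) + Bb' * nrm e')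
      ≤ (1 + Bc) * (T + T') + (Bb * T + Bb * T' + Bb' * T') := by
    have e1 : ε₂ * (Bb * nrm (dx e) + Bb * (nrm e' / √ε₁) + Bb' * nrm e')
        = Bb * (ε₂ * nrm (dx e)) + Bb * (ε₂ * (nrm e' / √ε₁)) + Bb' * (ε₂ * nrm e') := by ring
    rw [e1]
    have := he.conv
    have := he'.inv
    have := he'.low
    gcongr
  set G := (1 + Bc) * (T + T') + (Bb * T + Bb * T' + Bb' * T') with hG
  have hmin : 0 < min 1 γ := lt_min one_pos hγ
  have h5 : min 1 γ * energyNorm ε₁ χ ^ 2 ≤ G * energyNorm ε₁ χ :=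
    h1.trans ((le_abs_self _).trans (h2.trans (mul_le_mul_of_nonneg_right h4 hE)))
  rw [le_div_iff₀ hmin]
  -- One factor of the energy norm is cancelled; if that norm is zero, the bound holds because its
  -- right-hand side is nonnegative.
  rcases hE.eq_or_lt with h | h
  · rw [← h, zero_mul]
    have hs0 : 0 ≤ sumNorm ε₁ e := by
      have := nrm_nonneg (dx e)
      have := nrm_nonneg (dy e)
      have := nrm_nonneg e
      unfold sumNorm
      positivity
    have hs0' : 0 ≤ sumNorm ε₁ e' := by
      have := nrm_nonneg (dx e')
      have := nrm_nonneg (dy e')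
      have := nrm_nonneg e'
      unfold sumNorm
      positivity
    have hT := hs0.trans he.le
    have hT' := hs0'.trans he'.le
    positivity
  · refine le_of_mul_le_mul_right ?_ h
    calc _ = min 1 γ * energyNorm ε₁ χ ^ 2 := by ring
      _ ≤ _ := h5

end Errors

/-! ### Energy and convection bounds for a single part of the decomposition -/

section Parts

variable {X Y : ℕ → ℝ} {N k : ℕ} {A B B' K M Q S ε₁ ε₂ : ℝ} {r q : ℕ → ℝ} {ρ ψ : ℝ → ℝ}
  {g : ℝ × ℝ → ℝ}

/-- The bound of the interpolation errors. -/
def errBound (k N : ℕ) (K M Q S : ℝ) : ℝ :=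
  48 * K ^ 4 * interpConst k ^ 2 * M * Q * (S * (K / N) ^ k + (K / N) ^ (k + 1))

lemma interp_sumNorm_le (hg : LayerPart k M A B ρ ψ g) (hX : Mesh X N) (hY : Mesh Y N)
    (hk : 1 ≤ k) (hN : 0 < N) (hx : LayerMesh X N A K r ρ) (hy : LayerMesh Y N B K q ψ)
    (hA : √ε₁ * √A ≤ Q * S) (hB : √ε₁ * √B ≤ Q * S) (hQ : 1 ≤ Q) :
    sumNorm ε₁ (fun z => interp X Y N k g z - g z)
      ≤ 12 * K ^ 4 * interpConst k ^ 2 * M * Q * (S * (K / N) ^ k + (K / N) ^ (k + 1)) := by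
  have hM := hg.nonneg
  have hK := hx.one_le_K hN
  have hε := Real.sqrt_nonneg ε₁
  have h1 := mul_le_mul_of_nonneg_left (hg.nrm_dx_error_le hX hY hk hN hx hy) hε
  have h2 := mul_le_mul_of_nonneg_left (hg.nrm_dy_error_le hX hY hk hN hx hy) hε
  have h3 := hg.nrm_error_le hX hY hk hN hx hy
  have hκ : 0 ≤ (K / N) ^ k := by positivity
  have hκ' : 0 ≤ (K / N) ^ (k + 1) := by positivity
  set P := interpConst k ^ 2 * M with hP
  have hP0 : 0 ≤ P := by positivity
  have h4 : 6 * K ^ 2 * P * (K / N) ^ k * (√ε₁ * √A) ≤ 6 * K ^ 4 * P * (K / N) ^ k * (Q * S) := by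
    gcongr
    norm_num
  have h5 : 6 * K ^ 2 * P * (K / N) ^ k * (√ε₁ * √B) ≤ 6 * K ^ 4 * P * (K / N) ^ k * (Q * S) := by
    gcongr
    norm_num
  have h6 : 4 * 1 * P * 1 * (K / N) ^ (k + 1) ≤ 12 * K ^ 4 * P * Q * (K / N) ^ (k + 1) := by
    gcongr
    · norm_num
    · exact one_le_pow₀ hK
  unfold sumNorm
  calc _ ≤ 6 * K ^ 2 * P * (K / N) ^ k * (√ε₁ * √A) + 6 * K ^ 2 * P * (K / N) ^ k * (√ε₁ * √B)
        + 4 * 1 * P * 1 * (K / N) ^ (k + 1) := by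
        rw [hP]
        linarith
    _ ≤ _ := by
      rw [mul_assoc (12 * K ^ 4), ← hP]
      linarith

lemma interp_directError (hg : LayerPart k M A B ρ ψ g) (hX : Mesh X N) (hY : Mesh Y N)
    (hk : 1 ≤ k) (hN : 0 < N) (hx : LayerMesh X N A K r ρ) (hy : LayerMesh Y N B K q ψ)
    (hA : √ε₁ * √A ≤ Q * S) (hB : √ε₁ * √B ≤ Q * S) (hA' : ε₂ * √A ≤ Q * S) (hQ : 1 ≤ Q)
    (hS : 0 ≤ S) (hε₂ : 0 ≤ ε₂) :
    DirectError X Y N ε₁ ε₂ (errBound k N K M Q S) (fun z => interp X Y N k g z - g z) := by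
  have hM := hg.nonneg
  have hK := hx.one_le_K hN
  have h0 : 0 ≤ K ^ 4 * interpConst k ^ 2 * M * Q * (S * (K / N) ^ k + (K / N) ^ (k + 1)) := by
    positivity
  refine ⟨⟨hg.pw_error hX hY hk hN, ?_⟩, ?_⟩
  · refine (interp_sumNorm_le hg hX hY hk hN hx hy hA hB hQ).trans ?_
    unfold errBound
    linarith
  · refine (mul_le_mul_of_nonneg_left (hg.nrm_dx_error_le hX hY hk hN hx hy) hε₂).trans ?_
    have h1 : 6 * K ^ 2 * interpConst k ^ 2 * M * (K / N) ^ k * (ε₂ * √A)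
        ≤ 6 * K ^ 4 * interpConst k ^ 2 * M * (K / N) ^ k * (Q * S) := by
      gcongr
      norm_num
    have h2 : 0 ≤ K ^ 4 * interpConst k ^ 2 * M * Q * (S * (K / N) ^ k) := by positivity
    have h3 : 0 ≤ K ^ 4 * interpConst k ^ 2 * M * Q * (K / N) ^ (k + 1) := by positivity
    unfold errBound
    linarith

/-- The bound of the correction of the interpolant. -/
lemma correction_sumError (hg : LayerPart k M A B ρ ψ g) (hX : Mesh X N) (hY : Mesh Y N)
    (hk : 1 ≤ k) (hN : 8 ≤ N) (hx : LayerMesh X N A K r ρ) (hy : LayerMesh Y N B K q ψ)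
    (hT : Transition X Y N (3 * (N / 4)) A B' K r ρ) (hA : √ε₁ * √A ≤ Q * S)
    (hB : √ε₁ * √B ≤ Q * S) (hB' : √ε₁ * √B' ≤ Q * S) (hQ : 1 ≤ Q) (hS : 0 ≤ S) :
    SumError X Y N ε₁
      (36 * K ^ 4 * interpConst k ^ 2 * M * Q * (S * (K / N) ^ k + (K / N) ^ (k + 1)))
      (fun z => opP X Y N k g z - opTheta X Y N k g z) := by
  have hN0 : 0 < N := by omega
  have hM := hg.nonneg
  have hK := hx.one_le_K hN0
  have hε := Real.sqrt_nonneg ε₁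
  have hΛ := one_le_interpConst k
  have hP := (opP_pp hX hY hk hN0 g).pw hX hY hN0
  have hΘ := (opTheta_pp hX hY hk hN0 g).pw hX hY hN0
  have e0 := nrm_opP_opTheta_le hg hX hY hk hx hy hT rfl
  have e1 := nrm_dx_opP_opTheta_le hg hX hY hk hx hy hT rfl
  have e2 := nrm_dy_opP_le hg hX hY hk hx hy hT rfl
  have e3 := nrm_dy_opTheta_le hg hX hY hk hx hy hT rfl
  refine ⟨hP.sub hΘ, ?_⟩
  have s0 := sumNorm_add_le (ε₁ := ε₁) hP hΘ.neg hX hY hN0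
  rw [sumNorm_neg] at s0
  refine le_trans s0 ?_
  set κ := K / (N : ℝ) with hκd
  have hκ0 : 0 < κ := by positivity
  have hκK : κ ≤ K := div_le_self (by linarith) (by exact_mod_cast hN0)
  set P := interpConst k ^ 2 * M * κ ^ k with hPd
  have hP0 : 0 ≤ P := by positivity
  -- The derivative bounds of the correction carry κ^(k+1), one power more than necessary; the
  -- surplus factor κ is bounded by K.
  have m : ∀ {n a : ℝ} (t : ℝ), 0 ≤ t → √ε₁ * √a ≤ Q * S → n ≤ t * κ * √a →
      √ε₁ * n ≤ t * K * (Q * S) := by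
    intro n a t ht ha hn
    calc √ε₁ * n ≤ √ε₁ * (t * κ * √a) := by gcongr
      _ = t * κ * (√ε₁ * √a) := by ring
      _ ≤ t * K * (Q * S) := by gcongr
  have x1 := m (4 * K * P) (by positivity) hA (e1.1.trans (le_of_eq (by rw [hPd, pow_succ]; ring)))
  have x2 := m (4 * K * P) (by positivity) hA (e1.2.trans (le_of_eq (by rw [hPd, pow_succ]; ring)))
  have y1 := m (2 * K ^ 2 * P) (by positivity) hB (e2.trans (le_of_eq (by rw [hPd, pow_succ]; ring)))
  have y2 := m (4 * K * P) (by positivity) hB' (e3.trans (le_of_eq (by rw [hPd, pow_succ]; ring)))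
  have hk2 : K ^ 2 ≤ K ^ 4 := pow_le_pow_right₀ hK (by norm_num)
  have hk3 : K ^ 3 ≤ K ^ 4 := pow_le_pow_right₀ hK (by norm_num)
  have z0 : 0 ≤ P * (Q * S) := by positivity
  have w1 := mul_le_mul_of_nonneg_right hk2 z0
  have w2 := mul_le_mul_of_nonneg_right hk3 z0
  have z1 : 0 ≤ interpConst k ^ 2 * (M * κ ^ (k + 1)) := by positivity
  have hKQ : 1 ≤ K ^ 4 * Q := one_le_mul_of_one_le_of_one_le (one_le_pow₀ hK) hQ
  have w3 := mul_le_mul_of_nonneg_right hKQ z1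
  have w4 : 0 ≤ K ^ 4 * (P * (Q * S)) := by positivity
  have goal_eq : 36 * K ^ 4 * interpConst k ^ 2 * M * Q * (S * κ ^ k + κ ^ (k + 1))
      = 36 * (K ^ 4 * (P * (Q * S))) + 36 * (K ^ 4 * Q * (interpConst k ^ 2 * (M * κ ^ (k + 1)))) := by
    rw [hPd]
    ring
  rw [goal_eq]
  unfold sumNorm
  nlinarith

/-- The L² error of order κ^k/√A exactly compensates the 1/√ε₁ of the integration by parts, because
ε₂/(√ε₁√A) is bounded by `hA'`. In the energy norm the error is that of Lagrange interpolation plus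
the correction. -/
lemma opPi_weakError (hg : LayerPart k M A B ρ ψ g) (hX : Mesh X N) (hY : Mesh Y N)
    (hk : 1 ≤ k) (hN : 8 ≤ N) (hx : LayerMesh X N A K r ρ) (hy : LayerMesh Y N B K q ψ)
    (hT : Transition X Y N (3 * (N / 4)) A B' K r ρ) (hA : √ε₁ * √A ≤ Q * S)
    (hB : √ε₁ * √B ≤ Q * S) (hB' : √ε₁ * √B' ≤ Q * S) (hA' : ε₂ / (√ε₁ * √A) ≤ Q * S)
    (hε : ε₂ ≤ Q * S) (hε₂ : 0 ≤ ε₂) (hQ : 1 ≤ Q) (hS : 0 ≤ S) :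
    WeakError X Y N ε₁ ε₂ (errBound k N K M Q S) (fun z => opPi X Y N k g z - g z) := by
  have hN0 : 0 < N := by omega
  have hM := hg.nonneg
  have hK := hx.one_le_K hN0
  have hA1 := hT.one_le_A
  have h1 := interp_sumNorm_le hg hX hY hk hN0 hx hy hA hB hQ
  have h2 := correction_sumError hg hX hY hk hN hx hy hT hA hB hB' hQ hS
  have hpi := hg.pw_error hX hY hk hN0
  have heq : (fun z => opPi X Y N k g z - g z) = fun z => (interp X Y N k g z - g z)
      + -(opP X Y N k g z - opTheta X Y N k g z) := by
    ext z
    rw [opPi]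
    ring
  have h3 := nrm_opPi_error_le hg hX hY hk hx hy hT rfl
  set n := nrm (fun z => opPi X Y N k g z - g z) with hn
  have z1 : 0 ≤ K ^ 4 * interpConst k ^ 2 * M * Q * (K / N) ^ (k + 1) := by positivity
  have z2 : 0 ≤ K ^ 4 * interpConst k ^ 2 * M * (Q * S) * (K / N) ^ k := by positivity
  refine ⟨⟨?_, ?_⟩, ?_, ?_⟩
  · rw [heq]
    exact hpi.add h2.pw.neg
  · rw [heq]
    refine (sumNorm_add_le hpi h2.pw.neg hX hY hN0).trans ?_
    rw [sumNorm_neg]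
    unfold errBound
    linarith [h2.le]
  · calc ε₂ * (n / √ε₁) ≤ ε₂ * (6 * K ^ 3 * (4 * interpConst k ^ 2 * M * K * (K / N) ^ k) / √A
          / √ε₁) := by
          gcongr
      _ = 24 * K ^ 4 * interpConst k ^ 2 * M * (ε₂ / (√ε₁ * √A)) * (K / N) ^ k := by
          rw [div_div, mul_comm (√A)]
          ring
      _ ≤ 24 * K ^ 4 * interpConst k ^ 2 * M * (Q * S) * (K / N) ^ k := by gcongr
      _ ≤ _ := by
        unfold errBound
        linarith
  · calc ε₂ * n ≤ ε₂ * (6 * K ^ 3 * (4 * interpConst k ^ 2 * M * K * (K / N) ^ k) / 1) := by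
          refine mul_le_mul_of_nonneg_left (h3.trans ?_) hε₂
          have : 1 ≤ √A := by rwa [Real.one_le_sqrt]
          gcongr
      _ = 24 * K ^ 4 * interpConst k ^ 2 * M * ε₂ * (K / N) ^ k := by ring
      _ ≤ 24 * K ^ 4 * interpConst k ^ 2 * M * (Q * S) * (K / N) ^ k := by gcongr
      _ ≤ _ := by
        unfold errBound
        linarith

end Parts

end BakhvalovFEM
end

noncomputable section
namespace BakhvalovFEM

/-! ### The error estimate for a decomposed solution -/

section Decomposition

variable {X Y : ℕ → ℝ} {N k : ℕ} {ε₁ ε₂ T : ℝ} {u uN : ℝ × ℝ → ℝ} {D : Parts}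

lemma opPi_pp (hX : Mesh X N) (hY : Mesh Y N) (hk : 1 ≤ k) (hN : 0 < N) (E : ℝ × ℝ → ℝ) :
    PP k N X Y (fun z => opPi X Y N k E z) :=
  ((interp_pp hX hY hk E).sub (opP_pp hX hY hk hN E)).add (opTheta_pp hX hY hk hN E)

/-- The interpolant of the solution is the sum of the interpolants of its parts. -/
lemma interp_parts (hX : Mesh X N) (hY : Mesh Y N) (hk : 1 ≤ k) (hN : 0 < N)
    (hu : ∀ z ∈ closedSquare, u z = D.S z + D.E10 z + D.E11 z + D.E20 z + D.E21 z + D.E31 z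
      + D.E32 z + D.E33 z + D.E34 z) {z : ℝ × ℝ} (hz : z ∈ closedSquare) :
    interp X Y N k u z = interp X Y N k D.S z + interp X Y N k D.E10 z + interp X Y N k D.E11 z
      + interp X Y N k D.E20 z + interp X Y N k D.E21 z + interp X Y N k D.E31 z
      + interp X Y N k D.E32 z + interp X Y N k D.E33 z + interp X Y N k D.E34 z := by
  rw [interp_congr hX hY hk hN hu hz]
  iterate 8 rw [interp_add hX hY hk hN hz]

lemma interp_sub_bigPi (hX : Mesh X N) (hY : Mesh Y N) (hk : 1 ≤ k) (hN : 0 < N)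
    (hu : ∀ z ∈ closedSquare, u z = D.S z + D.E10 z + D.E11 z + D.E20 z + D.E21 z + D.E31 z
      + D.E32 z + D.E33 z + D.E34 z) {z : ℝ × ℝ} (hz : z ∈ closedSquare) :
    interp X Y N k u z = bigPi X Y N k D z
      + ((opP X Y N k D.E11 z - opTheta X Y N k D.E11 z)
        + (opP X Y N k D.E32 z - opTheta X Y N k D.E32 z)
        + (opP X Y N k D.E33 z - opTheta X Y N k D.E33 z)) := by
  rw [interp_parts hX hY hk hN hu hz]
  simp only [bigPi, opPi]
  ring

lemma bigPi_mem (hX : Mesh X N) (hY : Mesh Y N) (hk : 1 ≤ k) (hN : 8 ≤ N)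
    (hu : ∀ z ∈ closedSquare, u z = D.S z + D.E10 z + D.E11 z + D.E20 z + D.E21 z + D.E31 z
      + D.E32 z + D.E33 z + D.E34 z) (hu0 : ∀ z ∈ closedSquare \ openSquare, u z = 0) :
    InFESpace k N X Y (bigPi X Y N k D) := by
  have hN0 : 0 < N := by omega
  have hi := fun g => interp_pp hX hY hk g
  have hπ := fun g => opPi_pp hX hY hk hN0 g
  have hpp : PP k N X Y (bigPi X Y N k D) :=
    ((((((((hi D.S).add (hi D.E10)).add (hπ D.E11)).add (hi D.E20)).add (hi D.E21)).add
      (hi D.E31)).add (hπ D.E32)).add (hπ D.E33)).add (hi D.E34)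
  refine ⟨hpp.continuousOn hX hY hN0, fun z hz => ?_, hpp⟩
  have h := interp_sub_bigPi hX hY hk hN0 hu hz.1
  rw [interp_boundary hX hY hk hN0 hu0 hz, opP_sub_opTheta_boundary hX hY hk hN D.E11 hz,
    opP_sub_opTheta_boundary hX hY hk hN D.E32 hz,
    opP_sub_opTheta_boundary hX hY hk hN D.E33 hz] at h
  linarith

/-- The error bounds, given the bounds of the interpolation errors of the parts. -/
lemma fem_error {b c : ℝ → ℝ} {f : ℝ × ℝ → ℝ} {Bb Bb' Bc γ : ℝ}
    (hX : Mesh X N) (hY : Mesh Y N) (hk : 1 ≤ k) (hN : 8 ≤ N)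
    (hb : ContDiffOn ℝ 1 b (Icc 0 1)) (hc : ContinuousOn c (Icc 0 1)) (hε : 0 < ε₁)
    (hε₂ : 0 ≤ ε₂) (hBb : ∀ x ∈ Icc (0 : ℝ) 1, |b x| ≤ Bb)
    (hBb' : ∀ x ∈ Icc (0 : ℝ) 1, |derivWithin b (Icc 0 1) x| ≤ Bb')
    (hBc : ∀ x ∈ Icc (0 : ℝ) 1, |c x| ≤ Bc) (hγ : 0 < γ)
    (hcoer : ∀ x ∈ Icc (0 : ℝ) 1, γ ≤ c x - 1 / 2 * ε₂ * derivWithin b (Icc 0 1) x)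
    (hu : ContDiffOn ℝ 2 u closedSquare) (hsol : IsSolution ε₁ ε₂ b c f u)
    (huN : IsFESolution k N X Y ε₁ ε₂ b c f uN)
    (hsum : ∀ z ∈ closedSquare, u z = D.S z + D.E10 z + D.E11 z + D.E20 z + D.E21 z + D.E31 z
      + D.E32 z + D.E33 z + D.E34 z)
    (hd : ∀ g, g = D.S ∨ g = D.E10 ∨ g = D.E20 ∨ g = D.E21 ∨ g = D.E31 ∨ g = D.E34 →
      DirectError X Y N ε₁ ε₂ T (fun z => interp X Y N k g z - g z))
    (hw : ∀ g, g = D.E11 ∨ g = D.E32 ∨ g = D.E33 →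
      SumError X Y N ε₁ T (fun z => interp X Y N k g z - g z) ∧
      SumError X Y N ε₁ T (fun z => opP X Y N k g z - opTheta X Y N k g z) ∧
      WeakError X Y N ε₁ ε₂ T (fun z => opPi X Y N k g z - g z)) :
    energyNorm ε₁ (fun z => bigPi X Y N k D z - uN z)
        ≤ ((1 + Bc) * 9 + (Bb * 9 + Bb' * 3)) / min 1 γ * T ∧
      energyNorm ε₁ (fun z => interp X Y N k u z - uN z)
        ≤ 3 * energyNorm ε₁ (fun z => bigPi X Y N k D z - uN z) + 3 * T ∧
      energyNorm ε₁ (fun z => u z - uN z)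
        ≤ 3 * energyNorm ε₁ (fun z => interp X Y N k u z - uN z) + 9 * T := by
  have hN0 : 0 < N := by omega
  have dS := hd D.S (by simp)
  have d10 := hd D.E10 (by simp)
  have d20 := hd D.E20 (by simp)
  have d21 := hd D.E21 (by simp)
  have d31 := hd D.E31 (by simp)
  have d34 := hd D.E34 (by simp)
  obtain ⟨i11, c11, w11⟩ := hw D.E11 (by simp)
  obtain ⟨i32, c32, w32⟩ := hw D.E32 (by simp)
  obtain ⟨i33, c33, w33⟩ := hw D.E33 (by simp)
  have hbig := bigPi_mem hX hY hk hN hsum hsol.boundary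
  have hupw : PW X Y N u := PW.of_contDiffOn hX hY (hu.of_le (by norm_num))
  refine ⟨?_, ?_, ?_⟩
  -- Six parts are estimated directly and three weakly, which is the origin of the coefficients 9 =
  -- 6 + 3 and 3.
  · have he := ((((dS.add hX hY hN0 hε₂ d10).add hX hY hN0 hε₂ d20).add hX hY hN0 hε₂ d21).add
      hX hY hN0 hε₂ d31).add hX hY hN0 hε₂ d34
    have he' := (w11.add hX hY hN0 hε₂ w32).add hX hY hN0 hε₂ w33
    refine (energy_estimate hX hY hN0 hb hc hε hε₂ hBb hBb' hBc hγ hcoer hu hsol huN hbig he he'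
      fun z hz => ?_).trans (le_of_eq ?_)
    · simp only [hsum z hz, bigPi]
      ring
    · ring
  · have hc := (c11.add hX hY hN0 c32).add hX hY hN0 c33
    have h := energyNorm_add_le hX hY hN0 hε.le (hbig.sub huN.1).pw hc
    refine (energyNorm_congr fun z hz => ?_).trans_le (h.trans (by linarith))
    simp only [interp_sub_bigPi hX hY hk hN0 hsum hz, add_sub_right_comm]
  · have hs := (((((((dS.toSumError.add hX hY hN0 d10.toSumError).add hX hY hN0 i11).add hX hY hN0
      d20.toSumError).add hX hY hN0 d21.toSumError).add hX hY hN0 d31.toSumError).add hX hY hN0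
      i32).add hX hY hN0 i33).add hX hY hN0 d34.toSumError
    have hI := ((interp_pp hX hY hk u).pw hX hY hN0).sub huN.1.pw
    have h := energyNorm_add_le hX hY hN0 hε.le hI hs.neg
    refine (energyNorm_congr fun z hz => ?_).trans_le (h.trans (by linarith))
    simp only [interp_parts hX hY hk hN0 hsum hz, hsum z hz]
    ring

end Decomposition

/-! ### The perturbation parameters -/

/-- With a = ε₂ b_* the root is μ₀, with a = -ε₂λ it is μ₁. From here on only the two quadratic
equations are used, not the explicit formulas. -/
lemma quadratic_root {ε β : ℝ} (hε : 0 < ε) (hβ : 0 < β) (a : ℝ) :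
    0 < (-a + √(a ^ 2 + 4 * ε * β)) / (2 * ε) ∧
      ε * ((-a + √(a ^ 2 + 4 * ε * β)) / (2 * ε)) ^ 2
        + a * ((-a + √(a ^ 2 + 4 * ε * β)) / (2 * ε)) = β := by
  have h0 : 0 < 4 * ε * β := by positivity
  have hs := Real.sq_sqrt (show 0 ≤ a ^ 2 + 4 * ε * β by positivity)
  have ha : |a| < √(a ^ 2 + 4 * ε * β) := by
    rw [← Real.sqrt_sq_eq_abs]
    exact Real.sqrt_lt_sqrt (sq_nonneg a) (by linarith)
  generalize √(a ^ 2 + 4 * ε * β) = t at *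
  constructor
  · have := le_abs_self a
    exact div_pos (by linarith) (by linarith)
  · have hx : 2 * ε * ((-a + t) / (2 * ε)) = -a + t := by field_simp
    generalize (-a + t) / (2 * ε) = x at *
    have h1 : (2 * ε * x + a) ^ 2 = a ^ 2 + 4 * ε * β := by rw [hx, ← hs]; ring
    exact mul_left_cancel₀ (mul_pos four_pos hε).ne' (by linarith)

lemma le_bMax {b c : ℝ → ℝ} {f : ℝ × ℝ → ℝ} {lam β : ℝ} (h : DataConditions b c f lam β) :
    lam ≤ bMax b := by
  have h0 : (0 : ℝ) ∈ Icc (0 : ℝ) 1 := by simp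
  exact (h.b_lower 0 h0).trans (le_csSup (isCompact_Icc.image_of_continuousOn
    h.b_smooth.continuousOn).bddAbove (mem_image_of_mem b h0))

/-- The relations between the parameters. -/
lemma parameter_bounds {ε₁ ε₂ lam β bs μ₀ μ₁ n : ℝ} (hε₁ : 0 < ε₁) (hε₁' : ε₁ ≤ 1) (hε₂ : 0 < ε₂)
    (hε₂' : ε₂ ≤ 1) (hlam : 0 < lam) (hβ : 0 < β) (hbs : lam ≤ bs) (hμ₀ : 0 < μ₀) (hμ₁ : 0 < μ₁)
    (h₀ : ε₁ * μ₀ ^ 2 + ε₂ * bs * μ₀ = β) (h₁ : ε₁ * μ₁ ^ 2 + -(ε₂ * lam) * μ₁ = β)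
    (hn : n ≤ μ₀) {Q : ℝ} (hQ : Q = 1 + √β + lam + β / lam + 1 / lam) :
    1 ≤ Q ∧ √ε₁ * √1 ≤ Q * √(√ε₁ + ε₂) ∧ √ε₁ * √μ₀ ≤ Q * √(√ε₁ + ε₂) ∧
      √ε₁ * √μ₁ ≤ Q * √(√ε₁ + ε₂) ∧ √ε₁ * √(√ε₁)⁻¹ ≤ Q * √(√ε₁ + ε₂) ∧
      ε₂ * √1 ≤ Q * √(√ε₁ + ε₂) ∧ ε₂ * √μ₀ ≤ Q * √(√ε₁ + ε₂) ∧
      ε₂ / (√ε₁ * √μ₁) ≤ Q * √(√ε₁ + ε₂) ∧ ε₂ ≤ Q * √(√ε₁ + ε₂) ∧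
      √ε₁ * √μ₁ ≤ 1 + √β + lam ∧ √ε₁ * n ≤ √β := by
  set e := √ε₁ with he
  have he0 : 0 < e := Real.sqrt_pos.2 hε₁
  have he2 : e ^ 2 = ε₁ := Real.sq_sqrt hε₁.le
  have he1 : e ≤ 1 := Real.sqrt_le_one.2 hε₁'
  have hsβ : 0 < √β := Real.sqrt_pos.2 hβ
  have hsβ2 : √β ^ 2 = β := Real.sq_sqrt hβ.le
  have hd1 : 0 < β / lam := by positivity
  have hd2 : 0 < 1 / lam := by positivity
  have hQ1 : 1 ≤ Q := by linarith
  have hs0 : 0 < e + ε₂ := by linarith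
  -- All bounds are compared through squares, which removes the outer root; Q ≤ Q² since Q ≥ 1.
  have key : ∀ t : ℝ, t ^ 2 ≤ Q * (e + ε₂) → t ≤ Q * √(e + ε₂) := by
    intro t ht
    refine le_of_sq_le_sq (ht.trans ?_) (by positivity)
    rw [mul_pow, Real.sq_sqrt hs0.le]
    gcongr
    nlinarith
  have hμ₀e : e * μ₀ ≤ √β := by
    refine le_of_sq_le_sq ?_ hsβ.le
    rw [mul_pow, he2, hsβ2]
    have : 0 < ε₂ * bs * μ₀ := by
      have : 0 < bs := by linarith
      positivity
    linarith
  have hμ₁e : ε₂ * lam ≤ ε₁ * μ₁ := by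
    have : ε₂ * lam * μ₁ ≤ ε₁ * μ₁ * μ₁ := by nlinarith
    exact le_of_mul_le_mul_right this hμ₁
  -- The equation for μ₁ says that ε₁μ₁ times (ε₁μ₁ - ε₂λ) equals ε₁β = (e√β)². If the claim failed,
  -- both factors would exceed e√β.
  have hμ₁e' : ε₁ * μ₁ ≤ ε₂ * lam + e * √β := by
    by_contra hcon
    push Not at hcon
    have h3 : e * √β < ε₁ * μ₁ := by nlinarith
    have h4 : (ε₁ * μ₁) * (ε₁ * μ₁ - ε₂ * lam) = ε₁ * β := by
      calc _ = ε₁ * (ε₁ * μ₁ ^ 2 + -(ε₂ * lam) * μ₁) := by ring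
        _ = _ := by rw [h₁]
    have h5 : (e * √β) * (e * √β) < (ε₁ * μ₁) * (ε₁ * μ₁ - ε₂ * lam) :=
      mul_lt_mul'' h3 (by linarith) (by positivity) (by positivity)
    have h6 : (e * √β) * (e * √β) = ε₁ * β := by
      rw [← he2, ← sq, mul_pow, hsβ2]
    linarith
  have hμ₀ε₂ : ε₂ * μ₀ ≤ β / lam := by
    rw [le_div_iff₀ hlam]
    have h1 : 0 < ε₁ * μ₀ ^ 2 := by positivity
    have h2 : ε₂ * μ₀ * lam ≤ ε₂ * μ₀ * bs := by gcongr
    nlinarith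
  have hee : ε₁ ≤ e := by nlinarith
  have hε₂2 : ε₂ ^ 2 ≤ ε₂ := by nlinarith
  have hQs : ∀ a b : ℝ, a ≤ Q → b ≤ Q → a * e + b * ε₂ ≤ Q * (e + ε₂) := fun a b ha hb => by
    linarith [mul_le_mul_of_nonneg_right ha he0.le, mul_le_mul_of_nonneg_right hb hε₂.le]
  refine ⟨hQ1, key _ ?_, key _ ?_, key _ ?_, key _ ?_, key _ ?_, key _ ?_, key _ ?_, key _ ?_,
    ?_, ?_⟩
  · rw [Real.sqrt_one, mul_one, he2]
    linarith [hQs 1 0 hQ1 (by linarith)]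
  · rw [mul_pow, Real.sq_sqrt hμ₀.le]
    have : e ^ 2 * μ₀ ≤ √β * e := by nlinarith
    linarith [hQs (√β) 0 (by linarith) (by linarith)]
  · rw [mul_pow, Real.sq_sqrt hμ₁.le, he2]
    linarith [hQs (√β) lam (by linarith) (by linarith)]
  · have : ε₁ * e⁻¹ = e := by rw [← he2, sq, mul_assoc, mul_inv_cancel₀ he0.ne', mul_one]
    rw [mul_pow, he2, Real.sq_sqrt (inv_nonneg.2 he0.le), this]
    linarith [hQs 1 0 hQ1 (by linarith)]
  · rw [Real.sqrt_one, mul_one]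
    linarith [hQs 0 1 (by linarith) hQ1]
  · rw [mul_pow, Real.sq_sqrt hμ₀.le]
    have : ε₂ ^ 2 * μ₀ ≤ β / lam * ε₂ := by nlinarith
    linarith [hQs 0 (β / lam) (by linarith) (by linarith)]
  · rw [div_pow, mul_pow, Real.sq_sqrt hμ₁.le, he2]
    have : ε₂ ^ 2 / (ε₁ * μ₁) ≤ 1 / lam * ε₂ := by
      calc _ ≤ ε₂ ^ 2 / (ε₂ * lam) := by gcongr
        _ = _ := by field_simp
    linarith [hQs 0 (1 / lam) (by linarith) (by linarith)]
  · linarith [hQs 0 1 (by linarith) hQ1]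
  · refine le_of_sq_le_sq ?_ (by linarith)
    rw [mul_pow, Real.sq_sqrt hμ₁.le, he2]
    have h7 : ε₂ * lam ≤ lam := mul_le_of_le_one_left hlam.le hε₂'
    have h8 : e * √β ≤ √β := mul_le_of_le_one_left hsβ.le he1
    have h9 := le_self_pow₀ (show 1 ≤ 1 + √β + lam by linarith) two_ne_zero
    linarith
  · exact (mul_le_mul_of_nonneg_left hn he0.le).trans hμ₀e

/-- All nine weights are products of a factor in x and a factor in y, each a (k + 1)-st power up to
the scaling of the derivatives; a missing layer is the constant 1. The absolute value appears
because C₀ has no prescribed sign. -/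
lemma DerivBound.layerPart {k : ℕ} {C₀ A B : ℝ} {w : ℕ → ℕ → ℝ × ℝ → ℝ} {g : ℝ × ℝ → ℝ}
    {ρ ψ : ℝ → ℝ} (h : DerivBound k C₀ w g)
    (hw : ∀ i j z, w i j z = (A ^ i * ρ z.1 ^ (k + 1)) * (B ^ j * ψ z.2 ^ (k + 1)))
    (hA : 0 ≤ A) (hB : 0 ≤ B) (hρ : ∀ x, 0 ≤ ρ x) (hψ : ∀ y, 0 ≤ ψ y) :
    LayerPart k |C₀| A B ρ ψ g where
  smooth := h.1
  bound i j hij x hx y hy := by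
    have h1 := h.2 i j hij (x, y) ⟨hx, hy⟩
    rw [mixedPartial_eq (h.1.of_le (by exact_mod_cast hij)) ⟨hx, hy⟩, hw] at h1
    have := hρ x
    have := hψ y
    exact h1.trans (mul_le_mul_of_nonneg_right (le_abs_self C₀) (by positivity))
  nonneg := abs_nonneg C₀

/-- With δ in place of p and 1/√ε₁ in place of both μ₀ and μ₁, all the mesh estimates for x apply to
y. -/
lemma meshY_eq (τ δ ε₁ : ℝ) (N : ℕ) :
    meshY τ δ ε₁ N = meshX τ δ (√ε₁)⁻¹ (√ε₁)⁻¹ N := by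
  have h1 : τ / (δ * (√ε₁)⁻¹) = τ / δ * √ε₁ := by rw [← div_div, div_inv_eq_mul]
  have h2 : sigmaX τ δ (√ε₁)⁻¹ = sigmaY τ δ ε₁ := by rw [sigmaX, sigmaY, h1, one_div]
  ext j
  rw [meshY, meshX, h1, h2, inv_inv]
  ring_nf

end BakhvalovFEM
end

noncomputable section
namespace BakhvalovFEM

/-! ### The error estimate with constants independent of the perturbation parameters -/

lemma IsLayerDecomposition.contDiffOn {k : ℕ} {C₀ ε₁ μ₀ μ₁ p δ : ℝ} {u : ℝ × ℝ → ℝ} {D : Parts}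
    (h : IsLayerDecomposition k C₀ ε₁ μ₀ μ₁ p δ u D) :
    ContDiffOn ℝ ((k + 1 : ℕ) : WithTop ℕ∞) u closedSquare :=
  ((((((((h.bound_S.1.add h.bound_E10.1).add h.bound_E11.1).add h.bound_E20.1).add
    h.bound_E21.1).add h.bound_E31.1).add h.bound_E32.1).add h.bound_E33.1).add
    h.bound_E34.1).congr h.sum_eq

/-- `K`, `ω` and the bounds of the coefficients are fixed before ε₁, ε₂ and N, and T depends on
these only through `errBound`; this is where uniformity becomes visible. -/
lemma parametric_error {k : ℕ} (hk : 1 ≤ k) {b c : ℝ → ℝ} {f : ℝ × ℝ → ℝ} {lam β γ : ℝ}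
    (hdata : DataConditions b c f lam β) (hγ : 0 < γ) {p δ τ C₀ : ℝ} (hp : 0 < p) (hp1 : p < 1)
    (hδ : 0 < δ) (hτ : (k : ℝ) + 1 ≤ τ) {Bb Bb' Bc K ω : ℝ}
    (hBb : ∀ x ∈ Icc (0 : ℝ) 1, |b x| ≤ Bb)
    (hBb' : ∀ x ∈ Icc (0 : ℝ) 1, |derivWithin b (Icc 0 1) x| ≤ Bb')
    (hBc : ∀ x ∈ Icc (0 : ℝ) 1, |c x| ≤ Bc)
    (hC : MeshConst k τ p 1 1 K) (hC' : MeshConst k τ δ (1 / √β) ω K) (hω : 0 < ω)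
    (hKβ : 1 + √β + lam ≤ K)
    {ε₁ ε₂ μ₀ μ₁ : ℝ} {N : ℕ} {u uN : ℝ × ℝ → ℝ} {D : Parts}
    (hε₁ : 0 < ε₁) (hε₁' : ε₁ < 1) (hε₂ : 0 < ε₂) (hε₂' : ε₂ < 1) (hεω : ω ≤ 1 - √ε₁)
    (hcoer : ∀ x ∈ Icc (0 : ℝ) 1, γ ≤ c x - 1 / 2 * ε₂ * derivWithin b (Icc 0 1) x)
    (hμ₀ : μ₀ = mu0 ε₁ ε₂ b β) (hμ₁ : μ₁ = mu1 ε₁ ε₂ lam β) (hN8 : 8 ≤ N) (hN4 : 4 ∣ N)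
    (hμ : μ₁⁻¹ ≤ μ₀⁻¹) (hμN : μ₀⁻¹ ≤ (N : ℝ)⁻¹) (hσ₀ : sigmaX τ p μ₀ ≤ 1 / 4)
    (hσ₁ : sigmaX τ p μ₁ ≤ 1 / 4) (hσ : sigmaY τ δ ε₁ ≤ 1 / 4) (hu : IsSolution ε₁ ε₂ b c f u)
    (hD : IsLayerDecomposition k C₀ ε₁ μ₀ μ₁ p δ u D)
    (huN : IsFESolution k N (meshX τ p μ₀ μ₁ N) (meshY τ δ ε₁ N) ε₁ ε₂ b c f uN) {T : ℝ}
    (hT : T = errBound k N K |C₀| (1 + √β + lam + β / lam + 1 / lam) √(√ε₁ + ε₂)) :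
    energyNorm ε₁ (fun z => bigPi (meshX τ p μ₀ μ₁ N) (meshY τ δ ε₁ N) N k D z - uN z)
        ≤ ((1 + Bc) * 9 + (Bb * 9 + Bb' * 3)) / min 1 γ * T ∧
      energyNorm ε₁ (fun z => interp (meshX τ p μ₀ μ₁ N) (meshY τ δ ε₁ N) N k u z - uN z)
        ≤ 3 * energyNorm ε₁
            (fun z => bigPi (meshX τ p μ₀ μ₁ N) (meshY τ δ ε₁ N) N k D z - uN z) + 3 * T ∧
      energyNorm ε₁ (fun z => u z - uN z)
        ≤ 3 * energyNorm ε₁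
            (fun z => interp (meshX τ p μ₀ μ₁ N) (meshY τ δ ε₁ N) N k u z - uN z) + 9 * T := by
  have hβ := hdata.beta_pos
  have hlam := hdata.lam_pos
  obtain ⟨n, hN⟩ := hN4
  have hn2 : 2 ≤ n := by omega
  have hn : 0 < n := by omega
  have h3n : 3 * (N / 4) = 3 * n := by omega
  have hN8' : (8 : ℝ) ≤ N := by exact_mod_cast hN8
  have hN0 : (0 : ℝ) < N := by linarith
  have hNpos : 0 < N := by omega
  obtain ⟨pos₀, h₀⟩ : 0 < μ₀ ∧ ε₁ * μ₀ ^ 2 + ε₂ * bMax b * μ₀ = β := by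
    have := quadratic_root hε₁ hβ (ε₂ * bMax b)
    rw [mul_pow] at this
    rwa [hμ₀, mu0]
  obtain ⟨pos₁, h₁⟩ : 0 < μ₁ ∧ ε₁ * μ₁ ^ 2 + -(ε₂ * lam) * μ₁ = β := by
    have := quadratic_root hε₁ hβ (-(ε₂ * lam))
    rw [neg_neg, neg_sq, mul_pow] at this
    rwa [hμ₁, mu1]
  have hNμ₀ : (N : ℝ) ≤ μ₀ := (inv_le_inv₀ pos₀ hN0).1 hμN
  have hNμ₁ : (N : ℝ) ≤ μ₁ := hNμ₀.trans ((inv_le_inv₀ pos₁ pos₀).1 hμ)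
  have one₀ : 1 < μ₀ := by linarith
  have one₁ : 1 < μ₁ := by linarith
  obtain ⟨hQ, q1, q₀, q₁, qB, r1, r₀, s₁, hε, hratio, hNε⟩ :=
    parameter_bounds hε₁ hε₁'.le hε₂ hε₂'.le hlam hβ (le_bMax hdata) pos₀ pos₁ h₀ h₁ hNμ₀ rfl
  set Q := 1 + √β + lam + β / lam + 1 / lam
  have hS : 0 ≤ √(√ε₁ + ε₂) := Real.sqrt_nonneg _
  set S := √(√ε₁ + ε₂)
  have hY' := meshY_eq τ δ ε₁ N
  have hσ' : sigmaX τ δ (√ε₁)⁻¹ = sigmaY τ δ ε₁ := by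
    rw [sigmaX, sigmaY, ← div_div, div_inv_eq_mul, one_div]
  have he : 0 < √ε₁ := Real.sqrt_pos.2 hε₁
  have he1 : √ε₁ < 1 := (Real.sqrt_lt' one_pos).2 (by simpa using hε₁')
  have hwt : ∀ t : ℝ, δ * (√ε₁)⁻¹ * t = δ * t / √ε₁ := fun t => by ring
  have hB1 : 1 < (√ε₁)⁻¹ := (one_lt_inv₀ he).2 he1
  have hτ0 : 0 < τ := by linarith [k.cast_nonneg (α := ℝ)]
  have hK : 1 ≤ K := by linarith [hC.eight]
  -- N ≤ μ₀ and √ε₁ μ₀ ≤ √β bound N√ε₁ by √β, so the y-layers are also thin on the scale 1/N.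
  have hκB : 1 / √β * N ≤ (√ε₁)⁻¹ := by
    have := Real.sqrt_pos.2 hβ
    rw [div_mul_eq_mul_div, one_mul, div_le_iff₀ this]
    exact (le_inv_mul_iff₀ he).2 hNε
  have hX := meshX_mesh hp hτ0 one₀ one₁ hN hn hσ₀ hσ₁
  have hX' := meshX_mesh hp hτ0 one₁ one₀ hN hn hσ₁ hσ₀
  have hY := meshX_mesh hδ hτ0 hB1 hB1 hN hn (hσ'.trans_le hσ) (hσ'.trans_le hσ)
  -- In each direction three layer functions occur: the constant 1, the layer at the left end, and
  -- its reflection.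
  have mX := LayerMesh.one hX hK fun i => meshX_sub_le hC hp hτ0 one₀ one₁ hN hn
    (sigmaX_nonneg hp hτ0 one₀) (sigmaX_nonneg hp hτ0 one₁)
  have mX₀ := meshX_layerMesh hC hp hτ one₀ one_pos (by linarith) hN hn hX
  have mX₁ := LayerMesh.reflect (meshX_layerMesh hC hp hτ one₁ one_pos (by linarith) hN hn hX')
    fun i hi => meshX_reflect (μ₀ := μ₀) hN hn hi
  have mY := LayerMesh.one hY hK fun i => meshX_sub_le hC' hδ hτ0 hB1 hB1 hN hn
    (sigmaX_nonneg hδ hτ0 hB1) (sigmaX_nonneg hδ hτ0 hB1)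
  have mY₀ := meshX_layerMesh hC' hδ hτ hB1 (by positivity) hκB hN hn hY
  have mY₁ := LayerMesh.reflect mY₀ fun i hi => meshX_reflect hN hn hi
  have hTr := meshX_transition (μ₀ := μ₀) hC hC' hp hp1 hδ hτ hNμ₁ hN hn2 hB1 hω
    (by rwa [inv_inv]) (by
      rw [one_div, inv_inv, le_div_iff₀ (Real.sqrt_pos.2 pos₁)]
      exact hratio.trans hKβ)
  rw [← h3n] at hTr
  rw [← hY'] at hY mY mY₀ mY₁ hTr
  have hl := fun q x => (layerFun_pos k q x).le
  have hA1 : (0 : ℝ) ≤ 1 := zero_le_one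
  have hB0 : 0 ≤ (√ε₁)⁻¹ := inv_nonneg.2 he.le
  have pS := hD.bound_S.layerPart (A := 1) (B := 1) (ρ := fun _ => 1) (ψ := fun _ => 1)
    (fun i j z => by simp) hA1 hA1 (fun _ => hA1) (fun _ => hA1)
  have p10 := hD.bound_E10.layerPart (B := 1) (ρ := layerFun k (p * μ₀)) (ψ := fun _ => 1)
    (fun i j z => by simp only [layerFun_pow, one_pow, mul_one]) pos₀.le hA1 (hl _) (fun _ => hA1)
  have p11 := hD.bound_E11.layerPart (B := 1) (ρ := fun x => layerFun k (p * μ₁) (1 - x))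
    (ψ := fun _ => 1) (fun i j z => by simp only [layerFun_pow, one_pow, mul_one]) pos₁.le hA1
    (fun _ => hl _ _) (fun _ => hA1)
  have p20 := hD.bound_E20.layerPart (A := 1) (ρ := fun _ => 1) (ψ := layerFun k (δ * (√ε₁)⁻¹))
    (fun i j z => by simp only [layerFun_pow, hwt, one_pow, one_mul]) hA1 hB0 (fun _ => hA1) (hl _)
  have p21 := hD.bound_E21.layerPart (A := 1) (ρ := fun _ => 1)
    (ψ := fun y => layerFun k (δ * (√ε₁)⁻¹) (1 - y))
    (fun i j z => by simp only [layerFun_pow, hwt, one_pow, one_mul]) hA1 hB0 (fun _ => hA1)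
    (fun _ => hl _ _)
  have p31 := hD.bound_E31.layerPart (A := μ₀) (B := (√ε₁)⁻¹) (ρ := layerFun k (p * μ₀))
    (ψ := layerFun k (δ * (√ε₁)⁻¹)) (fun i j z => by simp only [layerFun_pow, hwt]; ring) pos₀.le
    hB0 (hl _) (hl _)
  have p32 := hD.bound_E32.layerPart (A := μ₁) (B := (√ε₁)⁻¹)
    (ρ := fun x => layerFun k (p * μ₁) (1 - x)) (ψ := layerFun k (δ * (√ε₁)⁻¹))
    (fun i j z => by simp only [layerFun_pow, hwt]; ring) pos₁.le hB0 (fun _ => hl _ _) (hl _)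
  have p33 := hD.bound_E33.layerPart (A := μ₁) (B := (√ε₁)⁻¹)
    (ρ := fun x => layerFun k (p * μ₁) (1 - x)) (ψ := fun y => layerFun k (δ * (√ε₁)⁻¹) (1 - y))
    (fun i j z => by simp only [layerFun_pow, hwt]; ring) pos₁.le hB0 (fun _ => hl _ _)
    (fun _ => hl _ _)
  have p34 := hD.bound_E34.layerPart (A := μ₀) (B := (√ε₁)⁻¹) (ρ := layerFun k (p * μ₀))
    (ψ := fun y => layerFun k (δ * (√ε₁)⁻¹) (1 - y))
    (fun i j z => by simp only [layerFun_pow, hwt]; ring) pos₀.le hB0 (hl _) (fun _ => hl _ _)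
  refine fem_error hX hY hk hN8 hdata.b_smooth hdata.c_cont hε₁ hε₂.le hBb hBb' hBc hγ hcoer
    (hD.contDiffOn.of_le (by exact_mod_cast Nat.succ_le_succ hk)) hu huN hD.sum_eq ?_ ?_
  · rw [hT]
    rintro g (rfl | rfl | rfl | rfl | rfl | rfl)
    · exact interp_directError pS hX hY hk hNpos mX mY q1 q1 r1 hQ hS hε₂.le
    · exact interp_directError p10 hX hY hk hNpos mX₀ mY q₀ q1 r₀ hQ hS hε₂.le
    · exact interp_directError p20 hX hY hk hNpos mX mY₀ q1 qB r1 hQ hS hε₂.le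
    · exact interp_directError p21 hX hY hk hNpos mX mY₁ q1 qB r1 hQ hS hε₂.le
    · exact interp_directError p31 hX hY hk hNpos mX₀ mY₀ q₀ qB r₀ hQ hS hε₂.le
    · exact interp_directError p34 hX hY hk hNpos mX₀ mY₁ q₀ qB r₀ hQ hS hε₂.le
  · have key : ∀ {B q ψ g}, LayerPart k |C₀| μ₁ B (fun x => layerFun k (p * μ₁) (1 - x)) ψ g →
        LayerMesh (meshY τ δ ε₁ N) N B K q ψ → √ε₁ * √B ≤ Q * S →
        SumError (meshX τ p μ₀ μ₁ N) (meshY τ δ ε₁ N) N ε₁ T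
          (fun z => interp (meshX τ p μ₀ μ₁ N) (meshY τ δ ε₁ N) N k g z - g z) ∧
        SumError (meshX τ p μ₀ μ₁ N) (meshY τ δ ε₁ N) N ε₁ T
          (fun z => opP (meshX τ p μ₀ μ₁ N) (meshY τ δ ε₁ N) N k g z
            - opTheta (meshX τ p μ₀ μ₁ N) (meshY τ δ ε₁ N) N k g z) ∧
        WeakError (meshX τ p μ₀ μ₁ N) (meshY τ δ ε₁ N) N ε₁ ε₂ T
          (fun z => opPi (meshX τ p μ₀ μ₁ N) (meshY τ δ ε₁ N) N k g z - g z) := by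
      intro B q ψ g hg hm hq
      have h0 : 0 ≤ K ^ 4 * interpConst k ^ 2 * |C₀| * Q
          * (S * (K / N) ^ k + (K / N) ^ (k + 1)) := by positivity
      have i := interp_sumNorm_le hg hX hY hk hNpos mX₁ hm q₁ hq hQ
      have o := correction_sumError hg hX hY hk hN8 mX₁ hm hTr q₁ hq qB hQ hS
      have w := opPi_weakError hg hX hY hk hN8 mX₁ hm hTr q₁ hq qB s₁ hε hε₂.le hQ hS
      rw [hT]
      refine ⟨⟨hg.pw_error hX hY hk hNpos, i.trans ?_⟩, ⟨o.pw, o.le.trans ?_⟩, w⟩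
      all_goals
        unfold errBound
        linarith
    rintro g (rfl | rfl | rfl)
    · exact key p11 mY q1
    · exact key p32 mY₀ qB
    · exact key p33 mY₁ qB

lemma errBound_le {k N : ℕ} {K M Q S : ℝ} (hK : 1 ≤ K) (hM : 0 ≤ M) (hQ : 0 ≤ Q) (hS : 0 ≤ S) :
    errBound k N K M Q S ≤ 48 * K ^ 4 * interpConst k ^ 2 * M * Q * K ^ (k + 1)
      * (S * (N : ℝ) ^ (-(k : ℤ)) + (N : ℝ) ^ (-((k : ℤ) + 1))) := by
  have e1 : (N : ℝ) ^ (-(k : ℤ)) = ((N : ℝ) ^ k)⁻¹ := by rw [zpow_neg, zpow_natCast]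
  have e2 : (N : ℝ) ^ (-((k : ℤ) + 1)) = ((N : ℝ) ^ (k + 1))⁻¹ := by
    rw [zpow_neg]
    norm_cast
  calc errBound k N K M Q S
      = 48 * K ^ 4 * interpConst k ^ 2 * M * Q
        * (S * (K ^ k * ((N : ℝ) ^ k)⁻¹) + K ^ (k + 1) * ((N : ℝ) ^ (k + 1))⁻¹) := by
        rw [errBound, div_pow, div_pow, div_eq_mul_inv, div_eq_mul_inv]
    _ ≤ 48 * K ^ 4 * interpConst k ^ 2 * M * Q
        * (S * (K ^ (k + 1) * ((N : ℝ) ^ k)⁻¹) + K ^ (k + 1) * ((N : ℝ) ^ (k + 1))⁻¹) := by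
        gcongr
        exact k.le_succ
    _ = _ := by
        rw [e1, e2]
        ring

end BakhvalovFEM
end

theorem mainTheorem1
    (k : ℕ) (hk : 1 ≤ k)
    (b c : ℝ → ℝ) (f : ℝ × ℝ → ℝ) (lam β γ : ℝ)
    (hdata : DataConditions b c f lam β) (hγ : 0 < γ)
    (p k₀ δ τ : ℝ) (hp : p ∈ Set.Ioo (0 : ℝ) 1) (hk₀ : k₀ ∈ Set.Ioo (0 : ℝ) (1 / 2))
    (hδ : 0 < δ) (hδβ : δ ^ 2 ≤ (1 - p) * β / 2) (hτ : (k : ℝ) + 1 ≤ τ)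
    (C₀ εbar : ℝ) (hεbar : εbar < 1) :
    ∃ C : ℝ, 0 < C ∧
      ∀ (ε₁ ε₂ μ₀ μ₁ : ℝ) (N : ℕ) (X Y : ℕ → ℝ) (u uN : ℝ × ℝ → ℝ) (D : Parts),
        0 < ε₁ → ε₁ ≤ εbar → 0 < ε₂ → ε₂ ≤ εbar →
        (∀ x ∈ Set.Icc (0 : ℝ) 1, γ ≤ c x - 1 / 2 * ε₂ * derivWithin b (Set.Icc 0 1) x) →
        (∀ x ∈ Set.Icc (0 : ℝ) 1,
          2 * |derivWithin b (Set.Icc 0 1) x| * ε₂ ≤ k₀ * (1 - p) * β) →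
        μ₀ = mu0 ε₁ ε₂ b β → μ₁ = mu1 ε₁ ε₂ lam β →
        8 ≤ N → 4 ∣ N →
        μ₁⁻¹ ≤ μ₀⁻¹ → μ₀⁻¹ ≤ (N : ℝ)⁻¹ →
        sigmaX τ p μ₀ ≤ 1 / 4 → sigmaX τ p μ₁ ≤ 1 / 4 → sigmaY τ δ ε₁ ≤ 1 / 4 →
        X = meshX τ p μ₀ μ₁ N → Y = meshY τ δ ε₁ N →
        IsSolution ε₁ ε₂ b c f u →
        IsLayerDecomposition k C₀ ε₁ μ₀ μ₁ p δ u D →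
        IsFESolution k N X Y ε₁ ε₂ b c f uN →
        energyNorm ε₁ (fun z => interp X Y N k u z - uN z)
            + energyNorm ε₁ (fun z => bigPi X Y N k D z - uN z)
          ≤ C * √(√ε₁ + ε₂) * (N : ℝ) ^ (-(k : ℤ)) + C * (N : ℝ) ^ (-((k : ℤ) + 1)) ∧
        energyNorm ε₁ (fun z => u z - uN z)
          ≤ C * √(√ε₁ + ε₂) * (N : ℝ) ^ (-(k : ℤ)) + C * (N : ℝ) ^ (-((k : ℤ) + 1)) := by
  obtain ⟨Bb, hBb⟩ := isCompact_Icc.exists_bound_of_continuousOn hdata.b_smooth.continuousOn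
  obtain ⟨Bb', hBb'⟩ := isCompact_Icc.exists_bound_of_continuousOn
    (hdata.b_smooth.continuousOn_derivWithin (uniqueDiffOn_Icc zero_lt_one) le_rfl)
  obtain ⟨Bc, hBc⟩ := isCompact_Icc.exists_bound_of_continuousOn hdata.c_cont
  have hβ := hdata.beta_pos
  have hlam := hdata.lam_pos
  have h0 : (0 : ℝ) ∈ Set.Icc (0 : ℝ) 1 := by simp
  have hBb0 : 0 ≤ Bb := (norm_nonneg _).trans (hBb 0 h0)
  have hBb0' : 0 ≤ Bb' := (norm_nonneg _).trans (hBb' 0 h0)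
  have hBc0 : 0 ≤ Bc := (norm_nonneg _).trans (hBc 0 h0)
  have hp0 := hp.1
  have hτ0 : 0 < τ := by linarith [k.cast_nonneg (α := ℝ)]
  -- A lower bound of 1 - √ε₁ that does not depend on ε₁. It keeps the first and the last cell in y
  -- from being too short.
  obtain ⟨ω, hω, hωε⟩ : ∃ ω : ℝ, 0 < ω ∧ ω = 1 - √εbar :=
    ⟨_, sub_pos.2 ((Real.sqrt_lt' one_pos).2 (by simpa using hεbar)), rfl⟩
  have hsβ := Real.sqrt_pos.2 hβ
  have t1 : 0 < τ / p := by positivity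
  have t2 : 0 < τ / δ := by positivity
  have t3 := Real.exp_pos (p + τ)
  have t4 := Real.exp_pos (δ + τ)
  have t5 : 0 < ((k : ℝ) + 1) / p := by positivity
  have t6 : 0 < ((k : ℝ) + 1) / δ := by positivity
  have t7 : 0 < δ / ω := by positivity
  -- The sum of all quantities that K has to dominate, for the mesh in x (with p) and for the mesh
  -- in y (with δ).
  obtain ⟨K, hK⟩ : ∃ K : ℝ, K = 8 + 8 * (τ / p) + 8 * (τ / δ) + Real.exp (p + τ)
      + Real.exp (δ + τ) + √β + (k + 1) / p + (k + 1) / δ + p + δ / ω + lam := ⟨_, rfl⟩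
  have hC : MeshConst k τ p 1 1 K :=
    ⟨by linarith, by linarith, by linarith, by rw [div_one]; linarith, by linarith,
      by rw [div_one]; linarith⟩
  have hC' : MeshConst k τ δ (1 / √β) ω K :=
    ⟨by linarith, by linarith, by linarith, by rw [one_div_one_div]; linarith, by linarith,
      by linarith⟩
  have hQ : 0 < 1 + √β + lam + β / lam + 1 / lam := by positivity
  have hK1 : 1 ≤ K := by linarith
  have hΛ := one_le_interpConst k
  have hγ1 : 0 < min 1 γ := lt_min one_pos hγ
  set a := ((1 + Bc) * 9 + (Bb * 9 + Bb' * 3)) / min 1 γ with ha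
  have ha0 : 0 ≤ a := by positivity
  set G := 48 * K ^ 4 * interpConst k ^ 2 * |C₀| * (1 + √β + lam + β / lam + 1 / lam) * K ^ (k + 1)
    with hG
  have hG0 : 0 ≤ G := by positivity
  -- The three bounds are aT for Πu, then 3aT + 3T for u^I, and 3(3aT + 3T) + 9T = 9aT + 18T for u,
  -- the largest total; T is at most G times the rate. The summand 1 ensures that C is positive.
  refine ⟨(9 * a + 18) * G + 1, by positivity, ?_⟩
  rintro ε₁ ε₂ μ₀ μ₁ N X Y u uN D hε₁ hε₁' hε₂ hε₂' hcoer - hμ₀ hμ₁ hN8 hN4 hμ hμN hσ₀ hσ₁ hσ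
    rfl rfl hu hD huN
  obtain ⟨e1, e2, e3⟩ := parametric_error hk hdata hγ hp0 hp.2 hδ hτ hBb hBb' hBc hC hC' hω
    (by linarith) hε₁ (hε₁'.trans_lt hεbar) hε₂ (hε₂'.trans_lt hεbar)
    (by linarith [Real.sqrt_le_sqrt hε₁']) hcoer hμ₀ hμ₁ hN8 hN4 hμ hμN hσ₀ hσ₁ hσ hu hD huN rfl
  have hT := errBound_le (k := k) (N := N) hK1 (abs_nonneg C₀) hQ.le
    (Real.sqrt_nonneg (√ε₁ + ε₂))
  rw [← ha] at e1
  rw [← hG] at hT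
  set T := errBound k N K |C₀| (1 + √β + lam + β / lam + 1 / lam) √(√ε₁ + ε₂)
  set R := √(√ε₁ + ε₂) * (N : ℝ) ^ (-(k : ℤ)) + (N : ℝ) ^ (-((k : ℤ) + 1)) with hR
  have hR0 : 0 ≤ R := by positivity
  have e4 : a * T ≤ a * (G * R) := mul_le_mul_of_nonneg_left hT ha0
  have e5 : 0 ≤ a * (G * R) := by positivity
  have e6 : 0 ≤ G * R := by positivity
  have e7 : ((9 * a + 18) * G + 1) * √(√ε₁ + ε₂) * (N : ℝ) ^ (-(k : ℤ))
      + ((9 * a + 18) * G + 1) * (N : ℝ) ^ (-((k : ℤ) + 1))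
      = 9 * (a * (G * R)) + 18 * (G * R) + R := by
    rw [hR]
    ring
  rw [e7]
  constructor <;> linarith
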